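/- **Setting.** Let $\mathbb T=\mathbb R/\mathbb Z$. For $k\ge 1$ let $G^k=L^1(\mathbb T\times\mathbb R,(1+|v|^k)\,dx\,dv)$, $G^k_0=\{f\in G^k: f\ge 0,\ \iint f\,dx\,dv=1\}$, $\rho(f)(x)=\int f(x,v)\,dv$, $J(f)(x)=\int v f(x,v)\,dv$; let $H^s$ be the $L^2$-based Sobolev space of real functions on $\mathbb T$. Let $E$ be a bounded, separable, complete subset of a normed space that is continuously embedded in $W^{2,\infty}(\mathbb T)$. Let $m=(m_t)_{t\ge0}$ be a càdlàg, stochastically continuous, time-homogeneous Markov process with values in $E$ (Markov with respect to its canonical filtration), with laws $(\mathbb P_n)_{n\in E}$, $\mathbb P_n(m_0=n)=1$, and semigroup $P_t\psi(n)=\mathbb E_n[\psi(m_t)]$. Its generator $M$ is defined as follows: $\psi\in D(M)$ and $M\psi=\theta$ iff $\psi$ is Borel and locally bounded (bounded on bounded sets), $\theta$ is continuous and locally bounded, $(P_t\psi-\psi)/t\to\theta$ pointwise as $t\to0^+$, and $\sup_{t>0}\sup_{n\in B}|P_t\psi(n)-\psi(n)|/t<\infty$ for every bounded $B$. Let $\alpha\in(1/2,3/2)$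 and $\mathcal X=G_0^k\times H^\alpha\times E$. For $\xi\in C^1(\mathbb T\times\mathbb R)$ put $N_k(\xi)=\big\|\tfrac{\xi}{1+|v|^k}\big\|_\infty+\big\|\tfrac{(1+|v|)\nabla\xi}{1+|v|^k}\big\|_\infty$ and $\mathcal C_k=\{\xi\in C^1:N_k(\xi)<\infty\}$. A function $\psi:G^k\times H^\alpha\times E\to\mathbb R$ is a *good test function* if: (1) $\psi$ is Borel and locally bounded on $\mathcal X$; (2) $\psi(f,u,\cdot)\in D(M)$ for all $(f,u)\in G_0^k\times H^\alpha$, and $M\psi$ is continuous and locally bounded on $\mathcal X$; (3) at every point of $\mathcal X$, $\psi$ is Fréchet differentiable in $f\in G^k$ with differential $g\mapsto\iint g\,D_f\psi\,dx\,dv$, $D_f\psi\in\mathcal C_k$, and $D_f\psi:\mathcal X\to(\mathcal C_k,N_k)$ is continuous and locally bounded; (4) at every point of $\mathcal X$, $\psi$ is Fréchet differentiable in $u\in H^\alpha$ with differential $w\mapsto\int w\,D_u\psi\,dx$, $D_u\psi\in C^2(\mathbb T)$, and $D_u\psi:\mathcal X\to C^2(\mathbb T)$ is continuous and locally bounded.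 For $\varepsilon>0$ let $\mathcal L^\varepsilon=\varepsilon^{-2}\mathcal L_\sharp+\varepsilon^{-1}\mathcal L_\flat+\mathcal L_0+\varepsilon\mathcal L_1$, where $$\mathcal L_\sharp\psi=\iint f\,(n-v)\,\partial_vD_f\psi\,dx\,dv+M\psi,\qquad \mathcal L_\flat\psi=\iint f\,(v\,\partial_xD_f\psi+u\,\partial_vD_f\psi)\,dx\,dv,$$ $$\mathcal L_0\psi=\int \big(u\,\partial_x^2D_u\psi+J(f)\,D_u\psi\big)dx,\qquad \mathcal L_1\psi=-\int\rho(f)\,u\,D_u\psi\,dx .$$ Let $f_0\in G^k_0$ and $u_0\in H^\eta$, $\eta\in(3/2,2)$, be deterministic with $\iint(1+|v|^4)|f_0|^2\,dx\,dv+\iint(1+|v|)|\nabla_{x,v}f_0|\,dx\,dv<\infty$, and let $n\in E$. Put $m^\varepsilon_t=m_{\varepsilon^{-2}t}$ and $\mathcal F^\varepsilon_t=\sigma(m^\varepsilon_s,s\le t)$. For every $\omega$, let $(f^\varepsilon,u^\varepsilon)$ be the solution, with values in $G_0^k$ and with $u^\varepsilon\in C([0,\infty);H^\beta)$ for some $\beta\in(3/2,\eta)$,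 of $$\partial_tf^\varepsilon+\varepsilon^{-1}v\,\partial_xf^\varepsilon+\varepsilon^{-2}\partial_v[(\varepsilon u^\varepsilon-v+m^\varepsilon)f^\varepsilon]=0,\qquad \partial_tu^\varepsilon-\partial_x^2u^\varepsilon=J(f^\varepsilon)-\varepsilon\rho(f^\varepsilon)u^\varepsilon$$ with initial data $(f_0,u_0)$, in the sense that $f^\varepsilon_t=e^{\varepsilon^{-2}t}f_0\circ\Phi_0^t$, where $\Phi_s^t=(X_s,V_s)$ is the flow of $\dot X_s=\varepsilon^{-1}V_s$, $\dot V_s=\varepsilon^{-2}(\varepsilon u^\varepsilon_s(X_s)+m^\varepsilon_s(X_s)-V_s)$ with $\Phi_t^t=\mathrm{id}$, and $u^\varepsilon_t=e^{t\partial_x^2}u_0+\int_0^te^{(t-s)\partial_x^2}[J(f^\varepsilon_s)-\varepsilon\rho(f^\varepsilon_s)u^\varepsilon_s]\,ds$. **Proposition.** Let $\psi$ be a good test function. Then $\mathcal L^\varepsilon\psi$ is well defined (all the integrals converge absolutely), continuous and locally bounded on $\mathcal X$, and $$M^\varepsilon_\psi(t)=\psi(f^\varepsilon_t,u^\varepsilon_t,m^\varepsilon_t)-\int_0^t\mathcal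 L^\varepsilon\psi(f^\varepsilon_s,u^\varepsilon_s,m^\varepsilon_s)\,ds,\qquad t\ge0,$$ is an $L^2$ martingale with respect to $(\mathcal F^\varepsilon_t)_{t\ge0}$ under $\mathbb P_n$; its paths are càdlàg if moreover $\psi(f,u,\cdot)$ is continuous on $E$ for all $(f,u)\in G_0^k\times H^\alpha$. If $|\psi|^2$ is also a good test function, then the predictable quadratic variation of $M^\varepsilon_\psi$, i.e. the càdlàg, predictable, nondecreasing process $A$ with $A_0=0$ such that $|M_\psi^\varepsilon|^2-A$ is an $(\mathcal F_t^\varepsilon)$-martingale under $\mathbb P_n$, is $$A_t=\varepsilon^{-2}\int_0^t\big(M|\psi|^2-2\psi M\psi\big)(f^\varepsilon_s,u^\varepsilon_s,m^\varepsilon_s)\,ds .$$ -/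

import Mathlib

open MeasureTheory ProbabilityTheory Filter Topology Set AddCircle
open scoped NNReal ENNReal

noncomputable section

namespace Kinetic

/-! ### The torus, phase space and the weighted `L¹` spaces -/

/-- The torus `ℝ / ℤ`. -/
abbrev Torus : Type := UnitAddCircle

/-- Lebesgue measure `dx` on the torus (total mass `1`). -/
abbrev dx : Measure Torus := haarAddCircle

/-- Phase space, with points `z = (x, v)`. -/
abbrev Phase : Type := Torus × ℝ

/-- Lebesgue measure `dx dv` on phase space. -/
abbrev dxdv : Measure Phase := dx.prod volume

/-- The weighted measure `(1 + |v|^k) dx dv`. -/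
def weightedMeasure (k : ℝ) : Measure Phase :=
  dxdv.withDensity (fun z => ENNReal.ofReal (1 + |z.2| ^ k))

/-- The Banach space of (classes of) functions `f` on phase space with
`‖f‖ = ∫∫ (1 + |v|^k) |f(x,v)| dx dv < ∞`. -/
abbrev G (k : ℝ) : Type := Lp ℝ 1 (weightedMeasure k)

/-- The probability densities in `G k`. -/
def G0 (k : ℝ) : Set (G k) := {f | 0 ≤ f ∧ ∫ z, f z ∂dxdv = 1}

/-- The density `ρ(f)(x) = ∫ f(x,v) dv`. -/
def rho {k : ℝ} (f : G k) (x : Torus) : ℝ := ∫ v : ℝ, f (x, v)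

/-- The momentum `J(f)(x) = ∫ v f(x,v) dv`. -/
def momentum {k : ℝ} (f : G k) (x : Torus) : ℝ := ∫ v : ℝ, v * f (x, v)

/-! ### Sobolev spaces on the torus -/

/-- Fourier coefficients of a real square integrable function. -/
def coeff (u : Lp ℝ 2 dx) (j : ℤ) : ℂ := fourierCoeff (fun x => ((u x : ℝ) : ℂ)) j

/-- Multiplication of the Fourier coefficients by `(1 + (2πj)²)^{s/2}`. -/
def weightedCoeff (s : ℝ) (u : Lp ℝ 2 dx) (j : ℤ) : ℂ :=
  (((1 + (2 * Real.pi * j) ^ 2) ^ (s / 2) : ℝ) : ℂ) * coeff u j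

theorem integrable_coeff (u : Lp ℝ 2 dx) (j : ℤ) :
    Integrable (fun x => fourier (-j) x • ((u x : ℝ) : ℂ)) dx := by
  have h : Integrable (fun x => u x) dx :=
    (Lp.memLp u).integrable (by norm_num)
  refine h.ofReal.bdd_mul (c := 1) ?_ ?_
  · exact (map_continuous (fourier (-j))).aestronglyMeasurable
  · exact Eventually.of_forall fun x => by rw [fourier_apply, Circle.norm_coe]

theorem coeff_add (u w : Lp ℝ 2 dx) (j : ℤ) : coeff (u + w) j = coeff u j + coeff w j := by
  unfold coeff fourierCoeff
  rw [← integral_add (integrable_coeff u j) (integrable_coeff w j)]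
  refine integral_congr_ae ?_
  filter_upwards [Lp.coeFn_add u w] with x hx
  rw [hx, Pi.add_apply, Complex.ofReal_add, smul_add]

theorem coeff_smul (c : ℝ) (u : Lp ℝ 2 dx) (j : ℤ) : coeff (c • u) j = c • coeff u j := by
  unfold coeff fourierCoeff
  rw [← integral_smul]
  refine integral_congr_ae ?_
  filter_upwards [Lp.coeFn_smul c u] with x hx
  rw [hx, Pi.smul_apply]
  simp only [smul_eq_mul, Complex.ofReal_mul, Complex.real_smul]
  ring

theorem coeff_injective (u : Lp ℝ 2 dx) (h : ∀ j, coeff u j = 0) : u = 0 := by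
  have hm : MemLp (fun x => ((u x : ℝ) : ℂ)) 2 dx := (Lp.memLp u).ofReal
  have h1 : hm.toLp _ = (0 : Lp ℂ 2 dx) := by
    apply (fourierBasis (T := 1)).repr.injective
    ext j
    rw [fourierBasis_repr, map_zero]
    have : fourierCoeff (hm.toLp _) j = coeff u j := by
      unfold coeff fourierCoeff
      refine integral_congr_ae ?_
      filter_upwards [hm.coeFn_toLp] with x hx
      rw [hx]
    rw [this, h j]; rfl
  rw [Lp.eq_zero_iff_ae_eq_zero] at h1 ⊢
  filter_upwards [h1, hm.coeFn_toLp] with x hx hx'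
  rw [hx'] at hx
  simpa using hx

/-- The linear map sending `u` to its weighted Fourier coefficients. -/
def weightedCoeffₗ (s : ℝ) : Lp ℝ 2 dx →ₗ[ℝ] PreLp (fun _ : ℤ => ℂ) where
  toFun u := weightedCoeff s u
  map_add' u w := by
    funext j
    exact (congrArg _ (coeff_add u w j)).trans (mul_add _ _ _)
  map_smul' c u := by
    funext j
    refine (congrArg _ (coeff_smul c u j)).trans ?_
    exact mul_smul_comm c _ _

/-- The Sobolev space `H^s` as a subspace of `L²` (for `s ≥ 0`):
the real functions `u` with `∑ⱼ (1 + (2πj)²)^s |û(j)|² < ∞`. -/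
def sobolevSubmodule (s : ℝ) : Submodule ℝ (Lp ℝ 2 dx) :=
  (lpSubmodule ℝ (fun _ : ℤ => ℂ) 2).comap (weightedCoeffₗ s)

/-- The Sobolev space `H^s` on the torus, `s ≥ 0`, with the norm
`‖u‖² = ∑ⱼ (1 + (2πj)²)^s |û(j)|²`. -/
def H (s : ℝ) : Type := sobolevSubmodule s

instance (s : ℝ) : AddCommGroup (H s) := inferInstanceAs (AddCommGroup (sobolevSubmodule s))
instance (s : ℝ) : Module ℝ (H s) := inferInstanceAs (Module ℝ (sobolevSubmodule s))

/-- The underlying square integrable function. -/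
def H.toL2 {s : ℝ} (u : H s) : Lp ℝ 2 dx := Subtype.val u

/-- The isometry `u ↦ ((1 + (2πj)²)^{s/2} û(j))ⱼ` into `ℓ²` that defines the norm of `H s`. -/
def H.toEll2 (s : ℝ) : H s →ₗ[ℝ] lp (fun _ : ℤ => ℂ) 2 where
  toFun u := ⟨weightedCoeff s u.toL2, u.2⟩
  map_add' u w := Subtype.ext ((weightedCoeffₗ s).map_add u.toL2 w.toL2)
  map_smul' c u := Subtype.ext ((weightedCoeffₗ s).map_smul c u.toL2)

theorem H.toEll2_injective (s : ℝ) : Function.Injective (H.toEll2 s) := by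
  rw [injective_iff_map_eq_zero]
  intro u hu
  apply Subtype.ext
  apply coeff_injective
  intro j
  have h := congrFun (congrArg Subtype.val hu) j
  have h' : weightedCoeff s u.toL2 j = 0 := h
  unfold weightedCoeff at h'
  rcases mul_eq_zero.1 h' with h0 | h0
  · have : (0 : ℝ) < (1 + (2 * Real.pi * j) ^ 2) ^ (s / 2) := by positivity
    exact absurd (by exact_mod_cast h0) this.ne'
  · exact h0

instance (s : ℝ) : NormedAddCommGroup (H s) :=
  NormedAddCommGroup.induced (H s) (lp (fun _ : ℤ => ℂ) 2) (H.toEll2 s) (H.toEll2_injective s)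

instance (s : ℝ) : NormedSpace ℝ (H s) :=
  NormedSpace.induced ℝ (H s) (lp (fun _ : ℤ => ℂ) 2) (H.toEll2 s)

theorem sobolevSubmodule_anti {s r : ℝ} (h : s ≤ r) : sobolevSubmodule r ≤ sobolevSubmodule s := by
  intro u hu
  have hu' : Memℓp (weightedCoeff r u) 2 := hu
  have h2 : (0 : ℝ) < (2 : ℝ≥0∞).toReal := by norm_num
  show Memℓp (weightedCoeff s u) 2
  rw [memℓp_gen_iff h2] at hu' ⊢
  refine Summable.of_nonneg_of_le (fun j => by positivity) (fun j => ?_) hu'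
  refine Real.rpow_le_rpow (norm_nonneg _) ?_ h2.le
  have hb : (1 : ℝ) ≤ 1 + (2 * Real.pi * j) ^ 2 := by nlinarith [sq_nonneg (2 * Real.pi * j)]
  unfold weightedCoeff
  rw [norm_mul, norm_mul, Complex.norm_real, Complex.norm_real,
    Real.norm_of_nonneg (by positivity), Real.norm_of_nonneg (by positivity)]
  gcongr

/-- The inclusion `H^r ⊂ H^s` for `s ≤ r`. -/
def H.incl {s r : ℝ} (h : s ≤ r) (u : H r) : H s :=
  ⟨u.toL2, sobolevSubmodule_anti h u.2⟩

open Classical in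
/-- The continuous representative of `u ∈ H^s` (it exists for `s > 1/2`). -/
def H.rep {s : ℝ} (u : H s) : Torus → ℝ :=
  if h : ∃ g : C(Torus, ℝ), (u.toL2 : Torus → ℝ) =ᵐ[dx] g then (h.choose : Torus → ℝ) else 0

/-! ### `W^{2,∞}` on the torus -/

/-- `g'` is the weak derivative of `g` on the torus
(test functions are the smooth `1`-periodic functions). -/
def HasWeakDeriv (g g' : Torus → ℝ) : Prop :=
  ∀ φ : ℝ → ℝ, ContDiff ℝ ((⊤ : ℕ∞) : WithTop ℕ∞) φ → Function.Periodic φ 1 →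
    ∫ x in (0 : ℝ)..1, g x * deriv φ x = - ∫ x in (0 : ℝ)..1, g' x * φ x

/-- `g ∈ W^{2,∞}` and `‖g‖_{W^{2,∞}} = ‖g‖_∞ + ‖∂ₓg‖_∞ + ‖∂ₓ²g‖_∞ ≤ R`.  (Elements of `W^{2,∞}` of
the torus are identified with their continuous representatives.) -/
def W2InfBound (g : C(Torus, ℝ)) (R : ℝ) : Prop :=
  ∃ g₁ g₂ : Lp ℝ ∞ dx, HasWeakDeriv g g₁ ∧ HasWeakDeriv g₁ g₂ ∧ ‖g‖ + ‖g₁‖ + ‖g₂‖ ≤ R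

/-! ### Càdlàg paths, Markov processes and their generators -/

/-- Right-continuous with left limits. -/
def IsCadlag {S : Type*} [TopologicalSpace S] (x : ℝ≥0 → S) : Prop :=
  ∀ t, ContinuousWithinAt x (Ici t) t ∧ ∃ l, Tendsto x (𝓝[<] t) (𝓝 l)

/-- The canonical filtration `𝓕_t = σ(X_s, s ≤ t)` of a process. -/
def canonicalFiltration {Ω S : Type*} [mΩ : MeasurableSpace Ω] [MeasurableSpace S]
    (X : ℝ≥0 → Ω → S) (hX : ∀ t, Measurable (X t)) : Filtration ℝ≥0 mΩ where
  seq t := ⨆ s ≤ t, MeasurableSpace.comap (X s) inferInstance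
  mono' _ _ hst := biSup_mono fun _ hr => hr.trans hst
  le' _ := iSup₂_le fun s _ => (hX s).comap_le

/-- A càdlàg, stochastically continuous, time-homogeneous Markov process `X` with state space `S`,
with the family `(law n)` of probability measures under which it starts from `n`. -/
structure MarkovProcess (Ω S : Type*) [MeasurableSpace Ω] [PseudoMetricSpace S]
    [MeasurableSpace S] where
  /-- the process -/
  X : ℝ≥0 → Ω → S
  measurable_X : ∀ t, Measurable (X t)
  cadlag : ∀ ω, IsCadlag (fun t => X t ω)
  /-- the probability measure `ℙ_n` -/
  law : Kernel S Ω
  isMarkovKernel : IsMarkovKernel law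
  start : ∀ n, ∀ᵐ ω ∂(law n), X 0 ω = n
  markov : ∀ (n : S) (s t : ℝ≥0) (ψ : S → ℝ), Measurable ψ → (∃ C, ∀ y, |ψ y| ≤ C) →
    (law n)[fun ω => ψ (X (s + t) ω) | canonicalFiltration X measurable_X s]
      =ᵐ[law n] fun ω => ∫ ω', ψ (X t ω') ∂(law (X s ω))
  stochContinuous : ∀ (n : S) (t : ℝ≥0) (δ : ℝ), 0 < δ →
    Tendsto (fun s => law n {ω | δ < dist (X s ω) (X t ω)}) (𝓝 t) (𝓝 0)

/-- `ψ` maps bounded sets onto bounded sets. -/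
def LocBounded {S : Type*} [PseudoMetricSpace S] (ψ : S → ℝ) : Prop :=
  ∀ B : Set S, Bornology.IsBounded B → ∃ C : ℝ, ∀ p ∈ B, |ψ p| ≤ C

/-- Borel measurable and locally bounded functions. -/
def BLoc {S : Type*} [PseudoMetricSpace S] (ψ : S → ℝ) : Prop :=
  Measurable[borel S] ψ ∧ LocBounded ψ

/-- Continuous and locally bounded functions. -/
def CbLoc {S : Type*} [PseudoMetricSpace S] (ψ : S → ℝ) : Prop :=
  Continuous ψ ∧ LocBounded ψ

section Generator

variable {Ω S : Type*} [MeasurableSpace Ω] [PseudoMetricSpace S] [MeasurableSpace S]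

/-- The semigroup `P_t ψ(n) = 𝔼_n[ψ(X_t)]`. -/
def MarkovProcess.semigroup (m : MarkovProcess Ω S) (t : ℝ≥0) (ψ : S → ℝ) (n : S) : ℝ :=
  ∫ ω, ψ (m.X t ω) ∂(m.law n)

/-- The difference quotient `(P_t ψ - ψ) / t`. -/
def MarkovProcess.quotient (m : MarkovProcess Ω S) (ψ : S → ℝ) (t : ℝ≥0) (n : S) : ℝ :=
  (m.semigroup t ψ n - ψ n) / t

/-- `ψ` is in the domain of the infinitesimal generator `M`, and `M ψ = θ`:
`(P_t ψ - ψ) / t → θ` in the sense of locally bounded pointwise convergence. -/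
def MarkovProcess.HasGenerator (m : MarkovProcess Ω S) (ψ θ : S → ℝ) : Prop :=
  BLoc ψ ∧ CbLoc θ ∧
  (∀ n, Tendsto (fun t => m.quotient ψ t n) (𝓝[>] 0) (𝓝 (θ n))) ∧
  ∀ B : Set S, Bornology.IsBounded B → ∃ C : ℝ, ∀ t > 0, ∀ n ∈ B, |m.quotient ψ t n| ≤ C

/-- The domain `D(M)`. -/
def MarkovProcess.InDomain (m : MarkovProcess Ω S) (ψ : S → ℝ) : Prop :=
  ∃ θ, m.HasGenerator ψ θ

/-- The value `M ψ(n)` of the generator (meaningful for `ψ ∈ D(M)`). -/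
def MarkovProcess.generator (m : MarkovProcess Ω S) (ψ : S → ℝ) (n : S) : ℝ :=
  limUnder (𝓝[>] 0) (fun t => m.quotient ψ t n)

end Generator

/-! ### Solutions of the kinetic system -/

/-- `s ↦ (X s, V s)`, `s ∈ [0,t]`, is the characteristic curve of the kinetic system which is at
`z` at time `t`: `dX/ds = ε⁻¹ V`, `dV/ds = ε⁻² (w_s(X) - V)`, in integral form. -/
def IsCharacteristic (ε : ℝ) (w : ℝ≥0 → Torus → ℝ) (t : ℝ≥0) (z : Phase)
    (X : ℝ → Torus) (V : ℝ → ℝ) : Prop :=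
  ContinuousOn X (Icc 0 (t : ℝ)) ∧ ContinuousOn V (Icc 0 (t : ℝ)) ∧
  ∀ s ∈ Icc 0 (t : ℝ),
    X s = z.1 - ((∫ σ in s..(t : ℝ), ε⁻¹ * V σ : ℝ) : Torus) ∧
    V s = z.2 - ∫ σ in s..(t : ℝ), (ε ^ 2)⁻¹ * (w σ.toNNReal (X σ) - V σ)

/-- Given the path `n = (n_t)` of the (rescaled) driving term, `(f, u)` is the solution with initial
data `(f₀, u₀)` of
`∂ₜf + ε⁻¹ v ∂ₓf + ε⁻² ∂ᵥ[(ε u - v + n) f] = 0`,  `∂ₜu - ∂ₓ²u = J(f) - ε ρ(f) u`,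
in the sense that
* `u` is continuous with values in `H^β`;
* `f_t = e^{t/ε²} f₀ ∘ Φ₀ᵗ` where `Φ` is the flow of the characteristics with `w = ε u + n`;
* `u_t = S(t) u₀ + ∫₀ᵗ S(t-s) [J(f_s) - ε ρ(f_s) u_s] ds`, where the heat semigroup `S(t)` is the
  Fourier multiplier `exp(-(2πj)² t)`. -/
structure IsSolution (ε : ℝ) {k η β : ℝ} (n : ℝ≥0 → Torus → ℝ) (f₀ : G k) (u₀ : H η)
    (f : ℝ≥0 → G k) (u : ℝ≥0 → H β) : Prop where
  continuous_u : Continuous u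
  transport : ∃ (X : ℝ≥0 → Phase → ℝ → Torus) (V : ℝ≥0 → Phase → ℝ → ℝ),
    (∀ t z, IsCharacteristic ε (fun s x => ε * (u s).rep x + n s x) t z (X t z) (V t z)) ∧
    ∀ t, ∀ᵐ z ∂dxdv, f t z = Real.exp (t / ε ^ 2) * f₀ (X t z 0, V t z 0)
  mild : ∀ (t : ℝ≥0) (j : ℤ),
    coeff (u t).toL2 j = (Real.exp (-(2 * Real.pi * j) ^ 2 * t) : ℂ) * coeff u₀.toL2 j +
      ∫ s in (0 : ℝ)..t, (Real.exp (-(2 * Real.pi * j) ^ 2 * (t - s)) : ℂ) *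
        fourierCoeff (fun x => ((momentum (f s.toNNReal) x
          - ε * rho (f s.toNNReal) x * (u s.toNNReal).rep x : ℝ) : ℂ)) j

/-- The lift to `ℝ × ℝ` of a function on phase space. -/
def lift (φ : Phase → ℝ) (y : ℝ × ℝ) : ℝ := φ ((y.1 : Torus), y.2)

/-- `∂ₓ` of a function on phase space. -/
def dX (φ : Phase → ℝ) (z : Phase) : ℝ := deriv (fun h : ℝ => φ (z.1 + (h : Torus), z.2)) 0

/-- `∂ᵥ` of a function on phase space. -/
def dV (φ : Phase → ℝ) (z : Phase) : ℝ := deriv (fun v : ℝ => φ (z.1, v)) z.2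

/-- The condition
`∫∫ (1 + |v|⁴) |f₀|² dx dv + ∫∫ (1 + |v|) |∇f₀| dx dv < ∞`, where `∇f₀ = (gₓ, gᵥ)` is the
weak gradient. -/
def RegularDensity {k : ℝ} (f₀ : G k) : Prop :=
  Integrable (fun z => (1 + |z.2| ^ 4) * |f₀ z| ^ 2) dxdv ∧
  ∃ gx gv : Phase → ℝ,
    Integrable (fun z => (1 + |z.2|) * gx z) dxdv ∧
    Integrable (fun z => (1 + |z.2|) * gv z) dxdv ∧
    ∀ φ : Phase → ℝ, ContDiff ℝ ((⊤ : ℕ∞) : WithTop ℕ∞) (lift φ) → HasCompactSupport φ →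
      ∫ z, f₀ z * dX φ z ∂dxdv = - ∫ z, gx z * φ z ∂dxdv ∧
      ∫ z, f₀ z * dV φ z ∂dxdv = - ∫ z, gv z * φ z ∂dxdv

/-! ### Good test functions -/

/-- `N_k(ξ) = ‖ξ / (1 + |v|^k)‖_∞ + ‖(1 + |v|) ∇ξ / (1 + |v|^k)‖_∞`, for `ξ` of class `C¹`. -/
def Nk (k : ℝ) (ξ : Phase → ℝ) : ℝ≥0∞ :=
  (⨆ z : Phase, ENNReal.ofReal (|ξ z| / (1 + |z.2| ^ k))) +
  ⨆ z : Phase, ENNReal.ofReal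
    ((1 + |z.2|) * Real.sqrt (dX ξ z ^ 2 + dV ξ z ^ 2) / (1 + |z.2| ^ k))

/-- The space of `C¹` functions on phase space with `N_k(ξ) < ∞` (complete for the norm `N_k`). -/
def MemCk (k : ℝ) (ξ : Phase → ℝ) : Prop := ContDiff ℝ 1 (lift ξ) ∧ Nk k ξ < ∞

/-- `∂ₓ` of a function on the torus. -/
def dT (ζ : Torus → ℝ) (x : Torus) : ℝ := deriv (fun h : ℝ => ζ (x + (h : Torus))) 0

/-- `ζ ∈ C²(𝕋)`. -/
def MemC2 (ζ : Torus → ℝ) : Prop := ContDiff ℝ 2 (fun y : ℝ => ζ (y : Torus))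

/-- The norm of `C²(𝕋)`. -/
def C2norm (ζ : Torus → ℝ) : ℝ≥0∞ :=
  (⨆ x, ENNReal.ofReal |ζ x|) + (⨆ x, ENNReal.ofReal |dT ζ x|) +
    ⨆ x, ENNReal.ofReal |dT (dT ζ) x|

/-- A map `D` with values in a space of functions normed by `N` is continuous and maps bounded sets
onto bounded sets. -/
def CbLocIn {S Y : Type*} [PseudoMetricSpace S] (N : (Y → ℝ) → ℝ≥0∞) (D : S → Y → ℝ) : Prop :=
  (∀ p, Tendsto (fun q => N (D q - D p)) (𝓝 p) (𝓝 0)) ∧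
  ∀ B : Set S, Bornology.IsBounded B → ∃ C : ℝ≥0, ∀ p ∈ B, N (D p) ≤ C

section TestFunctions

variable {Ω F : Type*} [MeasurableSpace Ω] [NormedAddCommGroup F] [NormedSpace ℝ F]
  [MeasurableSpace F] {E : Set F} {k α : ℝ}

/-- The state space `G₀^k × H^α × E`. -/
abbrev State (k α : ℝ) (E : Set F) : Type _ := G0 k × H α × E

/-- The inclusion of the state space in `G^k × H^α × E`, on which test functions are defined. -/
def State.toAmbient (p : State k α E) : G k × H α × E := (p.1, p.2.1, p.2.2)

/-- `ξ` represents the differential of `ψ` in `f`: `Diff_f ψ(f,u,n)(g) = ∫∫ g ξ dx dv` for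
`g ∈ G^k`. -/
def IsDf (ψ : G k × H α × E → ℝ) (p : State k α E) (ξ : Phase → ℝ) : Prop :=
  ∃ L : G k →L[ℝ] ℝ, HasFDerivAt (fun g : G k => ψ (g, p.2.1, p.2.2)) L (p.1 : G k) ∧
    ∀ g : G k, L g = ∫ z, g z * ξ z ∂dxdv

/-- `ζ` represents the differential of `ψ` in `u`: `Diff_u ψ(f,u,n)(w) = ∫ w ζ dx` for
`w ∈ H^α`. -/
def IsDu (ψ : G k × H α × E → ℝ) (p : State k α E) (ζ : Torus → ℝ) : Prop :=
  ∃ L : H α →L[ℝ] ℝ, HasFDerivAt (fun w : H α => ψ (p.1, w, p.2.2)) L p.2.1 ∧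
    ∀ w : H α, L w = ∫ x, w.toL2 x * ζ x ∂dx

open Classical in
/-- `D_f ψ(f,u,n)`: the element of `𝓒_k` which represents the differential in `f` (if any). -/
def Df (ψ : G k × H α × E → ℝ) (p : State k α E) : Phase → ℝ :=
  if h : ∃ ξ, MemCk k ξ ∧ IsDf ψ p ξ then h.choose else 0

open Classical in
/-- `D_u ψ(f,u,n)`: the element of `C²(𝕋)` which represents the differential in `u` (if any). -/
def Du (ψ : G k × H α × E → ℝ) (p : State k α E) : Torus → ℝ :=
  if h : ∃ ζ, MemC2 ζ ∧ IsDu ψ p ζ then h.choose else 0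

/-- `M ψ(f,u,n)`: the generator of the driving process acts on the variable `n`. -/
def genN (m : MarkovProcess Ω E) (ψ : G k × H α × E → ℝ) (p : State k α E) : ℝ :=
  m.generator (fun n => ψ (p.1, p.2.1, n)) p.2.2

/-- Good test functions on the state space. -/
structure IsGoodTestFunction (m : MarkovProcess Ω E) (ψ : G k × H α × E → ℝ) : Prop where
  bLoc : BLoc fun p : State k α E => ψ p.toAmbient
  inDomain : ∀ f ∈ G0 k, ∀ u : H α, m.InDomain fun n => ψ (f, u, n)
  genN_cbLoc : CbLoc fun p : State k α E => genN m ψ p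
  exists_Df : ∀ p : State k α E, ∃ ξ, MemCk k ξ ∧ IsDf ψ p ξ
  Df_cbLoc : CbLocIn (Nk k) fun p : State k α E => Df ψ p
  exists_Du : ∀ p : State k α E, ∃ ζ, MemC2 ζ ∧ IsDu ψ p ζ
  Du_cbLoc : CbLocIn C2norm fun p : State k α E => Du ψ p

/-! ### The generator of the process

The brackets with derivatives of `f` and `u` are understood by duality (integration by parts). -/

/-- `⟨-∂ᵥ[(n - v) f], D_f ψ⟩ = ∫∫ (n - v) f ∂ᵥ D_f ψ` : integrand. -/
def sharpIntegrand (ι : F → C(Torus, ℝ)) (ψ : G k × H α × E → ℝ) (p : State k α E)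
    (z : Phase) : ℝ :=
  (p.1 : G k) z * ((ι p.2.2 z.1 - z.2) * dV (Df ψ p) z)

/-- `⟨-(v ∂ₓf + u ∂ᵥf), D_f ψ⟩ = ∫∫ f (v ∂ₓ D_f ψ + u ∂ᵥ D_f ψ)` : integrand. -/
def flatIntegrand (ψ : G k × H α × E → ℝ) (p : State k α E) (z : Phase) : ℝ :=
  (p.1 : G k) z * (z.2 * dX (Df ψ p) z + p.2.1.toL2 z.1 * dV (Df ψ p) z)

/-- `⟨∂ₓ²u + J(f), D_u ψ⟩ = ∫ (u ∂ₓ² D_u ψ + J(f) D_u ψ)` : integrand. -/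
def zeroIntegrand (ψ : G k × H α × E → ℝ) (p : State k α E) (x : Torus) : ℝ :=
  p.2.1.toL2 x * dT (dT (Du ψ p)) x + momentum (p.1 : G k) x * Du ψ p x

/-- `⟨ρ(f) u, D_u ψ⟩` : integrand. -/
def oneIntegrand (ψ : G k × H α × E → ℝ) (p : State k α E) (x : Torus) : ℝ :=
  rho (p.1 : G k) x * p.2.1.toL2 x * Du ψ p x

/-- `𝓛_♯ ψ = -⟨∂ᵥ[(n - v) f], D_f ψ⟩ + M ψ`. -/
def Lsharp (m : MarkovProcess Ω E) (ι : F → C(Torus, ℝ)) (ψ : G k × H α × E → ℝ)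
    (p : State k α E) : ℝ :=
  ∫ z, sharpIntegrand ι ψ p z ∂dxdv + genN m ψ p

/-- `𝓛_♭ ψ = -⟨v ∂ₓf + u ∂ᵥf, D_f ψ⟩`. -/
def Lflat (ψ : G k × H α × E → ℝ) (p : State k α E) : ℝ := ∫ z, flatIntegrand ψ p z ∂dxdv

/-- `𝓛₀ ψ = ⟨∂ₓ²u + J(f), D_u ψ⟩`. -/
def Lzero (ψ : G k × H α × E → ℝ) (p : State k α E) : ℝ := ∫ x, zeroIntegrand ψ p x ∂dx

/-- `𝓛₁ ψ = -⟨ρ(f) u, D_u ψ⟩`. -/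
def Lone (ψ : G k × H α × E → ℝ) (p : State k α E) : ℝ := - ∫ x, oneIntegrand ψ p x ∂dx

/-- `𝓛^ε = ε⁻² 𝓛_♯ + ε⁻¹ 𝓛_♭ + 𝓛₀ + ε 𝓛₁`. -/
def Leps (ε : ℝ) (m : MarkovProcess Ω E) (ι : F → C(Torus, ℝ)) (ψ : G k × H α × E → ℝ)
    (p : State k α E) : ℝ :=
  (ε ^ 2)⁻¹ * Lsharp m ι ψ p + ε⁻¹ * Lflat ψ p + Lzero ψ p + ε * Lone ψ p

/-- `𝓛^ε ψ(p)` is well defined: all the integrals which define it converge absolutely. -/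
def LepsWellDefined (ι : F → C(Torus, ℝ)) (ψ : G k × H α × E → ℝ) (p : State k α E) : Prop :=
  Integrable (sharpIntegrand ι ψ p) dxdv ∧ Integrable (flatIntegrand ψ p) dxdv ∧
  Integrable (zeroIntegrand ψ p) dx ∧ Integrable (oneIntegrand ψ p) dx

end TestFunctions

/-- The standing assumptions on the state space of the driving term: `E` is a bounded, separable
and complete subset of a normed space `F` which is continuously embedded (by `ι`) in
`W^{2,∞}(𝕋)`. -/
structure DrivingSpace {F : Type*} [NormedAddCommGroup F] [NormedSpace ℝ F]
    (E : Set F) (ι : F →ₗ[ℝ] C(Torus, ℝ)) : Prop where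
  injective : Function.Injective ι
  embedding : ∃ C : ℝ, ∀ n : F, W2InfBound (ι n) (C * ‖n‖)
  bounded : ∃ Cstar : ℝ, ∀ n ∈ E, ‖n‖ ≤ Cstar
  separable : TopologicalSpace.IsSeparable E
  complete : IsComplete E

/-- The rescaled driving process `m^ε_t = m_{t/ε²}`. -/
def rescaled {Ω S : Type*} (ε : ℝ) (X : ℝ≥0 → Ω → S) (t : ℝ≥0) : Ω → S :=
  X (((ε ^ 2)⁻¹).toNNReal * t)

/-- `A` is the predictable quadratic variation of `N`: it is càdlàg, predictable,
nondecreasing, null at `0`, and `|N|² - A` is a martingale. -/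
structure IsPredictableQuadraticVariation {Ω : Type*} [mΩ : MeasurableSpace Ω]
    (N A : ℝ≥0 → Ω → ℝ) (𝓕 : Filtration ℝ≥0 mΩ) (P : Measure Ω) : Prop where
  cadlag : ∀ ω, IsCadlag fun t => A t ω
  predictable : IsStronglyPredictable 𝓕 A
  monotone : ∀ ω, Monotone fun t => A t ω
  zero : ∀ ω, A 0 ω = 0
  martingale : Martingale (fun t ω => |N t ω| ^ 2 - A t ω) 𝓕 P

end Kinetic

end

set_option linter.unusedSectionVars false

noncomputable section

namespace Kinetic

/-! ### Fourier series and Sobolev spaces -/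

/-- The eigenvalues of `-∂ₓ²` on the torus. -/
def lam (j : ℤ) : ℝ := (2 * Real.pi * j) ^ 2

theorem lam_nonneg (j : ℤ) : 0 ≤ lam j := sq_nonneg _

theorem one_le_one_add_lam (j : ℤ) : 1 ≤ 1 + lam j := by linarith [lam_nonneg j]

theorem one_add_lam_pos (j : ℤ) : 0 < 1 + lam j := by linarith [lam_nonneg j]

theorem sq_le_lam (j : ℤ) : (j : ℝ) ^ 2 ≤ lam j := by
  unfold lam
  rw [mul_pow]
  have : 1 ≤ (2 * Real.pi) ^ 2 := by nlinarith [Real.pi_gt_three]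
  nlinarith [sq_nonneg (j : ℝ)]

theorem summable_one_add_lam_rpow {s : ℝ} (hs : 1 / 2 < s) :
    Summable fun j : ℤ => (1 + lam j) ^ (-s) := by
  have h1 : Summable fun j : ℤ => |(j : ℝ)| ^ (-(2 * s)) :=
    Real.summable_abs_int_rpow (by linarith)
  refine Summable.of_norm_bounded_eventually h1 ?_
  have : ∀ᶠ j : ℤ in cofinite, j ≠ 0 := by
    rw [Filter.eventually_cofinite]; simp
  filter_upwards [this] with j hj
  have hj' : (0 : ℝ) < |(j : ℝ)| := abs_pos.2 (by exact_mod_cast hj)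
  rw [Real.norm_of_nonneg (Real.rpow_nonneg (one_add_lam_pos j).le _)]
  have e : |(j : ℝ)| ^ (-(2 * s)) = ((j : ℝ) ^ 2) ^ (-s) := by
    rw [← sq_abs, ← Real.rpow_natCast, ← Real.rpow_mul hj'.le]
    congr 1; push_cast; ring
  rw [e]
  refine Real.rpow_le_rpow_of_nonpos ?_ ?_ (by linarith)
  · positivity
  · linarith [sq_le_lam j]

theorem summable_rpow_div {α Λ : ℝ} (hα : α < 3 / 2) (hΛ : 1 ≤ Λ) :
    Summable fun j : ℤ => (1 + lam j) ^ α / (lam j + Λ) ^ 2 := by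
  refine Summable.of_nonneg_of_le (fun j => ?_) (fun j => ?_)
    (summable_one_add_lam_rpow (s := 2 - α) (by linarith))
  · have := one_add_lam_pos j
    positivity
  · have h := one_add_lam_pos j
    have e : (1 + lam j) ^ (-(2 - α)) = (1 + lam j) ^ α / (1 + lam j) ^ 2 := by
      rw [neg_sub, Real.rpow_sub h]; norm_cast
    rw [e]
    exact div_le_div_of_nonneg_left (by positivity) (by positivity)
      (pow_le_pow_left₀ h.le (by linarith) 2)

theorem tendsto_tsum_rpow_div {α : ℝ} (hα : α < 3 / 2) :
    Tendsto (fun Λ : ℝ => ∑' j : ℤ, (1 + lam j) ^ α / (lam j + Λ) ^ 2) atTop (𝓝 0) := by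
  have h := tendsto_tsum_of_dominated_convergence (𝓕 := atTop)
    (f := fun (Λ : ℝ) (j : ℤ) => (1 + lam j) ^ α / (lam j + Λ) ^ 2) (g := fun _ => 0)
    (summable_rpow_div hα le_rfl) (fun j => ?_) ?_
  · simpa using h
  · refine Tendsto.div_atTop (a := (1 + lam j) ^ α) tendsto_const_nhds ?_
    exact (tendsto_pow_atTop (by norm_num)).comp (tendsto_atTop_add_const_left _ _ tendsto_id)
  · filter_upwards [eventually_ge_atTop 1] with Λ hΛ j
    have h := one_add_lam_pos j
    rw [Real.norm_of_nonneg (by positivity)]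
    have := lam_nonneg j
    gcongr

/-- The complexification of a real square integrable function. -/
def cplx (u : Lp ℝ 2 dx) : Lp ℂ 2 dx := (Lp.memLp u).ofReal.toLp

theorem coe_cplx (u : Lp ℝ 2 dx) : cplx u =ᵐ[dx] fun x => ((u x : ℝ) : ℂ) :=
  MemLp.coeFn_toLp _

theorem fourierCoeff_cplx (u : Lp ℝ 2 dx) (j : ℤ) : fourierCoeff (cplx u) j = coeff u j := by
  unfold coeff fourierCoeff
  refine integral_congr_ae ?_
  filter_upwards [coe_cplx u] with x hx
  rw [hx]

theorem norm_cplx (u : Lp ℝ 2 dx) : ‖cplx u‖ = ‖u‖ := by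
  rw [Lp.norm_def, Lp.norm_def]
  congr 1
  refine eLpNorm_congr_norm_ae ?_
  filter_upwards [coe_cplx u] with x hx
  rw [hx, Complex.norm_real]

theorem hasSum_sq_coeff (u : Lp ℝ 2 dx) : HasSum (fun j => ‖coeff u j‖ ^ 2) (‖u‖ ^ 2) := by
  have h := lp.hasSum_norm (p := 2) (by norm_num) ((fourierBasis (T := 1)).repr (cplx u))
  simp only [fourierBasis_repr, fourierCoeff_cplx, LinearIsometryEquiv.norm_map, norm_cplx,
    ENNReal.toReal_ofNat] at h
  exact_mod_cast h

theorem le_of_sq_le_sq {a b : ℝ} (h : a ^ 2 ≤ b ^ 2) (hb : 0 ≤ b) : a ≤ b :=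
  (le_abs_self a).trans (abs_le_of_sq_le_sq h hb)

theorem norm_weightedCoeff_sq (s : ℝ) (u : Lp ℝ 2 dx) (j : ℤ) :
    ‖weightedCoeff s u j‖ ^ 2 = (1 + lam j) ^ s * ‖coeff u j‖ ^ 2 := by
  have h := one_add_lam_pos j
  unfold weightedCoeff
  rw [norm_mul, mul_pow, Complex.norm_real]
  congr 1
  change ‖(1 + lam j) ^ (s / 2)‖ ^ 2 = _
  rw [Real.norm_of_nonneg (by positivity), ← Real.rpow_natCast, ← Real.rpow_mul h.le]
  congr 1; push_cast; ring

theorem H.hasSum_norm_sq {s : ℝ} (u : H s) :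
    HasSum (fun j => (1 + lam j) ^ s * ‖coeff u.toL2 j‖ ^ 2) (‖u‖ ^ 2) := by
  have h := lp.hasSum_norm (p := 2) (by norm_num) (H.toEll2 s u)
  have e : ‖H.toEll2 s u‖ = ‖u‖ := rfl
  have e' : ∀ j, (H.toEll2 s u) j = weightedCoeff s u.toL2 j := fun _ => rfl
  rw [e] at h
  simp only [e', ENNReal.toReal_ofNat] at h
  have h2 : HasSum (fun j => ‖weightedCoeff s u.toL2 j‖ ^ 2) (‖u‖ ^ 2) := by exact_mod_cast h
  simpa only [norm_weightedCoeff_sq] using h2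

theorem mem_sobolevSubmodule_iff {s : ℝ} {u : Lp ℝ 2 dx} :
    u ∈ sobolevSubmodule s ↔ Summable fun j => (1 + lam j) ^ s * ‖coeff u j‖ ^ 2 := by
  have h2 : (0 : ℝ) < (2 : ℝ≥0∞).toReal := by norm_num
  change Memℓp (weightedCoeff s u) 2 ↔ _
  rw [memℓp_gen_iff h2]
  simp only [← norm_weightedCoeff_sq, ENNReal.toReal_ofNat]
  norm_cast

theorem H.toL2_sub {s : ℝ} (u w : H s) : (u - w).toL2 = u.toL2 - w.toL2 := rfl
theorem H.toL2_incl {s r : ℝ} (h : s ≤ r) (u : H r) : (H.incl h u).toL2 = u.toL2 := by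
  unfold H.incl H.toL2
  dsimp only

theorem H.ext {s : ℝ} {u w : H s} (h : u.toL2 = w.toL2) : u = w := Subtype.ext h

theorem coeff_sub (u w : Lp ℝ 2 dx) (j : ℤ) : coeff (u - w) j = coeff u j - coeff w j := by
  have h := coeff_add (u - w) w j
  rw [sub_add_cancel] at h
  rw [h, add_sub_cancel_right]

theorem H.norm_incl_le {s r : ℝ} (h : s ≤ r) (u : H r) : ‖H.incl h u‖ ≤ ‖u‖ := by
  have h1 := H.hasSum_norm_sq (H.incl h u)
  have h2 := H.hasSum_norm_sq u
  have h3 : ‖H.incl h u‖ ^ 2 ≤ ‖u‖ ^ 2 := by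
    refine hasSum_le (fun j => ?_) h1 h2
    rw [H.toL2_incl]
    have := one_le_one_add_lam j
    gcongr
  exact le_of_sq_le_sq h3 (norm_nonneg _)

theorem H.incl_sub {s r : ℝ} (h : s ≤ r) (u w : H r) :
    H.incl h (u - w) = H.incl h u - H.incl h w := by
  apply H.ext
  rw [H.toL2_incl, H.toL2_sub, H.toL2_sub, H.toL2_incl, H.toL2_incl]

theorem H.continuous_incl {s r : ℝ} (h : s ≤ r) : Continuous (H.incl h) := by
  refine (LipschitzWith.of_dist_le_mul (K := 1) fun u w => ?_).continuous
  rw [dist_eq_norm, dist_eq_norm, ← H.incl_sub, NNReal.coe_one, one_mul]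
  exact H.norm_incl_le h _

theorem H.norm_toL2_le {s : ℝ} (hs : 0 ≤ s) (u : H s) : ‖u.toL2‖ ≤ ‖u‖ := by
  have h3 : ‖u.toL2‖ ^ 2 ≤ ‖u‖ ^ 2 := by
    refine hasSum_le (fun j => ?_) (hasSum_sq_coeff u.toL2) (H.hasSum_norm_sq u)
    have := Real.one_le_rpow (one_le_one_add_lam j) hs
    nlinarith [sq_nonneg ‖coeff u.toL2 j‖]
  exact le_of_sq_le_sq h3 (norm_nonneg _)

theorem H.summable_mul_coeff {s : ℝ} {b : ℤ → ℝ} (hb : ∀ j, 0 ≤ b j)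
    (h : Summable fun j => b j ^ 2 * (1 + lam j) ^ (-s)) (u : H s) :
    (Summable fun j => b j * ‖coeff u.toL2 j‖) ∧
      ∑' j, b j * ‖coeff u.toL2 j‖ ≤ √(∑' j, b j ^ 2 * (1 + lam j) ^ (-s)) * ‖u‖ := by
  have hu := H.hasSum_norm_sq u
  have e1 : ∀ j, (b j * (1 + lam j) ^ (-(s / 2))) ^ (2 : ℝ) = b j ^ 2 * (1 + lam j) ^ (-s) := by
    intro j
    have h := one_add_lam_pos j
    rw [Real.rpow_two, mul_pow, ← Real.rpow_natCast (_ ^ _), ← Real.rpow_mul h.le]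
    congr 2; push_cast; ring
  have e2 : ∀ j, ((1 + lam j) ^ (s / 2) * ‖coeff u.toL2 j‖) ^ (2 : ℝ) =
      (1 + lam j) ^ s * ‖coeff u.toL2 j‖ ^ 2 := by
    intro j
    have h := one_add_lam_pos j
    rw [Real.rpow_two, mul_pow, ← Real.rpow_natCast (_ ^ _), ← Real.rpow_mul h.le]
    congr 2; push_cast; ring
  have e3 : ∀ j, b j * (1 + lam j) ^ (-(s / 2)) * ((1 + lam j) ^ (s / 2) * ‖coeff u.toL2 j‖) =
      b j * ‖coeff u.toL2 j‖ := by
    intro j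
    have h := one_add_lam_pos j
    rw [Real.rpow_neg h.le]
    have : (1 + lam j) ^ (s / 2) ≠ 0 := (Real.rpow_pos_of_pos h _).ne'
    field_simp
  have key := Real.summable_and_inner_le_Lp_mul_Lq_tsum_of_nonneg
    (f := fun j => b j * (1 + lam j) ^ (-(s / 2)))
    (g := fun j => (1 + lam j) ^ (s / 2) * ‖coeff u.toL2 j‖) (p := 2) (q := 2)
    Real.HolderConjugate.two_two
    (fun j => mul_nonneg (hb j) (Real.rpow_nonneg (one_add_lam_pos j).le _))
    (fun j => mul_nonneg (Real.rpow_nonneg (one_add_lam_pos j).le _) (norm_nonneg _))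
    (by simpa only [e1] using h) (by simpa only [e2] using hu.summable)
  simp only [e1, e2, e3] at key
  refine ⟨key.1, key.2.trans (le_of_eq ?_)⟩
  rw [hu.tsum_eq, Real.sqrt_eq_rpow]
  congr 1
  rw [← Real.sqrt_eq_rpow, Real.sqrt_sq (norm_nonneg _)]

/-- If the Fourier coefficients of `u` are summable, its Fourier series converges uniformly. -/
theorem exists_hasSum_fourier (u : Lp ℝ 2 dx) (h : Summable fun j => ‖coeff u j‖) :
    ∃ g : C(Torus, ℝ), (u : Torus → ℝ) =ᵐ[dx] g ∧
      ∀ x, HasSum (fun j => coeff u j * fourier j x) ((g x : ℝ) : ℂ) := by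
  have hs : Summable fun j => coeff u j • (fourier j : C(Torus, ℂ)) := by
    refine Summable.of_norm ?_
    simpa only [norm_smul, fourier_norm, mul_one] using h
  obtain ⟨G, hG⟩ := hs
  have h1 : HasSum (fun j => coeff u j • fourierLp 2 j)
      (ContinuousMap.toLp (E := ℂ) 2 dx ℂ G) := by
    have := hG.mapL (ContinuousMap.toLp (E := ℂ) 2 dx ℂ)
    simpa using this
  have h2 := hasSum_fourier_series_L2 (cplx u)
  simp only [fourierCoeff_cplx] at h2
  have h3 := h1.unique h2
  have h4 : (G : Torus → ℂ) =ᵐ[dx] fun x => ((u x : ℝ) : ℂ) := by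
    have a := ContinuousMap.coeFn_toLp (p := 2) (𝕜 := ℂ) dx G
    rw [h3] at a
    exact a.symm.trans (coe_cplx u)
  have hcont : Continuous fun x => (G x).re := Complex.continuous_re.comp G.continuous
  refine ⟨⟨fun x => (G x).re, hcont⟩, ?_, fun x => ?_⟩
  · filter_upwards [h4] with x hx
    simp [hx]
  · have h5 : (G : Torus → ℂ) = fun x => (((G x).re : ℝ) : ℂ) := by
      refine Continuous.ae_eq_iff_eq dx G.continuous (by fun_prop) |>.1 ?_
      filter_upwards [h4] with x hx
      rw [hx]; simp
    have h6 := hG.map (ContinuousMap.evalCLM ℂ x) (ContinuousMap.evalCLM ℂ x).continuous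
    have h7 := congrFun h5 x
    rw [ContinuousMap.coe_mk, ← h7]
    exact h6

open Classical in
/-- The continuous representative of a square integrable function, if any. -/
def contRep (u : Lp ℝ 2 dx) : C(Torus, ℝ) :=
  if h : ∃ g : C(Torus, ℝ), (u : Torus → ℝ) =ᵐ[dx] g then h.choose else 0

theorem H.rep_eq {s : ℝ} (u : H s) : u.rep = contRep u.toL2 := by
  unfold H.rep contRep
  split_ifs <;> rfl

theorem contRep_eq {u : Lp ℝ 2 dx} {g : C(Torus, ℝ)} (h : (u : Torus → ℝ) =ᵐ[dx] g) :
    contRep u = g := by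
  have hex : ∃ g : C(Torus, ℝ), (u : Torus → ℝ) =ᵐ[dx] g := ⟨g, h⟩
  rw [contRep, dif_pos hex]
  apply DFunLike.coe_injective
  exact Continuous.ae_eq_iff_eq dx (map_continuous _) (map_continuous _) |>.1
    (hex.choose_spec.symm.trans h)

theorem contRep_ae {u : Lp ℝ 2 dx} (h : Summable fun j => ‖coeff u j‖) :
    (u : Torus → ℝ) =ᵐ[dx] contRep u := by
  obtain ⟨g, hg, -⟩ := exists_hasSum_fourier u h
  rwa [contRep_eq hg]

theorem hasSum_contRep {u : Lp ℝ 2 dx} (h : Summable fun j => ‖coeff u j‖) (x : Torus) :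
    HasSum (fun j => coeff u j * fourier j x) ((contRep u x : ℝ) : ℂ) := by
  obtain ⟨g, hg, hg'⟩ := exists_hasSum_fourier u h
  rw [contRep_eq hg]
  exact hg' x

theorem norm_fourier_apply (j : ℤ) (x : Torus) : ‖(fourier j x : ℂ)‖ = 1 := by
  rw [fourier_apply, Circle.norm_coe]

theorem abs_contRep_le {u : Lp ℝ 2 dx} (h : Summable fun j => ‖coeff u j‖) (x : Torus) :
    |contRep u x| ≤ ∑' j, ‖coeff u j‖ := by
  rw [← Real.norm_eq_abs, ← Complex.norm_real, ← (hasSum_contRep h x).tsum_eq]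
  refine (norm_tsum_le_tsum_norm ?_).trans (le_of_eq ?_) <;>
  simp only [norm_mul, norm_fourier_apply, mul_one]
  exact h

theorem exists_coe_eq_norm_eq (x : Torus) : ∃ r : ℝ, (r : Torus) = x ∧ |r| = ‖x‖ := by
  obtain ⟨r, rfl⟩ := QuotientAddGroup.mk_surjective x
  refine ⟨r - round r, ?_, ?_⟩
  · have : ((round r : ℝ) : Torus) = 0 := by
      rw [AddCircle.coe_eq_zero_iff]
      exact ⟨round r, by simp⟩
    change ((r - round r : ℝ) : Torus) = _
    rw [AddCircle.coe_sub, this, sub_zero]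
  · exact (UnitAddCircle.norm_eq).symm

theorem norm_coe_le (r : ℝ) : ‖(r : Torus)‖ ≤ |r| := by
  rw [UnitAddCircle.norm_eq]
  simpa using round_le r 0

theorem norm_fourier_sub_le (j : ℤ) (x y : Torus) :
    ‖(fourier j x : ℂ) - fourier j y‖ ≤ 2 * Real.pi * |(j : ℝ)| * dist x y := by
  obtain ⟨r, hr, hr'⟩ := exists_coe_eq_norm_eq (x - y)
  have hx : x = y + (r : Torus) := by rw [hr]; abel
  have h1 : (fourier j x : ℂ) = fourier j y * fourier j (r : Torus) := by
    rw [hx]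
    simp only [fourier_apply, smul_add, toCircle_add, Circle.coe_mul]
  rw [h1, dist_eq_norm, ← hr', ← mul_sub_one, norm_mul, norm_fourier_apply, one_mul,
    fourier_coe_apply]
  have e : (2 * Real.pi * Complex.I * j * r / (1 : ℝ) : ℂ) =
      Complex.I * ((2 * Real.pi * j * r : ℝ) : ℂ) := by
    push_cast; ring
  rw [e]
  refine Real.norm_exp_I_mul_ofReal_sub_one_le.trans (le_of_eq ?_)
  rw [Real.norm_eq_abs, abs_mul, abs_mul, abs_of_pos (by positivity : 0 < 2 * Real.pi)]

theorem summable_norm_coeff_of {u : Lp ℝ 2 dx}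
    (h : Summable fun j : ℤ => (1 + 2 * Real.pi * |(j : ℝ)|) * ‖coeff u j‖) :
    Summable fun j => ‖coeff u j‖ := by
  refine Summable.of_nonneg_of_le (fun _ => norm_nonneg _) (fun j => ?_) h
  have : 0 ≤ 2 * Real.pi * |(j : ℝ)| := by positivity
  nlinarith [norm_nonneg (coeff u j)]

theorem abs_contRep_sub_le {u : Lp ℝ 2 dx}
    (h : Summable fun j : ℤ => (1 + 2 * Real.pi * |(j : ℝ)|) * ‖coeff u j‖) (x y : Torus) :
    |contRep u x - contRep u y| ≤
      (∑' j : ℤ, (1 + 2 * Real.pi * |(j : ℝ)|) * ‖coeff u j‖) * dist x y := by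
  have h0 := summable_norm_coeff_of h
  rw [← Real.norm_eq_abs, ← Complex.norm_real, Complex.ofReal_sub,
    ← ((hasSum_contRep h0 x).sub (hasSum_contRep h0 y)).tsum_eq, ← tsum_mul_right]
  refine tsum_of_norm_bounded ((h.mul_right (dist x y)).hasSum) fun j => ?_
  rw [← mul_sub, norm_mul]
  calc ‖coeff u j‖ * ‖(fourier j x : ℂ) - fourier j y‖
      ≤ ‖coeff u j‖ * (2 * Real.pi * |(j : ℝ)| * dist x y) := by
        gcongr; exact norm_fourier_sub_le j x y
    _ ≤ (1 + 2 * Real.pi * |(j : ℝ)|) * ‖coeff u j‖ * dist x y := by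
        have := mul_nonneg (norm_nonneg (coeff u j)) (dist_nonneg (x := x) (y := y))
        nlinarith

/-- The constant of the embedding `H^s ⊂ C(𝕋)`. -/
def supConst (s : ℝ) : ℝ := √(∑' j : ℤ, (1 + lam j) ^ (-s))

theorem supConst_nonneg (s : ℝ) : 0 ≤ supConst s := Real.sqrt_nonneg _

theorem H.summable_coeff {s : ℝ} (hs : 1 / 2 < s) (u : H s) :
    (Summable fun j => ‖coeff u.toL2 j‖) ∧ ∑' j, ‖coeff u.toL2 j‖ ≤ supConst s * ‖u‖ := by
  have h := H.summable_mul_coeff (b := fun _ => 1) (fun _ => zero_le_one)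
    (by simpa using summable_one_add_lam_rpow hs) u
  simpa [supConst] using h

theorem sq_one_add_le (j : ℤ) : (1 + 2 * Real.pi * |(j : ℝ)|) ^ 2 ≤ 2 * (1 + lam j) := by
  have : lam j = (2 * Real.pi * |(j : ℝ)|) ^ 2 := by
    unfold lam; rw [mul_pow, mul_pow _ |_|, sq_abs]
  rw [this]
  nlinarith [sq_nonneg (1 - 2 * Real.pi * |(j : ℝ)|)]

/-- The constant of the embedding of `H^s` in the Lipschitz functions, `s > 3/2`. -/
def lipConst (s : ℝ) : ℝ :=
  √(∑' j : ℤ, (1 + 2 * Real.pi * |(j : ℝ)|) ^ 2 * (1 + lam j) ^ (-s))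

theorem lipConst_nonneg (s : ℝ) : 0 ≤ lipConst s := Real.sqrt_nonneg _

theorem H.summable_mul_coeff_one {s : ℝ} (hs : 3 / 2 < s) (u : H s) :
    (Summable fun j : ℤ => (1 + 2 * Real.pi * |(j : ℝ)|) * ‖coeff u.toL2 j‖) ∧
    ∑' j : ℤ, (1 + 2 * Real.pi * |(j : ℝ)|) * ‖coeff u.toL2 j‖ ≤ lipConst s * ‖u‖ := by
  refine H.summable_mul_coeff (fun j => by positivity) ?_ u
  refine Summable.of_nonneg_of_le (fun j => ?_) (fun j => ?_)
    ((summable_one_add_lam_rpow (s := s - 1) (by linarith)).mul_left 2)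
  · have := one_add_lam_pos j
    positivity
  · have h := one_add_lam_pos j
    have e : (1 + lam j) ^ (-(s - 1)) = (1 + lam j) * (1 + lam j) ^ (-s) := by
      rw [neg_sub, sub_eq_add_neg, Real.rpow_add h, Real.rpow_one]
    rw [e, ← mul_assoc]
    gcongr
    exact sq_one_add_le j

theorem H.contRep_ae {s : ℝ} (hs : 1 / 2 < s) (u : H s) :
    (u.toL2 : Torus → ℝ) =ᵐ[dx] contRep u.toL2 :=
  Kinetic.contRep_ae (H.summable_coeff hs u).1

theorem H.norm_contRep_le {s : ℝ} (hs : 1 / 2 < s) (u : H s) :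
    ‖contRep u.toL2‖ ≤ supConst s * ‖u‖ := by
  rw [ContinuousMap.norm_le _ (mul_nonneg (supConst_nonneg _) (norm_nonneg _))]
  intro x
  exact (abs_contRep_le (H.summable_coeff hs u).1 x).trans (H.summable_coeff hs u).2

theorem H.contRep_sub {s : ℝ} (hs : 1 / 2 < s) (u w : H s) :
    contRep (u - w).toL2 = contRep u.toL2 - contRep w.toL2 := by
  apply contRep_eq
  rw [H.toL2_sub]
  filter_upwards [Lp.coeFn_sub u.toL2 w.toL2, H.contRep_ae hs u, H.contRep_ae hs w] with x h1 h2 h3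
  rw [h1, Pi.sub_apply, h2, h3]; rfl

theorem H.continuous_contRep {s : ℝ} (hs : 1 / 2 < s) :
    Continuous fun u : H s => contRep u.toL2 := by
  refine (LipschitzWith.of_dist_le_mul (K := (supConst s).toNNReal) fun u w => ?_).continuous
  rw [dist_eq_norm, dist_eq_norm, ← H.contRep_sub hs, Real.coe_toNNReal _ (supConst_nonneg s)]
  exact H.norm_contRep_le hs _

theorem H.abs_contRep_sub_le {s : ℝ} (hs : 3 / 2 < s) (u : H s) (x y : Torus) :
    |contRep u.toL2 x - contRep u.toL2 y| ≤ lipConst s * ‖u‖ * dist x y := by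
  have h := H.summable_mul_coeff_one hs u
  refine (Kinetic.abs_contRep_sub_le h.1 x y).trans ?_
  gcongr
  exact h.2

/-- Dominated convergence in `H^s`. -/
theorem H.tendsto_of_dominated {s : ℝ} {ι : Type*} {l : Filter ι} {u : ι → H s} {w : H s}
    {a : ℤ → ℝ} (ha : Summable fun j => (1 + lam j) ^ s * a j ^ 2)
    (hu : ∀ i j, ‖coeff (u i).toL2 j‖ ≤ a j) (hw : ∀ j, ‖coeff w.toL2 j‖ ≤ a j)
    (h : ∀ j, Tendsto (fun i => coeff (u i).toL2 j) l (𝓝 (coeff w.toL2 j))) :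
    Tendsto u l (𝓝 w) := by
  rw [tendsto_iff_norm_sub_tendsto_zero]
  have key : Tendsto (fun i => ∑' j, (1 + lam j) ^ s * ‖coeff (u i - w).toL2 j‖ ^ 2) l
      (𝓝 (∑' _ : ℤ, (0 : ℝ))) := by
    refine tendsto_tsum_of_dominated_convergence (ha.mul_left 4) (fun j => ?_) ?_
    · have h1 := ((h j).sub_const (coeff w.toL2 j)).norm.pow 2 |>.const_mul ((1 + lam j) ^ s)
      simpa [H.toL2_sub, coeff_sub] using h1
    · refine Eventually.of_forall fun i j => ?_
      have h0 := one_add_lam_pos j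
      rw [Real.norm_of_nonneg (by positivity), H.toL2_sub, coeff_sub]
      have h1 : ‖coeff (u i).toL2 j - coeff w.toL2 j‖ ≤ 2 * a j :=
        (norm_sub_le _ _).trans (by linarith [hu i j, hw j])
      have h2 : ‖coeff (u i).toL2 j - coeff w.toL2 j‖ ^ 2 ≤ (2 * a j) ^ 2 := by gcongr
      have h3 : 0 ≤ (1 + lam j) ^ s := by positivity
      nlinarith
  simp only [tsum_zero] at key
  have h2 : ∀ i, ∑' j, (1 + lam j) ^ s * ‖coeff (u i - w).toL2 j‖ ^ 2 = ‖u i - w‖ ^ 2 :=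
    fun i => (H.hasSum_norm_sq (u i - w)).tsum_eq
  simp only [h2] at key
  have h3 := key.sqrt
  simpa [Real.sqrt_sq (norm_nonneg _)] using h3

instance : SecondCountableTopology (Lp ℂ 2 dx) :=
  have : Fact ((2 : ℝ≥0∞) ≠ ∞) := ⟨by norm_num⟩
  Lp.SecondCountableTopology

instance (s : ℝ) : SecondCountableTopology (H s) := by
  have : SecondCountableTopology (lp (fun _ : ℤ => ℂ) 2) :=
    (fourierBasis (T := 1)).repr.symm.toHomeomorph.secondCountableTopology
  have h : Isometry (H.toEll2 s) :=
    AddMonoidHomClass.isometry_of_norm (H.toEll2 s) fun _ => rfl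
  exact h.isEmbedding.isInducing.secondCountableTopology

end Kinetic

namespace Kinetic

/-! ### The driving space -/

theorem measurePreserving_coe :
    MeasurePreserving ((↑) : ℝ → Torus) (volume.restrict (Ioc (0 : ℝ) 1)) dx := by
  have h := UnitAddCircle.measurePreserving_mk 0
  rw [zero_add] at h
  have e : (volume : Measure UnitAddCircle) = dx := by
    rw [AddCircle.volume_eq_smul_haarAddCircle, ENNReal.ofReal_one, one_smul]
  rwa [e] at h

theorem fourierCoeff_ofReal {g : Torus → ℝ} (hg : Integrable g dx) (j : ℤ) :
    fourierCoeff (fun x => ((g x : ℝ) : ℂ)) j =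
      ((∫ x in (0 : ℝ)..1, g x * Real.cos (2 * Real.pi * j * x) : ℝ) : ℂ) -
        Complex.I * ((∫ x in (0 : ℝ)..1, g x * Real.sin (2 * Real.pi * j * x) : ℝ) : ℂ) := by
  have hi : Integrable (fun x : ℝ => g x) (volume.restrict (Ioc (0 : ℝ) 1)) :=
    measurePreserving_coe.integrable_comp_of_integrable hg
  have hc : Integrable (fun x : ℝ => g x * Real.cos (2 * Real.pi * j * x))
      (volume.restrict (Ioc (0 : ℝ) 1)) := by
    refine hi.mul_bdd (c := 1) (by fun_prop) (Eventually.of_forall fun x => ?_)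
    exact Real.abs_cos_le_one _
  have hs : Integrable (fun x : ℝ => g x * Real.sin (2 * Real.pi * j * x))
      (volume.restrict (Ioc (0 : ℝ) 1)) := by
    refine hi.mul_bdd (c := 1) (by fun_prop) (Eventually.of_forall fun x => ?_)
    exact Real.abs_sin_le_one _
  rw [fourierCoeff_eq_intervalIntegral _ j 0, zero_add, div_one, one_smul,
    intervalIntegral.integral_of_le zero_le_one, intervalIntegral.integral_of_le zero_le_one,
    intervalIntegral.integral_of_le zero_le_one, ← integral_complex_ofReal,
    ← integral_complex_ofReal, ← integral_const_mul, ← integral_sub hc.ofReal (hs.ofReal.const_mul _)]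
  congr 1
  ext x
  rw [fourier_coe_apply, smul_eq_mul]
  have e : (2 * Real.pi * Complex.I * (-j : ℤ) * x / (1 : ℝ) : ℂ) =
      ((-(2 * Real.pi * j * x) : ℝ) : ℂ) * Complex.I := by push_cast; ring
  rw [e, Complex.exp_mul_I, ← Complex.ofReal_cos, ← Complex.ofReal_sin, Real.cos_neg, Real.sin_neg]
  push_cast
  ring

theorem HasWeakDeriv.fourierCoeff {g g' : Torus → ℝ} (h : HasWeakDeriv g g')
    (hg : Integrable g dx) (hg' : Integrable g' dx) (j : ℤ) :
    fourierCoeff (fun x => ((g' x : ℝ) : ℂ)) j =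
      (2 * Real.pi * j * Complex.I) * fourierCoeff (fun x => ((g x : ℝ) : ℂ)) j := by
  rw [fourierCoeff_ofReal hg, fourierCoeff_ofReal hg']
  have hper : ∀ x : ℝ, 2 * Real.pi * j * (x + 1) = 2 * Real.pi * j * x + j * (2 * Real.pi) := by
    intro x; ring
  have hlin : ∀ x : ℝ, HasDerivAt (fun x : ℝ => 2 * Real.pi * j * x) (2 * Real.pi * j) x := by
    intro x
    simpa using (hasDerivAt_id x).const_mul (2 * Real.pi * (j : ℝ))
  have hc := h (fun x => Real.cos (2 * Real.pi * j * x)) (by fun_prop)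
    (fun x => by simp only [hper, Real.cos_add_int_mul_two_pi])
  have hs := h (fun x => Real.sin (2 * Real.pi * j * x)) (by fun_prop)
    (fun x => by simp only [hper, Real.sin_add_int_mul_two_pi])
  have dc : ∀ x : ℝ, deriv (fun x : ℝ => Real.cos (2 * Real.pi * j * x)) x =
      -Real.sin (2 * Real.pi * j * x) * (2 * Real.pi * j) := fun x => (hlin x).cos.deriv
  have ds : ∀ x : ℝ, deriv (fun x : ℝ => Real.sin (2 * Real.pi * j * x)) x =
      Real.cos (2 * Real.pi * j * x) * (2 * Real.pi * j) := fun x => (hlin x).sin.deriv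
  simp only [dc] at hc
  simp only [ds] at hs
  have hc' : ∫ x in (0 : ℝ)..1, g' x * Real.cos (2 * Real.pi * j * x) =
      (2 * Real.pi * j) * ∫ x in (0 : ℝ)..1, g x * Real.sin (2 * Real.pi * j * x) := by
    rw [← neg_eq_iff_eq_neg] at hc
    rw [← hc, ← intervalIntegral.integral_const_mul, ← intervalIntegral.integral_neg]
    congr 1; ext x; ring
  have hs' : ∫ x in (0 : ℝ)..1, g' x * Real.sin (2 * Real.pi * j * x) =
      -((2 * Real.pi * j) * ∫ x in (0 : ℝ)..1, g x * Real.cos (2 * Real.pi * j * x)) := by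
    rw [← neg_eq_iff_eq_neg] at hs
    rw [← hs, ← intervalIntegral.integral_const_mul]
    congr 2; ext x; ring
  rw [hc', hs']
  push_cast
  linear_combination (2 * Real.pi * j *
    (∫ x in (0 : ℝ)..1, g x * Real.sin (2 * Real.pi * j * x) : ℝ)) * Complex.I_sq

/-- The square integrable function defined by a continuous function. -/
def contL2 (g : C(Torus, ℝ)) : Lp ℝ 2 dx := ContinuousMap.toLp (E := ℝ) 2 dx ℝ g

theorem coe_contL2 (g : C(Torus, ℝ)) : contL2 g =ᵐ[dx] g := ContinuousMap.coeFn_toLp dx g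

theorem contRep_contL2 (g : C(Torus, ℝ)) : contRep (contL2 g) = g := contRep_eq (coe_contL2 g)

theorem coeff_congr {u : Lp ℝ 2 dx} {g : Torus → ℝ} (h : (u : Torus → ℝ) =ᵐ[dx] g) (j : ℤ) :
    coeff u j = fourierCoeff (fun x => ((g x : ℝ) : ℂ)) j := by
  unfold coeff fourierCoeff
  refine integral_congr_ae ?_
  filter_upwards [h] with x hx
  rw [hx]

theorem norm_le_of_ae_bound {u : Lp ℝ 2 dx} {C : ℝ} (hC : 0 ≤ C) (h : ∀ᵐ x ∂dx, ‖u x‖ ≤ C) :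
    ‖u‖ ≤ C := by
  refine (Lp.norm_le_of_ae_bound hC h).trans ?_
  simp [measureUnivNNReal]

theorem ae_norm_le_Lp_top (g : Lp ℝ ∞ dx) : ∀ᵐ x ∂dx, ‖g x‖ ≤ ‖g‖ := by
  have h := enorm_ae_le_eLpNormEssSup g dx
  have h2 := (Lp.memLp g).2.ne
  rw [eLpNorm_exponent_top] at h2
  filter_upwards [h] with x hx
  rw [Lp.norm_def, eLpNorm_exponent_top, ← toReal_enorm]
  exact ENNReal.toReal_mono h2 hx

theorem norm_contL2_le (g : C(Torus, ℝ)) : ‖contL2 g‖ ≤ ‖g‖ := by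
  refine norm_le_of_ae_bound (norm_nonneg g) ?_
  filter_upwards [coe_contL2 g] with x hx
  rw [hx]; exact g.norm_coe_le_norm x

theorem W2InfBound.exists_sobolev {g : C(Torus, ℝ)} {R : ℝ} (h : W2InfBound g R) :
    ∃ U : H 2, U.toL2 = contL2 g ∧ ‖U‖ ≤ R := by
  obtain ⟨g₁, g₂, h1, h2, hR⟩ := h
  have i1 : Integrable g₁ dx := (Lp.memLp g₁).integrable le_top
  have m2 : MemLp g₂ 2 dx := (Lp.memLp g₂).mono_exponent le_top
  have i2 : Integrable g₂ dx := (Lp.memLp g₂).integrable le_top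
  have i0 : Integrable g dx := g.continuous.integrable_of_hasCompactSupport
    (HasCompactSupport.of_compactSpace g)
  set h2' : Lp ℝ 2 dx := m2.toLp
  have hc : ∀ j, coeff (contL2 g - h2') j = (1 + lam j : ℝ) * coeff (contL2 g) j := by
    intro j
    rw [coeff_sub, coeff_congr (coe_contL2 g), coeff_congr m2.coeFn_toLp,
      h2.fourierCoeff i1 i2, h1.fourierCoeff i0 i1]
    unfold lam
    push_cast
    linear_combination (-(2 * Real.pi * j) ^ 2 *
      fourierCoeff (fun x => ((g x : ℝ) : ℂ)) j : ℂ) * Complex.I_sq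
  have hp := hasSum_sq_coeff (contL2 g - h2')
  have e : ∀ j, ‖coeff (contL2 g - h2') j‖ ^ 2 =
      (1 + lam j) ^ (2 : ℝ) * ‖coeff (contL2 g) j‖ ^ 2 := by
    intro j
    rw [hc, norm_mul, mul_pow, Complex.norm_real, Real.norm_of_nonneg (one_add_lam_pos j).le,
      Real.rpow_two]
  simp only [e] at hp
  have hmem : contL2 g ∈ sobolevSubmodule 2 := mem_sobolevSubmodule_iff.2 hp.summable
  let U : H 2 := ⟨contL2 g, hmem⟩
  have hU : U.toL2 = contL2 g := by
    unfold H.toL2 U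
    dsimp only
  refine ⟨U, hU, ?_⟩
  have hn := H.hasSum_norm_sq U
  rw [hU] at hn
  have h3 := hn.unique hp
  have h4 : ‖U‖ ≤ ‖contL2 g - h2'‖ := le_of_sq_le_sq h3.le (norm_nonneg _)
  have h5 : ‖h2'‖ ≤ ‖g₂‖ := by
    refine norm_le_of_ae_bound (norm_nonneg g₂) ?_
    filter_upwards [m2.coeFn_toLp, ae_norm_le_Lp_top g₂] with x hx hx'
    rw [hx]; exact hx'
  calc ‖U‖ ≤ ‖contL2 g - h2'‖ := h4
    _ ≤ ‖contL2 g‖ + ‖h2'‖ := norm_sub_le _ _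
    _ ≤ ‖g‖ + ‖g₂‖ := add_le_add (norm_contL2_le g) h5
    _ ≤ R := by linarith [norm_nonneg g₁]

theorem W2InfBound.abs_sub_le {g : C(Torus, ℝ)} {R : ℝ} (h : W2InfBound g R) (x y : Torus) :
    |g x - g y| ≤ lipConst 2 * R * dist x y := by
  obtain ⟨U, hU, hR⟩ := h.exists_sobolev
  have := H.abs_contRep_sub_le (by norm_num : (3 / 2 : ℝ) < 2) U x y
  rw [hU, contRep_contL2] at this
  refine this.trans ?_
  have := lipConst_nonneg 2
  gcongr

theorem W2InfBound.norm_le {g : C(Torus, ℝ)} {R : ℝ} (h : W2InfBound g R) : ‖g‖ ≤ R := by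
  obtain ⟨g₁, g₂, -, -, hR⟩ := h
  linarith [norm_nonneg g₁, norm_nonneg g₂]

namespace DrivingSpace

variable {F : Type*} [NormedAddCommGroup F] [NormedSpace ℝ F] {E : Set F} {ι : F →ₗ[ℝ] C(Torus, ℝ)}

theorem continuous_embedding (hE : DrivingSpace E ι) : Continuous ι := by
  obtain ⟨C, hC⟩ := hE.embedding
  exact (LinearMap.mkContinuous ι C fun n => (hC n).norm_le).continuous

/-- Uniform bounds on the elements of `E`, in sup norm and in Lipschitz norm. -/
theorem exists_bound (hE : DrivingSpace E ι) :
    ∃ C : ℝ, 0 ≤ C ∧ ∀ n ∈ E, ‖ι n‖ ≤ C ∧ ∀ x y, |ι n x - ι n y| ≤ C * dist x y := by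
  obtain ⟨C, hC⟩ := hE.embedding
  obtain ⟨R, hR⟩ := hE.bounded
  refine ⟨(1 + lipConst 2) * (|C| * |R|), ?_, fun n hn => ⟨?_, fun x y => ?_⟩⟩
  · have := lipConst_nonneg 2
    positivity
  · have h1 := (hC n).norm_le
    have h2 : C * ‖n‖ ≤ |C| * |R| := by
      gcongr
      · exact le_abs_self _
      · exact (hR n hn).trans (le_abs_self _)
    have h3 : 0 ≤ lipConst 2 * (|C| * |R|) := by
      have := lipConst_nonneg 2
      positivity
    linarith
  · refine ((hC n).abs_sub_le x y).trans ?_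
    have h2 : C * ‖n‖ ≤ |C| * |R| := by
      gcongr
      · exact le_abs_self _
      · exact (hR n hn).trans (le_abs_self _)
    have h4 := lipConst_nonneg 2
    have h5 : lipConst 2 * (C * ‖n‖) ≤ lipConst 2 * (|C| * |R|) :=
      mul_le_mul_of_nonneg_left h2 h4
    have h6 : 0 ≤ |C| * |R| := by positivity
    exact mul_le_mul_of_nonneg_right (by linarith) dist_nonneg

theorem secondCountable (hE : DrivingSpace E ι) : SecondCountableTopology E := by
  have := hE.separable.separableSpace
  exact UniformSpace.secondCountable_of_separable E

theorem isBounded_univ (hE : DrivingSpace E ι) : Bornology.IsBounded (univ : Set E) := by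
  obtain ⟨R, hR⟩ := hE.bounded
  have hb : Bornology.IsBounded E := isBounded_iff_forall_norm_le.2 ⟨R, hR⟩
  have := Bornology.isBounded_image_subtype_val (s := (univ : Set E))
  rw [← this]
  simpa using hb

end DrivingSpace

end Kinetic

namespace Kinetic

/-! ### Calculus on phase space and on the torus -/

theorem isOpenQuotientMap_coe : IsOpenQuotientMap ((↑) : ℝ → Torus) :=
  QuotientAddGroup.isOpenQuotientMap_mk

theorem continuous_coe_torus : Continuous ((↑) : ℝ → Torus) := isOpenQuotientMap_coe.continuous

theorem continuous_of_lift {φ : Phase → ℝ} (h : Continuous (lift φ)) : Continuous φ := by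
  have hq : IsOpenQuotientMap (Prod.map ((↑) : ℝ → Torus) (id : ℝ → ℝ)) :=
    isOpenQuotientMap_coe.prodMap .id
  exact hq.isQuotientMap.continuous_iff.2 h

theorem continuous_of_comp_coe {ζ : Torus → ℝ} (h : Continuous fun y : ℝ => ζ y) :
    Continuous ζ := isOpenQuotientMap_coe.isQuotientMap.continuous_iff.2 h

theorem dT_coe (ζ : Torus → ℝ) (y : ℝ) : dT ζ y = deriv (fun y : ℝ => ζ y) y := by
  have h := deriv_comp_const_add (fun y : ℝ => ζ y) y 0
  rw [add_zero] at h
  rw [← h]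
  rfl

theorem dV_coe (φ : Phase → ℝ) (x v : ℝ) :
    dV φ ((x : Torus), v) = deriv (fun v' => lift φ (x, v')) v := rfl

theorem dX_coe (φ : Phase → ℝ) (x v : ℝ) :
    dX φ ((x : Torus), v) = deriv (fun x' => lift φ (x', v)) x := by
  have h := deriv_comp_const_add (fun x' => lift φ (x', v)) x 0
  rw [add_zero] at h
  rw [← h]
  rfl

section C1

variable {φ φ' : Phase → ℝ}

theorem dV_eq_fderiv (h : ContDiff ℝ 1 (lift φ)) (x v : ℝ) :
    dV φ ((x : Torus), v) = fderiv ℝ (lift φ) (x, v) (0, 1) := by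
  have h1 := (h.differentiable one_ne_zero (x, v)).hasFDerivAt
  have h2 : HasDerivAt (fun v' : ℝ => (x, v')) ((0 : ℝ), (1 : ℝ)) v :=
    (hasDerivAt_const v x).prodMk (hasDerivAt_id v)
  rw [dV_coe]
  exact (h1.comp_hasDerivAt v h2).deriv

theorem dX_eq_fderiv (h : ContDiff ℝ 1 (lift φ)) (x v : ℝ) :
    dX φ ((x : Torus), v) = fderiv ℝ (lift φ) (x, v) (1, 0) := by
  have h1 := (h.differentiable one_ne_zero (x, v)).hasFDerivAt
  have h2 : HasDerivAt (fun x' : ℝ => (x', v)) ((1 : ℝ), (0 : ℝ)) x :=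
    (hasDerivAt_id x).prodMk (hasDerivAt_const x v)
  rw [dX_coe]
  exact (h1.comp_hasDerivAt x h2).deriv

theorem fderiv_lift (h : ContDiff ℝ 1 (lift φ)) (x v a b : ℝ) :
    fderiv ℝ (lift φ) (x, v) (a, b) = a * dX φ ((x : Torus), v) + b * dV φ ((x : Torus), v) := by
  rw [dX_eq_fderiv h, dV_eq_fderiv h, ← smul_eq_mul, ← smul_eq_mul, ← map_smul, ← map_smul,
    ← map_add]
  simp

theorem continuous_dV (h : ContDiff ℝ 1 (lift φ)) : Continuous (dV φ) := by
  apply continuous_of_lift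
  have : lift (dV φ) = fun y => fderiv ℝ (lift φ) y (0, 1) := by
    ext ⟨x, v⟩; exact dV_eq_fderiv h x v
  rw [this]
  exact (h.continuous_fderiv one_ne_zero).clm_apply continuous_const

theorem continuous_dX (h : ContDiff ℝ 1 (lift φ)) : Continuous (dX φ) := by
  apply continuous_of_lift
  have : lift (dX φ) = fun y => fderiv ℝ (lift φ) y (1, 0) := by
    ext ⟨x, v⟩; exact dX_eq_fderiv h x v
  rw [this]
  exact (h.continuous_fderiv one_ne_zero).clm_apply continuous_const

theorem dV_sub (h : ContDiff ℝ 1 (lift φ)) (h' : ContDiff ℝ 1 (lift φ')) (z : Phase) :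
    dV (φ - φ') z = dV φ z - dV φ' z := by
  obtain ⟨x, v⟩ := z
  obtain ⟨x, rfl⟩ := QuotientAddGroup.mk_surjective x
  have e : lift (φ - φ') = lift φ - lift φ' := rfl
  have h2 : ContDiff ℝ 1 (lift (φ - φ')) := by rw [e]; exact h.sub h'
  have := dV_eq_fderiv h2 x v
  rw [e, fderiv_sub (h.differentiable one_ne_zero _) (h'.differentiable one_ne_zero _)] at this
  exact this.trans (congrArg₂ (· - ·) (dV_eq_fderiv h x v) (dV_eq_fderiv h' x v)).symm

theorem dX_sub (h : ContDiff ℝ 1 (lift φ)) (h' : ContDiff ℝ 1 (lift φ')) (z : Phase) :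
    dX (φ - φ') z = dX φ z - dX φ' z := by
  obtain ⟨x, v⟩ := z
  obtain ⟨x, rfl⟩ := QuotientAddGroup.mk_surjective x
  have e : lift (φ - φ') = lift φ - lift φ' := rfl
  have h2 : ContDiff ℝ 1 (lift (φ - φ')) := by rw [e]; exact h.sub h'
  have := dX_eq_fderiv h2 x v
  rw [e, fderiv_sub (h.differentiable one_ne_zero _) (h'.differentiable one_ne_zero _)] at this
  exact this.trans (congrArg₂ (· - ·) (dX_eq_fderiv h x v) (dX_eq_fderiv h' x v)).symm

end C1

section C2

variable {ζ ζ' : Torus → ℝ}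

theorem MemC2.contDiff_dT (h : MemC2 ζ) : ContDiff ℝ 1 (fun y : ℝ => dT ζ y) := by
  have : (fun y : ℝ => dT ζ y) = deriv (fun y : ℝ => ζ y) := funext (dT_coe ζ)
  rw [this]
  have h' : ContDiff ℝ (1 + 1) (fun y : ℝ => ζ y) := h
  exact (contDiff_succ_iff_deriv.1 h').2.2

theorem MemC2.continuous (h : MemC2 ζ) : Continuous ζ :=
  continuous_of_comp_coe (ContDiff.continuous h)

theorem MemC2.hasDerivAt (h : MemC2 ζ) (y : ℝ) : HasDerivAt (fun y : ℝ => ζ y) (dT ζ y) y := by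
  rw [dT_coe]
  exact (ContDiff.differentiable h two_ne_zero y).hasDerivAt

theorem MemC2.hasDerivAt_dT (h : MemC2 ζ) (y : ℝ) :
    HasDerivAt (fun y : ℝ => dT ζ y) (dT (dT ζ) y) y := by
  rw [dT_coe]
  exact (h.contDiff_dT.differentiable one_ne_zero y).hasDerivAt

theorem MemC2.continuous_dT (h : MemC2 ζ) : Continuous (dT ζ) :=
  continuous_of_comp_coe h.contDiff_dT.continuous

theorem MemC2.continuous_dT_dT (h : MemC2 ζ) : Continuous (dT (dT ζ)) := by
  apply continuous_of_comp_coe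
  have : (fun y : ℝ => dT (dT ζ) y) = deriv (fun y : ℝ => dT ζ y) := funext (dT_coe _)
  rw [this]
  exact h.contDiff_dT.continuous_deriv le_rfl

theorem MemC2.dT_sub (h : MemC2 ζ) (h' : MemC2 ζ') : dT (ζ - ζ') = dT ζ - dT ζ' := by
  funext x
  obtain ⟨x, rfl⟩ := QuotientAddGroup.mk_surjective x
  have e := ((h.hasDerivAt x).sub (h'.hasDerivAt x)).deriv
  exact (dT_coe _ x).trans e

theorem MemC2.dT_dT_sub (h : MemC2 ζ) (h' : MemC2 ζ') :
    dT (dT (ζ - ζ')) = dT (dT ζ) - dT (dT ζ') := by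
  rw [h.dT_sub h']
  funext x
  obtain ⟨x, rfl⟩ := QuotientAddGroup.mk_surjective x
  have e := ((h.hasDerivAt_dT x).sub (h'.hasDerivAt_dT x)).deriv
  exact (dT_coe _ x).trans e

theorem hasWeakDeriv_of_hasDerivAt {g g' : Torus → ℝ}
    (h : ∀ y : ℝ, HasDerivAt (fun y : ℝ => g y) (g' y) y) (hg' : Continuous g') :
    HasWeakDeriv g g' := by
  intro φ hφ hper
  have hd : Continuous (deriv φ) := hφ.continuous_deriv (by norm_num)
  have h1 := intervalIntegral.integral_mul_deriv_eq_deriv_mul (a := 0) (b := 1)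
    (u := fun y : ℝ => g y) (u' := fun y : ℝ => g' y) (v := φ) (v' := deriv φ)
    (fun x _ => h x) (fun x _ => (hφ.differentiable (by norm_num) x).hasDerivAt)
    ((hg'.comp continuous_coe_torus).intervalIntegrable _ _) (hd.intervalIntegrable _ _)
  rw [h1]
  have e1 : φ 1 = φ 0 := by simpa using hper 0
  have e2 : ((1 : ℝ) : Torus) = ((0 : ℝ) : Torus) := by
    have := AddCircle.coe_period (1 : ℝ)
    rw [this]; rfl
  rw [e1, e2]
  ring

theorem MemC2.hasWeakDeriv (h : MemC2 ζ) : HasWeakDeriv ζ (dT ζ) :=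
  hasWeakDeriv_of_hasDerivAt h.hasDerivAt h.continuous_dT

theorem MemC2.hasWeakDeriv_dT (h : MemC2 ζ) : HasWeakDeriv (dT ζ) (dT (dT ζ)) :=
  hasWeakDeriv_of_hasDerivAt h.hasDerivAt_dT h.continuous_dT_dT

theorem integrable_of_continuous {g : Torus → ℝ} (h : Continuous g) : Integrable g dx :=
  h.integrable_of_hasCompactSupport (HasCompactSupport.of_compactSpace g)

theorem MemC2.fourierCoeff_dT_dT (h : MemC2 ζ) (j : ℤ) :
    fourierCoeff (fun x => ((dT (dT ζ) x : ℝ) : ℂ)) j =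
      -(lam j : ℂ) * fourierCoeff (fun x => ((ζ x : ℝ) : ℂ)) j := by
  rw [h.hasWeakDeriv_dT.fourierCoeff (integrable_of_continuous h.continuous_dT)
    (integrable_of_continuous h.continuous_dT_dT),
    h.hasWeakDeriv.fourierCoeff (integrable_of_continuous h.continuous)
    (integrable_of_continuous h.continuous_dT)]
  unfold lam
  push_cast
  linear_combination ((2 * Real.pi * j) ^ 2 *
      fourierCoeff (fun x => ((ζ x : ℝ) : ℂ)) j : ℂ) * Complex.I_sq

/-- A function of class `C²` as a continuous function. -/
def MemC2.toC (h : MemC2 ζ) : C(Torus, ℝ) := ⟨ζ, h.continuous⟩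

theorem MemC2.mem_sobolev (h : MemC2 ζ) {α : ℝ} (hα : α ≤ 2) :
    ∃ U : H α, U.toL2 = contL2 h.toC := by
  have hw : W2InfBound h.toC (‖h.toC‖ + ‖ContinuousMap.toLp (E := ℝ) ∞ dx ℝ
      ⟨dT ζ, h.continuous_dT⟩‖ + ‖ContinuousMap.toLp (E := ℝ) ∞ dx ℝ
      ⟨dT (dT ζ), h.continuous_dT_dT⟩‖) := by
    refine ⟨_, _, ?_, ?_, le_rfl⟩
    · intro φ hφ hper
      rw [show ∫ x in (0 : ℝ)..1, h.toC x * deriv φ x = _ from h.hasWeakDeriv φ hφ hper]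
      congr 1
      rw [intervalIntegral.integral_of_le zero_le_one, intervalIntegral.integral_of_le zero_le_one]
      refine integral_congr_ae ?_
      filter_upwards [measurePreserving_coe.quasiMeasurePreserving.ae
        (ContinuousMap.coeFn_toLp (p := ∞) (𝕜 := ℝ) dx ⟨dT ζ, h.continuous_dT⟩)] with x hx
      rw [hx]; rfl
    · intro φ hφ hper
      have := h.hasWeakDeriv_dT φ hφ hper
      rw [intervalIntegral.integral_of_le zero_le_one,
        intervalIntegral.integral_of_le zero_le_one] at this ⊢
      convert this using 1
      · refine integral_congr_ae ?_
        filter_upwards [measurePreserving_coe.quasiMeasurePreserving.ae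
          (ContinuousMap.coeFn_toLp (p := ∞) (𝕜 := ℝ) dx ⟨dT ζ, h.continuous_dT⟩)] with x hx
        rw [hx]; rfl
      · congr 1
        refine integral_congr_ae ?_
        filter_upwards [measurePreserving_coe.quasiMeasurePreserving.ae
          (ContinuousMap.coeFn_toLp (p := ∞) (𝕜 := ℝ) dx ⟨dT (dT ζ), h.continuous_dT_dT⟩)] with x hx
        rw [hx]; rfl
  obtain ⟨U, hU, -⟩ := hw.exists_sobolev
  exact ⟨H.incl hα U, by rw [H.toL2_incl, hU]⟩

/-- The real form of the `C²` norm. -/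
def c2 (ζ : Torus → ℝ) : ℝ := (C2norm ζ).toReal

theorem c2_nonneg (ζ : Torus → ℝ) : 0 ≤ c2 ζ := ENNReal.toReal_nonneg

theorem abs_le_toReal_of_le_iSup {X : Type*} {a : X → ℝ} {N : ℝ≥0∞} (hN : N ≠ ∞)
    (h : (⨆ x, ENNReal.ofReal (a x)) ≤ N) (x : X) : a x ≤ N.toReal := by
  have h1 : ENNReal.ofReal (a x) ≤ N := (le_iSup (fun x => ENNReal.ofReal (a x)) x).trans h
  exact (ENNReal.ofReal_le_iff_le_toReal hN).1 h1

theorem abs_le_c2 (h : C2norm ζ ≠ ∞) (x : Torus) : |ζ x| ≤ c2 ζ :=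
  abs_le_toReal_of_le_iSup (a := fun x => |ζ x|) h (by
    unfold C2norm; exact le_self_add.trans le_self_add) x

theorem abs_dT_dT_le_c2 (h : C2norm ζ ≠ ∞) (x : Torus) : |dT (dT ζ) x| ≤ c2 ζ :=
  abs_le_toReal_of_le_iSup (a := fun x => |dT (dT ζ) x|) h (by
    unfold C2norm; exact le_add_self) x

end C2

/-! ### The weighted `L¹` spaces -/

/-- The weight `1 + |v|^k`. -/
def wt (k : ℝ) (z : Phase) : ℝ := 1 + |z.2| ^ k

section Weight

variable {k : ℝ}

theorem one_le_wt (z : Phase) : 1 ≤ wt k z := by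
  unfold wt
  linarith [Real.rpow_nonneg (abs_nonneg z.2) k]

theorem wt_pos (z : Phase) : 0 < wt k z := zero_lt_one.trans_le (one_le_wt z)

theorem abs_snd_le_wt (hk : 1 ≤ k) (z : Phase) : |z.2| ≤ wt k z := by
  unfold wt
  rcases le_total |z.2| 1 with h | h
  · linarith [Real.rpow_nonneg (abs_nonneg z.2) k]
  · have := Real.rpow_le_rpow_of_exponent_le h hk
    rw [Real.rpow_one] at this
    linarith

theorem measurable_wt : Measurable (wt k) := by
  unfold wt
  fun_prop

theorem weightedMeasure_eq : weightedMeasure k = dxdv.withDensity fun z => ENNReal.ofReal (wt k z) :=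
  rfl

theorem measurable_ofReal_wt : Measurable fun z => ENNReal.ofReal (wt k z) :=
  measurable_wt.ennreal_ofReal

theorem ae_weighted : ae (weightedMeasure k) = ae dxdv := by
  apply le_antisymm
  · exact (withDensity_absolutelyContinuous _ _).ae_le
  · refine (withDensity_absolutelyContinuous' measurable_ofReal_wt.aemeasurable ?_).ae_le
    refine Eventually.of_forall fun z => ?_
    simpa using wt_pos z

theorem integrable_weighted_iff {f : Phase → ℝ} :
    Integrable f (weightedMeasure k) ↔ Integrable (fun z => wt k z * f z) dxdv := by
  rw [weightedMeasure_eq, integrable_withDensity_iff_integrable_smul' measurable_ofReal_wt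
    (Eventually.of_forall fun _ => ENNReal.ofReal_lt_top)]
  simp only [ENNReal.toReal_ofReal (wt_pos _).le, smul_eq_mul]

theorem integral_weighted (f : Phase → ℝ) :
    ∫ z, f z ∂(weightedMeasure k) = ∫ z, wt k z * f z ∂dxdv := by
  rw [weightedMeasure_eq, integral_withDensity_eq_integral_toReal_smul measurable_ofReal_wt
    (Eventually.of_forall fun _ => ENNReal.ofReal_lt_top)]
  simp only [ENNReal.toReal_ofReal (wt_pos _).le, smul_eq_mul]

theorem G.integrable_wt_mul (f : G k) : Integrable (fun z => wt k z * f z) dxdv :=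
  integrable_weighted_iff.1 (L1.integrable_coeFn f)

theorem G.aestronglyMeasurable (f : G k) : AEStronglyMeasurable f dxdv :=
  (Lp.stronglyMeasurable f).aestronglyMeasurable

theorem G.norm_eq (f : G k) : ‖f‖ = ∫ z, wt k z * |f z| ∂dxdv := by
  rw [L1.norm_eq_integral_norm, integral_weighted]
  rfl

theorem G.integrable_wt_mul_abs (f : G k) : Integrable (fun z => wt k z * |f z|) dxdv := by
  refine f.integrable_wt_mul.norm.congr (Eventually.of_forall fun z => ?_)
  simp only [Real.norm_eq_abs, abs_mul, abs_of_pos (wt_pos z)]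

theorem G.integrable_mul {f : G k} {Θ : Phase → ℝ} {C : ℝ} (hm : AEStronglyMeasurable Θ dxdv)
    (h : ∀ z, |Θ z| ≤ C * wt k z) : Integrable (fun z => f z * Θ z) dxdv := by
  refine (f.integrable_wt_mul_abs.const_mul C).mono' (f.aestronglyMeasurable.mul hm)
    (Eventually.of_forall fun z => ?_)
  rw [Real.norm_eq_abs, abs_mul]
  calc |f z| * |Θ z| ≤ |f z| * (C * wt k z) := by gcongr; exact h z
    _ = C * (wt k z * |f z|) := by ring

theorem G.abs_integral_mul_le (f : G k) {Θ : Phase → ℝ} {C : ℝ}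
    (h : ∀ z, |Θ z| ≤ C * wt k z) : |∫ z, f z * Θ z ∂dxdv| ≤ C * ‖f‖ := by
  rw [← Real.norm_eq_abs, G.norm_eq, ← integral_const_mul]
  refine norm_integral_le_of_norm_le (f.integrable_wt_mul_abs.const_mul C)
    (Eventually.of_forall fun z => ?_)
  rw [Real.norm_eq_abs, abs_mul]
  calc |f z| * |Θ z| ≤ |f z| * (C * wt k z) := by gcongr; exact h z
    _ = C * (wt k z * |f z|) := by ring

theorem G.coe_sub_ae (f g : G k) : ∀ᵐ z ∂dxdv, (f - g : G k) z = f z - g z := by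
  have := Lp.coeFn_sub f g
  rwa [EventuallyEq, ae_weighted] at this

theorem G.integral_sub_mul {f g : G k} {Θ : Phase → ℝ} {C : ℝ} (hm : AEStronglyMeasurable Θ dxdv)
    (h : ∀ z, |Θ z| ≤ C * wt k z) :
    ∫ z, (f - g : G k) z * Θ z ∂dxdv = ∫ z, f z * Θ z ∂dxdv - ∫ z, g z * Θ z ∂dxdv := by
  rw [← integral_sub (G.integrable_mul hm h) (G.integrable_mul hm h)]
  refine integral_congr_ae ?_
  filter_upwards [G.coe_sub_ae f g] with z hz
  rw [hz, sub_mul]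

theorem G.abs_integral_mul_sub_le {f g : G k} {Θ Θ' : Phase → ℝ} {C η : ℝ}
    (hm : AEStronglyMeasurable Θ dxdv) (hm' : AEStronglyMeasurable Θ' dxdv)
    (h : ∀ z, |Θ z| ≤ C * wt k z) (h' : ∀ z, |Θ z - Θ' z| ≤ η * wt k z) :
    |∫ z, f z * Θ z ∂dxdv - ∫ z, g z * Θ' z ∂dxdv| ≤ C * ‖f - g‖ + η * ‖g‖ := by
  have hΘ' : ∀ z, |Θ' z| ≤ (C + η) * wt k z := fun z => by
    have := abs_sub_abs_le_abs_sub (Θ' z) (Θ z)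
    rw [abs_sub_comm] at this
    linarith [h z, h' z]
  have e : ∫ z, f z * Θ z ∂dxdv - ∫ z, g z * Θ' z ∂dxdv =
      ∫ z, (f - g : G k) z * Θ z ∂dxdv + ∫ z, g z * (Θ z - Θ' z) ∂dxdv := by
    rw [G.integral_sub_mul hm h]
    have : ∫ z, g z * (Θ z - Θ' z) ∂dxdv = ∫ z, g z * Θ z ∂dxdv - ∫ z, g z * Θ' z ∂dxdv := by
      rw [← integral_sub (G.integrable_mul hm h) (G.integrable_mul hm' hΘ')]
      congr 1; ext z; ring
    rw [this]; ring
  rw [e]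
  exact (abs_add_le _ _).trans (add_le_add (G.abs_integral_mul_le _ h) (G.abs_integral_mul_le _ h'))

/-- The element of `G k` defined by a function. -/
def mkG {f : Phase → ℝ} (hf : Integrable (fun z => wt k z * f z) dxdv) : G k :=
  (memLp_one_iff_integrable.2 (integrable_weighted_iff.2 hf)).toLp

theorem coe_mkG {f : Phase → ℝ} (hf : Integrable (fun z => wt k z * f z) dxdv) :
    mkG hf =ᵐ[dxdv] f := by
  have := (memLp_one_iff_integrable.2 (integrable_weighted_iff.2 hf)).coeFn_toLp
  rwa [EventuallyEq, ae_weighted] at this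

theorem G.integral_mul_momentum {f : G k} (hk : 1 ≤ k) {ζ : Torus → ℝ} (hζ : Continuous ζ) :
    Integrable (fun x => momentum f x * ζ x) dx ∧
    ∫ x, momentum f x * ζ x ∂dx = ∫ z, f z * (z.2 * ζ z.1) ∂dxdv := by
  obtain ⟨C, hC⟩ := isCompact_univ.exists_bound_of_continuousOn hζ.continuousOn
  have h0 : 0 ≤ C := (norm_nonneg _).trans (hC 0 (mem_univ _))
  have hi : Integrable (fun z : Phase => f z * (z.2 * ζ z.1)) dxdv := by
    refine G.integrable_mul (C := C) (by fun_prop) fun z => ?_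
    rw [abs_mul, mul_comm]
    exact mul_le_mul (hC _ (mem_univ _)) (abs_snd_le_wt hk z) (abs_nonneg _) h0
  have e : ∀ x, ∫ v, f (x, v) * (v * ζ x) = momentum f x * ζ x := by
    intro x
    unfold momentum
    rw [← integral_mul_const]
    congr 1; ext v; ring
  have h1 := hi.integral_prod_left
  have h2 := integral_prod _ hi
  simp only [e] at h1 h2
  exact ⟨h1, h2.symm⟩

theorem G.integral_mul_rho {f : G k} {ζ : Torus → ℝ} (hζ : Continuous ζ) :
    Integrable (fun x => rho f x * ζ x) dx ∧
    ∫ x, rho f x * ζ x ∂dx = ∫ z, f z * ζ z.1 ∂dxdv := by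
  obtain ⟨C, hC⟩ := isCompact_univ.exists_bound_of_continuousOn hζ.continuousOn
  have h0 : 0 ≤ C := (norm_nonneg _).trans (hC 0 (mem_univ _))
  have hi : Integrable (fun z : Phase => f z * ζ z.1) dxdv := by
    refine G.integrable_mul (C := C) (by fun_prop) fun z => ?_
    refine (hC _ (mem_univ _)).trans (le_mul_of_one_le_right h0 (one_le_wt z))
  have e : ∀ x, ∫ v, f (x, v) * ζ x = rho f x * ζ x := by
    intro x
    unfold rho
    rw [← integral_mul_const]
  have h1 := hi.integral_prod_left
  have h2 := integral_prod _ hi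
  simp only [e] at h1 h2
  exact ⟨h1, h2.symm⟩

instance : SFinite (weightedMeasure k) := by
  rw [weightedMeasure_eq]; infer_instance

instance : SecondCountableTopology (G k) :=
  have : Fact ((1 : ℝ≥0∞) ≠ ∞) := ⟨by norm_num⟩
  Lp.SecondCountableTopology

/-! ### The norm `N_k` -/

/-- The real form of the norm `N_k`. -/
def nk (k : ℝ) (ξ : Phase → ℝ) : ℝ := (Nk k ξ).toReal

theorem nk_nonneg (ξ : Phase → ℝ) : 0 ≤ nk k ξ := ENNReal.toReal_nonneg

theorem abs_le_nk {ξ : Phase → ℝ} (h : Nk k ξ ≠ ∞) (z : Phase) : |ξ z| ≤ nk k ξ * wt k z := by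
  have := abs_le_toReal_of_le_iSup (a := fun z : Phase => |ξ z| / (1 + |z.2| ^ k)) h
    (by unfold Nk; exact le_self_add) z
  exact (div_le_iff₀ (wt_pos z)).1 this

theorem sqrt_le_nk {ξ : Phase → ℝ} (h : Nk k ξ ≠ ∞) (z : Phase) :
    (1 + |z.2|) * √(dX ξ z ^ 2 + dV ξ z ^ 2) ≤ nk k ξ * wt k z := by
  have := abs_le_toReal_of_le_iSup
    (a := fun z : Phase => (1 + |z.2|) * √(dX ξ z ^ 2 + dV ξ z ^ 2) / (1 + |z.2| ^ k)) h
    (by unfold Nk; exact le_add_self) z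
  exact (div_le_iff₀ (wt_pos z)).1 this

theorem dX_le_nk {ξ : Phase → ℝ} (h : Nk k ξ ≠ ∞) (z : Phase) :
    (1 + |z.2|) * |dX ξ z| ≤ nk k ξ * wt k z := by
  refine le_trans ?_ (sqrt_le_nk h z)
  gcongr
  exact Real.abs_le_sqrt (by nlinarith [sq_nonneg (dV ξ z)])

theorem dV_le_nk {ξ : Phase → ℝ} (h : Nk k ξ ≠ ∞) (z : Phase) :
    (1 + |z.2|) * |dV ξ z| ≤ nk k ξ * wt k z := by
  refine le_trans ?_ (sqrt_le_nk h z)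
  gcongr
  exact Real.abs_le_sqrt (by nlinarith [sq_nonneg (dX ξ z)])

end Weight

end Kinetic

namespace Kinetic

/-! ### The generator on good test functions -/

/-- The function paired with `f` in `𝓛^ε ψ` (without the generator of the driving process). -/
def drift (ε : ℝ) (n w : C(Torus, ℝ)) (ξ : Phase → ℝ) (ζ : Torus → ℝ) (z : Phase) : ℝ :=
  (ε ^ 2)⁻¹ * ((n z.1 - z.2) * dV ξ z) + ε⁻¹ * (z.2 * dX ξ z + w z.1 * dV ξ z) +
    z.2 * ζ z.1 - ε * (w z.1 * ζ z.1)

/-- The constant in the bound of `drift`. -/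
def driftBound (ε A B N Z : ℝ) : ℝ :=
  (ε ^ 2)⁻¹ * ((A + 1) * N) + ε⁻¹ * ((1 + B) * N) + Z + ε * (B * Z)

section Drift

variable {k ε : ℝ} {n w n' w' : C(Torus, ℝ)} {ξ ξ' : Phase → ℝ} {ζ ζ' : Torus → ℝ}

theorem abs_snd_mul_le {a N W v : ℝ} (h : (1 + |v|) * |a| ≤ N * W) : |v * a| ≤ N * W := by
  rw [abs_mul]
  nlinarith [abs_nonneg v, abs_nonneg a]

theorem abs_mul_le_of_weighted {a b N W v B : ℝ} (h : (1 + |v|) * |a| ≤ N * W) (hb : |b| ≤ B) :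
    |b * a| ≤ B * (N * W) := by
  rw [abs_mul]
  have h1 : |a| ≤ N * W := by nlinarith [mul_nonneg (abs_nonneg v) (abs_nonneg a)]
  exact mul_le_mul hb h1 (abs_nonneg _) ((abs_nonneg _).trans hb)

theorem abs_apply_le (n : C(Torus, ℝ)) (x : Torus) : |n x| ≤ ‖n‖ := n.norm_coe_le_norm x

theorem abs_drift_le {A B : ℝ} (hk : 1 ≤ k) (hε : 0 < ε) (hξ : Nk k ξ ≠ ∞) (hζ : C2norm ζ ≠ ∞)
    (hA : ‖n‖ ≤ A) (hB : ‖w‖ ≤ B) (z : Phase) :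
    |drift ε n w ξ ζ z| ≤ driftBound ε A B (nk k ξ) (c2 ζ) * wt k z := by
  have h1 := dX_le_nk hξ z
  have h2 := dV_le_nk hξ z
  have hn : |n z.1| ≤ A := (abs_apply_le n z.1).trans hA
  have hw : |w z.1| ≤ B := (abs_apply_le w z.1).trans hB
  have a1 : |(n z.1 - z.2) * dV ξ z| ≤ (A + 1) * nk k ξ * wt k z := by
    rw [sub_mul]
    refine (abs_sub _ _).trans ?_
    linarith [abs_mul_le_of_weighted h2 hn, abs_snd_mul_le h2]
  have a2 : |z.2 * dX ξ z + w z.1 * dV ξ z| ≤ (1 + B) * nk k ξ * wt k z := by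
    refine (abs_add_le _ _).trans ?_
    linarith [abs_mul_le_of_weighted h2 hw, abs_snd_mul_le h1]
  have a3 : |z.2 * ζ z.1| ≤ c2 ζ * wt k z := by
    rw [abs_mul, mul_comm]
    exact mul_le_mul (abs_le_c2 hζ _) (abs_snd_le_wt hk z) (abs_nonneg _) (c2_nonneg _)
  have a4 : |w z.1 * ζ z.1| ≤ B * c2 ζ * wt k z := by
    rw [abs_mul]
    have hB0 : 0 ≤ B := (norm_nonneg _).trans hB
    have : |w z.1| * |ζ z.1| ≤ B * c2 ζ :=
      mul_le_mul hw (abs_le_c2 hζ _) (abs_nonneg _) hB0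
    exact this.trans (le_mul_of_one_le_right (mul_nonneg hB0 (c2_nonneg _)) (one_le_wt z))
  unfold drift driftBound
  have e1 : 0 < (ε ^ 2)⁻¹ := by positivity
  have e2 : 0 < ε⁻¹ := by positivity
  calc _ ≤ |(ε ^ 2)⁻¹ * ((n z.1 - z.2) * dV ξ z)| +
        |ε⁻¹ * (z.2 * dX ξ z + w z.1 * dV ξ z)| + |z.2 * ζ z.1| + |ε * (w z.1 * ζ z.1)| := by
        refine (abs_sub _ _).trans ?_
        gcongr
        exact (abs_add_le _ _).trans (by gcongr; exact abs_add_le _ _)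
    _ ≤ (ε ^ 2)⁻¹ * ((A + 1) * nk k ξ * wt k z) + ε⁻¹ * ((1 + B) * nk k ξ * wt k z) +
        c2 ζ * wt k z + ε * (B * c2 ζ * wt k z) := by
        rw [abs_mul (ε ^ 2)⁻¹, abs_mul ε⁻¹, abs_mul ε, abs_of_pos e1, abs_of_pos e2, abs_of_pos hε]
        gcongr
    _ = _ := by ring

theorem abs_drift_sub_le {A B : ℝ} (hk : 1 ≤ k) (hε : 0 < ε) (hξ : ContDiff ℝ 1 (lift ξ))
    (hξ' : MemCk k ξ') (hd : Nk k (ξ - ξ') ≠ ∞) (hζ' : C2norm ζ' ≠ ∞) (hdζ : C2norm (ζ - ζ') ≠ ∞)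
    (hA : ‖n‖ ≤ A) (hB : ‖w‖ ≤ B) (z : Phase) :
    |drift ε n w ξ ζ z - drift ε n' w' ξ' ζ' z| ≤
      (driftBound ε A B (nk k (ξ - ξ')) (c2 (ζ - ζ')) + (ε ^ 2)⁻¹ * (‖n - n'‖ * nk k ξ') +
        ε⁻¹ * (‖w - w'‖ * nk k ξ') + ε * (‖w - w'‖ * c2 ζ')) * wt k z := by
  have h0 := abs_drift_le hk hε hd hdζ hA hB z
  have h2 := dV_le_nk hξ'.2.ne z
  have hn := abs_apply_le (n - n') z.1
  have hw := abs_apply_le (w - w') z.1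
  have e : drift ε n w ξ ζ z - drift ε n' w' ξ' ζ' z = drift ε n w (ξ - ξ') (ζ - ζ') z +
      (ε ^ 2)⁻¹ * ((n - n') z.1 * dV ξ' z) + ε⁻¹ * ((w - w') z.1 * dV ξ' z) -
      ε * ((w - w') z.1 * ζ' z.1) := by
    unfold drift
    rw [dV_sub hξ hξ'.1, dX_sub hξ hξ'.1]
    simp only [Pi.sub_apply, ContinuousMap.sub_apply]
    ring
  have a1 := abs_mul_le_of_weighted h2 hn
  have a2 := abs_mul_le_of_weighted h2 hw
  have a3 : |(w - w') z.1 * ζ' z.1| ≤ ‖w - w'‖ * c2 ζ' * wt k z := by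
    rw [abs_mul]
    have : |(w - w') z.1| * |ζ' z.1| ≤ ‖w - w'‖ * c2 ζ' :=
      mul_le_mul hw (abs_le_c2 hζ' _) (abs_nonneg _) (norm_nonneg _)
    exact this.trans (le_mul_of_one_le_right (mul_nonneg (norm_nonneg _) (c2_nonneg _))
      (one_le_wt z))
  have e1 : 0 < (ε ^ 2)⁻¹ := by positivity
  have e2 : 0 < ε⁻¹ := by positivity
  rw [e]
  calc _ ≤ |drift ε n w (ξ - ξ') (ζ - ζ') z| + |(ε ^ 2)⁻¹ * ((n - n') z.1 * dV ξ' z)| +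
        |ε⁻¹ * ((w - w') z.1 * dV ξ' z)| + |ε * ((w - w') z.1 * ζ' z.1)| := by
        refine (abs_sub _ _).trans ?_
        gcongr
        exact (abs_add_le _ _).trans (by gcongr; exact abs_add_le _ _)
    _ ≤ driftBound ε A B (nk k (ξ - ξ')) (c2 (ζ - ζ')) * wt k z +
        (ε ^ 2)⁻¹ * (‖n - n'‖ * (nk k ξ' * wt k z)) + ε⁻¹ * (‖w - w'‖ * (nk k ξ' * wt k z)) +
        ε * (‖w - w'‖ * c2 ζ' * wt k z) := by
        rw [abs_mul (ε ^ 2)⁻¹, abs_mul ε⁻¹, abs_mul ε, abs_of_pos e1, abs_of_pos e2, abs_of_pos hε]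
        gcongr
    _ = _ := by ring

theorem continuous_drift (hξ : ContDiff ℝ 1 (lift ξ)) (hζ : Continuous ζ) :
    Continuous (drift ε n w ξ ζ) := by
  have h1 := continuous_dV hξ
  have h2 := continuous_dX hξ
  unfold drift
  fun_prop

end Drift

section Good

variable {Ω F : Type*} [MeasurableSpace Ω] [NormedAddCommGroup F] [NormedSpace ℝ F]
  [MeasurableSpace F] {E : Set F} {k α : ℝ} {m : MarkovProcess Ω E} {ψ : G k × H α × E → ℝ}
  {ι : F →ₗ[ℝ] C(Torus, ℝ)} {ε : ℝ}

theorem IsGoodTestFunction.Df_spec (h : IsGoodTestFunction m ψ) (p : State k α E) :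
    MemCk k (Df ψ p) ∧ IsDf ψ p (Df ψ p) := by
  unfold Df
  rw [dif_pos (h.exists_Df p)]
  exact (h.exists_Df p).choose_spec

theorem IsGoodTestFunction.Du_spec (h : IsGoodTestFunction m ψ) (p : State k α E) :
    MemC2 (Du ψ p) ∧ IsDu ψ p (Du ψ p) := by
  unfold Du
  rw [dif_pos (h.exists_Du p)]
  exact (h.exists_Du p).choose_spec

theorem IsGoodTestFunction.exists_nk_le (h : IsGoodTestFunction m ψ) {B : Set (State k α E)}
    (hB : Bornology.IsBounded B) : ∃ C : ℝ, 0 ≤ C ∧ ∀ p ∈ B, nk k (Df ψ p) ≤ C := by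
  obtain ⟨C, hC⟩ := h.Df_cbLoc.2 B hB
  exact ⟨C, C.2, fun p hp => ENNReal.toReal_le_coe_of_le_coe (hC p hp)⟩

theorem IsGoodTestFunction.exists_c2_le (h : IsGoodTestFunction m ψ) {B : Set (State k α E)}
    (hB : Bornology.IsBounded B) : ∃ C : ℝ, 0 ≤ C ∧ ∀ p ∈ B, c2 (Du ψ p) ≤ C := by
  obtain ⟨C, hC⟩ := h.Du_cbLoc.2 B hB
  exact ⟨C, C.2, fun p hp => ENNReal.toReal_le_coe_of_le_coe (hC p hp)⟩

theorem IsGoodTestFunction.C2norm_ne_top (h : IsGoodTestFunction m ψ) (p : State k α E) :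
    C2norm (Du ψ p) ≠ ∞ := by
  obtain ⟨C, hC⟩ := h.Du_cbLoc.2 {p} Bornology.isBounded_singleton
  exact ((hC p rfl).trans_lt ENNReal.coe_lt_top).ne

theorem IsGoodTestFunction.tendsto_nk (h : IsGoodTestFunction m ψ) (p : State k α E) :
    Tendsto (fun q => nk k (Df ψ q - Df ψ p)) (𝓝 p) (𝓝 0) ∧
      ∀ᶠ q in 𝓝 p, Nk k (Df ψ q - Df ψ p) ≠ ∞ := by
  have h1 := h.Df_cbLoc.1 p
  constructor
  · exact (ENNReal.tendsto_toReal ENNReal.zero_ne_top).comp h1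
  · filter_upwards [h1.eventually_lt_const ENNReal.zero_lt_top] with q hq using hq.ne

theorem IsGoodTestFunction.tendsto_c2 (h : IsGoodTestFunction m ψ) (p : State k α E) :
    Tendsto (fun q => c2 (Du ψ q - Du ψ p)) (𝓝 p) (𝓝 0) ∧
      ∀ᶠ q in 𝓝 p, C2norm (Du ψ q - Du ψ p) ≠ ∞ := by
  have h1 := h.Du_cbLoc.1 p
  constructor
  · exact (ENNReal.tendsto_toReal ENNReal.zero_ne_top).comp h1
  · filter_upwards [h1.eventually_lt_const ENNReal.zero_lt_top] with q hq using hq.ne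

/-- The continuous representative of the component `u` of a state. -/
def State.vel (p : State k α E) : C(Torus, ℝ) := contRep p.2.1.toL2

theorem State.ae_vel (hα : 1 / 2 < α) (p : State k α E) :
    (p.2.1.toL2 : Torus → ℝ) =ᵐ[dx] p.vel := H.contRep_ae hα p.2.1

theorem State.norm_vel_le (hα : 1 / 2 < α) (p : State k α E) :
    ‖p.vel‖ ≤ supConst α * ‖p.2.1‖ := H.norm_contRep_le hα p.2.1

theorem State.continuous_vel (hα : 1 / 2 < α) : Continuous (State.vel : State k α E → _) :=
  (H.continuous_contRep hα).comp (continuous_fst.comp continuous_snd)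

/-- The part of `𝓛^ε ψ` which comes from the differentials in `f` and `u`. -/
def Lfu (ε : ℝ) (ι : F →ₗ[ℝ] C(Torus, ℝ)) (ψ : G k × H α × E → ℝ) (p : State k α E) : ℝ :=
  ∫ z, (p.1 : G k) z * drift ε (ι p.2.2) p.vel (Df ψ p) (Du ψ p) z ∂dxdv +
    ∫ x, p.vel x * dT (dT (Du ψ p)) x ∂dx

section Integrability

variable (hk : 1 ≤ k) (hα : 1 / 2 < α) (h : IsGoodTestFunction m ψ) (p : State k α E)
include hk hα h

theorem sharp_integrable : Integrable (sharpIntegrand ι ψ p) dxdv := by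
  have hξ := (h.Df_spec p).1
  refine G.integrable_mul (C := (‖ι p.2.2‖ + 1) * nk k (Df ψ p)) ?_ fun z => ?_
  · have := continuous_dV hξ.1
    exact Continuous.aestronglyMeasurable (by fun_prop)
  · have h2 := dV_le_nk hξ.2.ne z
    rw [sub_mul]
    refine (abs_sub _ _).trans ?_
    linarith [abs_mul_le_of_weighted h2 (abs_apply_le (ι p.2.2) z.1), abs_snd_mul_le h2]

theorem flat_ae : (flatIntegrand ψ p) =ᵐ[dxdv] fun z =>
    (p.1 : G k) z * (z.2 * dX (Df ψ p) z + p.vel z.1 * dV (Df ψ p) z) := by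
  have : ∀ᵐ z : Phase ∂dxdv, p.2.1.toL2 z.1 = p.vel z.1 :=
    Measure.quasiMeasurePreserving_fst.ae (p.ae_vel hα)
  filter_upwards [this] with z hz
  unfold flatIntegrand
  rw [hz]

theorem flat_integrable : Integrable (flatIntegrand ψ p) dxdv := by
  have hξ := (h.Df_spec p).1
  refine Integrable.congr ?_ (flat_ae hk hα h p).symm
  refine G.integrable_mul (C := (1 + ‖p.vel‖) * nk k (Df ψ p)) ?_ fun z => ?_
  · have := continuous_dV hξ.1
    have := continuous_dX hξ.1
    exact Continuous.aestronglyMeasurable (by fun_prop)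
  · have h2 := dV_le_nk hξ.2.ne z
    refine (abs_add_le _ _).trans ?_
    linarith [abs_mul_le_of_weighted h2 (abs_apply_le p.vel z.1), abs_snd_mul_le (dX_le_nk hξ.2.ne z)]

theorem zero_integrable : Integrable (zeroIntegrand ψ p) dx ∧
    ∫ x, zeroIntegrand ψ p x ∂dx = ∫ x, p.vel x * dT (dT (Du ψ p)) x ∂dx +
      ∫ z, (p.1 : G k) z * (z.2 * Du ψ p z.1) ∂dxdv := by
  have hζ := (h.Du_spec p).1
  obtain ⟨i1, i2⟩ := G.integral_mul_momentum (f := (p.1 : G k)) hk hζ.continuous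
  have hc := hζ.continuous_dT_dT
  have i3 : Integrable (fun x => p.vel x * dT (dT (Du ψ p)) x) dx :=
    integrable_of_continuous (by fun_prop)
  have e : zeroIntegrand ψ p =ᵐ[dx] fun x => p.vel x * dT (dT (Du ψ p)) x +
      momentum (p.1 : G k) x * Du ψ p x := by
    filter_upwards [p.ae_vel hα] with x hx
    unfold zeroIntegrand
    rw [hx]
  refine ⟨(i3.add i1).congr e.symm, ?_⟩
  rw [integral_congr_ae e, integral_add i3 i1, i2]

theorem one_integrable : Integrable (oneIntegrand ψ p) dx ∧
    ∫ x, oneIntegrand ψ p x ∂dx = ∫ z, (p.1 : G k) z * (p.vel z.1 * Du ψ p z.1) ∂dxdv := by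
  have hζ := (h.Du_spec p).1
  have hc := hζ.continuous
  obtain ⟨i1, i2⟩ := G.integral_mul_rho (f := (p.1 : G k))
    (ζ := fun x => p.vel x * Du ψ p x) (by fun_prop)
  have e : oneIntegrand ψ p =ᵐ[dx] fun x => rho (p.1 : G k) x * (p.vel x * Du ψ p x) := by
    filter_upwards [p.ae_vel hα] with x hx
    unfold oneIntegrand
    rw [hx, mul_assoc]
  exact ⟨i1.congr e.symm, by rw [integral_congr_ae e, i2]⟩

theorem lepsWellDefined : LepsWellDefined ι ψ p :=
  ⟨sharp_integrable hk hα h p, flat_integrable hk hα h p, (zero_integrable hk hα h p).1,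
    (one_integrable hk hα h p).1⟩

theorem Leps_eq : Leps ε m ι ψ p = Lfu ε ι ψ p + (ε ^ 2)⁻¹ * genN m ψ p := by
  have hζ := (h.Du_spec p).1
  have hc := hζ.continuous
  have j1 := sharp_integrable (ι := ι) hk hα h p
  have j2 := (flat_integrable hk hα h p).congr (flat_ae hk hα h p)
  have j3 : Integrable (fun z => (p.1 : G k) z * (z.2 * Du ψ p z.1)) dxdv := by
    refine G.integrable_mul (C := c2 (Du ψ p)) (by fun_prop) fun z => ?_
    rw [abs_mul, mul_comm]
    exact mul_le_mul (abs_le_c2 (h.C2norm_ne_top p) _) (abs_snd_le_wt hk z) (abs_nonneg _)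
      (c2_nonneg _)
  have j4 : Integrable (fun z => (p.1 : G k) z * (p.vel z.1 * Du ψ p z.1)) dxdv := by
    refine G.integrable_mul (C := ‖p.vel‖ * c2 (Du ψ p)) (by fun_prop) fun z => ?_
    rw [abs_mul]
    have : |p.vel z.1| * |Du ψ p z.1| ≤ ‖p.vel‖ * c2 (Du ψ p) :=
      mul_le_mul (abs_apply_le _ _) (abs_le_c2 (h.C2norm_ne_top p) _) (abs_nonneg _) (norm_nonneg _)
    exact this.trans (le_mul_of_one_le_right (mul_nonneg (norm_nonneg _) (c2_nonneg _))
      (one_le_wt z))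
  have e : ∫ z, (p.1 : G k) z * drift ε (ι p.2.2) p.vel (Df ψ p) (Du ψ p) z ∂dxdv =
      (ε ^ 2)⁻¹ * (∫ z, sharpIntegrand ι ψ p z ∂dxdv) +
      ε⁻¹ * (∫ z, (p.1 : G k) z * (z.2 * dX (Df ψ p) z + p.vel z.1 * dV (Df ψ p) z) ∂dxdv) +
      (∫ z, (p.1 : G k) z * (z.2 * Du ψ p z.1) ∂dxdv) -
      ε * (∫ z, (p.1 : G k) z * (p.vel z.1 * Du ψ p z.1) ∂dxdv) := by
    rw [← integral_const_mul, ← integral_const_mul, ← integral_const_mul]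
    have i1 := j1.const_mul (ε ^ 2)⁻¹
    have i2 := j2.const_mul ε⁻¹
    have i4 := j4.const_mul ε
    have i12 := i1.add i2
    have i123 := i12.add j3
    rw [← integral_add i1 i2]
    refine Eq.trans ?_ ((integral_sub i123 i4).trans (congrArg₂ _ (integral_add i12 j3) rfl))
    congr 1
    ext z
    simp only [Pi.add_apply]
    unfold drift sharpIntegrand
    ring
  unfold Leps Lsharp Lflat Lzero Lone Lfu
  rw [e, integral_congr_ae (flat_ae hk hα h p), (zero_integrable hk hα h p).2,
    (one_integrable hk hα h p).2]
  ring

theorem abs_Lfu_le {A B N Z R : ℝ} (hε : 0 < ε) (hA : ‖ι p.2.2‖ ≤ A) (hB : ‖p.vel‖ ≤ B)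
    (hN : nk k (Df ψ p) ≤ N) (hZ : c2 (Du ψ p) ≤ Z) (hR : ‖(p.1 : G k)‖ ≤ R) :
    |Lfu ε ι ψ p| ≤ driftBound ε A B N Z * R + B * Z := by
  have hA0 : 0 ≤ A := (norm_nonneg _).trans hA
  have hB0 : 0 ≤ B := (norm_nonneg _).trans hB
  have hN0 : 0 ≤ N := (nk_nonneg _).trans hN
  have hZ0 : 0 ≤ Z := (c2_nonneg _).trans hZ
  have h1 : ∀ z, |drift ε (ι p.2.2) p.vel (Df ψ p) (Du ψ p) z| ≤
      driftBound ε A B N Z * wt k z := fun z => by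
    refine (abs_drift_le hk hε (h.Df_spec p).1.2.ne (h.C2norm_ne_top p) hA hB z).trans ?_
    have := (wt_pos (k := k) z).le
    unfold driftBound
    gcongr
  have hD : 0 ≤ driftBound ε A B N Z := by unfold driftBound; positivity
  have h2 : |∫ x, p.vel x * dT (dT (Du ψ p)) x ∂dx| ≤ B * Z := by
    rw [← Real.norm_eq_abs]
    refine (norm_integral_le_of_norm_le_const (C := B * Z) (Eventually.of_forall fun x => ?_)).trans
      (by simp)
    rw [norm_mul]
    exact mul_le_mul ((p.vel.norm_coe_le_norm x).trans hB)
      ((abs_dT_dT_le_c2 (h.C2norm_ne_top p) x).trans hZ) (norm_nonneg _) hB0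
  unfold Lfu
  refine (abs_add_le _ _).trans (add_le_add ((G.abs_integral_mul_le _ h1).trans ?_) h2)
  gcongr

end Integrability

theorem State.isBounded_iff_exists {B : Set (State k α E)} (hB : Bornology.IsBounded B) :
    ∃ R : ℝ, 0 ≤ R ∧ ∀ p ∈ B, ‖(p.1 : G k)‖ ≤ R ∧ ‖p.2.1‖ ≤ R := by
  have h1 : Bornology.IsBounded ((fun p : State k α E => (p.1 : G k)) '' B) := by
    refine (LipschitzWith.of_dist_le_mul (K := 1) fun p q => ?_).isBounded_image hB
    rw [NNReal.coe_one, one_mul, Prod.dist_eq]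
    exact le_max_left _ _
  have h2 : Bornology.IsBounded ((fun p : State k α E => p.2.1) '' B) := by
    refine (LipschitzWith.of_dist_le_mul (K := 1) fun p q => ?_).isBounded_image hB
    rw [NNReal.coe_one, one_mul, Prod.dist_eq, Prod.dist_eq]
    exact (le_max_left _ _).trans (le_max_right _ _)
  obtain ⟨R1, hR1⟩ := isBounded_iff_forall_norm_le.1 h1
  obtain ⟨R2, hR2⟩ := isBounded_iff_forall_norm_le.1 h2
  refine ⟨max 0 (max R1 R2), le_max_left _ _, fun p hp => ⟨?_, ?_⟩⟩
  · exact (hR1 _ (mem_image_of_mem _ hp)).trans ((le_max_left _ _).trans (le_max_right _ _))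
  · exact (hR2 _ (mem_image_of_mem _ hp)).trans ((le_max_right _ _).trans (le_max_right _ _))

theorem exists_bounds (hE : DrivingSpace E ι) (hα : 1 / 2 < α) (h : IsGoodTestFunction m ψ)
    {S : Set (State k α E)} (hS : Bornology.IsBounded S) :
    ∃ A B N Z R : ℝ, ∀ p ∈ S, ‖ι p.2.2‖ ≤ A ∧ ‖p.vel‖ ≤ B ∧ nk k (Df ψ p) ≤ N ∧
      c2 (Du ψ p) ≤ Z ∧ ‖(p.1 : G k)‖ ≤ R := by
  obtain ⟨A, -, hA⟩ := hE.exists_bound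
  obtain ⟨R, hR0, hR⟩ := State.isBounded_iff_exists hS
  obtain ⟨N, -, hN⟩ := h.exists_nk_le hS
  obtain ⟨Z, -, hZ⟩ := h.exists_c2_le hS
  refine ⟨A, supConst α * R, N, Z, R, fun p hp => ⟨(hA _ p.2.2.2).1, ?_, hN p hp, hZ p hp,
    (hR p hp).1⟩⟩
  refine (p.norm_vel_le hα).trans ?_
  have := supConst_nonneg α
  gcongr
  exact (hR p hp).2

theorem continuous_Lfu (hE : DrivingSpace E ι) (hε : 0 < ε) (hk : 1 ≤ k) (hα : 1 / 2 < α)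
    (h : IsGoodTestFunction m ψ) : Continuous fun p : State k α E => Lfu ε ι ψ p := by
  rw [continuous_iff_continuousAt]
  intro p
  obtain ⟨A, B, N, Z, R, hb⟩ := exists_bounds hE hα h (Metric.isBounded_ball (x := p) (r := 1))
  have hp := hb p (Metric.mem_ball_self one_pos)
  have hA0 : 0 ≤ A := (norm_nonneg _).trans hp.1
  have hB0 : 0 ≤ B := (norm_nonneg _).trans hp.2.1
  have hN0 : 0 ≤ N := (nk_nonneg _).trans hp.2.2.1
  have hZ0 : 0 ≤ Z := (c2_nonneg _).trans hp.2.2.2.1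
  set η : State k α E → ℝ := fun q => driftBound ε A B (nk k (Df ψ q - Df ψ p))
    (c2 (Du ψ q - Du ψ p)) + (ε ^ 2)⁻¹ * (‖ι q.2.2 - ι p.2.2‖ * nk k (Df ψ p)) +
        ε⁻¹ * (‖q.vel - p.vel‖ * nk k (Df ψ p)) + ε * (‖q.vel - p.vel‖ * c2 (Du ψ p)) with hη
  have tn : Tendsto (fun q : State k α E => ‖ι q.2.2 - ι p.2.2‖) (𝓝 p) (𝓝 0) := by
    rw [← tendsto_iff_norm_sub_tendsto_zero]
    have : Continuous fun q : State k α E => ι q.2.2 :=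
      hE.continuous_embedding.comp (by fun_prop)
    exact this.tendsto p
  have tv : Tendsto (fun q : State k α E => ‖q.vel - p.vel‖) (𝓝 p) (𝓝 0) := by
    rw [← tendsto_iff_norm_sub_tendsto_zero]
    exact (State.continuous_vel hα).tendsto p
  have tf : Tendsto (fun q : State k α E => ‖(q.1 : G k) - (p.1 : G k)‖) (𝓝 p) (𝓝 0) := by
    rw [← tendsto_iff_norm_sub_tendsto_zero]
    have : Continuous fun q : State k α E => (q.1 : G k) := by fun_prop
    exact this.tendsto p
  obtain ⟨tk, ek⟩ := h.tendsto_nk p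
  obtain ⟨tc, ec⟩ := h.tendsto_c2 p
  have tη : Tendsto η (𝓝 p) (𝓝 0) := by
    have : Tendsto η (𝓝 p) (𝓝 (driftBound ε A B 0 0 + (ε ^ 2)⁻¹ * (0 * nk k (Df ψ p)) +
        ε⁻¹ * (0 * nk k (Df ψ p)) + ε * (0 * c2 (Du ψ p)))) := by
      rw [hη]
      unfold driftBound
      exact (((((tk.const_mul _).const_mul _).add ((tk.const_mul _).const_mul _)).add tc).add
        ((tc.const_mul _).const_mul _) |>.add ((tn.mul_const _).const_mul _) |>.add
        ((tv.mul_const _).const_mul _)).add ((tv.mul_const _).const_mul _)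
    simpa [driftBound] using this
  rw [ContinuousAt, tendsto_iff_norm_sub_tendsto_zero]
  have tb : Tendsto (fun q : State k α E => driftBound ε A B N Z * ‖(q.1 : G k) - (p.1 : G k)‖ +
      η q * ‖(p.1 : G k)‖ + (B * c2 (Du ψ q - Du ψ p) + ‖q.vel - p.vel‖ * c2 (Du ψ p)))
      (𝓝 p) (𝓝 0) := by
    have := ((tf.const_mul (driftBound ε A B N Z)).add (tη.mul_const ‖(p.1 : G k)‖)).add
      ((tc.const_mul B).add (tv.mul_const (c2 (Du ψ p))))
    simpa using this
  refine squeeze_zero' (Eventually.of_forall fun _ => norm_nonneg _) ?_ tb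
  filter_upwards [ek, ec, Metric.ball_mem_nhds p one_pos] with q hq1 hq2 hq3
  obtain ⟨b1, b2, b3, b4, b5⟩ := hb q hq3
  have hξ := (h.Df_spec q).1
  have hζ := (h.Du_spec q).1
  have hξ' := (h.Df_spec p).1
  have hζ' := (h.Du_spec p).1
  have d1 : ∀ z, |drift ε (ι q.2.2) q.vel (Df ψ q) (Du ψ q) z| ≤
      driftBound ε A B N Z * wt k z := fun z => by
    refine (abs_drift_le hk hε hξ.2.ne (h.C2norm_ne_top q) b1 b2 z).trans ?_
    have := (wt_pos (k := k) z).le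
    unfold driftBound
    gcongr
  have d2 := abs_drift_sub_le (n' := ι p.2.2) (w' := p.vel) hk hε hξ.1 hξ' hq1
    (h.C2norm_ne_top p) hq2 b1 b2
  have key := G.abs_integral_mul_sub_le (f := (q.1 : G k)) (g := (p.1 : G k))
    (continuous_drift (ε := ε) (n := ι q.2.2) (w := q.vel) hξ.1 hζ.continuous).aestronglyMeasurable
    (continuous_drift (ε := ε) (n := ι p.2.2) (w := p.vel) hξ'.1 hζ'.continuous).aestronglyMeasurable
    d1 d2
  have hc := hζ.continuous_dT_dT
  have hc' := hζ'.continuous_dT_dT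
  have key2 : |∫ x, q.vel x * dT (dT (Du ψ q)) x ∂dx - ∫ x, p.vel x * dT (dT (Du ψ p)) x ∂dx| ≤
      B * c2 (Du ψ q - Du ψ p) + ‖q.vel - p.vel‖ * c2 (Du ψ p) := by
    rw [← integral_sub (integrable_of_continuous (by fun_prop))
      (integrable_of_continuous (by fun_prop)), ← Real.norm_eq_abs]
    refine (norm_integral_le_of_norm_le_const (C := B * c2 (Du ψ q - Du ψ p) +
      ‖q.vel - p.vel‖ * c2 (Du ψ p)) (Eventually.of_forall fun x => ?_)).trans (by simp)
    have e : q.vel x * dT (dT (Du ψ q)) x - p.vel x * dT (dT (Du ψ p)) x =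
        q.vel x * dT (dT (Du ψ q - Du ψ p)) x + (q.vel - p.vel) x * dT (dT (Du ψ p)) x := by
      rw [hζ.dT_dT_sub hζ', Pi.sub_apply, ContinuousMap.sub_apply]; ring
    rw [e]
    refine (norm_add_le _ _).trans ?_
    rw [norm_mul, norm_mul]
    refine add_le_add ?_ ?_
    · exact mul_le_mul ((q.vel.norm_coe_le_norm x).trans b2) (abs_dT_dT_le_c2 hq2 x)
        (norm_nonneg _) hB0
    · exact mul_le_mul ((q.vel - p.vel).norm_coe_le_norm x)
        (abs_dT_dT_le_c2 (h.C2norm_ne_top p) x) (norm_nonneg _) (norm_nonneg _)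
  unfold Lfu
  rw [add_sub_add_comm]
  refine (norm_add_le _ _).trans (add_le_add ?_ key2)
  rw [Real.norm_eq_abs]
  exact key

theorem Leps_cbLoc (hE : DrivingSpace E ι) (hε : 0 < ε) (hk : 1 ≤ k) (hα : 1 / 2 < α)
    (h : IsGoodTestFunction m ψ) : CbLoc fun p : State k α E => Leps ε m ι ψ p := by
  have e : (fun p : State k α E => Leps ε m ι ψ p) =
      fun p => Lfu ε ι ψ p + (ε ^ 2)⁻¹ * genN m ψ p := funext fun p => Leps_eq hk hα h p
  rw [e]
  refine ⟨(continuous_Lfu hE hε hk hα h).add (continuous_const.mul h.genN_cbLoc.1), fun S hS => ?_⟩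
  obtain ⟨A, B, N, Z, R, hb⟩ := exists_bounds hE hα h hS
  obtain ⟨C, hC⟩ := h.genN_cbLoc.2 S hS
  refine ⟨driftBound ε A B N Z * R + B * Z + (ε ^ 2)⁻¹ * C, fun p hp => ?_⟩
  obtain ⟨b1, b2, b3, b4, b5⟩ := hb p hp
  refine (abs_add_le _ _).trans (add_le_add (abs_Lfu_le hk hα h p hε b1 b2 b3 b4 b5) ?_)
  rw [abs_mul, abs_of_pos (by positivity)]
  gcongr
  exact hC p hp

end Good

end Kinetic

namespace Kinetic

section Uniqueness

variable {Ω F : Type*} [MeasurableSpace Ω] [NormedAddCommGroup F] [NormedSpace ℝ F]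
  [MeasurableSpace F] {E : Set F} {k α : ℝ} {m : MarkovProcess Ω E} {ψ : G k × H α × E → ℝ}
  {ι : F →ₗ[ℝ] C(Torus, ℝ)} {ε : ℝ} {p : State k α E}

theorem eq_zero_of_forall_integral_mul (hk : 1 ≤ k) {h : Phase → ℝ} (hc : Continuous h)
    (h0 : ∀ g : G k, ∫ z, g z * h z ∂dxdv = 0) : h = 0 := by
  refine (Continuous.ae_eq_iff_eq dxdv hc continuous_zero).1 ?_
  have key : ∀ R : ℕ, ∀ᵐ z : Phase ∂dxdv, |z.2| ≤ R → h z = 0 := by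
    intro R
    set s : Set Phase := {z | |z.2| ≤ R} with hs
    have hsm : MeasurableSet s := measurableSet_le (by fun_prop) measurable_const
    have hK : IsCompact s := by
      have : s = univ ×ˢ Icc (-(R : ℝ)) R := by
        ext z; simp [hs, abs_le]
      rw [this]
      exact isCompact_univ.prod isCompact_Icc
    have hcont : ContinuousOn (fun z => h z * h z) s := (hc.mul hc).continuousOn
    have hi : Integrable (fun z => wt k z * s.indicator h z) dxdv := by
      obtain ⟨D, hD⟩ := hK.exists_bound_of_continuousOn (f := h) hc.continuousOn
      have hfin : dxdv s < ∞ := hK.measure_lt_top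
      have : Integrable (s.indicator fun z => wt k z * h z) dxdv := by
        rw [integrable_indicator_iff hsm]
        refine Measure.integrableOn_of_bounded (M := (1 + (R : ℝ) ^ k) * |D|) hfin.ne
          (measurable_wt.aestronglyMeasurable.mul hc.aestronglyMeasurable) ?_
        refine (ae_restrict_iff' hsm).2 (Eventually.of_forall fun z hz => ?_)
        rw [norm_mul, Real.norm_of_nonneg (wt_pos z).le]
        refine mul_le_mul ?_ ((hD z hz).trans (le_abs_self _)) (norm_nonneg _) (by positivity)
        unfold wt
        gcongr
        exact hz
      refine this.congr (Eventually.of_forall fun z => ?_)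
      by_cases hz : z ∈ s <;> simp [hz]
    have h1 := h0 (mkG hi)
    have h2 : ∫ z in s, h z * h z ∂dxdv = 0 := by
      rw [← h1, ← integral_indicator hsm]
      refine integral_congr_ae ?_
      filter_upwards [coe_mkG hi] with z hz
      rw [hz]
      by_cases hz : z ∈ s <;> simp [hz]
    have hint : IntegrableOn (fun z => h z * h z) s dxdv := hcont.integrableOn_compact hK
    have h3 := (setIntegral_eq_zero_iff_of_nonneg_ae (μ := dxdv) (s := s)
      (f := fun z => h z * h z) (Eventually.of_forall fun z => mul_self_nonneg (h z)) hint).1 h2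
    have h4 := (ae_restrict_iff' hsm).1 h3
    filter_upwards [h4] with z hz hzs
    exact mul_self_eq_zero.1 (hz hzs)
  filter_upwards [ae_all_iff.2 key] with z hz
  obtain ⟨R, hR⟩ := exists_nat_ge |z.2|
  exact hz R hR

theorem IsDf.unique (hk : 1 ≤ k) {ξ ξ' : Phase → ℝ} {C C' : ℝ} (h : IsDf ψ p ξ)
    (h' : IsDf ψ p ξ') (hc : Continuous ξ) (hc' : Continuous ξ') (hb : ∀ z, |ξ z| ≤ C * wt k z)
    (hb' : ∀ z, |ξ' z| ≤ C' * wt k z) : ξ = ξ' := by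
  obtain ⟨L, hL, hL'⟩ := h
  obtain ⟨L₂, hL₂, hL₂'⟩ := h'
  have e := hL.unique hL₂
  subst e
  rw [← sub_eq_zero]
  refine eq_zero_of_forall_integral_mul hk (hc.sub hc') fun g => ?_
  have e1 := (hL' g).symm.trans (hL₂' g)
  have := integral_sub (G.integrable_mul (f := g) hc.aestronglyMeasurable hb)
    (G.integrable_mul (f := g) hc'.aestronglyMeasurable hb')
  rw [e1, sub_self] at this
  rw [← this]
  congr 1; ext z
  rw [Pi.sub_apply]; ring

theorem IsDu.unique (hα : α ≤ 2) {ζ ζ' : Torus → ℝ} (h : IsDu ψ p ζ) (h' : IsDu ψ p ζ')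
    (hc : MemC2 ζ) (hc' : MemC2 ζ') : ζ = ζ' := by
  obtain ⟨L, hL, hL'⟩ := h
  obtain ⟨L₂, hL₂, hL₂'⟩ := h'
  have e := hL.unique hL₂
  subst e
  have hd : MemC2 (ζ - ζ') := ContDiff.sub hc hc'
  obtain ⟨U, hU⟩ := hd.mem_sobolev hα
  have e1 := (hL' U).symm.trans (hL₂' U)
  have c1 := hc.continuous
  have c2 := hc'.continuous
  have e2 : ∀ g : Torus → ℝ, ∫ x, U.toL2 x * g x ∂dx = ∫ x, (ζ x - ζ' x) * g x ∂dx := by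
    intro g
    refine integral_congr_ae ?_
    rw [hU]
    filter_upwards [coe_contL2 hd.toC] with x hx
    rw [hx]; rfl
  rw [e2, e2] at e1
  have e3 : ∫ x, (ζ x - ζ' x) * (ζ x - ζ' x) ∂dx = 0 := by
    have := integral_sub (integrable_of_continuous (g := fun x => (ζ x - ζ' x) * ζ x) (by fun_prop))
      (integrable_of_continuous (g := fun x => (ζ x - ζ' x) * ζ' x) (by fun_prop))
    rw [e1, sub_self] at this
    rw [← this]
    congr 1; ext x; ring
  have e4 := (integral_eq_zero_iff_of_nonneg (μ := dx) (fun x => mul_self_nonneg (ζ x - ζ' x))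
    (integrable_of_continuous (by fun_prop))).1 e3
  refine (Continuous.ae_eq_iff_eq dx c1 c2).1 ?_
  filter_upwards [e4] with x hx
  exact sub_eq_zero.1 (mul_self_eq_zero.1 hx)

theorem IsDf.sq {ξ : Phase → ℝ} (h : IsDf ψ p ξ) :
    IsDf (fun q => |ψ q| ^ 2) p fun z => 2 * ψ p.toAmbient * ξ z := by
  obtain ⟨L, hL, hL'⟩ := h
  refine ⟨(2 * ψ p.toAmbient) • L, ?_, fun g => ?_⟩
  · simp only [sq_abs]
    have := hL.pow 2
    simpa [State.toAmbient] using this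
  · rw [smul_apply, hL', smul_eq_mul, ← integral_const_mul]
    congr 1; ext z; ring

theorem IsDu.sq {ζ : Torus → ℝ} (h : IsDu ψ p ζ) :
    IsDu (fun q => |ψ q| ^ 2) p fun x => 2 * ψ p.toAmbient * ζ x := by
  obtain ⟨L, hL, hL'⟩ := h
  refine ⟨(2 * ψ p.toAmbient) • L, ?_, fun g => ?_⟩
  · simp only [sq_abs]
    have := hL.pow 2
    simpa [State.toAmbient] using this
  · rw [smul_apply, hL', smul_eq_mul, ← integral_const_mul]
    congr 1; ext z; ring

theorem dV_const_mul (c : ℝ) (φ : Phase → ℝ) (z : Phase) :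
    dV (fun z => c * φ z) z = c * dV φ z := deriv_const_mul_field c

theorem dX_const_mul (c : ℝ) (φ : Phase → ℝ) (z : Phase) :
    dX (fun z => c * φ z) z = c * dX φ z := deriv_const_mul_field c

theorem dT_const_mul (c : ℝ) (ζ : Torus → ℝ) :
    dT (fun x => c * ζ x) = fun x => c * dT ζ x := funext fun _ => deriv_const_mul_field c

theorem drift_const_mul (n w : C(Torus, ℝ)) (ξ : Phase → ℝ) (ζ : Torus → ℝ) (c : ℝ) (z : Phase) :
    drift ε n w (fun z => c * ξ z) (fun x => c * ζ x) z = c * drift ε n w ξ ζ z := by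
  unfold drift
  rw [dV_const_mul, dX_const_mul]
  ring

theorem Lfu_sq (hk : 1 ≤ k) (hα : α ≤ 2) (h : IsGoodTestFunction m ψ)
    (h2 : IsGoodTestFunction m fun q => |ψ q| ^ 2) (p : State k α E) :
    Lfu ε ι (fun q => |ψ q| ^ 2) p = 2 * ψ p.toAmbient * Lfu ε ι ψ p := by
  have s1 := h.Df_spec p
  have s2 := h2.Df_spec p
  have t1 := h.Du_spec p
  have t2 := h2.Du_spec p
  have hcont : ∀ {ξ : Phase → ℝ}, MemCk k ξ → Continuous ξ := fun hξ =>
    continuous_of_lift hξ.1.continuous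
  have e1 : Df (fun q => |ψ q| ^ 2) p = fun z => 2 * ψ p.toAmbient * Df ψ p z := by
    refine IsDf.unique hk s2.2 s1.2.sq (hcont s2.1) (continuous_const.mul (hcont s1.1))
      (abs_le_nk s2.1.2.ne) (C' := |2 * ψ p.toAmbient| * nk k (Df ψ p)) fun z => ?_
    rw [abs_mul, mul_assoc]
    gcongr
    exact abs_le_nk s1.1.2.ne z
  have e2 : Du (fun q => |ψ q| ^ 2) p = fun x => 2 * ψ p.toAmbient * Du ψ p x :=
    IsDu.unique hα t2.2 t1.2.sq t2.1 (ContDiff.mul contDiff_const t1.1)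
  unfold Lfu
  rw [e1, e2, dT_const_mul, dT_const_mul, mul_add, ← integral_const_mul, ← integral_const_mul]
  simp only [drift_const_mul]
  congr 2
  · ext z; ring
  · ext x; ring

theorem Leps_sq (hk : 1 ≤ k) (hα : 1 / 2 < α) (hα' : α ≤ 2) (h : IsGoodTestFunction m ψ)
    (h2 : IsGoodTestFunction m fun q => |ψ q| ^ 2) (p : State k α E) :
    Leps ε m ι (fun q => |ψ q| ^ 2) p = 2 * ψ p.toAmbient * Leps ε m ι ψ p +
      (ε ^ 2)⁻¹ * (genN m (fun q => |ψ q| ^ 2) p - 2 * ψ p.toAmbient * genN m ψ p) := by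
  rw [Leps_eq hk hα h, Leps_eq hk hα h2, Lfu_sq hk hα' h h2]
  ring

end Uniqueness

/-! ### Markov processes -/

section Markov

variable {Ω S : Type*} [MeasurableSpace Ω] [PseudoMetricSpace S] [MeasurableSpace S]
  [BorelSpace S] (m : MarkovProcess Ω S)

instance : IsMarkovKernel m.law := m.isMarkovKernel

theorem BLoc.measurable {ψ : S → ℝ} (h : BLoc ψ) : Measurable ψ := by
  have := h.1
  rwa [← BorelSpace.measurable_eq] at this

theorem LocBounded.exists_bound (hS : Bornology.IsBounded (univ : Set S)) {ψ : S → ℝ}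
    (h : LocBounded ψ) : ∃ C, ∀ n, |ψ n| ≤ C :=
  (h univ hS).imp fun _ hC n => hC n (mem_univ n)

namespace MarkovProcess

variable {m}

theorem integrable_comp {X : Type*} [MeasurableSpace X] {μ : Measure X} [IsFiniteMeasure μ]
    {f : X → ℝ} (hf : Measurable f) {C : ℝ} (hC : ∀ x, |f x| ≤ C) : Integrable f μ :=
  Integrable.of_bound hf.aestronglyMeasurable C (Eventually.of_forall hC)

theorem measurable_semigroup {ψ : S → ℝ} (hψ : Measurable ψ) (t : ℝ≥0) :
    Measurable (m.semigroup t ψ) := by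
  have h : StronglyMeasurable (Function.uncurry fun (_ : S) (ω : Ω) => ψ (m.X t ω)) :=
    ((hψ.comp (m.measurable_X t)).comp measurable_snd).stronglyMeasurable
  exact (h.integral_kernel_prod_right (κ := m.law)).measurable

theorem abs_semigroup_le {ψ : S → ℝ} {C : ℝ} (hC : ∀ n, |ψ n| ≤ C) (t : ℝ≥0) (n : S) :
    |m.semigroup t ψ n| ≤ C := by
  unfold semigroup
  rw [← Real.norm_eq_abs]
  refine (norm_integral_le_of_norm_le_const (C := C) (Eventually.of_forall fun ω => hC _)).trans
    (by simp)

theorem semigroup_zero (ψ : S → ℝ) (n : S) : m.semigroup 0 ψ n = ψ n := by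
  unfold semigroup
  rw [integral_congr_ae (g := fun _ => ψ n)]
  · simp
  · filter_upwards [m.start n] with ω hω
    rw [hω]

theorem semigroup_add {ψ : S → ℝ} (hψ : Measurable ψ) {C : ℝ} (hC : ∀ n, |ψ n| ≤ C)
    (s t : ℝ≥0) (n : S) : m.semigroup (s + t) ψ n = m.semigroup s (m.semigroup t ψ) n := by
  have h := m.markov n s t ψ hψ ⟨C, hC⟩
  have h1 := integral_condExp (μ := m.law n)
    ((canonicalFiltration m.X m.measurable_X).le s) (f := fun ω => ψ (m.X (s + t) ω))
  rw [integral_congr_ae h] at h1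
  exact h1.symm

/-- The bound of the increments of the semigroup by the generator. -/
theorem abs_semigroup_sub_le (hS : Bornology.IsBounded (univ : Set S)) {ψ θ : S → ℝ}
    (h : m.HasGenerator ψ θ) {K : ℝ} (hK : ∀ n, |θ n| ≤ K) (t : ℝ≥0) (n : S) :
    |m.semigroup t ψ n - ψ n| ≤ K * t := by
  obtain ⟨hψ, hθ, hlim, hbd⟩ := h
  obtain ⟨C, hC⟩ := LocBounded.exists_bound hS hψ.2
  obtain ⟨D, hD⟩ := hbd univ hS
  have hm := hψ.measurable
  have hD0 : ∀ t : ℝ≥0, ∀ n, |m.semigroup t ψ n - ψ n| ≤ D * t := by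
    intro t n
    rcases eq_or_ne t 0 with rfl | ht
    · simp [semigroup_zero]
    · have := hD t (pos_iff_ne_zero.2 ht) n (mem_univ n)
      unfold quotient at this
      rw [abs_div, div_le_iff₀ (by positivity)] at this
      simpa using this
  have hinc : ∀ (s h : ℝ≥0), m.semigroup (s + h) ψ n - m.semigroup s ψ n =
      ∫ ω, (m.semigroup h ψ (m.X s ω) - ψ (m.X s ω)) ∂(m.law n) := by
    intro s h
    rw [semigroup_add hm hC, integral_sub]
    · rfl
    · exact integrable_comp ((measurable_semigroup hm h).comp (m.measurable_X s))
        fun ω => abs_semigroup_le hC h _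
    · exact integrable_comp (hm.comp (m.measurable_X s)) fun ω => hC _
  set g : ℝ → ℝ := fun s => m.semigroup s.toNNReal ψ n with hg
  have hlip : ∀ s s' : ℝ, 0 ≤ s → s ≤ s' → |g s' - g s| ≤ D * (s' - s) := by
    intro s s' hs hss
    have e : s'.toNNReal = s.toNNReal + (s' - s).toNNReal := by
      rw [← Real.toNNReal_add hs (sub_nonneg.2 hss), add_sub_cancel]
    rw [hg]
    simp only []
    rw [e, hinc, ← Real.norm_eq_abs]
    refine (norm_integral_le_of_norm_le_const (C := D * (s' - s))
      (Eventually.of_forall fun ω => ?_)).trans (by simp)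
    have := hD0 (s' - s).toNNReal (m.X s.toNNReal ω)
    rwa [Real.coe_toNNReal _ (sub_nonneg.2 hss)] at this
  have hcont : ContinuousOn g (Icc 0 (t : ℝ)) := by
    have hDn : 0 ≤ |D| := abs_nonneg _
    refine (LipschitzOnWith.of_dist_le_mul (K := |D|.toNNReal) fun x hx y hy => ?_).continuousOn
    rw [Real.dist_eq, Real.dist_eq, Real.coe_toNNReal _ hDn]
    have hh : ∀ s s' : ℝ, 0 ≤ s → s ≤ s' → |g s' - g s| ≤ |D| * |s' - s| := fun s s' h1 h2 => by
      refine (hlip s s' h1 h2).trans ?_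
      rw [abs_of_nonneg (sub_nonneg.2 h2)]
      exact mul_le_mul_of_nonneg_right (le_abs_self _) (sub_nonneg.2 h2)
    rcases le_total y x with hxy | hxy
    · exact hh y x hy.1 hxy
    · rw [abs_sub_comm, abs_sub_comm x y]
      exact hh x y hx.1 hxy
  have hderiv : ∀ s ∈ Ico 0 (t : ℝ),
      HasDerivWithinAt g (m.semigroup s.toNNReal θ n) (Ici s) s := by
    intro s hs
    rw [← hasDerivWithinAt_Ioi_iff_Ici, hasDerivWithinAt_iff_tendsto_slope' (by simp)]
    have e : ∀ᶠ s' in 𝓝[>] s, ∫ ω, m.quotient ψ (s' - s).toNNReal (m.X s.toNNReal ω) ∂(m.law n) =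
        slope g s s' := by
      filter_upwards [self_mem_nhdsWithin] with s' hs'
      have hss : s ≤ s' := le_of_lt hs'
      have e : s'.toNNReal = s.toNNReal + (s' - s).toNNReal := by
        rw [← Real.toNNReal_add hs.1 (sub_nonneg.2 hss), add_sub_cancel]
      rw [slope_def_field, hg]
      simp only []
      rw [e, hinc]
      unfold quotient
      rw [integral_div, Real.coe_toNNReal _ (sub_nonneg.2 hss)]
    refine Tendsto.congr' e ?_
    have htend : Tendsto (fun s' : ℝ => (s' - s).toNNReal) (𝓝[>] s) (𝓝[>] 0) := by
      refine tendsto_nhdsWithin_iff.2 ⟨?_, ?_⟩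
      · have : Tendsto (fun s' : ℝ => (s' - s).toNNReal) (𝓝 s) (𝓝 (s - s).toNNReal) :=
          (continuous_real_toNNReal.comp (continuous_id.sub continuous_const)).tendsto s
        rw [sub_self, Real.toNNReal_zero] at this
        exact this.mono_left nhdsWithin_le_nhds
      · filter_upwards [self_mem_nhdsWithin] with s' hs'
        exact Real.toNNReal_pos.2 (sub_pos.2 hs')
    refine tendsto_integral_filter_of_dominated_convergence (fun _ => D) ?_ ?_
      (integrable_const _) ?_
    · refine Eventually.of_forall fun s' => ?_
      have := (((measurable_semigroup (m := m) hm (s' - s).toNNReal).sub hm).div_const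
        ((s' - s).toNNReal : ℝ)).comp (m.measurable_X s.toNNReal)
      exact this.aestronglyMeasurable
    · filter_upwards [htend.eventually self_mem_nhdsWithin] with s' hs'
      exact Eventually.of_forall fun ω => hD _ hs' _ (mem_univ _)
    · exact Eventually.of_forall fun ω => (hlim _).comp htend
  have := norm_image_sub_le_of_norm_deriv_right_le_segment hcont hderiv
    (fun s _ => abs_semigroup_le hK s.toNNReal n) t ⟨t.2, le_rfl⟩
  simpa [hg, semigroup_zero] using this

theorem HasGenerator.generator_eq {ψ θ : S → ℝ} (h : m.HasGenerator ψ θ) : m.generator ψ = θ :=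
  funext fun n => (h.2.2.1 n).limUnder_eq

theorem InDomain.hasGenerator {ψ : S → ℝ} (h : m.InDomain ψ) :
    m.HasGenerator ψ (m.generator ψ) := by
  obtain ⟨θ, hθ⟩ := h
  rwa [hθ.generator_eq]

/-- The carré du champ operator is nonnegative. -/
theorem carreDuChamp_nonneg (hS : Bornology.IsBounded (univ : Set S)) {ψ : S → ℝ}
    (h : m.InDomain ψ) (h2 : m.InDomain fun n => |ψ n| ^ 2) (n : S) :
    0 ≤ m.generator (fun n => |ψ n| ^ 2) n - 2 * ψ n * m.generator ψ n := by
  have l1 := h.hasGenerator.2.2.1 n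
  have l2 := h2.hasGenerator.2.2.1 n
  obtain ⟨C, hC⟩ := LocBounded.exists_bound hS h.hasGenerator.1.2
  have hm := h.hasGenerator.1.measurable
  refine ge_of_tendsto (l2.sub (l1.const_mul (2 * ψ n))) (Eventually.of_forall fun t => ?_)
  unfold quotient semigroup
  have i1 : Integrable (fun ω => ψ (m.X t ω)) (m.law n) :=
    integrable_comp (hm.comp (m.measurable_X t)) fun ω => hC _
  have i2 : Integrable (fun ω => |ψ (m.X t ω)| ^ 2) (m.law n) :=
    integrable_comp (C := C ^ 2) ((hm.comp (m.measurable_X t)).abs.pow_const 2) fun ω => by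
      rw [abs_of_nonneg (by positivity)]
      gcongr
      exact hC _
  have e : ∫ ω, (ψ (m.X t ω) - ψ n) ^ 2 ∂(m.law n) =
      ∫ ω, |ψ (m.X t ω)| ^ 2 ∂(m.law n) - 2 * ψ n * ∫ ω, ψ (m.X t ω) ∂(m.law n) + ψ n ^ 2 := by
    rw [← integral_const_mul, ← integral_sub i2 (i1.const_mul _)]
    have : (ψ n ^ 2 : ℝ) = ∫ _, ψ n ^ 2 ∂(m.law n) := by simp
    rw [this]
    refine Eq.trans ?_ (integral_add (i2.sub (i1.const_mul (2 * ψ n)))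
      (integrable_const (ψ n ^ 2)))
    congr 1; ext ω
    simp only [sq_abs]
    ring
  have e2 : 0 ≤ ∫ ω, (ψ (m.X t ω) - ψ n) ^ 2 ∂(m.law n) := integral_nonneg fun ω => sq_nonneg _
  rw [e] at e2
  have e3 : (∫ ω, |ψ (m.X t ω)| ^ 2 ∂(m.law n) - |ψ n| ^ 2) / t -
      2 * ψ n * ((∫ ω, ψ (m.X t ω) ∂(m.law n) - ψ n) / t) =
      (∫ ω, |ψ (m.X t ω)| ^ 2 ∂(m.law n) - 2 * ψ n * ∫ ω, ψ (m.X t ω) ∂(m.law n) + ψ n ^ 2) / t := by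
    rw [sq_abs]; ring
  rw [e3]
  positivity

/-- The Markov property, with an argument frozen at time `s`. -/
theorem setIntegral_frozen {Y : Type*} [MeasurableSpace Y] {π : Y → S} (hπ : Measurable π)
    {W : Ω → Y} {s : ℝ≥0} (hW : Measurable[canonicalFiltration m.X m.measurable_X s] W)
    (hWX : ∀ ω, π (W ω) = m.X s ω) {Θ : Y × S → ℝ} (hΘ : Measurable Θ) {C : ℝ}
    (hC : ∀ q, |Θ q| ≤ C) (n : S) (t : ℝ≥0) {A : Set Ω}
    (hA : MeasurableSet[canonicalFiltration m.X m.measurable_X s] A) :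
    ∫ ω in A, Θ (W ω, m.X (s + t) ω) ∂(m.law n) =
      ∫ ω in A, ∫ ω', Θ (W ω, m.X t ω') ∂(m.law (m.X s ω)) ∂(m.law n) := by
  set 𝓖 := canonicalFiltration m.X m.measurable_X
  have hW' : Measurable W := hW.mono (𝓖.le s) le_rfl
  set κ : Kernel Y S := (m.law.map (m.X t)).comap π hπ with hκ
  have : IsMarkovKernel (m.law.map (m.X t)) := Kernel.IsMarkovKernel.map _ (m.measurable_X t)
  set Q := (m.law n).restrict A
  have key : Q.map (fun ω => (W ω, m.X (s + t) ω)) = (Q.map W) ⊗ₘ κ := by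
    have : IsFiniteMeasure (Q.map (fun ω => (W ω, m.X (s + t) ω))) := inferInstance
    refine Measure.ext_prod fun {D B} hD hB => ?_
    have hDA : MeasurableSet[𝓖 s] (A ∩ W ⁻¹' D) := hA.inter (hW hD)
    rw [Measure.compProd_apply_prod hD hB, setLIntegral_map hD (κ.measurable_coe hB) hW',
      Measure.map_apply (hW'.prodMk (m.measurable_X _)) (hD.prod hB)]
    have h1 := m.markov n s t (B.indicator fun _ => 1) (measurable_const.indicator hB)
      ⟨1, fun y => by by_cases hy : y ∈ B <;> simp [hy]⟩
    have h2 := setIntegral_condExp (μ := m.law n) (𝓖.le s)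
      (f := fun ω => B.indicator (fun _ => (1 : ℝ)) (m.X (s + t) ω))
      (integrable_comp ((measurable_const.indicator hB).comp (m.measurable_X _)) (C := 1)
        fun ω => by by_cases hy : m.X (s + t) ω ∈ B <;> simp [hy]) hDA
    rw [setIntegral_congr_ae (g := fun ω => ∫ ω', B.indicator (fun _ => (1 : ℝ)) (m.X t ω')
      ∂(m.law (m.X s ω))) (𝓖.le s _ hDA) (h1.mono fun ω h _ => h)] at h2
    have e1 : ∀ y, ∫ ω', B.indicator (fun _ => (1 : ℝ)) (m.X t ω') ∂(m.law y) =
        ((m.law.map (m.X t)) y).real B := by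
      intro y
      rw [measureReal_def, Kernel.map_apply' _ (m.measurable_X t) _ hB]
      have : (fun ω' => B.indicator (fun _ => (1 : ℝ)) (m.X t ω')) =
          (m.X t ⁻¹' B).indicator fun _ => 1 := by
        ext ω'; rfl
      rw [this, integral_indicator_const _ (m.measurable_X t hB)]
      simp [Measure.real]
    have e2 : ∫ ω in A ∩ W ⁻¹' D, B.indicator (fun _ => (1 : ℝ)) (m.X (s + t) ω) ∂(m.law n) =
        (m.law n).real (A ∩ W ⁻¹' D ∩ m.X (s + t) ⁻¹' B) := by
      have : (fun ω' => B.indicator (fun _ => (1 : ℝ)) (m.X (s + t) ω')) =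
          (m.X (s + t) ⁻¹' B).indicator fun _ => 1 := by
        ext ω'; rfl
      rw [this, integral_indicator_const _ (m.measurable_X _ hB)]
      simp [Measure.real, Measure.restrict_apply (m.measurable_X _ hB), inter_comm]
    simp only [e1] at h2
    rw [e2] at h2
    have e3 : ∫⁻ ω in W ⁻¹' D, κ (W ω) B ∂Q =
        ENNReal.ofReal (∫ ω in A ∩ W ⁻¹' D, ((m.law.map (m.X t)) (m.X s ω)).real B ∂(m.law n)) := by
      rw [ofReal_integral_eq_lintegral_ofReal]
      · rw [Measure.restrict_restrict (hW' hD), inter_comm]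
        refine lintegral_congr fun ω => ?_
        rw [hκ, Kernel.comap_apply, hWX, measureReal_def, ENNReal.ofReal_toReal (measure_ne_top _ _)]
      · refine Integrable.of_bound (C := 1) ?_ (Eventually.of_forall fun ω => ?_)
        · exact (((Kernel.measurable_coe _ hB).comp
            (m.measurable_X s)).ennreal_toReal).aestronglyMeasurable
        · rw [measureReal_def, Real.norm_of_nonneg ENNReal.toReal_nonneg]
          exact ENNReal.toReal_le_of_le_ofReal zero_le_one (by simpa using prob_le_one)
      · exact Eventually.of_forall fun ω => ENNReal.toReal_nonneg
    rw [e3, h2, Measure.real, ENNReal.ofReal_toReal (measure_ne_top _ _),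
      Measure.restrict_apply ((hW'.prodMk (m.measurable_X _)) (hD.prod hB))]
    congr 1
    ext ω
    simp only [mem_inter_iff, mem_preimage, mem_prod]
    tauto
  have hiΘ : Integrable Θ (Q.map W ⊗ₘ κ) := integrable_comp hΘ hC
  have l1 : ∫ ω in A, Θ (W ω, m.X (s + t) ω) ∂(m.law n) =
      ∫ q, Θ q ∂(Q.map (fun ω => (W ω, m.X (s + t) ω))) :=
    (integral_map (hW'.prodMk (m.measurable_X _)).aemeasurable hΘ.aestronglyMeasurable).symm
  rw [l1, key, Measure.integral_compProd hiΘ]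
  rw [integral_map hW'.aemeasurable]
  · congr 1
    ext ω
    rw [hκ, Kernel.comap_apply, hWX, Kernel.map_apply _ (m.measurable_X t),
      integral_map (m.measurable_X t).aemeasurable]
    exact (hΘ.comp measurable_prodMk_left).aestronglyMeasurable
  · exact (StronglyMeasurable.integral_kernel_prod_right (κ := κ)
      (f := fun y z => Θ (y, z)) hΘ.stronglyMeasurable).aestronglyMeasurable

end MarkovProcess

end Markov

end Kinetic

namespace Kinetic

/-! ### Integral curves of kinetic systems -/

theorem le_mul_exp_of_le_add_integral {D : ℝ → ℝ} {A K T : ℝ} (hK : 0 ≤ K)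
    (hc : ContinuousOn D (Icc 0 T)) (h0 : ∀ s ∈ Icc 0 T, 0 ≤ D s) (hT : 0 ≤ T) (hA : 0 ≤ A)
    (h : ∀ s ∈ Icc 0 T, D s ≤ A + K * ∫ σ in (0 : ℝ)..s, D σ) : D T ≤ A * Real.exp (K * T) := by
  have hint : IntervalIntegrable D volume 0 T := by
    refine ContinuousOn.intervalIntegrable ?_
    rwa [uIcc_of_le hT]
  set g : ℝ → ℝ := fun s => A + K * ∫ σ in (0 : ℝ)..s, D σ with hg
  have hgc : ContinuousOn g (Icc 0 T) := by
    refine continuousOn_const.add (continuousOn_const.mul ?_)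
    have := intervalIntegral.continuousOn_primitive_interval' hint (a := 0) (by simp)
    rwa [uIcc_of_le hT] at this
  have hg0 : ∀ s ∈ Icc 0 T, 0 ≤ g s := fun s hs => (h0 s hs).trans (h s hs)
  have hd : ∀ s ∈ Ico 0 T, HasDerivWithinAt g (K * D s) (Ici s) s := by
    intro s hs
    have hs' : s ∈ Icc 0 T := ⟨hs.1, hs.2.le⟩
    refine HasDerivWithinAt.const_add _ (HasDerivWithinAt.const_mul _ ?_)
    have hcs : ContinuousWithinAt D (Ioi s) s :=
      (hc s hs').mono_of_mem_nhdsWithin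
        (mem_of_superset (Ioo_mem_nhdsGT hs.2) fun x hx => ⟨hs.1.trans hx.1.le, hx.2.le⟩)
    refine intervalIntegral.integral_hasDerivWithinAt_right
      (hint.mono_set ?_) (t := Ioi s) ?_ hcs
    · rw [uIcc_of_le hs.1, uIcc_of_le hT]
      exact Icc_subset_Icc_right hs.2.le
    · exact ⟨Ioc s T, Ioc_mem_nhdsGT hs.2,
        (hc.mono fun x hx => ⟨hs.1.trans hx.1.le, hx.2⟩).aestronglyMeasurable measurableSet_Ioc⟩
  have key := norm_le_gronwallBound_of_norm_deriv_right_le hgc hd (δ := A) (K := K) (ε := 0)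
    (by simp [hg, abs_of_nonneg hA]) (fun s hs => by
      have hs' : s ∈ Icc 0 T := ⟨hs.1, hs.2.le⟩
      rw [norm_mul, Real.norm_of_nonneg hK, Real.norm_of_nonneg (h0 s hs'),
        Real.norm_of_nonneg (hg0 s hs'), add_zero]
      exact mul_le_mul_of_nonneg_left (h s hs') hK) T ⟨hT, le_rfl⟩
  rw [gronwallBound_ε0, sub_zero] at key
  exact (h T ⟨hT, le_rfl⟩).trans ((le_abs_self _).trans key)

/-- `(X, V)` solves `dX/ds = a V`, `dV/ds = b V + c W_s(X)` on `[0,T]` and starts from `z`. -/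
structure IsCurve (a b c : ℝ) (W : ℝ → C(Torus, ℝ)) (T : ℝ) (z : Phase) (X : ℝ → Torus)
    (V : ℝ → ℝ) : Prop where
  contX : ContinuousOn X (Icc 0 T)
  contV : ContinuousOn V (Icc 0 T)
  eqX : ∀ s ∈ Icc 0 T, X s = z.1 + ((∫ σ in (0 : ℝ)..s, a * V σ : ℝ) : Torus)
  eqV : ∀ s ∈ Icc 0 T, V s = z.2 + ∫ σ in (0 : ℝ)..s, (b * V σ + c * W σ (X σ))

/-- `W` is measurable in time, and bounded by `B` and `L`-Lipschitz in space on `[0,T]`. -/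
structure FieldBound (W : ℝ → C(Torus, ℝ)) (T B L : ℝ) : Prop where
  meas : StronglyMeasurable W
  le : ∀ s ∈ Icc 0 T, ‖W s‖ ≤ B
  lip : ∀ s ∈ Icc 0 T, ∀ x y, |W s x - W s y| ≤ L * dist x y

section Curve

variable {a b c T B L : ℝ} {W W' : ℝ → C(Torus, ℝ)} {z z' : Phase} {X X' : ℝ → Torus}
  {V V' : ℝ → ℝ}

theorem FieldBound.abs_apply_le (h : FieldBound W T B L) {s : ℝ} (hs : s ∈ Icc 0 T) (x : Torus) :
    |W s x| ≤ B := ((W s).norm_coe_le_norm x).trans (h.le s hs)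

theorem FieldBound.nonneg (h : FieldBound W T B L) (hT : 0 ≤ T) : 0 ≤ B :=
  (norm_nonneg _).trans (h.le 0 ⟨le_rfl, hT⟩)

theorem FieldBound.integrableOn (h : FieldBound W T B L) (hX : ContinuousOn X (Icc 0 T)) :
    IntegrableOn (fun s => W s (X s)) (Icc 0 T) := by
  have : IsFiniteMeasure (volume.restrict (Icc 0 T)) := ⟨by simp⟩
  refine Integrable.of_bound (C := B) ?_
    ((ae_restrict_iff' measurableSet_Icc).2 (Eventually.of_forall fun s hs =>
      h.abs_apply_le hs _))
  have h1 : AEStronglyMeasurable X (volume.restrict (Icc 0 T)) :=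
    hX.aestronglyMeasurable measurableSet_Icc
  have h2 : Continuous fun q : C(Torus, ℝ) × Torus => q.1 q.2 := by fun_prop
  exact h2.comp_aestronglyMeasurable (h.meas.aestronglyMeasurable.prodMk h1)

theorem intervalIntegrable_of_Icc {g : ℝ → ℝ} (hg : IntegrableOn g (Icc 0 T)) {s r : ℝ}
    (hs : s ∈ Icc 0 T) (hr : r ∈ Icc 0 T) : IntervalIntegrable g volume s r := by
  refine IntegrableOn.intervalIntegrable (hg.mono_set ?_)
  rw [uIcc]
  exact Icc_subset_Icc (le_min hs.1 hr.1) (max_le hs.2 hr.2)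

theorem IsCurve.integrableOn_V (h : IsCurve a b c W T z X V) : IntegrableOn V (Icc 0 T) :=
  h.contV.integrableOn_Icc

theorem IsCurve.abs_le (h : IsCurve a b c W T z X V) (hW : FieldBound W T B L) {s : ℝ}
    (hs : s ∈ Icc 0 T) : |V s| ≤ (|z.2| + |c| * B * T) * Real.exp (|b| * T) := by
  have hT : 0 ≤ T := hs.1.trans hs.2
  have hB := hW.nonneg hT
  have key : |V s| ≤ (|z.2| + |c| * B * T) * Real.exp (|b| * s) := by
    refine le_mul_exp_of_le_add_integral (D := fun s => |V s|) (abs_nonneg b)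
      (h.contV.abs.mono (Icc_subset_Icc_right hs.2)) (fun _ _ => abs_nonneg _) hs.1 (by positivity)
      fun r hr => ?_
    have hr' : r ∈ Icc 0 T := ⟨hr.1, hr.2.trans hs.2⟩
    have i1 := intervalIntegrable_of_Icc h.integrableOn_V ⟨le_rfl, hT⟩ hr'
    rw [h.eqV r hr']
    refine (abs_add_le _ _).trans ?_
    have : |∫ σ in (0 : ℝ)..r, (b * V σ + c * W σ (X σ))| ≤
        ∫ σ in (0 : ℝ)..r, (|b| * |V σ| + |c| * B) := by
      rw [← Real.norm_eq_abs]
      refine intervalIntegral.norm_integral_le_of_norm_le hr.1 (Eventually.of_forall fun σ hσ => ?_)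
        ((i1.abs.const_mul _).add intervalIntegrable_const)
      refine (norm_add_le _ _).trans ?_
      rw [norm_mul, norm_mul]
      refine add_le_add le_rfl (mul_le_mul_of_nonneg_left ?_ (norm_nonneg _))
      · exact hW.abs_apply_le ⟨hσ.1.le, hσ.2.trans hr'.2⟩ _
    rw [intervalIntegral.integral_add (i1.abs.const_mul _) intervalIntegrable_const,
      intervalIntegral.integral_const_mul, intervalIntegral.integral_const, smul_eq_mul,
      sub_zero] at this
    have h3 : r * (|c| * B) ≤ |c| * B * T := by
      rw [mul_comm]
      exact mul_le_mul_of_nonneg_left hr'.2 (by positivity)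
    linarith
  refine key.trans ?_
  gcongr
  exact hs.2

/-- Stability of integral curves with respect to the initial point and the field. -/
theorem IsCurve.dist_le (h : IsCurve a b c W T z X V) (h' : IsCurve a b c W' T z' X' V')
    {B' L' : ℝ} (hW : FieldBound W T B' L') (hW' : FieldBound W' T B L) (hL : 0 ≤ L) {s : ℝ}
    (hs : s ∈ Icc 0 T) :
    dist (X s) (X' s) + |V s - V' s| ≤
      (dist z.1 z'.1 + |z.2 - z'.2| + |c| * ∫ σ in (0 : ℝ)..s, |W σ (X σ) - W' σ (X σ)|) *
        Real.exp ((|a| + |b| + |c| * L) * s) := by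
  have hT : 0 ≤ T := hs.1.trans hs.2
  have j1 := (hW.integrableOn h.contX).sub (hW'.integrableOn h.contX)
  have cd : ContinuousOn (fun s => dist (X s) (X' s) + |V s - V' s|) (Icc 0 T) :=
    (continuous_dist.comp_continuousOn (h.contX.prodMk h'.contX)).add (h.contV.sub h'.contV).abs
  have m0 : ∀ σ ∈ Icc 0 s, 0 ≤ ∫ σ in (0 : ℝ)..σ, |W σ (X σ) - W' σ (X σ)| := fun σ hσ =>
    intervalIntegral.integral_nonneg hσ.1 fun _ _ => abs_nonneg _
  refine le_mul_exp_of_le_add_integral (D := fun s => dist (X s) (X' s) + |V s - V' s|)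
    (by positivity) (cd.mono (Icc_subset_Icc_right hs.2)) (fun _ _ => by positivity) hs.1
    (by have := m0 s ⟨hs.1, le_rfl⟩; positivity) fun r hr => ?_
  have hr' : r ∈ Icc 0 T := ⟨hr.1, hr.2.trans hs.2⟩
  have h0 : (0 : ℝ) ∈ Icc 0 T := ⟨le_rfl, hT⟩
  have i1 := intervalIntegrable_of_Icc h.integrableOn_V h0 hr'
  have i2 := intervalIntegrable_of_Icc h'.integrableOn_V h0 hr'
  have k1 := intervalIntegrable_of_Icc (hW.integrableOn h.contX) h0 hr'
  have k2 := intervalIntegrable_of_Icc (hW'.integrableOn h'.contX) h0 hr'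
  have k3 : IntervalIntegrable (fun σ => W σ (X σ) - W' σ (X σ)) volume 0 r :=
    intervalIntegrable_of_Icc j1 h0 hr'
  have kd := intervalIntegrable_of_Icc cd.integrableOn_Icc h0 hr'
  have eX : dist (X r) (X' r) ≤ dist z.1 z'.1 + ∫ σ in (0 : ℝ)..r, |a| * |V σ - V' σ| := by
    rw [h.eqX r hr', h'.eqX r hr', dist_eq_norm, dist_eq_norm, add_sub_add_comm]
    refine (norm_add_le _ _).trans (add_le_add le_rfl ?_)
    rw [← AddCircle.coe_sub, ← intervalIntegral.integral_sub (i1.const_mul a) (i2.const_mul a)]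
    refine (norm_coe_le _).trans ?_
    rw [← Real.norm_eq_abs]
    refine intervalIntegral.norm_integral_le_of_norm_le hr.1 (Eventually.of_forall fun σ _ => ?_)
      ((i1.sub i2).abs.const_mul _)
    rw [← mul_sub, norm_mul]; rfl
  have eV : |V r - V' r| ≤ |z.2 - z'.2| + ∫ σ in (0 : ℝ)..r, (|b| * |V σ - V' σ| +
      (|c| * |W σ (X σ) - W' σ (X σ)| + |c| * L * dist (X σ) (X' σ))) := by
    rw [h.eqV r hr', h'.eqV r hr', add_sub_add_comm]
    refine (abs_add_le _ _).trans (add_le_add le_rfl ?_)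
    rw [← intervalIntegral.integral_sub ((i1.const_mul b).add (k1.const_mul c))
      ((i2.const_mul b).add (k2.const_mul c)), ← Real.norm_eq_abs]
    have cX : IntervalIntegrable (fun σ => dist (X σ) (X' σ)) volume 0 r := intervalIntegrable_of_Icc (continuous_dist.comp_continuousOn (h.contX.prodMk h'.contX)).integrableOn_Icc h0 hr'
    refine intervalIntegral.norm_integral_le_of_norm_le hr.1 (Eventually.of_forall fun σ hσ => ?_)
      (((i1.sub i2).abs.const_mul _).add ((k3.abs.const_mul _).add (cX.const_mul _)))
    have e : b * V σ + c * W σ (X σ) - (b * V' σ + c * W' σ (X' σ)) =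
        b * (V σ - V' σ) + (c * (W σ (X σ) - W' σ (X σ)) + c * (W' σ (X σ) - W' σ (X' σ))) := by
      ring
    rw [e]
    refine (norm_add_le _ _).trans (add_le_add (norm_mul _ _).le ?_)
    refine (norm_add_le _ _).trans (add_le_add (norm_mul _ _).le ?_)
    rw [norm_mul, mul_assoc]
    exact mul_le_mul_of_nonneg_left (hW'.lip σ ⟨hσ.1.le, hσ.2.trans hr'.2⟩ _ _) (norm_nonneg _)
  have cX : IntervalIntegrable (fun σ => dist (X σ) (X' σ)) volume 0 r := intervalIntegrable_of_Icc (continuous_dist.comp_continuousOn (h.contX.prodMk h'.contX)).integrableOn_Icc h0 hr'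
  have iv := (i1.sub i2).abs
  rw [intervalIntegral.integral_const_mul] at eX
  rw [intervalIntegral.integral_add (iv.const_mul _) ((k3.abs.const_mul _).add (cX.const_mul _)),
    intervalIntegral.integral_add (k3.abs.const_mul _) (cX.const_mul _),
    intervalIntegral.integral_const_mul, intervalIntegral.integral_const_mul,
    intervalIntegral.integral_const_mul] at eV
  rw [intervalIntegral.integral_add cX iv]
  have mono : ∫ σ in (0 : ℝ)..r, |W σ (X σ) - W' σ (X σ)| ≤
      ∫ σ in (0 : ℝ)..s, |W σ (X σ) - W' σ (X σ)| := by
    refine intervalIntegral.integral_mono_interval le_rfl hr.1 hr.2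
      (Eventually.of_forall fun σ => abs_nonneg _)
      (intervalIntegrable_of_Icc j1 h0 ⟨hs.1, hs.2⟩).abs
  have n1 : 0 ≤ ∫ σ in (0 : ℝ)..r, |V σ - V' σ| :=
    intervalIntegral.integral_nonneg hr.1 fun _ _ => abs_nonneg _
  have n2 : 0 ≤ ∫ σ in (0 : ℝ)..r, dist (X σ) (X' σ) :=
    intervalIntegral.integral_nonneg hr.1 fun _ _ => dist_nonneg
  have q1 : 0 ≤ |c| * L * ∫ σ in (0 : ℝ)..r, |V σ - V' σ| := by positivity
  have q2 : 0 ≤ (|a| + |b|) * ∫ σ in (0 : ℝ)..r, dist (X σ) (X' σ) := by positivity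
  have q3 := mul_le_mul_of_nonneg_left mono (abs_nonneg c)
  linarith

theorem IsCurve.unique (h : IsCurve a b c W T z X V) (h' : IsCurve a b c W T z X' V')
    (hW : FieldBound W T B L) (hL : 0 ≤ L) {s : ℝ} (hs : s ∈ Icc 0 T) :
    X s = X' s ∧ V s = V' s := by
  have := h.dist_le h' hW hW hL hs
  simp only [dist_self, sub_self, abs_zero, intervalIntegral.integral_zero, mul_zero, add_zero,
    zero_mul] at this
  have d1 : 0 ≤ dist (X s) (X' s) := dist_nonneg
  have d2 := abs_nonneg (V s - V' s)
  exact ⟨dist_le_zero.1 (by linarith), sub_eq_zero.1 (abs_nonpos_iff.1 (by linarith))⟩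

theorem isCharacteristic_iff {ε : ℝ} {w : ℝ≥0 → Torus → ℝ} {t : ℝ≥0}
    (hw : ∀ s ∈ Icc 0 (t : ℝ), ∀ x, w s.toNNReal x = W s x) :
    IsCharacteristic ε w t z X V ↔
      IsCurve (-ε⁻¹) (ε ^ 2)⁻¹ (-(ε ^ 2)⁻¹) (fun r => W (t - r)) t z (fun r => X (t - r))
        (fun r => V (t - r)) := by
  have hm : ∀ r ∈ Icc 0 (t : ℝ), (t : ℝ) - r ∈ Icc 0 (t : ℝ) := fun r hr =>
    ⟨sub_nonneg.2 hr.2, sub_le_self _ hr.1⟩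
  have hmt : MapsTo (fun r => (t : ℝ) - r) (Icc 0 (t : ℝ)) (Icc 0 (t : ℝ)) := hm
  have hcs : ContinuousOn (fun r => (t : ℝ) - r) (Icc 0 (t : ℝ)) := by fun_prop
  have e1 : ∀ r, -∫ σ in ((t : ℝ) - r)..t, ε⁻¹ * V σ = ∫ σ in (0 : ℝ)..r, -ε⁻¹ * V (t - σ) := by
    intro r
    rw [intervalIntegral.integral_comp_sub_left (fun σ => -ε⁻¹ * V σ), sub_zero,
      ← intervalIntegral.integral_neg]
    simp only [neg_mul]
  have e2 : ∀ r ∈ Icc 0 (t : ℝ), -∫ σ in ((t : ℝ) - r)..t,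
      (ε ^ 2)⁻¹ * (w σ.toNNReal (X σ) - V σ) =
      ∫ σ in (0 : ℝ)..r, ((ε ^ 2)⁻¹ * V (t - σ) + -(ε ^ 2)⁻¹ * W (t - σ) (X (t - σ))) := by
    intro r hr
    rw [intervalIntegral.integral_comp_sub_left
      (fun σ => (ε ^ 2)⁻¹ * V σ + -(ε ^ 2)⁻¹ * W σ (X σ)), sub_zero,
      ← intervalIntegral.integral_neg]
    refine intervalIntegral.integral_congr fun σ hσ => ?_
    rw [uIcc_of_le (hm r hr).2] at hσ
    rw [hw σ ⟨(hm r hr).1.trans hσ.1, hσ.2⟩]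
    ring
  constructor
  · rintro ⟨c1, c2, h⟩
    refine ⟨c1.comp hcs hmt, c2.comp hcs hmt, fun r hr => ?_, fun r hr => ?_⟩
    · rw [(h _ (hm r hr)).1, ← e1, AddCircle.coe_neg, sub_eq_add_neg]
    · rw [(h _ (hm r hr)).2, ← e2 r hr, sub_eq_add_neg]
  · rintro ⟨c1, c2, h1, h2⟩
    refine ⟨?_, ?_, fun s hs => ⟨?_, ?_⟩⟩
    · simpa [Function.comp_def] using c1.comp hcs hmt
    · simpa [Function.comp_def] using c2.comp hcs hmt
    · have := h1 _ (hm s hs)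
      simp only [sub_sub_cancel] at this
      rw [this, ← e1, sub_sub_cancel, AddCircle.coe_neg, sub_eq_add_neg]
    · have := h2 _ (hm s hs)
      simp only [sub_sub_cancel] at this
      rw [this, ← e2 _ (hm s hs), sub_sub_cancel, sub_eq_add_neg]

end Curve

end Kinetic

namespace Kinetic

/-! ### Liouville's theorem -/

theorem isCompact_slab (R : ℝ) : IsCompact {z : Phase | |z.2| ≤ R} := by
  have : {z : Phase | |z.2| ≤ R} = univ ×ˢ Icc (-R) R := by
    ext z; simp [abs_le]
  rw [this]
  exact isCompact_univ.prod isCompact_Icc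

theorem exists_subset_slab {K : Set Phase} (hK : IsCompact K) :
    ∃ R, ∀ z ∈ K, |z.2| ≤ R :=
  hK.exists_bound_of_continuousOn (f := fun z : Phase => z.2) continuous_snd.continuousOn

/-- One step of the symplectic Euler scheme. -/
def eulerStep (a b c : ℝ) (W : ℝ → C(Torus, ℝ)) (h s : ℝ) (z : Phase) : Phase :=
  (z.1 + ((h * (a * z.2) : ℝ) : Torus),
    (1 + b * h) * z.2 + ∫ σ in s..(s + h), c * W σ (z.1 + ((h * (a * z.2) : ℝ) : Torus)))

/-- The symplectic Euler scheme. -/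
def euler (a b c : ℝ) (W : ℝ → C(Torus, ℝ)) (h : ℝ) : ℕ → Phase → Phase
  | 0, z => z
  | i + 1, z => eulerStep a b c W h (i * h) (euler a b c W h i z)

section Euler

variable {a b c T B L : ℝ} {W : ℝ → C(Torus, ℝ)} {z y : Phase} {X : ℝ → Torus} {V : ℝ → ℝ}
  {h s : ℝ}

theorem FieldBound.intervalIntegrable_const (hW : FieldBound W T B L) (x : Torus)
    {s r : ℝ} (hs : s ∈ Icc 0 T) (hr : r ∈ Icc 0 T) :
    IntervalIntegrable (fun σ => W σ x) volume s r :=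
  intervalIntegrable_of_Icc (hW.integrableOn (X := fun _ => x) continuousOn_const) hs hr

theorem FieldBound.abs_integral_le (hW : FieldBound W T B L) (x : Torus)
    (hs : s ∈ Icc 0 T) (hr : s + h ∈ Icc 0 T) (hh : 0 ≤ h) :
    |∫ σ in s..(s + h), c * W σ x| ≤ |c| * B * h := by
  rw [← Real.norm_eq_abs]
  refine (intervalIntegral.norm_integral_le_of_norm_le_const (C := |c| * B) fun σ hσ => ?_).trans ?_
  · rw [uIoc_of_le (by linarith)] at hσ
    rw [norm_mul]
    exact mul_le_mul_of_nonneg_left (hW.abs_apply_le ⟨hs.1.trans hσ.1.le, hσ.2.trans hr.2⟩ _)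
      (norm_nonneg _)
  · rw [add_sub_cancel_left, abs_of_nonneg hh]

theorem FieldBound.continuous_integral (hW : FieldBound W T B L) (hL : 0 ≤ L)
    (hs : s ∈ Icc 0 T) (hr : s + h ∈ Icc 0 T) (hh : 0 ≤ h) :
    Continuous fun x : Torus => ∫ σ in s..(s + h), c * W σ x := by
  have hK : 0 ≤ |c| * L * h := by positivity
  refine (LipschitzWith.of_dist_le_mul (K := (|c| * L * h).toNNReal) fun x y => ?_).continuous
  rw [Real.coe_toNNReal _ hK, Real.dist_eq, ← intervalIntegral.integral_sub
    ((hW.intervalIntegrable_const x hs hr).const_mul c)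
    ((hW.intervalIntegrable_const y hs hr).const_mul c), ← Real.norm_eq_abs]
  refine (intervalIntegral.norm_integral_le_of_norm_le_const (C := |c| * (L * dist x y))
    fun σ hσ => ?_).trans ?_
  · rw [uIoc_of_le (by linarith)] at hσ
    rw [← mul_sub, norm_mul]
    exact mul_le_mul_of_nonneg_left (hW.lip σ ⟨hs.1.trans hσ.1.le, hσ.2.trans hr.2⟩ _ _)
      (norm_nonneg _)
  · rw [add_sub_cancel_left, abs_of_nonneg hh]
    linarith

theorem measurable_eulerStep (hW : FieldBound W T B L) (hL : 0 ≤ L)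
    (hs : s ∈ Icc 0 T) (hr : s + h ∈ Icc 0 T) (hh : 0 ≤ h) :
    Measurable (eulerStep a b c W h s) := by
  have h1 : Continuous fun z : Phase => z.1 + ((h * (a * z.2) : ℝ) : Torus) :=
    continuous_fst.add (continuous_coe_torus.comp (by fun_prop))
  refine (Continuous.prodMk h1 ?_).measurable
  exact (continuous_const.mul continuous_snd).add ((hW.continuous_integral hL hs hr hh).comp h1)

theorem map_eulerStep (hW : FieldBound W T B L) (hL : 0 ≤ L) (hb : 0 ≤ b)
    (hs : s ∈ Icc 0 T) (hr : s + h ∈ Icc 0 T) (hh : 0 ≤ h) :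
    dxdv.map (eulerStep a b c W h s) = ENNReal.ofReal (1 + b * h)⁻¹ • dxdv := by
  have h1 : MeasurePreserving (fun z : Phase => (z.1 + ((h * (a * z.2) : ℝ) : Torus), z.2))
      dxdv dxdv := by
    have : MeasurePreserving (fun q : ℝ × Torus => (q.1, q.2 + ((h * (a * q.1) : ℝ) : Torus)))
        (volume.prod dx) (volume.prod dx) := by
      refine MeasurePreserving.skew_product (f := id)
        (g := fun v (x : Torus) => x + ((h * (a * v) : ℝ) : Torus)) (MeasurePreserving.id _) ?_ ?_
      · exact (continuous_snd.add (continuous_coe_torus.comp (by fun_prop))).measurable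
      · exact Eventually.of_forall fun v => (measurePreserving_add_right dx _).map_eq
    exact (Measure.measurePreserving_swap.comp this).comp Measure.measurePreserving_swap
  have hb' : 0 < 1 + b * h := by positivity
  have h2 : MeasurePreserving (fun z : Phase => (z.1, (1 + b * h) * z.2 +
      ∫ σ in s..(s + h), c * W σ z.1)) dxdv (ENNReal.ofReal (1 + b * h)⁻¹ • dxdv) := by
    have e : ENNReal.ofReal (1 + b * h)⁻¹ • dxdv =
        dx.prod (ENNReal.ofReal (1 + b * h)⁻¹ • (volume : Measure ℝ)) :=
      (Measure.prod_smul_right _).symm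
    rw [e]
    refine MeasurePreserving.skew_product (f := id)
      (g := fun x v => (1 + b * h) * v + ∫ σ in s..(s + h), c * W σ x)
      (MeasurePreserving.id _) ?_ ?_
    · exact ((continuous_const.mul continuous_snd).add
        ((hW.continuous_integral hL hs hr hh).comp continuous_fst)).measurable
    · refine Eventually.of_forall fun x => ?_
      have : (fun v : ℝ => (1 + b * h) * v + ∫ σ in s..(s + h), c * W σ x) =
          (fun v => v + ∫ σ in s..(s + h), c * W σ x) ∘ fun v => (1 + b * h) * v := rfl
      rw [this, ← Measure.map_map (measurable_add_const _) (measurable_const_mul _),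
        Real.map_volume_mul_left hb'.ne', abs_of_pos (inv_pos.2 hb'), Measure.map_smul,
        (measurePreserving_add_right volume _).map_eq]
  exact (h2.comp h1).map_eq

theorem abs_le_abs_eulerStep (hW : FieldBound W T B L) (hb : 0 ≤ b)
    (hs : s ∈ Icc 0 T) (hr : s + h ∈ Icc 0 T) (hh : 0 ≤ h) (z : Phase) :
    |z.2| ≤ |(eulerStep a b c W h s z).2| + |c| * B * h := by
  have h1 := hW.abs_integral_le (c := c) (z.1 + ((h * (a * z.2) : ℝ) : Torus)) hs hr hh
  have h2 : |z.2| ≤ |(1 + b * h) * z.2| := by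
    rw [abs_mul, abs_of_nonneg (by positivity : 0 ≤ 1 + b * h)]
    have : 0 ≤ b * h * |z.2| := by positivity
    linarith
  have h3 := abs_add_le ((eulerStep a b c W h s z).2)
    (-∫ σ in s..(s + h), c * W σ (z.1 + ((h * (a * z.2) : ℝ) : Torus)))
  rw [abs_neg] at h3
  have h4 : (eulerStep a b c W h s z).2 +
    (-∫ σ in s..(s + h), c * W σ (z.1 + ((h * (a * z.2) : ℝ) : Torus))) = (1 + b * h) * z.2 := by
    unfold eulerStep; ring
  rw [h4] at h3
  linarith

/-- The local error of the symplectic Euler scheme. -/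
theorem IsCurve.euler_error (hc : IsCurve a b c W T z X V) (hW : FieldBound W T B L) (hL : 0 ≤ L)
    {M : ℝ} (hM : ∀ s ∈ Icc 0 T, |V s| ≤ M) (hs : s ∈ Icc 0 T) (hr : s + h ∈ Icc 0 T)
    (hh : 0 ≤ h) (y : Phase) :
    dist (X (s + h)) (eulerStep a b c W h s y).1 + |V (s + h) - (eulerStep a b c W h s y).2| ≤
      (1 + (|a| + |b| + |c| * L * (1 + |a| * T)) * h) * (dist (X s) y.1 + |V s - y.2|) +
      (|a| * (|b| * M + |c| * B) * (1 + |c| * L * T) + |b| * (|b| * M + |c| * B) +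
        |c| * L * (|a| * M)) * h ^ 2 := by
  have hT : 0 ≤ T := hs.1.trans hs.2
  have hM0 : 0 ≤ M := (abs_nonneg _).trans (hM s hs)
  have hB0 := hW.nonneg hT
  have h0 : (0 : ℝ) ∈ Icc 0 T := ⟨le_rfl, hT⟩
  have hmem : ∀ σ ∈ Icc s (s + h), σ ∈ Icc 0 T := fun σ hσ => ⟨hs.1.trans hσ.1, hσ.2.trans hr.2⟩
  have iV : ∀ {p q : ℝ}, p ∈ Icc 0 T → q ∈ Icc 0 T → IntervalIntegrable V volume p q :=
    fun hp hq => intervalIntegrable_of_Icc hc.integrableOn_V hp hq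
  have iW : ∀ {p q : ℝ}, p ∈ Icc 0 T → q ∈ Icc 0 T →
      IntervalIntegrable (fun σ => W σ (X σ)) volume p q :=
    fun hp hq => intervalIntegrable_of_Icc (hW.integrableOn hc.contX) hp hq
  have iF : ∀ {p q : ℝ}, p ∈ Icc 0 T → q ∈ Icc 0 T →
      IntervalIntegrable (fun σ => b * V σ + c * W σ (X σ)) volume p q := fun hp hq =>
    ((iV hp hq).const_mul b).add ((iW hp hq).const_mul c)
  have dX : ∀ {p q : ℝ}, p ∈ Icc 0 T → q ∈ Icc 0 T →
      X q = X p + ((∫ σ in p..q, a * V σ : ℝ) : Torus) := by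
    intro p q hp hq
    rw [hc.eqX p hp, hc.eqX q hq, add_assoc, ← AddCircle.coe_add,
      intervalIntegral.integral_add_adjacent_intervals ((iV h0 hp).const_mul a)
        ((iV hp hq).const_mul a)]
  have dV : ∀ {p q : ℝ}, p ∈ Icc 0 T → q ∈ Icc 0 T →
      V q = V p + ∫ σ in p..q, (b * V σ + c * W σ (X σ)) := by
    intro p q hp hq
    rw [hc.eqV p hp, hc.eqV q hq, add_assoc,
      intervalIntegral.integral_add_adjacent_intervals (iF h0 hp) (iF hp hq)]
  set M1 : ℝ := |b| * M + |c| * B with hM1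
  have hM10 : 0 ≤ M1 := by positivity
  have bV : ∀ σ ∈ Icc s (s + h), |V σ - V s| ≤ M1 * h := by
    intro σ hσ
    rw [dV hs (hmem σ hσ), add_sub_cancel_left, ← Real.norm_eq_abs]
    refine (intervalIntegral.norm_integral_le_of_norm_le_const (C := M1) fun r hr' => ?_).trans ?_
    · rw [uIoc_of_le hσ.1] at hr'
      have hrT := hmem r ⟨hr'.1.le, hr'.2.trans hσ.2⟩
      refine (norm_add_le _ _).trans ?_
      rw [norm_mul, norm_mul]
      exact add_le_add (mul_le_mul_of_nonneg_left (hM r hrT) (norm_nonneg _))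
        (mul_le_mul_of_nonneg_left (hW.abs_apply_le hrT _) (norm_nonneg _))
    · rw [abs_of_nonneg (sub_nonneg.2 hσ.1)]
      exact mul_le_mul_of_nonneg_left (by linarith [hσ.2]) hM10
  set x' : Torus := y.1 + ((h * (a * y.2) : ℝ) : Torus) with hx'
  set e1 := dist (X s) y.1 with he1
  set e2 := |V s - y.2| with he2
  have he1' : 0 ≤ e1 := dist_nonneg
  have he2' : 0 ≤ e2 := abs_nonneg _
  have bV' : ∀ σ ∈ Icc s (s + h), |V σ - y.2| ≤ e2 + M1 * h := by
    intro σ hσ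
    have := abs_sub_le (V σ) (V s) y.2
    have := bV σ hσ
    linarith
  have hle : s ≤ s + h := by linarith
  have dist1 : dist (X (s + h)) x' ≤ e1 + |a| * ((e2 + M1 * h) * h) := by
    have ey : h * (a * y.2) = ∫ _ in s..(s + h), a * y.2 := by
      rw [intervalIntegral.integral_const, smul_eq_mul, add_sub_cancel_left]
    rw [dX hs hr, hx', dist_eq_norm, add_sub_add_comm, ← AddCircle.coe_sub]
    refine (norm_add_le _ _).trans (add_le_add (dist_eq_norm _ _).ge ((norm_coe_le _).trans ?_))
    rw [ey, ← intervalIntegral.integral_sub ((iV hs hr).const_mul a) intervalIntegrable_const,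
      ← Real.norm_eq_abs]
    refine (intervalIntegral.norm_integral_le_of_norm_le_const (C := |a| * (e2 + M1 * h))
      fun σ hσ => ?_).trans ?_
    · rw [uIoc_of_le hle] at hσ
      rw [← mul_sub, norm_mul]
      exact mul_le_mul_of_nonneg_left (bV' σ ⟨hσ.1.le, hσ.2⟩) (norm_nonneg _)
    · rw [add_sub_cancel_left, abs_of_nonneg hh, mul_assoc]
  have dist2 : ∀ σ ∈ Icc s (s + h), dist (X σ) x' ≤
      |a| * M * h + (e1 + |a| * ((e2 + M1 * h) * h)) := by
    intro σ hσ
    refine (dist_triangle _ (X (s + h)) _).trans (add_le_add ?_ dist1)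
    rw [dX (hmem σ hσ) hr, dist_eq_norm, sub_add_cancel_left, norm_neg]
    refine (norm_coe_le _).trans ?_
    rw [← Real.norm_eq_abs]
    refine (intervalIntegral.norm_integral_le_of_norm_le_const (C := |a| * M) fun r hr' => ?_).trans
      ?_
    · rw [uIoc_of_le hσ.2] at hr'
      rw [norm_mul]
      exact mul_le_mul_of_nonneg_left (hM r (hmem r ⟨hσ.1.trans hr'.1.le, hr'.2⟩)) (norm_nonneg _)
    · rw [abs_of_nonneg (sub_nonneg.2 hσ.2)]
      exact mul_le_mul_of_nonneg_left (by linarith [hσ.1]) (by positivity)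
  have dist3 : |V (s + h) - (eulerStep a b c W h s y).2| ≤ e2 + (|b| * (e2 + M1 * h) +
      |c| * (L * (|a| * M * h + (e1 + |a| * ((e2 + M1 * h) * h))))) * h := by
    have ey : (eulerStep a b c W h s y).2 = y.2 + ∫ σ in s..(s + h), (b * y.2 + c * W σ x') := by
      rw [intervalIntegral.integral_add intervalIntegrable_const
        ((hW.intervalIntegrable_const x' hs hr).const_mul c), intervalIntegral.integral_const,
        smul_eq_mul, add_sub_cancel_left]
      unfold eulerStep
      ring
    rw [ey, dV hs hr, add_sub_add_comm]
    refine (abs_add_le _ _).trans (add_le_add le_rfl ?_)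
    rw [← intervalIntegral.integral_sub (iF hs hr) (intervalIntegrable_const.add
        ((hW.intervalIntegrable_const x' hs hr).const_mul c)), ← Real.norm_eq_abs]
    refine (intervalIntegral.norm_integral_le_of_norm_le_const (C := |b| * (e2 + M1 * h) +
      |c| * (L * (|a| * M * h + (e1 + |a| * ((e2 + M1 * h) * h))))) fun σ hσ => ?_).trans ?_
    · rw [uIoc_of_le hle] at hσ
      have hσ' : σ ∈ Icc s (s + h) := ⟨hσ.1.le, hσ.2⟩
      rw [add_sub_add_comm, ← mul_sub, ← mul_sub]
      refine (norm_add_le _ _).trans ?_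
      rw [norm_mul, norm_mul]
      refine add_le_add (mul_le_mul_of_nonneg_left (bV' σ hσ') (norm_nonneg _))
        (mul_le_mul_of_nonneg_left ?_ (norm_nonneg _))
      exact (hW.lip σ (hmem σ hσ') _ _).trans (mul_le_mul_of_nonneg_left (dist2 σ hσ') hL)
    · rw [add_sub_cancel_left, abs_of_nonneg hh]
  have hhT : h ≤ T := by linarith [hs.1, hr.2]
  refine (add_le_add dist1 dist3).trans ?_
  have p1 : 0 ≤ |a| * |c| * L * h * (T - h) * e2 := by
    have := sub_nonneg.2 hhT; positivity
  have p2 : 0 ≤ |a| * |c| * L * M1 * h ^ 2 * (T - h) := by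
    have := sub_nonneg.2 hhT; positivity
  have p3 : 0 ≤ |a| * h * e1 + |b| * h * e1 + |c| * L * |a| * T * h * e1 + |c| * L * h * e2 := by
    positivity
  linarith

end Euler

section Liouville

variable {a b c T B L : ℝ} {W : ℝ → C(Torus, ℝ)} {X : Phase → ℝ → Torus} {V : Phase → ℝ → ℝ}

theorem IsCurve.tendsto_euler {z : Phase} {X : ℝ → Torus} {V : ℝ → ℝ}
    (hc : IsCurve a b c W T z X V) (hW : FieldBound W T B L)
    (hL : 0 ≤ L) (hT : 0 ≤ T) :
    Tendsto (fun N : ℕ => euler a b c W (T / (N + 1 : ℕ)) (N + 1) z) atTop (𝓝 (X T, V T)) := by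
  obtain ⟨M, hM⟩ : ∃ M, ∀ s ∈ Icc 0 T, |V s| ≤ M := ⟨_, fun s hs => hc.abs_le hW hs⟩
  set K := |a| + |b| + |c| * L * (1 + |a| * T) with hK
  set C := |a| * (|b| * M + |c| * B) * (1 + |c| * L * T) + |b| * (|b| * M + |c| * B) +
        |c| * L * (|a| * M) with hC
  have hM0 : 0 ≤ M := (abs_nonneg _).trans (hM 0 ⟨le_rfl, hT⟩)
  have hB0 := hW.nonneg hT
  have hK0 : 0 ≤ K := by positivity
  have hC0 : 0 ≤ C := by positivity
  have key : ∀ N : ℕ, dist (X T) (euler a b c W (T / (N + 1 : ℕ)) (N + 1) z).1 +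
      |V T - (euler a b c W (T / (N + 1 : ℕ)) (N + 1) z).2| ≤
      T * C * Real.exp (K * T) * (T / (N + 1 : ℕ)) := by
    intro N
    set h := T / (N + 1 : ℕ) with hh
    have hh0 : 0 ≤ h := by positivity
    have hN : ((N + 1 : ℕ) : ℝ) * h = T := by
      rw [hh]; field_simp
    have step : ∀ i : ℕ, i ≤ N + 1 → dist (X (i * h)) (euler a b c W h i z).1 +
        |V (i * h) - (euler a b c W h i z).2| ≤ i * (C * h ^ 2) * Real.exp (K * h * i) := by
      intro i
      induction i with
      | zero =>
        intro _
        have e1 := hc.eqX 0 ⟨le_rfl, hT⟩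
        have e2 := hc.eqV 0 ⟨le_rfl, hT⟩
        simp only [intervalIntegral.integral_same, AddCircle.coe_zero, add_zero] at e1 e2
        simp [euler, e1, e2]
      | succ i ih =>
        intro hi
        have ih' := ih (by omega)
        have le1 : ∀ j : ℕ, j ≤ N + 1 → (j : ℝ) * h ∈ Icc 0 T := fun j hj =>
          ⟨by positivity, by
            rw [← hN]; exact mul_le_mul_of_nonneg_right (by exact_mod_cast hj) hh0⟩
        have m2 := le1 (i + 1) hi
        have e : ((i + 1 : ℕ) : ℝ) * h = i * h + h := by push_cast; ring
        rw [e] at m2 ⊢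
        have := hc.euler_error hW hL hM (le1 i (by omega)) m2 hh0 (euler a b c W h i z)
        refine this.trans ?_
        have x1 : 1 + K * h ≤ Real.exp (K * h) := by
          have := Real.add_one_le_exp (K * h); linarith
        have x2 : Real.exp (K * h * ((i + 1 : ℕ) : ℝ)) = Real.exp (K * h) * Real.exp (K * h * i) := by
          rw [← Real.exp_add]; congr 1; push_cast; ring
        have x3 : 1 ≤ Real.exp (K * h * ((i + 1 : ℕ) : ℝ)) := Real.one_le_exp (by positivity)
        have x4 : C * h ^ 2 ≤ C * h ^ 2 * Real.exp (K * h * ((i + 1 : ℕ) : ℝ)) :=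
          le_mul_of_one_le_right (by positivity) x3
        have x5 := mul_le_mul x1 ih' (by positivity) (Real.exp_pos _).le
        have x6 : Real.exp (K * h) * (i * (C * h ^ 2) * Real.exp (K * h * i)) =
            i * (C * h ^ 2) * Real.exp (K * h * ((i + 1 : ℕ) : ℝ)) := by
          rw [x2]; ring
        rw [x6] at x5
        have x7 : ((i + 1 : ℕ) : ℝ) * (C * h ^ 2) * Real.exp (K * h * ((i + 1 : ℕ) : ℝ)) =
            i * (C * h ^ 2) * Real.exp (K * h * ((i + 1 : ℕ) : ℝ)) +
              C * h ^ 2 * Real.exp (K * h * ((i + 1 : ℕ) : ℝ)) := by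
          push_cast; ring
        rw [x7]
        exact add_le_add x5 x4
    have := step (N + 1) le_rfl
    rw [hN] at this
    refine this.trans (le_of_eq ?_)
    have e3 : K * h * ((N + 1 : ℕ) : ℝ) = K * T := by rw [← hN]; ring
    rw [e3]
    calc ((N + 1 : ℕ) : ℝ) * (C * h ^ 2) * Real.exp (K * T)
        = (((N + 1 : ℕ) : ℝ) * h) * C * Real.exp (K * T) * h := by ring
      _ = _ := by rw [hN]
  have lim : Tendsto (fun N : ℕ => T * C * Real.exp (K * T) * (T / (N + 1 : ℕ))) atTop (𝓝 0) := by
    have := (tendsto_const_div_atTop_nhds_zero_nat T).comp (tendsto_add_atTop_nat 1)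
    simpa using this.const_mul (T * C * Real.exp (K * T))
  have hsq := squeeze_zero (fun N => by positivity) key lim
  rw [tendsto_iff_dist_tendsto_zero]
  refine squeeze_zero (fun _ => dist_nonneg) (fun N => ?_) hsq
  rw [dist_comm, Prod.dist_eq]
  exact max_le (le_add_of_nonneg_right (abs_nonneg _)) (by
    rw [Real.dist_eq]; exact le_add_of_nonneg_left dist_nonneg)

theorem continuous_endpoint (hW : FieldBound W T B L) (hL : 0 ≤ L)
    (hc : ∀ z, IsCurve a b c W T z (X z) (V z)) {s : ℝ} (hs : s ∈ Icc 0 T) :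
    Continuous fun z => (X z s, V z s) := by
  rw [continuous_iff_continuousAt]
  intro z
  unfold ContinuousAt
  rw [tendsto_iff_dist_tendsto_zero]
  have lim : Tendsto (fun y : Phase => (dist y.1 z.1 + |y.2 - z.2|) *
      Real.exp ((|a| + |b| + |c| * L) * s)) (𝓝 z) (𝓝 0) := by
    have : Continuous fun y : Phase => (dist y.1 z.1 + |y.2 - z.2|) *
      Real.exp ((|a| + |b| + |c| * L) * s) := by fun_prop
    simpa using this.tendsto z
  refine squeeze_zero (fun _ => dist_nonneg) (fun y => ?_) lim
  have := (hc y).dist_le (hc z) hW hW hL hs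
  simp only [sub_self, abs_zero, intervalIntegral.integral_zero, mul_zero, add_zero] at this
  refine le_trans ?_ this
  rw [Prod.dist_eq]
  exact max_le (le_add_of_nonneg_right (abs_nonneg _)) (by
    rw [Real.dist_eq]; exact le_add_of_nonneg_left dist_nonneg)

theorem measurable_euler (hW : FieldBound W T B L) (hL : 0 ≤ L) {h : ℝ} (hh : 0 ≤ h) (i : ℕ)
    (hi : i * h ≤ T) : Measurable (euler a b c W h i) := by
  induction i with
  | zero => exact measurable_id
  | succ i ih =>
    have e : ((i + 1 : ℕ) : ℝ) * h = i * h + h := by push_cast; ring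
    rw [e] at hi
    have h0 : 0 ≤ i * h := by positivity
    exact (measurable_eulerStep hW hL ⟨h0, by linarith⟩ ⟨by linarith, hi⟩ hh).comp
      (ih (by linarith))

theorem map_euler (hW : FieldBound W T B L) (hL : 0 ≤ L) (hb : 0 ≤ b) {h : ℝ} (hh : 0 ≤ h) (i : ℕ)
    (hi : i * h ≤ T) :
    dxdv.map (euler a b c W h i) = ENNReal.ofReal (((1 + b * h)⁻¹) ^ i) • dxdv := by
  induction i with
  | zero => simp [euler, Measure.map_id']
  | succ i ih =>
    have e : ((i + 1 : ℕ) : ℝ) * h = i * h + h := by push_cast; ring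
    rw [e] at hi
    have h0 : 0 ≤ i * h := by positivity
    have m1 : i * h ∈ Icc 0 T := ⟨h0, by linarith⟩
    have m2 : i * h + h ∈ Icc 0 T := ⟨by linarith, hi⟩
    have := Measure.map_map (μ := dxdv) (measurable_eulerStep (a := a) (b := b) (c := c)
      hW hL m1 m2 hh) (measurable_euler (a := a) (b := b) (c := c) hW hL hh i m1.2)
    have e2 : euler a b c W h (i + 1) = eulerStep a b c W h (i * h) ∘ euler a b c W h i := rfl
    rw [e2, ← this, ih m1.2, Measure.map_smul, map_eulerStep hW hL hb m1 m2 hh, smul_smul,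
      ← ENNReal.ofReal_mul (by positivity), pow_succ]

theorem abs_le_abs_euler (hW : FieldBound W T B L) (hb : 0 ≤ b) {h : ℝ} (hh : 0 ≤ h) (i : ℕ)
    (hi : i * h ≤ T) (z : Phase) : |z.2| ≤ |(euler a b c W h i z).2| + |c| * B * (i * h) := by
  induction i with
  | zero => simp [euler]
  | succ i ih =>
    have e : ((i + 1 : ℕ) : ℝ) * h = i * h + h := by push_cast; ring
    rw [e] at hi ⊢
    have h0 : 0 ≤ i * h := by positivity
    have := abs_le_abs_eulerStep (a := a) (c := c) hW hb (s := i * h) ⟨h0, by linarith⟩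
      ⟨by linarith, hi⟩ hh (euler a b c W h i z)
    have := ih (by linarith)
    have e2 : euler a b c W h (i + 1) z = eulerStep a b c W h (i * h) (euler a b c W h i z) := rfl
    rw [e2]
    linarith

/-- The flow of a kinetic system with friction `b` contracts the volume by `exp (-b T)`. -/
theorem liouville (hW : FieldBound W T B L) (hL : 0 ≤ L) (hb : 0 ≤ b) (hT : 0 ≤ T)
    (hc : ∀ z, IsCurve a b c W T z (X z) (V z)) :
    dxdv.map (fun z => (X z T, V z T)) = ENNReal.ofReal (Real.exp (-(b * T))) • dxdv := by
  have hTT : T ∈ Icc 0 T := ⟨hT, le_rfl⟩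
  have cΦ := continuous_endpoint hW hL hc hTT
  have hB0 := hW.nonneg hT
  have hlow : ∀ z, |z.2| ≤ |V z T| + |c| * B * T := by
    intro z
    have l1 := ((hc z).tendsto_euler hW hL hT)
    have l2 : Tendsto (fun N : ℕ => |(euler a b c W (T / (N + 1 : ℕ)) (N + 1) z).2| + |c| * B * T)
        atTop (𝓝 (|V z T| + |c| * B * T)) := by
      have : Tendsto (fun q : Phase => |q.2| + |c| * B * T) (𝓝 (X z T, V z T))
        (𝓝 (|V z T| + |c| * B * T)) := by
        have h : Continuous fun q : Phase => |q.2| + |c| * B * T := by fun_prop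
        exact h.tendsto (X z T, V z T)
      exact this.comp l1
    refine ge_of_tendsto l2 (Eventually.of_forall fun N => ?_)
    have e : ((N + 1 : ℕ) : ℝ) * (T / (N + 1 : ℕ)) = T := by field_simp
    have := abs_le_abs_euler (a := a) (c := c) hW hb (h := T / (N + 1 : ℕ)) (by positivity) (N + 1)
      e.le z
    rwa [e] at this
  have lf1 : IsLocallyFiniteMeasure (dxdv.map (fun z => (X z T, V z T))) := by
    refine ⟨fun y => ⟨{q : Phase | |q.2| < |y.2| + 1}, ?_, ?_⟩⟩
    · exact (isOpen_lt (by fun_prop) continuous_const).mem_nhds (by simp)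
    · rw [Measure.map_apply cΦ.measurable (measurableSet_lt (by fun_prop) measurable_const)]
      refine (measure_mono (t := {z : Phase | |z.2| ≤ |y.2| + 1 + |c| * B * T}) fun z hz => ?_).trans_lt
        (isCompact_slab _).measure_lt_top
      have hz' : |V z T| < |y.2| + 1 := hz
      exact (hlow z).trans (by linarith)
  have lf2 : IsLocallyFiniteMeasure (ENNReal.ofReal (Real.exp (-(b * T))) • dxdv) :=
    ⟨fun y => by
      obtain ⟨s, hs, hs'⟩ := dxdv.exists_isOpen_measure_lt_top y
      refine ⟨s, hs'.1.mem_nhds hs, ?_⟩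
      rw [Measure.smul_apply, smul_eq_mul]
      exact ENNReal.mul_lt_top ENNReal.ofReal_lt_top hs'.2⟩
  have r1 := Measure.Regular.of_sigmaCompactSpace_of_isLocallyFiniteMeasure
    (dxdv.map (fun z => (X z T, V z T)))
  have r2 := Measure.Regular.of_sigmaCompactSpace_of_isLocallyFiniteMeasure
    (ENNReal.ofReal (Real.exp (-(b * T))) • dxdv)
  refine Measure.ext_of_integral_eq_on_compactlySupported fun g => ?_
  have hgc : Continuous g := map_continuous g
  obtain ⟨R, hR⟩ := exists_subset_slab g.hasCompactSupport.isCompact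
  obtain ⟨Q, hQ⟩ := g.hasCompactSupport.exists_bound_of_continuous hgc
  rw [integral_map cΦ.aemeasurable hgc.aestronglyMeasurable, integral_smul_measure,
    ENNReal.toReal_ofReal (Real.exp_pos _).le, smul_eq_mul]
  have l1 : Tendsto (fun N : ℕ => ∫ z, g (euler a b c W (T / (N + 1 : ℕ)) (N + 1) z) ∂dxdv) atTop
      (𝓝 (∫ z, g (X z T, V z T) ∂dxdv)) := by
    refine tendsto_integral_of_dominated_convergence
      ({z : Phase | |z.2| ≤ R + |c| * B * T}.indicator fun _ => Q) (fun N => ?_) ?_ (fun N => ?_) ?_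
    · have e : ((N + 1 : ℕ) : ℝ) * (T / (N + 1 : ℕ)) = T := by field_simp
      exact (hgc.measurable.comp
        (measurable_euler hW hL (by positivity) _ e.le)).aestronglyMeasurable
    · rw [integrable_indicator_iff (measurableSet_le (by fun_prop) measurable_const)]
      exact integrableOn_const (isCompact_slab _).measure_lt_top.ne
    · refine Eventually.of_forall fun z => ?_
      by_cases hz : z ∈ {z : Phase | |z.2| ≤ R + |c| * B * T}
      · rw [indicator_of_mem hz]; exact hQ _
      · rw [indicator_of_notMem hz, norm_le_zero_iff]
        by_contra hne
        have h1 := hR _ (subset_tsupport _ hne)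
        have e : ((N + 1 : ℕ) : ℝ) * (T / (N + 1 : ℕ)) = T := by field_simp
        have := abs_le_abs_euler (a := a) (c := c) hW hb (h := T / (N + 1 : ℕ)) (by positivity)
          (N + 1) e.le z
        rw [e] at this
        exact hz (this.trans (by linarith))
    · exact Eventually.of_forall fun z => (hgc.tendsto _).comp ((hc z).tendsto_euler hW hL hT)
  have l2 : Tendsto (fun N : ℕ => ∫ z, g (euler a b c W (T / (N + 1 : ℕ)) (N + 1) z) ∂dxdv) atTop
      (𝓝 (Real.exp (-(b * T)) * ∫ z, g z ∂dxdv)) := by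
    have e : ∀ N : ℕ, ((1 + b * T / (N + 1 : ℕ)) ^ (N + 1))⁻¹ * ∫ z, g z ∂dxdv =
        ∫ z, g (euler a b c W (T / (N + 1 : ℕ)) (N + 1) z) ∂dxdv := by
      intro N
      have e : ((N + 1 : ℕ) : ℝ) * (T / (N + 1 : ℕ)) = T := by field_simp
      rw [← integral_map (measurable_euler hW hL (by positivity) _ e.le).aemeasurable
        hgc.aestronglyMeasurable, map_euler hW hL hb (by positivity) _ e.le,
        integral_smul_measure, ENNReal.toReal_ofReal (by positivity), smul_eq_mul, inv_pow,
        mul_div_assoc]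
    refine Tendsto.congr e ?_
    refine Tendsto.mul_const _ ?_
    rw [Real.exp_neg]
    exact ((Real.tendsto_one_add_div_pow_exp (b * T)).comp (tendsto_add_atTop_nat 1)).inv₀
      (Real.exp_pos _).ne'
  exact tendsto_nhds_unique l1 l2

end Liouville

end Kinetic

namespace Kinetic

/-! ### The flow of the characteristics -/

section Flow

variable {ε : ℝ} {w : ℝ≥0 → Torus → ℝ} {W : ℝ → C(Torus, ℝ)} {t : ℝ≥0} {z : Phase}
  {X : ℝ → Torus} {V : ℝ → ℝ} {B L : ℝ}

theorem FieldBound.reverse {T : ℝ} (h : FieldBound W T B L) :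
    FieldBound (fun r => W (T - r)) T B L where
  meas := h.meas.comp_measurable (by fun_prop)
  le s hs := h.le _ ⟨sub_nonneg.2 hs.2, sub_le_self _ hs.1⟩
  lip s hs := h.lip _ ⟨sub_nonneg.2 hs.2, sub_le_self _ hs.1⟩

theorem IsCharacteristic.isCurve (h : IsCharacteristic ε w t z X V)
    (hw : ∀ s ∈ Icc 0 (t : ℝ), ∀ x, w s.toNNReal x = W s x) (hW : FieldBound W t B L) :
    IsCurve ε⁻¹ (-(ε ^ 2)⁻¹) (ε ^ 2)⁻¹ W t (X 0, V 0) X V := by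
  obtain ⟨cX, cV, h⟩ := h
  have h0 : (0 : ℝ) ∈ Icc 0 (t : ℝ) := ⟨le_rfl, t.2⟩
  have ht : (t : ℝ) ∈ Icc 0 (t : ℝ) := ⟨t.2, le_rfl⟩
  have iF : IntegrableOn (fun σ => -(ε ^ 2)⁻¹ * V σ + (ε ^ 2)⁻¹ * W σ (X σ)) (Icc 0 (t : ℝ)) :=
    (cV.integrableOn_Icc.const_mul _).add ((hW.integrableOn cX).const_mul _)
  have iV : IntegrableOn (fun σ => ε⁻¹ * V σ) (Icc 0 (t : ℝ)) := cV.integrableOn_Icc.const_mul _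
  refine ⟨cX, cV, fun s hs => ?_, fun s hs => ?_⟩
  · rw [(h s hs).1, (h 0 h0).1, ← intervalIntegral.integral_add_adjacent_intervals
      (intervalIntegrable_of_Icc iV h0 hs) (intervalIntegrable_of_Icc iV hs ht), AddCircle.coe_add,
      sub_add_eq_sub_sub_swap, sub_add_cancel]
  · have e : ∀ s ∈ Icc 0 (t : ℝ), ∫ σ in s..(t : ℝ), (ε ^ 2)⁻¹ * (w σ.toNNReal (X σ) - V σ) =
        ∫ σ in s..(t : ℝ), (-(ε ^ 2)⁻¹ * V σ + (ε ^ 2)⁻¹ * W σ (X σ)) := by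
      intro s hs
      refine intervalIntegral.integral_congr fun σ hσ => ?_
      rw [uIcc_of_le hs.2] at hσ
      rw [hw σ ⟨hs.1.trans hσ.1, hσ.2⟩]
      ring
    rw [(h s hs).2, (h 0 h0).2, e s hs, e 0 h0, ← intervalIntegral.integral_add_adjacent_intervals
      (intervalIntegrable_of_Icc iF h0 hs) (intervalIntegrable_of_Icc iF hs ht)]
    ring

theorem IsCharacteristic.eq_end (h : IsCharacteristic ε w t z X V) : (X t, V t) = z := by
  have := h.2.2 t ⟨t.2, le_rfl⟩
  simp only [intervalIntegral.integral_same, AddCircle.coe_zero, sub_zero] at this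
  exact Prod.ext this.1 this.2

theorem IsCharacteristic.restrict (h : IsCharacteristic ε w t z X V)
    (hw : ∀ s ∈ Icc 0 (t : ℝ), ∀ x, w s.toNNReal x = W s x) (hW : FieldBound W t B L)
    {s : ℝ≥0} (hs : s ≤ t) : IsCharacteristic ε w s (X s, V s) X V := by
  obtain ⟨cX, cV, h⟩ := h
  have hs' : (s : ℝ) ≤ t := hs
  have hsub : Icc 0 (s : ℝ) ⊆ Icc 0 (t : ℝ) := Icc_subset_Icc_right hs'
  have ht : (t : ℝ) ∈ Icc 0 (t : ℝ) := ⟨t.2, le_rfl⟩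
  have hss : (s : ℝ) ∈ Icc 0 (t : ℝ) := ⟨s.2, hs'⟩
  have iV : IntegrableOn (fun σ => ε⁻¹ * V σ) (Icc 0 (t : ℝ)) := cV.integrableOn_Icc.const_mul _
  have iF : IntegrableOn (fun σ => (ε ^ 2)⁻¹ * (w σ.toNNReal (X σ) - V σ)) (Icc 0 (t : ℝ)) := by
    have : IntegrableOn (fun σ => (ε ^ 2)⁻¹ * (W σ (X σ) - V σ)) (Icc 0 (t : ℝ)) :=
      ((hW.integrableOn cX).sub cV.integrableOn_Icc).const_mul _
    exact this.congr_fun (fun σ hσ => by simp only [hw σ hσ]) measurableSet_Icc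
  refine ⟨cX.mono hsub, cV.mono hsub, fun r hr => ⟨?_, ?_⟩⟩
  · rw [(h r (hsub hr)).1, (h s hss).1, ← intervalIntegral.integral_add_adjacent_intervals
      (intervalIntegrable_of_Icc iV (hsub hr) hss) (intervalIntegrable_of_Icc iV hss ht),
      AddCircle.coe_add, sub_add_eq_sub_sub_swap]
  · rw [(h r (hsub hr)).2, (h s hss).2, ← intervalIntegral.integral_add_adjacent_intervals
      (intervalIntegrable_of_Icc iF (hsub hr) hss) (intervalIntegrable_of_Icc iF hss ht)]
    ring

theorem IsCharacteristic.unique {X' : ℝ → Torus} {V' : ℝ → ℝ} (h : IsCharacteristic ε w t z X V)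
    (h' : IsCharacteristic ε w t z X' V')
    (hw : ∀ s ∈ Icc 0 (t : ℝ), ∀ x, w s.toNNReal x = W s x) (hW : FieldBound W t B L)
    (hL : 0 ≤ L) : (X 0, V 0) = (X' 0, V' 0) := by
  have := ((isCharacteristic_iff hw).1 h).unique ((isCharacteristic_iff hw).1 h') hW.reverse hL
    (s := t) ⟨t.2, le_rfl⟩
  simp only [sub_self] at this
  exact Prod.ext this.1 this.2

theorem exists_flow {X : ℝ≥0 → Phase → ℝ → Torus} {V : ℝ≥0 → Phase → ℝ → ℝ}
    {B L : ℝ → ℝ} (hw : ∀ s : ℝ, ∀ x, w s.toNNReal x = W s x)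
    (hW : ∀ T, FieldBound W T (B T) (L T)) (hL : ∀ T, 0 ≤ L T)
    (h : ∀ t z, IsCharacteristic ε w t z (X t z) (V t z)) :
    ∃ Ψ : ℝ → Phase ≃ₜ Phase,
      (∀ T y, IsCurve ε⁻¹ (-(ε ^ 2)⁻¹) (ε ^ 2)⁻¹ W T y (fun s => (Ψ s y).1) fun s => (Ψ s y).2) ∧
      (∀ t : ℝ≥0, ∀ z, (Ψ t).symm z = (X t z 0, V t z 0)) ∧
      ∀ t : ℝ≥0, dxdv.map (Ψ t).symm = ENNReal.ofReal (Real.exp (-(t / ε ^ 2))) • dxdv := by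
  have hw' : ∀ t : ℝ≥0, ∀ s ∈ Icc 0 (t : ℝ), ∀ x, w s.toNNReal x = W s x := fun _ s _ => hw s
  set Φ : ℝ≥0 → Phase → Phase := fun t z => (X t z 0, V t z 0) with hΦ
  have rev : ∀ (t : ℝ≥0) z, IsCurve (-ε⁻¹) (ε ^ 2)⁻¹ (-(ε ^ 2)⁻¹) (fun r => W (t - r)) t z
      (fun r => X t z (t - r)) fun r => V t z (t - r) := fun t z =>
    (isCharacteristic_iff (hw' t)).1 (h t z)
  have cont : ∀ t, Continuous (Φ t) := by
    intro t
    have := continuous_endpoint (hW t).reverse (hL t) (rev t) (s := t) ⟨t.2, le_rfl⟩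
    simpa only [sub_self] using this
  have vol : ∀ t : ℝ≥0, dxdv.map (Φ t) = ENNReal.ofReal (Real.exp (-(t / ε ^ 2))) • dxdv := by
    intro t
    have := liouville (hW t).reverse (hL t) (by positivity) t.2 (rev t)
    simp only [sub_self] at this
    rwa [inv_mul_eq_div] at this
  have fwd : ∀ (t : ℝ≥0) z, IsCurve ε⁻¹ (-(ε ^ 2)⁻¹) (ε ^ 2)⁻¹ W t (Φ t z) (X t z) (V t z) := fun t z =>
    (h t z).isCurve (hw' t) (hW t)
  have inj : ∀ t, Function.Injective (Φ t) := by
    intro t z z' hz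
    have h1 := fwd t z
    rw [hz] at h1
    have := h1.unique (fwd t z') (hW t) (hL t) (s := t) ⟨t.2, le_rfl⟩
    rw [← (h t z).eq_end, ← (h t z').eq_end]
    exact Prod.ext this.1 this.2
  have proper : ∀ t, IsProperMap (Φ t) := by
    intro t
    refine isProperMap_iff_isCompact_preimage.2 ⟨cont t, fun K hK => ?_⟩
    obtain ⟨R, hR⟩ := exists_subset_slab hK
    refine (isCompact_slab ((R + |(ε ^ 2)⁻¹| * B t * t) *
      Real.exp (|(-(ε ^ 2)⁻¹)| * t))).of_isClosed_subset (hK.isClosed.preimage (cont t))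
      fun z hz => ?_
    have := (fwd t z).abs_le (hW t) (s := t) ⟨t.2, le_rfl⟩
    have e : V t z t = z.2 := congrArg Prod.snd (h t z).eq_end
    rw [e] at this
    refine this.trans ?_
    have := hR _ hz
    gcongr
  have surj : ∀ t, Function.Surjective (Φ t) := by
    intro t
    have ho : IsOpen (range (Φ t))ᶜ := (proper t).isClosedMap.isClosed_range.isOpen_compl
    have h1 : dxdv.map (Φ t) (range (Φ t))ᶜ = 0 := by
      rw [Measure.map_apply (cont t).measurable ho.measurableSet]
      simp
    rw [vol, Measure.smul_apply, smul_eq_mul, mul_eq_zero, or_iff_right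
      (ENNReal.ofReal_pos.2 (Real.exp_pos _)).ne', ho.measure_eq_zero_iff dxdv, compl_empty_iff] at h1
    exact range_eq_univ.1 h1
  set H : ℝ≥0 → Phase ≃ₜ Phase := fun t =>
    (Equiv.ofBijective (Φ t) ⟨inj t, surj t⟩).toHomeomorphOfContinuousClosed (cont t)
      (proper t).isClosedMap with hH
  have hHΦ : ∀ t z, H t z = Φ t z := fun t z => rfl
  refine ⟨fun s => (H s.toNNReal).symm, fun T y => ?_, fun t z => ?_, fun t => ?_⟩
  · rcases lt_or_ge T 0 with hT | hT
    · have : Icc 0 T = ∅ := Icc_eq_empty (not_le.2 hT)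
      refine ⟨?_, ?_, ?_, ?_⟩ <;> simp [this]
    · lift T to ℝ≥0 using hT
      set z := (H T).symm y with hz
      have hzy : Φ T z = y := by rw [← hHΦ, hz, Homeomorph.apply_symm_apply]
      have key : ∀ s ∈ Icc 0 (T : ℝ), (H s.toNNReal).symm y = (X T z s, V T z s) := by
        intro s hs
        lift s to ℝ≥0 using hs.1
        rw [Real.toNNReal_coe, Homeomorph.symm_apply_eq, hHΦ, ← hzy]
        exact ((h s _).unique ((h T z).restrict (hw' T) (hW T) (by exact_mod_cast hs.2)) (hw' s)
          (hW s) (hL s)).symm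
      have f := fwd T z
      rw [hzy] at f
      refine ⟨f.contX.congr fun s hs => ?_, f.contV.congr fun s hs => ?_, fun s hs => ?_,
        fun s hs => ?_⟩
      · beta_reduce; rw [key s hs]
      · beta_reduce; rw [key s hs]
      · rw [key s hs]
        refine (f.eqX s hs).trans (congrArg (fun r : ℝ => y.1 + (r : Torus)) ?_)
        refine intervalIntegral.integral_congr fun σ hσ => ?_
        rw [uIcc_of_le hs.1] at hσ
        beta_reduce
        rw [key σ ⟨hσ.1, hσ.2.trans hs.2⟩]
      · rw [key s hs]
        refine (f.eqV s hs).trans (congrArg (fun r : ℝ => y.2 + r) ?_)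
        refine intervalIntegral.integral_congr fun σ hσ => ?_
        rw [uIcc_of_le hs.1] at hσ
        beta_reduce
        rw [key σ ⟨hσ.1, hσ.2.trans hs.2⟩]
  · rw [Homeomorph.symm_symm, Real.toNNReal_coe]; rfl
  · rw [Homeomorph.symm_symm, Real.toNNReal_coe]; exact vol t

end Flow

end Kinetic

namespace Kinetic

/-! ### Right-continuous functions -/

/-- The dyadic-type approximation of the time `s` from the right. -/
def rightApprox (N : ℕ) (s : ℝ≥0) : ℝ≥0 := ((⌊s * (N + 1 : ℕ)⌋₊ + 1 : ℕ) : ℝ≥0) / (N + 1 : ℕ)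

theorem lt_rightApprox (N : ℕ) (s : ℝ≥0) : s < rightApprox N s := by
  unfold rightApprox
  rw [lt_div_iff₀ (by positivity)]
  have := Nat.lt_floor_add_one (s * ((N + 1 : ℕ) : ℝ≥0))
  exact_mod_cast this

theorem rightApprox_le (N : ℕ) (s : ℝ≥0) : rightApprox N s ≤ s + 1 / (N + 1 : ℕ) := by
  unfold rightApprox
  rw [div_le_iff₀ (by positivity), add_mul, one_div, inv_mul_cancel₀ (by positivity)]
  push_cast
  gcongr
  have := Nat.floor_le (a := s * ((N + 1 : ℕ) : ℝ≥0)) (by positivity)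
  exact_mod_cast this

theorem tendsto_rightApprox (s : ℝ≥0) : Tendsto (fun N => rightApprox N s) atTop (𝓝[>] s) := by
  refine tendsto_nhdsWithin_iff.2 ⟨?_, Eventually.of_forall fun N => lt_rightApprox N s⟩
  have h : Tendsto (fun N : ℕ => s + 1 / ((N + 1 : ℕ) : ℝ≥0)) atTop (𝓝 (s + 0)) := by
    refine tendsto_const_nhds.add ?_
    exact_mod_cast tendsto_one_div_add_atTop_nhds_zero_nat (𝕜 := ℝ≥0)
  rw [add_zero] at h
  exact tendsto_of_tendsto_of_tendsto_of_le_of_le tendsto_const_nhds h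
    (fun N => (lt_rightApprox N s).le) fun N => rightApprox_le N s

theorem stronglyMeasurable_of_rightCont {S : Type*} [TopologicalSpace S]
    [TopologicalSpace.PseudoMetrizableSpace S] {x : ℝ≥0 → S}
    (h : ∀ t, ContinuousWithinAt x (Ioi t) t) : StronglyMeasurable x := by
  refine stronglyMeasurable_of_tendsto atTop (f := fun N s => x (rightApprox N s)) (fun N => ?_)
    (tendsto_pi_nhds.2 fun s => (h s).tendsto.comp (tendsto_rightApprox s))
  have h1 : StronglyMeasurable fun i : ℕ => x (((i + 1 : ℕ) : ℝ≥0) / (N + 1 : ℕ)) :=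
    StronglyMeasurable.of_discrete
  exact h1.comp_measurable (g := fun s : ℝ≥0 => ⌊s * (N + 1 : ℕ)⌋₊)
    (Nat.measurable_floor.comp (by fun_prop))

theorem IsCadlag.rightCont {S : Type*} [TopologicalSpace S] {x : ℝ≥0 → S} (h : IsCadlag x)
    (t : ℝ≥0) : ContinuousWithinAt x (Ioi t) t := (h t).1.mono Ioi_subset_Ici_self

theorem IsCadlag.comp {S S' : Type*} [TopologicalSpace S] [TopologicalSpace S'] {x : ℝ≥0 → S}
    (h : IsCadlag x) {g : S → S'} (hg : Continuous g) : IsCadlag fun t => g (x t) := fun t =>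
  ⟨hg.continuousAt.comp_continuousWithinAt (h t).1,
    (h t).2.imp' g fun l hl => (hg.tendsto l).comp hl⟩

theorem IsCadlag.comp_mul {S : Type*} [TopologicalSpace S] {x : ℝ≥0 → S}
    (h : IsCadlag x) {c : ℝ≥0} (hc : 0 < c) : IsCadlag fun t => x (c * t) := by
  intro t
  have h1 : Tendsto (fun t => c * t) (𝓝 t) (𝓝 (c * t)) := tendsto_const_nhds.mul tendsto_id
  refine ⟨(h (c * t)).1.tendsto.comp (tendsto_nhdsWithin_iff.2
    ⟨h1.mono_left nhdsWithin_le_nhds, ?_⟩), ?_⟩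
  · filter_upwards [self_mem_nhdsWithin] with s hs
    exact mul_le_mul_right (show t ≤ s from hs) c
  · obtain ⟨l, hl⟩ := (h (c * t)).2
    refine ⟨l, hl.comp (tendsto_nhdsWithin_iff.2 ⟨h1.mono_left nhdsWithin_le_nhds, ?_⟩)⟩
    filter_upwards [self_mem_nhdsWithin] with s hs
    exact mul_lt_mul_of_pos_left (show s < t from hs) hc

/-! ### Solutions of the kinetic system, with the flow of the characteristics -/

variable {k η β : ℝ}

/-- The solution `(f, u)` of the kinetic system with driving term `n`, together with the flow `Ψ`
of its characteristics.  `C` bounds the driving term and its Lipschitz constant in space. -/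
structure KineticSolution (ε C : ℝ) (n : ℝ → C(Torus, ℝ)) (f₀ : G k) (u₀ : H η)
    (f : ℝ → G k) (u : ℝ → H β) (Ψ : ℝ → Phase ≃ₜ Phase) : Prop where
  meas_n : StronglyMeasurable n
  norm_n : ∀ s, ‖n s‖ ≤ C
  lip_n : ∀ s x y, |n s x - n s y| ≤ C * dist x y
  continuous_u : Continuous u
  curve : ∀ T y, IsCurve ε⁻¹ (-(ε ^ 2)⁻¹) (ε ^ 2)⁻¹ (fun s => ε • contRep (u s).toL2 + n s) T y
    (fun s => (Ψ s y).1) fun s => (Ψ s y).2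
  transport : ∀ t, 0 ≤ t → ∀ᵐ y ∂dxdv, f t (Ψ t y) = Real.exp (t / ε ^ 2) * f₀ y
  volume : ∀ t, 0 ≤ t → dxdv.map (Ψ t) = ENNReal.ofReal (Real.exp (t / ε ^ 2)) • dxdv
  mild : ∀ t, 0 ≤ t → ∀ j, coeff (u t).toL2 j =
    (Real.exp (-lam j * t) : ℂ) * coeff u₀.toL2 j + ∫ s in (0 : ℝ)..t,
      (Real.exp (-lam j * (t - s)) : ℂ) * fourierCoeff (fun x => ((momentum (f s) x
          - ε * rho (f s) x * contRep (u s).toL2 x : ℝ) : ℂ)) j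

theorem fieldBound_add {ε C M : ℝ} (hε : 0 < ε) (hβ : 3 / 2 < β) {n : ℝ → C(Torus, ℝ)}
    {u : ℝ → H β} (hn : StronglyMeasurable n) (h1 : ∀ s, ‖n s‖ ≤ C)
    (h2 : ∀ s x y, |n s x - n s y| ≤ C * dist x y) (hu : Continuous u) {T P : ℝ}
    (hP : ∀ s ∈ Icc 0 T, ‖contRep (u s).toL2‖ ≤ P) (hM : ∀ s ∈ Icc 0 T, ‖u s‖ ≤ M) :
    FieldBound (fun s => ε • contRep (u s).toL2 + n s) T (ε * P + C)
      (ε * (lipConst β * M) + C) where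
  meas := ((((H.continuous_contRep (by linarith)).comp hu).const_smul ε).stronglyMeasurable).add hn
  le s hs := by
    refine (norm_add_le _ _).trans (add_le_add ?_ (h1 s))
    rw [norm_smul, Real.norm_of_nonneg hε.le]
    exact mul_le_mul_of_nonneg_left (hP s hs) hε.le
  lip s hs x y := by
    have e : (ε • contRep (u s).toL2 + n s) x - (ε • contRep (u s).toL2 + n s) y =
        ε * (contRep (u s).toL2 x - contRep (u s).toL2 y) + (n s x - n s y) := by
      simp only [ContinuousMap.add_apply, ContinuousMap.smul_apply, smul_eq_mul]
      ring
    rw [e, add_mul]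
    refine (abs_add_le _ _).trans (add_le_add ?_ (h2 s x y))
    rw [abs_mul, abs_of_pos hε, mul_assoc]
    refine mul_le_mul_of_nonneg_left ((H.abs_contRep_sub_le hβ _ x y).trans ?_) hε.le
    gcongr
    · exact lipConst_nonneg β
    · exact hM s hs

theorem exists_norm_le {X : Type*} [SeminormedAddGroup X] {u : ℝ → X} (hu : Continuous u) (T : ℝ) :
    ∃ M, ∀ s ∈ Icc 0 T, ‖u s‖ ≤ M :=
  isCompact_Icc.exists_bound_of_continuousOn hu.continuousOn

theorem IsSolution.exists_kineticSolution {ε C : ℝ} (hε : 0 < ε) (hC : 0 ≤ C) (hβ : 3 / 2 < β)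
    {n : ℝ≥0 → C(Torus, ℝ)} {f₀ : G k} {u₀ : H η} {f : ℝ≥0 → G k} {u : ℝ≥0 → H β}
    (h : IsSolution ε (fun t x => n t x) f₀ u₀ f u) (hn : ∀ t, ContinuousWithinAt n (Ioi t) t)
    (h1 : ∀ s, ‖n s‖ ≤ C) (h2 : ∀ s x y, |n s x - n s y| ≤ C * dist x y) :
    ∃ Ψ, KineticSolution ε C (fun s => n s.toNNReal) f₀ u₀ (fun s => f s.toNNReal)
      (fun s => u s.toNNReal) Ψ := by
  obtain ⟨hu, ⟨X, V, hchar, htr⟩, hmild⟩ := h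
  have mn : StronglyMeasurable fun s : ℝ => n s.toNNReal :=
    (stronglyMeasurable_of_rightCont hn).comp_measurable measurable_real_toNNReal
  have cu : Continuous fun s : ℝ => u s.toNNReal := hu.comp continuous_real_toNNReal
  choose M hM using fun T => exists_norm_le cu T
  choose P hP using fun T => exists_norm_le ((H.continuous_contRep (s := β) (by linarith)).comp cu) T
  obtain ⟨Ψ, hΨ1, hΨ2, hΨ3⟩ := exists_flow (ε := ε)
    (w := fun s x => ε * (u s).rep x + n s x)
    (W := fun s => ε • contRep (u s.toNNReal).toL2 + n s.toNNReal)
    (B := fun T => ε * P T + C) (L := fun T => ε * (lipConst β * |M T|) + C)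
    (fun s x => by rw [H.rep_eq]; rfl)
    (fun T => fieldBound_add hε hβ mn (fun s => h1 _) (fun s => h2 _) cu (hP T)
      fun s hs => (hM T s hs).trans (le_abs_self _))
    (fun T => by have := lipConst_nonneg β; positivity) hchar
  have vol : ∀ t, 0 ≤ t → dxdv.map (Ψ t) = ENNReal.ofReal (Real.exp (t / ε ^ 2)) • dxdv := by
    intro t ht
    lift t to ℝ≥0 using ht
    have := congrArg (Measure.map (Ψ t)) (hΨ3 t)
    rw [Measure.map_map (Ψ t).measurable (Ψ t).symm.measurable,
      Homeomorph.self_comp_symm, Measure.map_id, Measure.map_smul] at this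
    conv_rhs => rw [this]
    rw [smul_smul, ← ENNReal.ofReal_mul (Real.exp_pos _).le, ← Real.exp_add, add_neg_cancel,
      Real.exp_zero, ENNReal.ofReal_one, one_smul]
  refine ⟨Ψ, mn, fun s => h1 _, fun s => h2 _, cu, hΨ1, fun t ht => ?_, vol, fun t ht j => ?_⟩
  · have hv := vol t ht
    lift t to ℝ≥0 using ht
    have h4 : ∀ᵐ z ∂(dxdv.map (Ψ t)), f t z =
        Real.exp (t / ε ^ 2) * f₀ (X t z 0, V t z 0) := by
      rw [hv]
      exact Measure.ae_smul_measure (htr t) _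
    have h5 := ae_of_ae_map (Ψ t).measurable.aemeasurable h4
    filter_upwards [h5] with y hy
    have e := hΨ2 t (Ψ t y)
    rw [Homeomorph.symm_apply_apply] at e
    rw [← e] at hy
    rwa [Real.toNNReal_coe]
  · lift t to ℝ≥0 using ht
    have := hmild t j
    simp only [H.rep_eq] at this
    rw [Real.toNNReal_coe, this]
    simp only [lam]

end Kinetic

namespace Kinetic

/-! ### The Fourier coefficients of the force -/

section Force

variable {k : ℝ} {X : Type*} [NormedAddCommGroup X] [NormedSpace ℝ X]

theorem G.integrable_smul {f : G k} {Θ : Phase → X} {C : ℝ} (hm : AEStronglyMeasurable Θ dxdv)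
    (h : ∀ z, ‖Θ z‖ ≤ C * wt k z) : Integrable (fun z => f z • Θ z) dxdv := by
  refine (f.integrable_wt_mul_abs.const_mul C).mono' (f.aestronglyMeasurable.smul hm)
    (Eventually.of_forall fun z => ?_)
  rw [norm_smul, Real.norm_eq_abs]
  calc |f z| * ‖Θ z‖ ≤ |f z| * (C * wt k z) := mul_le_mul_of_nonneg_left (h z) (abs_nonneg _)
    _ = C * (wt k z * |f z|) := by ring

theorem G.norm_integral_smul_le (f : G k) {Θ : Phase → X} {C : ℝ}
    (h : ∀ z, ‖Θ z‖ ≤ C * wt k z) : ‖∫ z, f z • Θ z ∂dxdv‖ ≤ C * ‖f‖ := by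
  rw [G.norm_eq, ← integral_const_mul]
  refine norm_integral_le_of_norm_le (f.integrable_wt_mul_abs.const_mul C)
    (Eventually.of_forall fun z => ?_)
  rw [norm_smul, Real.norm_eq_abs]
  calc |f z| * ‖Θ z‖ ≤ |f z| * (C * wt k z) := mul_le_mul_of_nonneg_left (h z) (abs_nonneg _)
    _ = C * (wt k z * |f z|) := by ring

theorem G.integrable (f : G k) : Integrable f dxdv := by
  have := G.integrable_mul (f := f) (Θ := fun _ => 1) (C := 1) (by fun_prop)
    fun z => by simpa using one_le_wt z
  simpa using this

theorem G.integrable_snd_mul (hk : 1 ≤ k) (f : G k) :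
    Integrable (fun z : Phase => f z * z.2) dxdv :=
  G.integrable_mul (C := 1) (by fun_prop) fun z => by simpa using abs_snd_le_wt hk z

/-- The Fourier coefficients of `J(f) - ε ρ(f) w`. -/
def forceCoeff (ε : ℝ) (f : G k) (w : C(Torus, ℝ)) (j : ℤ) : ℂ :=
  fourierCoeff (fun x => ((momentum f x - ε * rho f x * w x : ℝ) : ℂ)) j

def forceKernel (ε : ℝ) (w : C(Torus, ℝ)) (j : ℤ) (z : Phase) : ℂ :=
  fourier (-j) z.1 * ((z.2 - ε * w z.1 : ℝ) : ℂ)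

variable {ε : ℝ} {w w' : C(Torus, ℝ)} {j : ℤ}

theorem continuous_forceKernel : Continuous fun q : C(Torus, ℝ) × Phase => forceKernel ε q.1 j q.2 := by
  unfold forceKernel
  have h1 : Continuous fun q : C(Torus, ℝ) × Phase => q.1 q.2.1 := by fun_prop
  have h2 : Continuous fun q : C(Torus, ℝ) × Phase => (fourier (-j) q.2.1 : ℂ) := by fun_prop
  exact h2.mul (Complex.continuous_ofReal.comp (by fun_prop))

theorem norm_forceKernel_le (hε : 0 ≤ ε) (z : Phase) :
    ‖forceKernel ε w j z‖ ≤ |z.2| + ε * ‖w‖ := by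
  unfold forceKernel
  rw [norm_mul, norm_fourier_apply, one_mul, Complex.norm_real, Real.norm_eq_abs]
  refine (abs_sub _ _).trans (add_le_add le_rfl ?_)
  rw [abs_mul, abs_of_nonneg hε]
  exact mul_le_mul_of_nonneg_left (w.norm_coe_le_norm _) hε

theorem norm_forceKernel_sub_le (hε : 0 ≤ ε) (z z' : Phase) :
    ‖forceKernel ε w j z - forceKernel ε w' j z'‖ ≤
      2 * Real.pi * |(j : ℝ)| * dist z.1 z'.1 * (|z'.2| + ε * ‖w'‖) + |z.2 - z'.2| +
        ε * |w z.1 - w' z'.1| := by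
  have e : forceKernel ε w j z - forceKernel ε w' j z' =
      ((fourier (-j) z.1 : ℂ) - fourier (-j) z'.1) * ((z'.2 - ε * w' z'.1 : ℝ) : ℂ) +
      fourier (-j) z.1 * ((z.2 - z'.2 - ε * (w z.1 - w' z'.1) : ℝ) : ℂ) := by
    unfold forceKernel
    push_cast
    ring
  rw [e, add_assoc]
  refine (norm_add_le _ _).trans (add_le_add ?_ ?_)
  · rw [norm_mul]
    have h1 := norm_fourier_sub_le (-j) z.1 z'.1
    rw [Int.cast_neg, abs_neg] at h1
    refine mul_le_mul h1 ?_ (norm_nonneg _) (by positivity)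
    rw [Complex.norm_real, Real.norm_eq_abs]
    refine (abs_sub _ _).trans (add_le_add le_rfl ?_)
    rw [abs_mul, abs_of_nonneg hε]
    exact mul_le_mul_of_nonneg_left (w'.norm_coe_le_norm _) hε
  · rw [norm_mul, norm_fourier_apply, one_mul, Complex.norm_real, Real.norm_eq_abs]
    refine (abs_sub _ _).trans (add_le_add le_rfl ?_)
    rw [abs_mul, abs_of_nonneg hε]

theorem norm_forceKernel_le_wt (hk : 1 ≤ k) (hε : 0 ≤ ε) (z : Phase) :
    ‖forceKernel ε w j z‖ ≤ (1 + ε * ‖w‖) * wt k z := by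
  refine (norm_forceKernel_le hε z).trans ?_
  rw [add_mul, one_mul]
  exact add_le_add (abs_snd_le_wt hk z) (le_mul_of_one_le_right (by positivity) (one_le_wt z))

theorem forceCoeff_eq (hk : 1 ≤ k) (hε : 0 ≤ ε) (f : G k) :
    forceCoeff ε f w j = ∫ z, f z • forceKernel ε w j z ∂dxdv := by
  have hi : Integrable (fun z => f z • forceKernel ε w j z) dxdv :=
    G.integrable_smul ((continuous_forceKernel.comp
      (continuous_const.prodMk continuous_id)).aestronglyMeasurable)
      (norm_forceKernel_le_wt hk hε)
  rw [integral_prod _ hi]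
  unfold forceCoeff fourierCoeff
  refine integral_congr_ae ?_
  filter_upwards [f.integrable.prod_right_ae, (f.integrable_snd_mul hk).prod_right_ae] with x h1 h2
  have e : ∀ v : ℝ, f (x, v) • forceKernel ε w j (x, v) =
      fourier (-j) x * ((f (x, v) * v - ε * w x * f (x, v) : ℝ) : ℂ) := by
    intro v
    unfold forceKernel
    rw [Complex.real_smul]
    push_cast
    ring
  simp only [e]
  rw [integral_const_mul, smul_eq_mul]
  congr 1
  rw [integral_complex_ofReal, integral_sub h2 (h1.const_mul _), integral_const_mul]
  unfold momentum rho
  congr 2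
  · congr 1; ext v; ring
  · ring

end Force

theorem IsCurve.reverse {a b c T B L : ℝ} {W : ℝ → C(Torus, ℝ)} {z : Phase} {X : ℝ → Torus}
    {V : ℝ → ℝ} (h : IsCurve a b c W T z X V) (hW : FieldBound W T B L) :
    IsCurve (-a) (-b) (-c) (fun r => W (T - r)) T (X T, V T) (fun r => X (T - r))
      fun r => V (T - r) := by
  have hm : ∀ r ∈ Icc 0 T, T - r ∈ Icc 0 T := fun r hr =>
    ⟨sub_nonneg.2 hr.2, sub_le_self _ hr.1⟩
  have hcs : ContinuousOn (fun r => T - r) (Icc 0 T) := by fun_prop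
  have iF : IntegrableOn (fun σ => b * V σ + c * W σ (X σ)) (Icc 0 T) :=
    (h.contV.integrableOn_Icc.const_mul _).add ((hW.integrableOn h.contX).const_mul _)
  have iV : IntegrableOn (fun σ => a * V σ) (Icc 0 T) := h.contV.integrableOn_Icc.const_mul _
  refine ⟨h.contX.comp hcs hm, h.contV.comp hcs hm, fun r hr => ?_, fun r hr => ?_⟩
  all_goals
    have hT : 0 ≤ T := hr.1.trans hr.2
    have h0 : (0 : ℝ) ∈ Icc 0 T := ⟨le_rfl, hT⟩
    have hTT : T ∈ Icc 0 T := ⟨hT, le_rfl⟩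
  · rw [h.eqX _ (hm r hr), h.eqX T hTT, intervalIntegral.integral_comp_sub_left
      (fun σ => -a * V σ), sub_zero, ← intervalIntegral.integral_add_adjacent_intervals
      (intervalIntegrable_of_Icc iV h0 (hm r hr)) (intervalIntegrable_of_Icc iV (hm r hr) hTT),
      add_assoc, ← AddCircle.coe_add]
    congr 2
    simp only [neg_mul, intervalIntegral.integral_neg]
    ring
  · rw [h.eqV _ (hm r hr), h.eqV T hTT, intervalIntegral.integral_comp_sub_left
      (fun σ => -b * V σ + -c * W σ (X σ)), sub_zero,
      ← intervalIntegral.integral_add_adjacent_intervals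
      (intervalIntegrable_of_Icc iF h0 (hm r hr)) (intervalIntegrable_of_Icc iF (hm r hr) hTT)]
    have : ∀ σ, -b * V σ + -c * W σ (X σ) = -(b * V σ + c * W σ (X σ)) := fun σ => by ring
    simp only [this, intervalIntegral.integral_neg]
    ring

/-! ### First consequences of the representation by the flow -/

namespace KineticSolution

variable {k η β ε C : ℝ} {n : ℝ → C(Torus, ℝ)} {f₀ : G k} {u₀ : H η}
  {f : ℝ → G k} {u : ℝ → H β} {Ψ : ℝ → Phase ≃ₜ Phase} {t T P : ℝ}
  {X : Type*} [NormedAddCommGroup X] [NormedSpace ℝ X]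

theorem integral_comp (h : KineticSolution ε C n f₀ u₀ f u Ψ) (ht : 0 ≤ t) (F : Phase → X) :
    ∫ y, F (Ψ t y) ∂dxdv = Real.exp (t / ε ^ 2) • ∫ z, F z ∂dxdv := by
  rw [← (Ψ t).measurableEmbedding.integral_map, h.volume t ht, integral_smul_measure,
    ENNReal.toReal_ofReal (Real.exp_pos _).le]

theorem integrable_comp_iff (h : KineticSolution ε C n f₀ u₀ f u Ψ) (ht : 0 ≤ t) {F : Phase → X} :
    Integrable (fun y => F (Ψ t y)) dxdv ↔ Integrable F dxdv := by
  have := (Ψ t).measurableEmbedding.integrable_map_iff (μ := dxdv) (g := F)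
  rw [h.volume t ht, integrable_smul_measure (ENNReal.ofReal_pos.2 (Real.exp_pos _)).ne'
    ENNReal.ofReal_ne_top] at this
  exact this.symm

theorem integral_smul (h : KineticSolution ε C n f₀ u₀ f u Ψ) (ht : 0 ≤ t) (Θ : Phase → X) :
    ∫ z, f t z • Θ z ∂dxdv = ∫ y, f₀ y • Θ (Ψ t y) ∂dxdv := by
  have e := h.integral_comp ht fun z => f t z • Θ z
  have e2 : ∫ y, f t (Ψ t y) • Θ (Ψ t y) ∂dxdv =
      ∫ y, Real.exp (t / ε ^ 2) • (f₀ y • Θ (Ψ t y)) ∂dxdv := by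
    refine integral_congr_ae ?_
    filter_upwards [h.transport t ht] with y hy
    rw [hy, smul_smul]
  rw [e2, MeasureTheory.integral_smul] at e
  exact (smul_right_injective X (Real.exp_pos (t / ε ^ 2)).ne' e).symm

theorem integrable_smul_iff (h : KineticSolution ε C n f₀ u₀ f u Ψ) (ht : 0 ≤ t) {Θ : Phase → X} :
    Integrable (fun z => f t z • Θ z) dxdv ↔ Integrable (fun y => f₀ y • Θ (Ψ t y)) dxdv := by
  rw [← h.integrable_comp_iff ht, integrable_congr (g := fun y => Real.exp (t / ε ^ 2) •
    (f₀ y • Θ (Ψ t y)))]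
  · exact integrable_fun_smul_iff (Real.exp_pos _).ne' _
  · filter_upwards [h.transport t ht] with y hy
    rw [hy, smul_smul]

theorem fieldBound (h : KineticSolution ε C n f₀ u₀ f u Ψ) (hε : 0 < ε) (hβ : 3 / 2 < β)
    (hP : ∀ s ∈ Icc 0 T, ‖contRep (u s).toL2‖ ≤ P) :
    ∃ L, 0 ≤ L ∧ FieldBound (fun s => ε • contRep (u s).toL2 + n s) T (ε * P + C) L := by
  obtain ⟨M, hM⟩ := exists_norm_le h.continuous_u T
  have hC : 0 ≤ C := (norm_nonneg _).trans (h.norm_n 0)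
  exact ⟨_, by have := lipConst_nonneg β; positivity, fieldBound_add hε hβ h.meas_n h.norm_n
    h.lip_n h.continuous_u hP fun s hs => (hM s hs).trans (le_abs_self M)⟩

/-- The growth rate of the velocities. -/
def velConst (ε C T P : ℝ) : ℝ := (1 + (ε ^ 2)⁻¹ * (ε * P + C) * T) * Real.exp ((ε ^ 2)⁻¹ * T)

theorem velConst_pos (hε : 0 < ε) (hC : 0 ≤ C) (hP : 0 ≤ P) (hT : 0 ≤ T) :
    0 < velConst ε C T P := by
  unfold velConst; positivity

theorem nonneg (h : KineticSolution ε C n f₀ u₀ f u Ψ) : 0 ≤ C :=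
  (norm_nonneg _).trans (h.norm_n 0)

theorem bound_nonneg (hT : 0 ≤ T) (hP : ∀ s ∈ Icc 0 T, ‖contRep (u s).toL2‖ ≤ P) : 0 ≤ P :=
  (norm_nonneg _).trans (hP 0 ⟨le_rfl, hT⟩)

theorem abs_le_aux {Q A E v : ℝ} (hQ : 0 ≤ Q) (hE : 0 ≤ E) (hv : 0 ≤ v) (hA : A = Q) :
    (v + A) * E ≤ (1 + Q) * E * (1 + v) := by
  subst hA
  have : 0 ≤ E * (1 + A * v) := by positivity
  nlinarith

theorem abs_flow_le (h : KineticSolution ε C n f₀ u₀ f u Ψ) (hε : 0 < ε) (hβ : 3 / 2 < β)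
    (hP : ∀ s ∈ Icc 0 T, ‖contRep (u s).toL2‖ ≤ P) {s : ℝ} (hs : s ∈ Icc 0 T) (y : Phase) :
    |(Ψ s y).2| ≤ velConst ε C T P * (1 + |y.2|) := by
  obtain ⟨L, -, hL⟩ := h.fieldBound hε hβ hP
  have hT := hs.1.trans hs.2
  have hP0 := bound_nonneg hT hP
  have hC := h.nonneg
  refine ((h.curve T y).abs_le hL hs).trans ?_
  rw [abs_neg, abs_of_pos (by positivity : 0 < (ε ^ 2)⁻¹)]
  exact abs_le_aux (by positivity) (Real.exp_pos _).le (abs_nonneg _) rfl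

theorem abs_le_flow (h : KineticSolution ε C n f₀ u₀ f u Ψ) (hε : 0 < ε) (hβ : 3 / 2 < β)
    (hP : ∀ s ∈ Icc 0 T, ‖contRep (u s).toL2‖ ≤ P) {s : ℝ} (hs : s ∈ Icc 0 T) (y : Phase) :
    |y.2| ≤ velConst ε C T P * (1 + |(Ψ s y).2|) := by
  have hsub : Icc 0 s ⊆ Icc 0 T := Icc_subset_Icc_right hs.2
  obtain ⟨L, -, hL⟩ := h.fieldBound hε hβ fun r hr => hP r (hsub hr)
  have hT := hs.1.trans hs.2
  have hP0 := bound_nonneg hT hP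
  have hC := h.nonneg
  have hs0 := hs.1
  have h0 : (Ψ 0 y).2 = y.2 := by
    have := (h.curve T y).eqV 0 ⟨le_rfl, hT⟩
    simpa using this
  have := ((h.curve s y).reverse hL).abs_le hL.reverse (s := s) ⟨hs.1, le_rfl⟩
  simp only [sub_self, h0, abs_neg, neg_neg] at this
  rw [abs_of_pos (by positivity : 0 < (ε ^ 2)⁻¹)] at this
  refine this.trans ((abs_le_aux (by positivity) (Real.exp_pos _).le (abs_nonneg _) rfl).trans ?_)
  unfold velConst
  have := hs.2
  gcongr

theorem continuousOn_flow (h : KineticSolution ε C n f₀ u₀ f u Ψ) (T : ℝ) (y : Phase) :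
    ContinuousOn (fun s => Ψ s y) (Icc 0 T) :=
  (h.curve T y).contX.prodMk (h.curve T y).contV

theorem forceCoeff_eq (h : KineticSolution ε C n f₀ u₀ f u Ψ) (hk : 1 ≤ k) (hε : 0 ≤ ε)
    (ht : 0 ≤ t) (w : C(Torus, ℝ)) (j : ℤ) : forceCoeff ε (f t) w j =
      ∫ y, f₀ y • forceKernel ε w j (Ψ t y) ∂dxdv := by
  rw [Kinetic.forceCoeff_eq hk hε, h.integral_smul ht]

theorem norm_forceKernel_flow_le (h : KineticSolution ε C n f₀ u₀ f u Ψ) (hk : 1 ≤ k) (hε : 0 < ε)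
    (hβ : 3 / 2 < β) (hP : ∀ s ∈ Icc 0 T, ‖contRep (u s).toL2‖ ≤ P) {s : ℝ} (hs : s ∈ Icc 0 T)
    (j : ℤ) (y : Phase) :
    ‖forceKernel ε (contRep (u s).toL2) j (Ψ s y)‖ ≤ (2 * velConst ε C T P + ε * P) * wt k y := by
  refine (norm_forceKernel_le hε.le _).trans ?_
  have hT := hs.1.trans hs.2
  have hP0 := bound_nonneg hT hP
  have h1 := h.abs_flow_le hε hβ hP hs y
  have h2 := hP s hs
  have h3 := abs_snd_le_wt hk y
  have h4 := one_le_wt (k := k) y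
  have hv := (velConst_pos hε h.nonneg hP0 hT).le
  calc |(Ψ s y).2| + ε * ‖contRep (u s).toL2‖
      ≤ velConst ε C T P * (wt k y + wt k y) + ε * P * wt k y := by
        refine add_le_add (h1.trans (mul_le_mul_of_nonneg_left (by linarith) hv)) ?_
        exact (mul_le_mul_of_nonneg_left h2 hε.le).trans
          (le_mul_of_one_le_right (by positivity) h4)
    _ = _ := by ring

theorem continuousOn_forceCoeff (h : KineticSolution ε C n f₀ u₀ f u Ψ) (hk : 1 ≤ k) (hε : 0 < ε)
    (hβ : 3 / 2 < β) (T : ℝ) (j : ℤ) :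
    ContinuousOn (fun s => forceCoeff ε (f s) (contRep (u s).toL2) j) (Icc 0 T) := by
  have cu : Continuous fun s => contRep (u s).toL2 :=
    (H.continuous_contRep (by linarith)).comp h.continuous_u
  obtain ⟨P, hP⟩ := exists_norm_le cu T
  have key : ContinuousOn (fun s => ∫ y, f₀ y • forceKernel ε (contRep (u s).toL2) j (Ψ s y) ∂dxdv)
      (Icc 0 T) := by
    refine continuousOn_of_dominated (bound := fun y => (2 * velConst ε C T P + ε * P) *
      (wt k y * |f₀ y|)) (fun s hs => ?_) (fun s hs => ?_) (f₀.integrable_wt_mul_abs.const_mul _) ?_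
    · exact f₀.aestronglyMeasurable.smul (continuous_forceKernel.comp
        (continuous_const.prodMk (Ψ s).continuous)).aestronglyMeasurable
    · refine Eventually.of_forall fun y => ?_
      rw [norm_smul, Real.norm_eq_abs]
      have := mul_le_mul_of_nonneg_left (h.norm_forceKernel_flow_le hk hε hβ hP hs j y)
        (abs_nonneg (f₀ y))
      linarith
    · refine Eventually.of_forall fun y => ?_
      have hc : ContinuousOn (fun s => forceKernel ε (contRep (u s).toL2) j (Ψ s y)) (Icc 0 T) :=
        (continuous_forceKernel (ε := ε) (j := j)).comp_continuousOn
          (f := fun s => (contRep (u s).toL2, Ψ s y))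
          (cu.continuousOn.prodMk (h.continuousOn_flow T y))
      exact fun s hs => (hc s hs).tendsto.const_smul _
  exact key.congr fun s hs => h.forceCoeff_eq hk hε.le hs.1 _ _

end KineticSolution

end Kinetic

namespace Kinetic

/-! ### A priori bounds -/

theorem norm_integral_heat_le {g : ℝ → ℂ} {Q Λ l s : ℝ} (hs : 0 ≤ s) (hl : 0 < l + Λ) (hQ : 0 ≤ Q)
    (hg : ∀ σ ∈ Icc 0 s, ‖g σ‖ ≤ Q * Real.exp (Λ * σ)) :
    ‖∫ σ in (0 : ℝ)..s, (Real.exp (-l * (s - σ)) : ℂ) * g σ‖ ≤ Q * Real.exp (Λ * s) / (l + Λ) := by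
  have h1 : ‖∫ σ in (0 : ℝ)..s, (Real.exp (-l * (s - σ)) : ℂ) * g σ‖ ≤
      ∫ σ in (0 : ℝ)..s, Q * Real.exp (-l * s) * Real.exp ((l + Λ) * σ) := by
    refine intervalIntegral.norm_integral_le_of_norm_le hs (Eventually.of_forall fun σ hσ => ?_)
      (Continuous.intervalIntegrable (by fun_prop) _ _)
    rw [norm_mul, Complex.norm_real, Real.norm_of_nonneg (Real.exp_pos _).le]
    have := mul_le_mul_of_nonneg_left (hg σ ⟨hσ.1.le, hσ.2⟩) (Real.exp_pos (-l * (s - σ))).le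
    refine this.trans (le_of_eq ?_)
    rw [mul_left_comm, ← Real.exp_add, mul_assoc, ← Real.exp_add]
    congr 2; ring
  refine h1.trans ?_
  rw [intervalIntegral.integral_const_mul, intervalIntegral.integral_comp_mul_left _ hl.ne',
    integral_exp, mul_zero, Real.exp_zero, smul_eq_mul]
  have e : Q * Real.exp (Λ * s) / (l + Λ) =
      Q * Real.exp (-l * s) * ((l + Λ)⁻¹ * Real.exp ((l + Λ) * s)) := by
    have : Real.exp (Λ * s) = Real.exp (-l * s) * Real.exp ((l + Λ) * s) := by
      rw [← Real.exp_add]; congr 1; ring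
    rw [this]
    field_simp
  rw [e]
  have := inv_pos.2 hl
  gcongr
  linarith

theorem exists_weighted_bound {X : Type*} [SeminormedAddGroup X] {v : ℝ → X} (hv : Continuous v)
    {T : ℝ} (hT : 0 ≤ T) (Λ : ℝ) : ∃ D, 0 ≤ D ∧ (∃ s ∈ Icc 0 T, ‖v s‖ = D * Real.exp (Λ * s)) ∧
      ∀ s ∈ Icc 0 T, ‖v s‖ ≤ D * Real.exp (Λ * s) := by
  obtain ⟨s, hs, hmax⟩ := isCompact_Icc.exists_isMaxOn (nonempty_Icc.2 hT)
    (f := fun s => Real.exp (-(Λ * s)) * ‖v s‖) (by fun_prop)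
  refine ⟨Real.exp (-(Λ * s)) * ‖v s‖, by positivity, ⟨s, hs, ?_⟩, fun r hr => ?_⟩
  · rw [mul_right_comm, ← Real.exp_add, neg_add_cancel, Real.exp_zero, one_mul]
  · have h1 : Real.exp (-(Λ * r)) * ‖v r‖ ≤ Real.exp (-(Λ * s)) * ‖v s‖ := hmax hr
    have h2 := mul_le_mul_of_nonneg_right h1 (Real.exp_pos (Λ * r)).le
    rwa [mul_right_comm, ← Real.exp_add, neg_add_cancel, Real.exp_zero, one_mul] at h2

theorem exists_tsum_le {α δ : ℝ} (hα : α < 3 / 2) (hδ : 0 < δ) :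
    ∃ Λ, 1 ≤ Λ ∧ ∑' j : ℤ, (1 + lam j) ^ α / (lam j + Λ) ^ 2 ≤ δ := by
  have h := (tendsto_tsum_rpow_div hα).eventually (Iic_mem_nhds hδ)
  obtain ⟨Λ, h1, h2⟩ := (h.and (eventually_ge_atTop 1)).exists
  exact ⟨Λ, h2, h1⟩

theorem mul_add_div_sq_le {w : ℝ} (hw : 0 ≤ w) (A B l : ℝ) :
    w * (A + B / l) ^ 2 ≤ 2 * (w * A ^ 2) + 2 * B ^ 2 * (w / l ^ 2) := by
  have h : (A + B / l) ^ 2 ≤ 2 * A ^ 2 + 2 * (B / l) ^ 2 := by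
    nlinarith [sq_nonneg (A - B / l)]
  refine (mul_le_mul_of_nonneg_left h hw).trans (le_of_eq ?_)
  rw [div_pow]; ring

theorem summable_rpow_mul_sq {s η Λ : ℝ} (hs : s < 3 / 2) (hη : s ≤ η) (hΛ : 1 ≤ Λ) (u₀ : H η)
    (Q : ℝ) :
    Summable fun j => (1 + lam j) ^ s * (‖coeff u₀.toL2 j‖ + Q / (lam j + Λ)) ^ 2 := by
  have h1 : Summable fun j => 2 * ((1 + lam j) ^ η * ‖coeff u₀.toL2 j‖ ^ 2) +
      2 * Q ^ 2 * ((1 + lam j) ^ s / (lam j + Λ) ^ 2) :=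
    ((H.hasSum_norm_sq u₀).summable.mul_left _).add ((summable_rpow_div hs hΛ).mul_left _)
  refine Summable.of_nonneg_of_le (fun j => ?_) (fun j => ?_) h1
  · have := one_add_lam_pos j; positivity
  · have hl := one_add_lam_pos j
    refine (mul_add_div_sq_le (by positivity) _ _ _).trans (add_le_add ?_ le_rfl)
    have e1 : (1 + lam j) ^ s ≤ (1 + lam j) ^ η :=
      Real.rpow_le_rpow_of_exponent_le (one_le_one_add_lam j) hη
    exact mul_le_mul_of_nonneg_left (mul_le_mul_of_nonneg_right e1 (sq_nonneg _)) (by norm_num)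

/-- The square of the norm in `H s` of a sum of the form arising from the mild formulation. -/
theorem H.norm_sq_le_of_coeff_le {s Λ Q : ℝ} (hs : s < 3 / 2) (hΛ : 1 ≤ Λ) {U U0 : H s}
    (h : ∀ j, ‖coeff U.toL2 j‖ ≤ ‖coeff U0.toL2 j‖ + Q / (lam j + Λ)) :
    ‖U‖ ^ 2 ≤ 2 * ‖U0‖ ^ 2 +
      2 * Q ^ 2 * ∑' j : ℤ, (1 + lam j) ^ s / (lam j + Λ) ^ 2 := by
  refine hasSum_le (fun j => ?_) (H.hasSum_norm_sq U) (((H.hasSum_norm_sq U0).mul_left 2).add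
    ((summable_rpow_div hs hΛ).hasSum.mul_left _))
  have hl := one_add_lam_pos j
  refine le_trans ?_ (mul_add_div_sq_le (by positivity) _ _ _)
  have := h j
  gcongr

namespace KineticSolution

variable {k η β ε C : ℝ} {n : ℝ → C(Torus, ℝ)} {f₀ : G k} {u₀ : H η}
  {f : ℝ → G k} {u : ℝ → H β} {Ψ : ℝ → Phase ≃ₜ Phase} {t T P : ℝ}

theorem coeff_eq (h : KineticSolution ε C n f₀ u₀ f u Ψ) (ht : 0 ≤ t) (j : ℤ) :
    coeff (u t).toL2 j = (Real.exp (-lam j * t) : ℂ) * coeff u₀.toL2 j + ∫ s in (0 : ℝ)..t,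
      (Real.exp (-lam j * (t - s)) : ℂ) * forceCoeff ε (f s) (contRep (u s).toL2) j :=
  h.mild t ht j

theorem norm_coeff_le_of_force (h : KineticSolution ε C n f₀ u₀ f u Ψ) {Q Λ s : ℝ} (hs : 0 ≤ s)
    (hΛ : 1 ≤ Λ) (hQ : 0 ≤ Q) {j : ℤ}
    (hg : ∀ σ ∈ Icc 0 s, ‖forceCoeff ε (f σ) (contRep (u σ).toL2) j‖ ≤ Q * Real.exp (Λ * σ)) :
    ‖coeff (u s).toL2 j‖ ≤ ‖coeff u₀.toL2 j‖ + Q * Real.exp (Λ * s) / (lam j + Λ) := by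
  have hl := lam_nonneg j
  rw [h.coeff_eq hs]
  refine (norm_add_le _ _).trans (add_le_add ?_ (norm_integral_heat_le hs (by linarith) hQ hg))
  rw [norm_mul, Complex.norm_real, Real.norm_of_nonneg (Real.exp_pos _).le]
  refine mul_le_of_le_one_left (norm_nonneg _) (Real.exp_le_one_iff.2 ?_)
  have : 0 ≤ lam j * s := by positivity
  linarith

/-- The growth of the force in terms of the growth of the velocity field. -/
def growthConst (ε C T K : ℝ) : ℝ :=
  Real.exp ((ε ^ 2)⁻¹ * T) * (1 + (ε ^ 2)⁻¹ * T * (ε * K + C)) + ε * K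

theorem growthConst_nonneg {K : ℝ} (hε : 0 < ε) (hC : 0 ≤ C) (hT : 0 ≤ T) (hK : 0 ≤ K) :
    0 ≤ growthConst ε C T K := by
  unfold growthConst; positivity

theorem norm_forceCoeff_le (h : KineticSolution ε C n f₀ u₀ f u Ψ) (hk : 1 ≤ k) (hε : 0 < ε)
    (hβ : 3 / 2 < β) {s K R Y : ℝ} (hs : s ∈ Icc 0 T) (hK : 0 ≤ K)
    (hPs : ∀ r ∈ Icc 0 s, ‖contRep (u r).toL2‖ ≤ K * R) (hY : 1 ≤ Y) (hRY : R ≤ Y) (j : ℤ) :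
    ‖forceCoeff ε (f s) (contRep (u s).toL2) j‖ ≤ growthConst ε C T K * Y * ‖f₀‖ := by
  have hC := h.nonneg
  have hs0 := hs.1
  have hsT := hs.2
  have hT := hs0.trans hsT
  rw [h.forceCoeff_eq hk hε.le hs.1]
  refine G.norm_integral_smul_le f₀ fun y => ?_
  obtain ⟨L, -, hL⟩ := h.fieldBound hε hβ hPs
  have hV := (h.curve s y).abs_le hL (s := s) ⟨hs.1, le_rfl⟩
  have hinv : 0 < (ε ^ 2)⁻¹ := by positivity
  rw [abs_neg, abs_of_pos hinv] at hV
  refine (norm_forceKernel_le hε.le _).trans ?_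
  have w1 := one_le_wt (k := k) y
  have w2 := abs_snd_le_wt hk y
  have w0 := (wt_pos (k := k) y).le
  have hY0 : 0 ≤ Y := zero_le_one.trans hY
  have hεK : 0 ≤ ε * K := by positivity
  have x1 : ε * (K * R) + C ≤ (ε * K + C) * Y := by
    have a1 := mul_le_mul_of_nonneg_left hRY hεK
    have a2 := mul_le_mul_of_nonneg_left hY hC
    linarith
  have hE : Real.exp ((ε ^ 2)⁻¹ * s) ≤ Real.exp ((ε ^ 2)⁻¹ * T) :=
    Real.exp_le_exp.2 (mul_le_mul_of_nonneg_left hsT hinv.le)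
  have b1 : |y.2| ≤ wt k y * Y := w2.trans (le_mul_of_one_le_right w0 hY)
  have b0 : 0 ≤ (ε * K + C) * Y := by positivity
  have b2 : (ε ^ 2)⁻¹ * (ε * (K * R) + C) * s ≤ (ε ^ 2)⁻¹ * ((ε * K + C) * Y) * T * wt k y := by
    refine (mul_le_mul (mul_le_mul_of_nonneg_left x1 hinv.le) hsT hs0 (by positivity)).trans ?_
    exact le_mul_of_one_le_right (by positivity) w1
  have x2 : (|y.2| + (ε ^ 2)⁻¹ * (ε * (K * R) + C) * s) * Real.exp ((ε ^ 2)⁻¹ * s) ≤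
      (wt k y * Y + (ε ^ 2)⁻¹ * ((ε * K + C) * Y) * T * wt k y) * Real.exp ((ε ^ 2)⁻¹ * T) :=
    mul_le_mul (add_le_add b1 b2) hE (Real.exp_pos _).le (by positivity)
  have x3 : ε * ‖contRep (u s).toL2‖ ≤ ε * (K * Y) * wt k y := by
    have := hPs s ⟨hs.1, le_rfl⟩
    refine (mul_le_mul_of_nonneg_left (this.trans (mul_le_mul_of_nonneg_left hRY hK))
      hε.le).trans (le_mul_of_one_le_right (by positivity) w1)
  refine (add_le_add (hV.trans x2) x3).trans (le_of_eq ?_)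
  unfold growthConst
  ring

/-- Bounds of the Fourier coefficients which do not depend on the driving term. -/
theorem exists_coeff_bound (hk : 1 ≤ k) (hε : 0 < ε) (hβ : 3 / 2 < β) (hη : 3 / 2 < η)
    (hC : 0 ≤ C) (hT : 0 ≤ T) (f₀ : G k) (u₀ : H η) :
    ∃ (a : ℤ → ℝ) (P : ℝ), (∀ s : ℝ, s < 3 / 2 → Summable fun j => (1 + lam j) ^ s * a j ^ 2) ∧
      ∀ {n : ℝ → C(Torus, ℝ)} {f : ℝ → G k} {u : ℝ → H β} {Ψ : ℝ → Phase ≃ₜ Phase},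
        KineticSolution ε C n f₀ u₀ f u Ψ → ∀ t ∈ Icc 0 T,
          (∀ j, ‖coeff (u t).toL2 j‖ ≤ a j) ∧ ‖contRep (u t).toL2‖ ≤ P := by
  have hK0 : 0 ≤ supConst 1 := supConst_nonneg 1
  obtain ⟨K, hK⟩ : ∃ K, K = supConst 1 := ⟨_, rfl⟩
  rw [← hK] at hK0
  obtain ⟨C1, hC1⟩ : ∃ C1, C1 = growthConst ε C T K * ‖f₀‖ := ⟨_, rfl⟩
  have hC10 : 0 ≤ C1 := by
    rw [hC1]; exact mul_nonneg (growthConst_nonneg hε hC hT hK0) (norm_nonneg _)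
  obtain ⟨Λ, hΛ, hS⟩ := exists_tsum_le (α := 1) (by norm_num)
    (δ := 1 / (8 * (C1 ^ 2 + 1))) (by positivity)
  have hΛ0 : 0 < Λ := by linarith
  obtain ⟨S, hSdef⟩ : ∃ S, S = ∑' j : ℤ, (1 + lam j) ^ (1 : ℝ) / (lam j + Λ) ^ 2 := ⟨_, rfl⟩
  rw [← hSdef] at hS
  have hS0 : 0 ≤ S := by
    rw [hSdef]
    exact tsum_nonneg fun j => div_nonneg (Real.rpow_nonneg (one_add_lam_pos j).le _) (sq_nonneg _)
  have hS1 : 4 * C1 ^ 2 * S ≤ 1 / 2 := by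
    have h1 : 4 * C1 ^ 2 * S ≤ 4 * C1 ^ 2 * (1 / (8 * (C1 ^ 2 + 1))) :=
      mul_le_mul_of_nonneg_left hS (by positivity)
    refine h1.trans ?_
    rw [mul_one_div, div_le_iff₀ (by positivity)]
    linarith [sq_nonneg C1]
  obtain ⟨U0, hU0⟩ : ∃ U0, U0 = H.incl (by linarith : (1 : ℝ) ≤ η) u₀ := ⟨_, rfl⟩
  obtain ⟨D1, hD1⟩ : ∃ D1 : ℝ, D1 = 2 * ‖U0‖ + 1 := ⟨_, rfl⟩
  have hD10 : 0 ≤ D1 := by rw [hD1]; positivity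
  obtain ⟨Q, hQ⟩ : ∃ Q, Q = C1 * (1 + D1) * Real.exp (Λ * T) := ⟨_, rfl⟩
  refine ⟨fun j => ‖coeff u₀.toL2 j‖ + Q / (lam j + Λ), K * (D1 * Real.exp (Λ * T)), ?_, ?_⟩
  · intro s hs
    have hsη : s ≤ η := by linarith
    exact summable_rpow_mul_sq hs hsη hΛ u₀ Q
  intro n f u Ψ h
  have hle : (1 : ℝ) ≤ β := by linarith
  have cU : Continuous fun s => H.incl hle (u s) := (H.continuous_incl hle).comp h.continuous_u
  obtain ⟨D, hD0, ⟨s₁, hs₁, hs₁'⟩, hD⟩ := exists_weighted_bound cU hT Λ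
  have hrep : ∀ {D}, (∀ s ∈ Icc 0 T, ‖H.incl hle (u s)‖ ≤ D * Real.exp (Λ * s)) →
      ∀ s ∈ Icc 0 T, ‖contRep (u s).toL2‖ ≤ K * (D * Real.exp (Λ * s)) := by
    intro D hD s hs
    have e : contRep (u s).toL2 = contRep (H.incl hle (u s)).toL2 := by rw [H.toL2_incl]
    rw [e]
    refine (H.norm_contRep_le (by norm_num) _).trans ?_
    rw [← hK]
    exact mul_le_mul_of_nonneg_left (hD s hs) hK0
  have force : ∀ s ∈ Icc 0 T, ∀ j, ‖forceCoeff ε (f s) (contRep (u s).toL2) j‖ ≤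
      C1 * (1 + D) * Real.exp (Λ * s) := by
    intro s hs j
    have hPs : ∀ r ∈ Icc 0 s, ‖contRep (u r).toL2‖ ≤ K * (D * Real.exp (Λ * s)) := by
      intro r hr
      refine (hrep hD r ⟨hr.1, hr.2.trans hs.2⟩).trans ?_
      exact mul_le_mul_of_nonneg_left (mul_le_mul_of_nonneg_left
        (Real.exp_le_exp.2 (mul_le_mul_of_nonneg_left hr.2 hΛ0.le)) hD0) hK0
    have e1 : 1 ≤ Real.exp (Λ * s) := Real.one_le_exp (mul_nonneg hΛ0.le hs.1)
    have e2 := mul_nonneg hD0 (Real.exp_pos (Λ * s)).le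
    refine (h.norm_forceCoeff_le hk hε hβ hs hK0 hPs (Y := (1 + D) * Real.exp (Λ * s))
      (by linarith) (by linarith) j).trans (le_of_eq ?_)
    rw [hC1]; ring
  have coefb : ∀ s ∈ Icc 0 T, ∀ j, ‖coeff (u s).toL2 j‖ ≤
      ‖coeff u₀.toL2 j‖ + C1 * (1 + D) * Real.exp (Λ * s) / (lam j + Λ) := fun s hs j =>
    h.norm_coeff_le_of_force hs.1 hΛ (by positivity) fun σ hσ =>
      force σ ⟨hσ.1, hσ.2.trans hs.2⟩ j
  have hDle : D ≤ D1 := by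
    have e3 := H.norm_sq_le_of_coeff_le (s := 1) (U := H.incl hle (u s₁)) (U0 := U0) (by norm_num)
      hΛ fun j => by
        rw [H.toL2_incl, hU0, H.toL2_incl]; exact coefb s₁ hs₁ j
    rw [hs₁', ← hSdef] at e3
    have hex : 1 ≤ Real.exp (Λ * s₁) := Real.one_le_exp (mul_nonneg hΛ0.le hs₁.1)
    obtain ⟨X, hX⟩ : ∃ X, X = Real.exp (Λ * s₁) ^ 2 := ⟨_, rfl⟩
    have h1 : 1 ≤ X := by rw [hX]; exact one_le_pow₀ hex
    have e4 : D ^ 2 ≤ 2 * ‖U0‖ ^ 2 + 2 * (C1 * (1 + D)) ^ 2 * S := by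
      have h2 : 2 * ‖U0‖ ^ 2 ≤ 2 * ‖U0‖ ^ 2 * X := le_mul_of_one_le_right (by positivity) h1
      have h3 : D ^ 2 * X ≤ (2 * ‖U0‖ ^ 2 + 2 * (C1 * (1 + D)) ^ 2 * S) * X := by
        rw [mul_pow, mul_pow _ (Real.exp _), ← hX] at e3
        linarith
      exact le_of_mul_le_mul_right h3 (by linarith)
    have e5 : 2 * (C1 * (1 + D)) ^ 2 * S ≤ (4 * C1 ^ 2 * S) * (1 + D ^ 2) := by
      have := mul_nonneg (mul_nonneg (sq_nonneg C1) hS0) (sq_nonneg (1 - D))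
      linarith
    have e6 : (4 * C1 ^ 2 * S) * (1 + D ^ 2) ≤ 1 / 2 * (1 + D ^ 2) :=
      mul_le_mul_of_nonneg_right hS1 (by positivity)
    refine le_of_sq_le_sq ?_ hD10
    rw [hD1]
    have := norm_nonneg U0
    linarith
  have hDle' : ∀ s ∈ Icc 0 T, ‖H.incl hle (u s)‖ ≤ D1 * Real.exp (Λ * s) := fun s hs =>
    (hD s hs).trans (mul_le_mul_of_nonneg_right hDle (Real.exp_pos _).le)
  intro t ht
  have hexp : Real.exp (Λ * t) ≤ Real.exp (Λ * T) :=
    Real.exp_le_exp.2 (mul_le_mul_of_nonneg_left ht.2 hΛ0.le)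
  refine ⟨fun j => (coefb t ht j).trans (add_le_add le_rfl ?_), (hrep hDle' t ht).trans
    (mul_le_mul_of_nonneg_left (mul_le_mul_of_nonneg_left hexp hD10) hK0)⟩
  have hl : 0 < lam j + Λ := by linarith [lam_nonneg j]
  rw [hQ]
  refine div_le_div_of_nonneg_right (mul_le_mul (mul_le_mul_of_nonneg_left (by linarith) hC10) hexp
    (Real.exp_pos _).le (by positivity)) hl.le

end KineticSolution

end Kinetic

namespace Kinetic

/-! ### Stability with respect to the driving term -/

theorem integral_mul_le_sqrt {X : Type*} [MeasurableSpace X] {μ : Measure X} {F G : X → ℝ}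
    (hF : AEStronglyMeasurable F μ) (hG : AEStronglyMeasurable G μ) (hF0 : ∀ x, 0 ≤ F x)
    (hG0 : ∀ x, 0 ≤ G x) (hF2 : Integrable (fun x => F x ^ 2) μ)
    (hG2 : Integrable (fun x => G x ^ 2) μ) :
    ∫ x, F x * G x ∂μ ≤ √(∫ x, F x ^ 2 ∂μ) * √(∫ x, G x ^ 2 ∂μ) := by
  have e : ENNReal.ofReal 2 = 2 := by norm_num
  have := integral_mul_le_Lp_mul_Lq_of_nonneg (μ := μ) (p := 2) (q := 2)
    (by rw [Real.holderConjugate_iff]; norm_num)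
    (Eventually.of_forall hF0) (Eventually.of_forall hG0)
    (by rw [e]; exact (memLp_two_iff_integrable_sq hF).2 hF2)
    (by rw [e]; exact (memLp_two_iff_integrable_sq hG).2 hG2)
  simpa only [Real.rpow_two, ← Real.sqrt_eq_rpow] using this

theorem integral_sq_eq_norm_contL2 (w : C(Torus, ℝ)) : ∫ x, w x ^ 2 ∂dx = ‖contL2 w‖ ^ 2 := by
  have h := L2.inner_def (𝕜 := ℝ) (contL2 w) (contL2 w)
  rw [real_inner_self_eq_norm_sq] at h
  rw [h]
  refine integral_congr_ae ?_
  filter_upwards [coe_contL2 w] with x hx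
  rw [hx]
  simp [sq]

theorem H.contL2_contRep {s : ℝ} (hs : 1 / 2 < s) (u : H s) :
    contL2 (contRep u.toL2) = u.toL2 :=
  Lp.ext ((coe_contL2 _).trans (H.contRep_ae hs u).symm)

theorem H.continuous_toL2 {s : ℝ} (hs : 0 ≤ s) : Continuous (H.toL2 (s := s)) := by
  refine (LipschitzWith.of_dist_le_mul (K := 1) fun u w => ?_).continuous
  rw [dist_eq_norm, dist_eq_norm, ← H.toL2_sub, NNReal.coe_one, one_mul]
  exact H.norm_toL2_le hs _

theorem integrable_sq_div (w : C(Torus, ℝ)) :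
    Integrable (fun z : Phase => w z.1 ^ 2 * (1 + z.2 ^ 2)⁻¹) dxdv :=
  (integrable_of_continuous (g := fun x => w x ^ 2) (by fun_prop)).mul_prod
    integrable_inv_one_add_sq

theorem integral_sq_div (w : C(Torus, ℝ)) :
    ∫ z : Phase, w z.1 ^ 2 * (1 + z.2 ^ 2)⁻¹ ∂dxdv = ‖contL2 w‖ ^ 2 * Real.pi := by
  rw [integral_prod_mul (fun x => w x ^ 2) (fun v : ℝ => (1 + v ^ 2)⁻¹), integral_univ_inv_one_add_sq,
    integral_sq_eq_norm_contL2]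

namespace KineticSolution

variable {k η β ε C : ℝ} {n n' : ℝ → C(Torus, ℝ)} {f₀ : G k} {u₀ : H η}
  {f f' : ℝ → G k} {u u' : ℝ → H β} {Ψ Ψ' : ℝ → Phase ≃ₜ Phase} {t T P : ℝ}

/-- The constant in the comparison of the transported weighted `L¹` norm with the `L²` norm. -/
def l2Const (ε T κ : ℝ) (f₀ : G k) : ℝ :=
  √(∫ z, 4 * ((1 + |z.2| ^ 4) * |f₀ z| ^ 2) ∂dxdv) *
    √((1 + 2 * κ ^ 2) * (Real.exp (T / ε ^ 2) * Real.pi))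

theorem integral_weight_comp_le (h : KineticSolution ε C n f₀ u₀ f u Ψ) (hε : 0 < ε)
    (hβ : 3 / 2 < β) (hf₀ : Integrable (fun z => (1 + |z.2| ^ 4) * |f₀ z| ^ 2) dxdv)
    (hP : ∀ s ∈ Icc 0 T, ‖contRep (u s).toL2‖ ≤ P) {s : ℝ} (hs : s ∈ Icc 0 T) (w : C(Torus, ℝ)) :
    ∫ y, |f₀ y| * (1 + |y.2|) * |w (Ψ s y).1| ∂dxdv ≤
      l2Const ε T (velConst ε C T P) f₀ * ‖contL2 w‖ := by
  set κ := velConst ε C T P with hκ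
  have cs : Continuous fun y : Phase => √(1 + y.2 ^ 2) := by fun_prop
  have hpos : ∀ y : Phase, 0 < 1 + y.2 ^ 2 := fun y => by positivity
  have cw : Continuous fun y : Phase => w (Ψ s y).1 :=
    w.continuous.comp (continuous_fst.comp (Ψ s).continuous)
  set F : Phase → ℝ := fun y => |f₀ y| * (1 + |y.2|) * √(1 + y.2 ^ 2) with hF
  set G : Phase → ℝ := fun y => |w (Ψ s y).1| * (√(1 + y.2 ^ 2))⁻¹ with hG
  have mF : AEStronglyMeasurable F dxdv := by
    refine (f₀.aestronglyMeasurable.norm.mul ?_).mul cs.aestronglyMeasurable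
    exact (by fun_prop : Continuous fun y : Phase => 1 + |y.2|).aestronglyMeasurable
  have mG : AEStronglyMeasurable G dxdv :=
    (cw.abs.mul (cs.inv₀ fun y => (Real.sqrt_pos.2 (hpos y)).ne')).aestronglyMeasurable
  have F2 : ∀ y, F y ^ 2 ≤ 4 * ((1 + |y.2| ^ 4) * |f₀ y| ^ 2) := by
    intro y
    rw [hF]
    simp only [mul_pow, Real.sq_sqrt (hpos y).le]
    have : (1 + |y.2|) ^ 2 * (1 + y.2 ^ 2) ≤ 4 * (1 + |y.2| ^ 4) := by
      rw [← sq_abs y.2]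
      nlinarith [sq_nonneg (|y.2| - 1), sq_nonneg (|y.2| ^ 2 - 1), abs_nonneg y.2,
        mul_nonneg (sq_nonneg (|y.2| - 1)) (sq_nonneg (|y.2|))]
    calc |f₀ y| ^ 2 * (1 + |y.2|) ^ 2 * (1 + y.2 ^ 2)
        = |f₀ y| ^ 2 * ((1 + |y.2|) ^ 2 * (1 + y.2 ^ 2)) := by ring
      _ ≤ |f₀ y| ^ 2 * (4 * (1 + |y.2| ^ 4)) := by gcongr
      _ = _ := by ring
  have G2 : ∀ y, G y ^ 2 ≤ (1 + 2 * κ ^ 2) * (w (Ψ s y).1 ^ 2 * (1 + (Ψ s y).2 ^ 2)⁻¹) := by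
    intro y
    rw [hG]
    simp only [mul_pow, inv_pow, Real.sq_sqrt (hpos y).le, sq_abs]
    have h1 := h.abs_flow_le hε hβ hP hs y
    rw [← hκ] at h1
    have h2 : (Ψ s y).2 ^ 2 ≤ (κ * (1 + |y.2|)) ^ 2 := by
      rw [← sq_abs (Ψ s y).2]; gcongr
    have h3 : 1 + (Ψ s y).2 ^ 2 ≤ (1 + 2 * κ ^ 2) * (1 + y.2 ^ 2) := by
      have : (1 + |y.2|) ^ 2 ≤ 2 * (1 + y.2 ^ 2) := by
        rw [← sq_abs y.2]; nlinarith [sq_nonneg (|y.2| - 1)]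
      have := mul_le_mul_of_nonneg_left this (sq_nonneg κ)
      have := sq_nonneg y.2
      rw [mul_pow] at h2
      linarith
    have h4 : (1 + y.2 ^ 2)⁻¹ ≤ (1 + 2 * κ ^ 2) * (1 + (Ψ s y).2 ^ 2)⁻¹ := by
      rw [← div_eq_mul_inv, le_div_iff₀ (hpos _), inv_mul_le_iff₀ (hpos y), mul_comm]
      exact h3
    calc w (Ψ s y).1 ^ 2 * (1 + y.2 ^ 2)⁻¹
        ≤ w (Ψ s y).1 ^ 2 * ((1 + 2 * κ ^ 2) * (1 + (Ψ s y).2 ^ 2)⁻¹) := by gcongr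
      _ = _ := by ring
  have iw : Integrable (fun y => w (Ψ s y).1 ^ 2 * (1 + (Ψ s y).2 ^ 2)⁻¹) dxdv :=
    (h.integrable_comp_iff hs.1 (F := fun z => w z.1 ^ 2 * (1 + z.2 ^ 2)⁻¹)).2 (integrable_sq_div w)
  have iF2 : Integrable (fun y => F y ^ 2) dxdv := (hf₀.const_mul 4).mono' (mF.pow 2)
    (Eventually.of_forall fun y => by rw [Real.norm_of_nonneg (sq_nonneg _)]; exact F2 y)
  have iG2 : Integrable (fun y => G y ^ 2) dxdv := (iw.const_mul _).mono' (mG.pow 2)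
    (Eventually.of_forall fun y => by rw [Real.norm_of_nonneg (sq_nonneg _)]; exact G2 y)
  have key := integral_mul_le_sqrt mF mG (fun y => by positivity) (fun y => by positivity) iF2 iG2
  have e : ∀ y, F y * G y = |f₀ y| * (1 + |y.2|) * |w (Ψ s y).1| := by
    intro y
    have := (Real.sqrt_pos.2 (hpos y)).ne'
    rw [hF, hG]
    field_simp
  simp only [e] at key
  refine key.trans ?_
  unfold l2Const
  rw [mul_assoc]
  refine mul_le_mul (Real.sqrt_le_sqrt (integral_mono iF2 (hf₀.const_mul 4) F2)) ?_
    (Real.sqrt_nonneg _) (Real.sqrt_nonneg _)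
  have e2 : ∫ y, w (Ψ s y).1 ^ 2 * (1 + (Ψ s y).2 ^ 2)⁻¹ ∂dxdv =
      Real.exp (s / ε ^ 2) * (‖contL2 w‖ ^ 2 * Real.pi) := by
    rw [h.integral_comp hs.1 fun z => w z.1 ^ 2 * (1 + z.2 ^ 2)⁻¹, integral_sq_div, smul_eq_mul]
  have e3 := integral_mono iG2 (iw.const_mul (1 + 2 * κ ^ 2)) G2
  rw [integral_const_mul, e2] at e3
  refine (Real.sqrt_le_sqrt e3).trans ?_
  rw [← Real.sqrt_sq (norm_nonneg (contL2 w)), ← Real.sqrt_mul (by positivity)]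
  refine Real.sqrt_le_sqrt ?_
  rw [Real.sqrt_sq (norm_nonneg (contL2 w))]
  have := hs.2
  calc (1 + 2 * κ ^ 2) * (Real.exp (s / ε ^ 2) * (‖contL2 w‖ ^ 2 * Real.pi))
      ≤ (1 + 2 * κ ^ 2) * (Real.exp (T / ε ^ 2) * (‖contL2 w‖ ^ 2 * Real.pi)) := by gcongr
    _ = _ := by ring

theorem measurable_flow (h : KineticSolution ε C n f₀ u₀ f u Ψ) (hT : 0 ≤ T) :
    Measurable fun q : ℝ × Phase => Ψ (max 0 (min q.1 T)) q.2 := by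
  refine measurable_uncurry_of_continuous_of_measurable
    (u := fun r y => Ψ (max 0 (min r T)) y) (fun y => ?_) fun r => (Ψ _).measurable
  exact (h.continuousOn_flow T y).comp_continuous (by fun_prop)
    fun r => ⟨le_max_left _ _, max_le hT (min_le_right _ _)⟩

theorem integrable_norm_sub (h : KineticSolution ε C n f₀ u₀ f u Ψ)
    (h' : KineticSolution ε C n' f₀ u₀ f' u' Ψ') (a b : ℝ) :
    IntervalIntegrable (fun r => ‖n r - n' r‖) MeasureTheory.volume a b := by
  have : IntegrableOn (fun r => ‖n r - n' r‖) (uIcc a b) := by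
    have : IsFiniteMeasure (MeasureTheory.volume.restrict (uIcc a b)) := ⟨by simp [uIcc]⟩
    refine Integrable.of_bound (h.meas_n.sub h'.meas_n).norm.aestronglyMeasurable (C + C)
      (Eventually.of_forall fun r => ?_)
    rw [norm_norm]
    exact (norm_sub_le _ _).trans (add_le_add (h.norm_n r) (h'.norm_n r))
  exact this.intervalIntegrable

theorem flow_dist_le (h : KineticSolution ε C n f₀ u₀ f u Ψ)
    (h' : KineticSolution ε C n' f₀ u₀ f' u' Ψ') (hε : 0 < ε) (hβ : 3 / 2 < β)
    (hP : ∀ s ∈ Icc 0 T, ‖contRep (u s).toL2‖ ≤ P) {L : ℝ} (hL : 0 ≤ L)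
    (hW' : FieldBound (fun s => ε • contRep (u' s).toL2 + n' s) T (ε * P + C) L)
    {s : ℝ} (hs : s ∈ Icc 0 T) (y : Phase) :
    dist (Ψ s y).1 (Ψ' s y).1 + |(Ψ s y).2 - (Ψ' s y).2| ≤
      (ε ^ 2)⁻¹ * Real.exp ((ε⁻¹ + (ε ^ 2)⁻¹ + (ε ^ 2)⁻¹ * L) * T) *
      ∫ r in (0 : ℝ)..s, (ε * |(contRep (u r).toL2 - contRep (u' r).toL2) (Ψ r y).1| +
        ‖n r - n' r‖) := by
  obtain ⟨L₀, -, hW⟩ := h.fieldBound hε hβ hP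
  have hT := hs.1.trans hs.2
  have key := (h.curve T y).dist_le (h'.curve T y) hW hW' hL hs
  have a1 : 0 < ε⁻¹ := by positivity
  have a2 : 0 < (ε ^ 2)⁻¹ := by positivity
  rw [dist_self, sub_self, abs_zero, add_zero, zero_add, abs_neg, abs_of_pos a1, abs_of_pos a2]
    at key
  have cont : ContinuousOn (fun r => (contRep (u r).toL2 - contRep (u' r).toL2) (Ψ r y).1)
      (Icc 0 T) := by
    have c1 : Continuous fun s => contRep (u s).toL2 :=
      (H.continuous_contRep (by linarith)).comp h.continuous_u
    have c2 : Continuous fun s => contRep (u' s).toL2 :=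
      (H.continuous_contRep (by linarith)).comp h'.continuous_u
    have c3 : Continuous fun q : C(Torus, ℝ) × Torus => q.1 q.2 := by fun_prop
    exact c3.comp_continuousOn (f := fun r => (contRep (u r).toL2 - contRep (u' r).toL2, (Ψ r y).1))
      ((c1.sub c2).continuousOn.prodMk (h.curve T y).contX)
  have ii : IntervalIntegrable (fun r => ε *
      |(contRep (u r).toL2 - contRep (u' r).toL2) (Ψ r y).1| + ‖n r - n' r‖) MeasureTheory.volume 0 s :=
    ((intervalIntegrable_of_Icc cont.abs.integrableOn_Icc ⟨le_rfl, hT⟩ hs).const_mul ε).add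
      (h.integrable_norm_sub h' 0 s)
  have mono : ∫ r in (0 : ℝ)..s, |(ε • contRep (u r).toL2 + n r) (Ψ r y).1 -
      (ε • contRep (u' r).toL2 + n' r) (Ψ r y).1| ≤
      ∫ r in (0 : ℝ)..s, (ε * |(contRep (u r).toL2 - contRep (u' r).toL2) (Ψ r y).1| +
        ‖n r - n' r‖) := by
    refine intervalIntegral.integral_mono_on hs.1 ?_ ii fun r hr => ?_
    · exact (intervalIntegrable_of_Icc ((hW.integrableOn (h.curve T y).contX).sub
        (hW'.integrableOn (h.curve T y).contX)) ⟨le_rfl, hT⟩ hs).abs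
    · have e : (ε • contRep (u r).toL2 + n r) (Ψ r y).1 - (ε • contRep (u' r).toL2 + n' r) (Ψ r y).1
          = ε * (contRep (u r).toL2 - contRep (u' r).toL2) (Ψ r y).1 + (n r - n' r) (Ψ r y).1 := by
        simp only [ContinuousMap.add_apply, ContinuousMap.smul_apply, ContinuousMap.sub_apply,
          smul_eq_mul]
        ring
      rw [e]
      refine (abs_add_le _ _).trans (add_le_add ?_ ((n r - n' r).norm_coe_le_norm _))
      rw [abs_mul, abs_of_pos hε]
  refine key.trans ?_
  have i0 : 0 ≤ ∫ r in (0 : ℝ)..s, (ε * |(contRep (u r).toL2 - contRep (u' r).toL2) (Ψ r y).1| +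
        ‖n r - n' r‖) := intervalIntegral.integral_nonneg hs.1 fun r _ => by positivity
  have hsT := hs.2
  calc _ ≤ ((ε ^ 2)⁻¹ * ∫ r in (0 : ℝ)..s, (ε * |(contRep (u r).toL2 - contRep (u' r).toL2)
        (Ψ r y).1| + ‖n r - n' r‖)) * Real.exp ((ε⁻¹ + (ε ^ 2)⁻¹ + (ε ^ 2)⁻¹ * L) * T) := by
        refine mul_le_mul (mul_le_mul_of_nonneg_left mono a2.le) (Real.exp_le_exp.2 ?_)
          (Real.exp_pos _).le (by positivity)
        exact mul_le_mul_of_nonneg_left hsT (by positivity)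
    _ = _ := by ring

/-- The transported `L¹` norm of the distance between two flows. -/
theorem integral_flow_le (h : KineticSolution ε C n f₀ u₀ f u Ψ)
    (h' : KineticSolution ε C n' f₀ u₀ f' u' Ψ') (hk : 1 ≤ k) (hε : 0 < ε) (hβ : 3 / 2 < β)
    (hf₀ : Integrable (fun z => (1 + |z.2| ^ 4) * |f₀ z| ^ 2) dxdv)
    (hP : ∀ s ∈ Icc 0 T, ‖contRep (u s).toL2‖ ≤ P)
    (hP' : ∀ s ∈ Icc 0 T, ‖contRep (u' s).toL2‖ ≤ P) {D Λ : ℝ} (hΛ : 1 ≤ Λ) (hD0 : 0 ≤ D)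
    (hD : ∀ s ∈ Icc 0 T, ‖(u s - u' s).toL2‖ ≤ D * Real.exp (Λ * s)) {s : ℝ} (hs : s ∈ Icc 0 T) :
    Integrable (fun y => |f₀ y| * (1 + |y.2|) *
      (∫ r in (0 : ℝ)..s, (ε * |(contRep (u r).toL2 - contRep (u' r).toL2) (Ψ r y).1| +
        ‖n r - n' r‖))) dxdv ∧
    ∫ y, |f₀ y| * (1 + |y.2|) *
      (∫ r in (0 : ℝ)..s, (ε * |(contRep (u r).toL2 - contRep (u' r).toL2) (Ψ r y).1| +
        ‖n r - n' r‖)) ∂dxdv ≤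
      (ε * l2Const ε T (velConst ε C T P) f₀ + 2 * ‖f₀‖) *
        ((D + ∫ r in (0 : ℝ)..T, ‖n r - n' r‖) * Real.exp (Λ * s)) := by
  have hT := hs.1.trans hs.2
  have hP0 := bound_nonneg hT hP
  have c1 : Continuous fun s => contRep (u s).toL2 :=
    (H.continuous_contRep (by linarith)).comp h.continuous_u
  have c2 : Continuous fun s => contRep (u' s).toL2 :=
    (H.continuous_contRep (by linarith)).comp h'.continuous_u
  set c : ℝ → ℝ := fun r => max 0 (min r T) with hc
  have hcm : ∀ r, c r ∈ Icc 0 T := fun r => ⟨le_max_left _ _, max_le hT (min_le_right _ _)⟩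
  have hcr : ∀ r ∈ Icc 0 s, c r = r := fun r hr => by
    rw [hc]; simp only []; rw [min_eq_left (hr.2.trans hs.2), max_eq_right hr.1]
  set w : ℝ → C(Torus, ℝ) := fun r => contRep (u r).toL2 - contRep (u' r).toL2 with hw
  have cw : Continuous w := c1.sub c2
  have wP : ∀ r ∈ Icc 0 T, ‖w r‖ ≤ P + P := fun r hr =>
    (norm_sub_le _ _).trans (add_le_add (hP r hr) (hP' r hr))
  have w2 : ∀ r ∈ Icc 0 T, ‖contL2 (w r)‖ ≤ D * Real.exp (Λ * r) := by
    intro r hr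
    rw [hw]
    simp only []
    rw [← H.contRep_sub (by linarith), H.contL2_contRep (by linarith)]
    exact hD r hr
  set q : Phase → ℝ := fun y => |f₀ y| * (1 + |y.2|) with hq
  have iq : Integrable q dxdv := by
    have := (G.integrable_mul (f := f₀) (Θ := fun z => 1 + |z.2|) (C := 2) (by fun_prop) fun z => by
      rw [abs_of_nonneg (by positivity)]
      linarith [one_le_wt (k := k) z, abs_snd_le_wt hk z]).norm
    refine this.congr (Eventually.of_forall fun z => ?_)
    simp only [norm_mul, Real.norm_eq_abs, hq]
    rw [abs_of_nonneg (by positivity : 0 ≤ 1 + |z.2|)]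
  have q0 : ∀ y, 0 ≤ q y := fun y => by positivity
  have qle : ∫ y, q y ∂dxdv ≤ 2 * ‖f₀‖ := by
    rw [G.norm_eq, ← integral_const_mul]
    refine integral_mono iq (f₀.integrable_wt_mul_abs.const_mul 2) fun z => ?_
    have := mul_le_mul_of_nonneg_left (by linarith [one_le_wt (k := k) z, abs_snd_le_wt hk z] :
      1 + |z.2| ≤ 2 * wt k z) (abs_nonneg (f₀ z))
    simp only [hq]
    linarith
  have mW : Measurable fun p : ℝ × Phase => |w (c p.1) (Ψ (c p.1) p.2).1| := by
    have e1 : Continuous fun p : C(Torus, ℝ) × Torus => p.1 p.2 := by fun_prop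
    have e2 : Continuous fun r => w (c r) := cw.comp (by fun_prop)
    have e3 : StronglyMeasurable fun p : ℝ × Phase => (w (c p.1), (Ψ (c p.1) p.2).1) :=
      (e2.stronglyMeasurable.comp_measurable measurable_fst).prodMk
        (measurable_fst.comp (h.measurable_flow hT)).stronglyMeasurable
    exact (e1.comp_stronglyMeasurable e3).measurable.norm
  have key : ∀ y, ∫ r in (0 : ℝ)..s, (ε * |w r (Ψ r y).1| + ‖n r - n' r‖) =
      ε * (∫ r in Ioc 0 s, |w (c r) (Ψ (c r) y).1|) + ∫ r in (0 : ℝ)..s, ‖n r - n' r‖ := by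
    intro y
    have hy : ∀ r ∈ uIcc 0 s, ε * |w r (Ψ r y).1| + ‖n r - n' r‖ =
        ε * |w (c r) (Ψ (c r) y).1| + ‖n r - n' r‖ := fun r hr => by
      rw [uIcc_of_le hs.1] at hr
      rw [hcr r hr]
    rw [intervalIntegral.integral_congr hy, intervalIntegral.integral_add,
      intervalIntegral.integral_const_mul, intervalIntegral.integral_of_le hs.1]
    · refine IntervalIntegrable.const_mul ?_ _
      have : IntegrableOn (fun r => |w (c r) (Ψ (c r) y).1|) (Icc 0 s) := by
        have : IsFiniteMeasure (MeasureTheory.volume.restrict (Icc 0 s)) := ⟨by simp⟩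
        refine Integrable.of_bound (mW.comp measurable_prodMk_right).aestronglyMeasurable (P + P)
          (Eventually.of_forall fun r => ?_)
        rw [Real.norm_eq_abs, abs_abs]
        exact ((w (c r)).norm_coe_le_norm _).trans (wP _ (hcm r))
      exact intervalIntegrable_of_Icc this ⟨le_rfl, hs.1⟩ ⟨hs.1, le_rfl⟩
    · exact h.integrable_norm_sub h' 0 s
  have : IsFiniteMeasure (MeasureTheory.volume.restrict (Ioc 0 s)) := ⟨by simp⟩
  have ip : Integrable (fun p : Phase × ℝ => q p.1 * |w (c p.2) (Ψ (c p.2) p.1).1|)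
      (dxdv.prod (MeasureTheory.volume.restrict (Ioc 0 s))) := by
    refine ((iq.comp_fst (MeasureTheory.volume.restrict (Ioc 0 s))).mul_const (P + P)).mono'
      ((iq.comp_fst _).aestronglyMeasurable.mul
        (mW.comp measurable_swap).aestronglyMeasurable)
      (Eventually.of_forall fun p => ?_)
    rw [norm_mul, Real.norm_of_nonneg (q0 _), Real.norm_eq_abs, abs_abs]
    exact mul_le_mul_of_nonneg_left (((w (c p.2)).norm_coe_le_norm _).trans (wP _ (hcm _))) (q0 _)
  have ip1 := ip.integral_prod_left
  have ip2 : ∫ y, q y * (∫ r in Ioc 0 s, |w (c r) (Ψ (c r) y).1|) ∂dxdv =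
      ∫ r in Ioc 0 s, ∫ y, q y * |w (c r) (Ψ (c r) y).1| ∂dxdv := by
    rw [← integral_integral_swap ip]
    refine integral_congr_ae (Eventually.of_forall fun y => ?_)
    exact (integral_const_mul _ _).symm
  simp only [integral_const_mul] at ip1
  have e : ∀ y, q y * (∫ r in (0 : ℝ)..s, (ε * |w r (Ψ r y).1| + ‖n r - n' r‖)) =
      ε * (q y * ∫ r in Ioc 0 s, |w (c r) (Ψ (c r) y).1|) +
        q y * (∫ r in (0 : ℝ)..s, ‖n r - n' r‖) := fun y => by rw [key]; ring
  refine ⟨?_, ?_⟩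
  · refine Integrable.congr ((ip1.const_mul ε).add (iq.mul_const
      (∫ r in (0 : ℝ)..s, ‖n r - n' r‖))) (Eventually.of_forall fun y => ?_)
    exact (e y).symm
  set A := l2Const ε T (velConst ε C T P) f₀ with hA
  have hA0 : 0 ≤ A := by rw [hA]; unfold l2Const; positivity
  set d := ∫ r in (0 : ℝ)..T, ‖n r - n' r‖ with hd
  have hds : ∫ r in (0 : ℝ)..s, ‖n r - n' r‖ ≤ d :=
    intervalIntegral.integral_mono_interval le_rfl hs.1 hs.2
      (Eventually.of_forall fun r => norm_nonneg _) (h.integrable_norm_sub h' 0 T)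
  have hd0 : 0 ≤ d := intervalIntegral.integral_nonneg hT fun r _ => norm_nonneg _
  have hd0' : 0 ≤ ∫ r in (0 : ℝ)..s, ‖n r - n' r‖ :=
    intervalIntegral.integral_nonneg hs.1 fun r _ => norm_nonneg _
  have I1 : ∫ r in Ioc 0 s, ∫ y, q y * |w (c r) (Ψ (c r) y).1| ∂dxdv ≤
      A * (D * Real.exp (Λ * s)) := by
    have b : ∫ r in Ioc 0 s, ∫ y, q y * |w (c r) (Ψ (c r) y).1| ∂dxdv ≤
        ∫ r in Ioc 0 s, A * (D * Real.exp (Λ * r)) := by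
      refine setIntegral_mono_on (ip.integral_prod_right) ?_ measurableSet_Ioc fun r hr => ?_
      · exact (Continuous.integrableOn_Icc (by fun_prop)).mono_set Ioc_subset_Icc_self
      · rw [hcr r ⟨hr.1.le, hr.2⟩]
        have hrT : r ∈ Icc 0 T := ⟨hr.1.le, hr.2.trans hs.2⟩
        exact (h.integral_weight_comp_le hε hβ hf₀ hP hrT (w r)).trans
          (mul_le_mul_of_nonneg_left (w2 r hrT) hA0)
    refine b.trans ?_
    rw [integral_const_mul, integral_const_mul, ← intervalIntegral.integral_of_le hs.1,
      intervalIntegral.integral_comp_mul_left _ (by linarith : Λ ≠ 0), integral_exp, mul_zero,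
      Real.exp_zero, smul_eq_mul]
    have : Λ⁻¹ * (Real.exp (Λ * s) - 1) ≤ Real.exp (Λ * s) := by
      have h1 : Λ⁻¹ ≤ 1 := inv_le_one_of_one_le₀ hΛ
      have h2 : 1 ≤ Real.exp (Λ * s) := Real.one_le_exp (mul_nonneg (by linarith) hs.1)
      calc Λ⁻¹ * (Real.exp (Λ * s) - 1) ≤ 1 * (Real.exp (Λ * s) - 1) :=
            mul_le_mul_of_nonneg_right h1 (by linarith)
        _ ≤ _ := by linarith
    gcongr
  have e1 : 1 ≤ Real.exp (Λ * s) := Real.one_le_exp (mul_nonneg (by linarith) hs.1)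
  refine (le_of_eq (integral_congr_ae (Eventually.of_forall e))).trans ?_
  rw [integral_add (ip1.const_mul ε) (iq.mul_const _), integral_const_mul, integral_mul_const, ip2]
  have I2 : (∫ y, q y ∂dxdv) * ∫ r in (0 : ℝ)..s, ‖n r - n' r‖ ≤
      2 * ‖f₀‖ * (d * Real.exp (Λ * s)) :=
    mul_le_mul qle (hds.trans (le_mul_of_one_le_right hd0 e1)) hd0' (by positivity)
  have I3 := mul_le_mul_of_nonneg_left I1 hε.le
  have x1 : 0 ≤ ε * A * (d * Real.exp (Λ * s)) := by positivity
  have x2 : 0 ≤ 2 * ‖f₀‖ * (D * Real.exp (Λ * s)) := by positivity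
  linarith

/-- The constant in the stability estimate for the force. -/
def stabConst (ε C T P l L : ℝ) (f₀ : G k) : ℝ :=
  (velConst ε C T P + ε * P + 1 + ε * l) *
    ((ε ^ 2)⁻¹ * Real.exp ((ε⁻¹ + (ε ^ 2)⁻¹ + (ε ^ 2)⁻¹ * L) * T)) *
    (ε * l2Const ε T (velConst ε C T P) f₀ + 2 * ‖f₀‖) +
  ε * l2Const ε T (velConst ε C T P) f₀

theorem norm_forceCoeff_sub_le (h : KineticSolution ε C n f₀ u₀ f u Ψ)
    (h' : KineticSolution ε C n' f₀ u₀ f' u' Ψ') (hk : 1 ≤ k) (hε : 0 < ε) (hβ : 3 / 2 < β)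
    (hf₀ : Integrable (fun z => (1 + |z.2| ^ 4) * |f₀ z| ^ 2) dxdv)
    (hP : ∀ s ∈ Icc 0 T, ‖contRep (u s).toL2‖ ≤ P)
    (hP' : ∀ s ∈ Icc 0 T, ‖contRep (u' s).toL2‖ ≤ P) {l L : ℝ} (hl : 0 ≤ l) (hL : 0 ≤ L)
    (hlip : ∀ s ∈ Icc 0 T, ∀ x y, |contRep (u' s).toL2 x - contRep (u' s).toL2 y| ≤ l * dist x y)
    (hW' : FieldBound (fun s => ε • contRep (u' s).toL2 + n' s) T (ε * P + C) L)
    {D Λ : ℝ} (hΛ : 1 ≤ Λ) (hD0 : 0 ≤ D)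
    (hD : ∀ s ∈ Icc 0 T, ‖(u s - u' s).toL2‖ ≤ D * Real.exp (Λ * s)) {s : ℝ} (hs : s ∈ Icc 0 T)
    (j : ℤ) :
    ‖forceCoeff ε (f s) (contRep (u s).toL2) j - forceCoeff ε (f' s) (contRep (u' s).toL2) j‖ ≤
      stabConst ε C T P l L f₀ * (1 + 2 * Real.pi * |(j : ℝ)|) *
        (D + ∫ r in (0 : ℝ)..T, ‖n r - n' r‖) * Real.exp (Λ * s) := by
  have hT := hs.1.trans hs.2
  have hP0 := bound_nonneg hT hP
  have hκ := velConst_pos hε h.nonneg hP0 hT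
  obtain ⟨I1, I2⟩ := h.integral_flow_le h' hk hε hβ hf₀ hP hP' hΛ hD0 hD hs
  have I3 := h.integral_weight_comp_le hε hβ hf₀ hP hs (contRep (u s).toL2 - contRep (u' s).toL2)
  have e0 : ‖contL2 (contRep (u s).toL2 - contRep (u' s).toL2)‖ ≤ D * Real.exp (Λ * s) := by
    rw [← H.contRep_sub (by linarith), H.contL2_contRep (by linarith)]
    exact hD s hs
  have hdist := h.flow_dist_le h' hε hβ hP hL hW' hs
  have hvel := h'.abs_flow_le hε hβ hP' hs
  have iΘ := (G.integrable_smul (f := f₀) ((continuous_forceKernel (ε := ε) (j := j)).comp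
    ((continuous_const (y := contRep (u s).toL2)).prodMk (Ψ s).continuous)).aestronglyMeasurable
    (h.norm_forceKernel_flow_le hk hε hβ hP hs j))
  have iΘ' := (G.integrable_smul (f := f₀) ((continuous_forceKernel (ε := ε) (j := j)).comp
    ((continuous_const (y := contRep (u' s).toL2)).prodMk (Ψ' s).continuous)).aestronglyMeasurable
    (h'.norm_forceKernel_flow_le hk hε hβ hP' hs j))
  have hlip' := hlip s hs
  have hPs' := hP' s hs
  rw [h.forceCoeff_eq hk hε.le hs.1, h'.forceCoeff_eq hk hε.le hs.1]
  refine (le_of_eq (congrArg _ (integral_sub iΘ iΘ').symm)).trans ?_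
  unfold stabConst
  have hA0 : 0 ≤ l2Const ε T (velConst ε C T P) f₀ := by unfold l2Const; positivity
  obtain ⟨A, hA⟩ : ∃ A, A = l2Const ε T (velConst ε C T P) f₀ := ⟨_, rfl⟩
  obtain ⟨κ, hκ'⟩ : ∃ κ, κ = velConst ε C T P := ⟨_, rfl⟩
  obtain ⟨K, hK⟩ : ∃ K, K = (ε ^ 2)⁻¹ * Real.exp ((ε⁻¹ + (ε ^ 2)⁻¹ + (ε ^ 2)⁻¹ * L) * T) := ⟨_, rfl⟩
  obtain ⟨d, hd⟩ : ∃ d, d = ∫ r in (0 : ℝ)..T, ‖n r - n' r‖ := ⟨_, rfl⟩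
  have hK0 : 0 ≤ K := by rw [hK]; positivity
  have hd0 : 0 ≤ d := by
    rw [hd]; exact intervalIntegral.integral_nonneg hT fun r _ => norm_nonneg _
  obtain ⟨I, hI⟩ : ∃ I : Phase → ℝ, I = fun y => ∫ r in (0 : ℝ)..s,
    (ε * |(contRep (u r).toL2 - contRep (u' r).toL2) (Ψ r y).1| + ‖n r - n' r‖) := ⟨_, rfl⟩
  have hI' : ∀ y, (∫ r in (0 : ℝ)..s, (ε * |(contRep (u r).toL2 - contRep (u' r).toL2) (Ψ r y).1| +
    ‖n r - n' r‖)) = I y := fun y => by rw [hI]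
  have hI0 : ∀ y, 0 ≤ I y := fun y => by
    rw [hI]; exact intervalIntegral.integral_nonneg hs.1 fun r _ => by positivity
  simp only [hI', ← hd] at I1 I2 I3 hdist hvel hA0 hκ ⊢
  simp only [← hA, ← hK] at I1 I2 I3 hdist hvel hA0 hκ ⊢
  simp only [← hκ'] at hvel hκ ⊢
  obtain ⟨w, hw⟩ : ∃ w, w = contRep (u s).toL2 := ⟨_, rfl⟩
  obtain ⟨w', hw'⟩ : ∃ w', w' = contRep (u' s).toL2 := ⟨_, rfl⟩
  rw [← hw, ← hw'] at I3 e0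
  rw [← hw'] at hlip' hPs'
  obtain ⟨J, hJ⟩ : ∃ J, J = 2 * Real.pi * |(j : ℝ)| := ⟨_, rfl⟩
  have hJ0 : 0 ≤ J := by rw [hJ]; positivity
  have iw : Integrable (fun y => |f₀ y| * (1 + |y.2|) * |(w - w') (Ψ s y).1|) dxdv := by
    have cw : Continuous fun y : Phase => (1 + |y.2|) * |(w - w') (Ψ s y).1| :=
      (by fun_prop : Continuous fun y : Phase => 1 + |y.2|).mul
        ((w - w').continuous.comp (continuous_fst.comp (Ψ s).continuous)).abs
    have := (G.integrable_mul (f := f₀) (Θ := fun y => (1 + |y.2|) * |(w - w') (Ψ s y).1|)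
      (C := 2 * ‖w - w'‖) cw.measurable.aestronglyMeasurable fun z => by
        rw [abs_of_nonneg (by positivity)]
        have h1 := (w - w').norm_coe_le_norm (Ψ s z).1
        rw [Real.norm_eq_abs] at h1
        have h2 : 1 + |z.2| ≤ 2 * wt k z := by
          linarith [one_le_wt (k := k) z, abs_snd_le_wt hk z]
        have h3 := wt_pos (k := k) z
        calc (1 + |z.2|) * |(w - w') (Ψ s z).1| ≤ (2 * wt k z) * ‖w - w'‖ := by gcongr
          _ = _ := by ring).norm
    refine this.congr (Eventually.of_forall fun z => ?_)
    simp only [norm_mul, Real.norm_eq_abs, abs_abs]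
    rw [abs_of_nonneg (by positivity : 0 ≤ 1 + |z.2|), mul_assoc]
  have bound : ∀ y, ‖f₀ y • forceKernel ε w j (Ψ s y) - f₀ y • forceKernel ε w' j (Ψ' s y)‖ ≤
      (κ + ε * P + 1 + ε * l) * (1 + J) * K * (|f₀ y| * (1 + |y.2|) * I y) +
        ε * (|f₀ y| * (1 + |y.2|) * |(w - w') (Ψ s y).1|) := by
    intro y
    rw [← smul_sub, norm_smul, Real.norm_eq_abs]
    have h1 := norm_forceKernel_sub_le (w := w) (w' := w') (j := j) hε.le (Ψ s y) (Ψ' s y)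
    rw [← hJ] at h1
    have h2 : |w (Ψ s y).1 - w' (Ψ' s y).1| ≤ |(w - w') (Ψ s y).1| +
        l * dist (Ψ s y).1 (Ψ' s y).1 := by
      have : w (Ψ s y).1 - w' (Ψ' s y).1 = (w - w') (Ψ s y).1 +
        (w' (Ψ s y).1 - w' (Ψ' s y).1) := by simp
      rw [this]
      exact (abs_add_le _ _).trans (add_le_add le_rfl (hlip' _ _))
    have h3 := hvel y
    have h4 := hdist y
    obtain ⟨a, ha⟩ : ∃ a, a = dist (Ψ s y).1 (Ψ' s y).1 := ⟨_, rfl⟩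
    obtain ⟨b, hb⟩ : ∃ b, b = |(Ψ s y).2 - (Ψ' s y).2| := ⟨_, rfl⟩
    obtain ⟨e, he⟩ : ∃ e, e = |(w - w') (Ψ s y).1| := ⟨_, rfl⟩
    obtain ⟨p, hp⟩ : ∃ p, p = 1 + |y.2| := ⟨_, rfl⟩
    have ha0 : 0 ≤ a := by rw [ha]; exact dist_nonneg
    have hb0 : 0 ≤ b := by rw [hb]; exact abs_nonneg _
    have he0 : 0 ≤ e := by rw [he]; exact abs_nonneg _
    have hp1 : 1 ≤ p := by rw [hp]; linarith [abs_nonneg y.2]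
    rw [← ha] at h1 h2 h4
    rw [← hb] at h1 h4
    rw [← he] at h2
    rw [← hp] at h3
    rw [← he, ← hp]
    have hI0 := hI0 y
    have h5 : |(Ψ' s y).2| + ε * ‖w'‖ ≤ (κ + ε * P) * p := by
      have : ε * ‖w'‖ ≤ ε * P * p := (mul_le_mul_of_nonneg_left hPs' hε.le).trans
        (le_mul_of_one_le_right (by positivity) hp1)
      linarith
    have h6 : J * a * (|(Ψ' s y).2| + ε * ‖w'‖) + b + ε * |w (Ψ s y).1 - w' (Ψ' s y).1| ≤
        (κ + ε * P + 1 + ε * l) * (1 + J) * p * (K * I y) + ε * (p * e) := by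
      have x1 : J * a * (|(Ψ' s y).2| + ε * ‖w'‖) ≤ J * (K * I y) * ((κ + ε * P) * p) := by
        gcongr; linarith
      have x2 : ε * |w (Ψ s y).1 - w' (Ψ' s y).1| ≤ ε * (p * e + l * p * (K * I y)) := by
        refine mul_le_mul_of_nonneg_left (h2.trans (add_le_add
          (le_mul_of_one_le_left he0 hp1) ?_)) hε.le
        have : a ≤ K * I y := by linarith
        calc l * a ≤ l * (K * I y) := by gcongr
          _ ≤ (l * (K * I y)) * p := le_mul_of_one_le_right (by positivity) hp1
          _ = _ := by ring
      have x3 : b ≤ p * (K * I y) := by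
        have : b ≤ K * I y := by linarith
        exact this.trans (le_mul_of_one_le_left (by positivity) hp1)
      have y1 : 0 ≤ (κ + ε * P) * p * (K * I y) := by positivity
      have y2 : 0 ≤ (1 + ε * l) * J * p * (K * I y) := by positivity
      linarith
    calc |f₀ y| * ‖forceKernel ε w j (Ψ s y) - forceKernel ε w' j (Ψ' s y)‖
        ≤ |f₀ y| * ((κ + ε * P + 1 + ε * l) * (1 + J) * p * (K * I y) + ε * (p * e)) :=
          mul_le_mul_of_nonneg_left (h1.trans h6) (abs_nonneg _)
      _ = _ := by ring
  rw [← hJ]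
  rw [hw, hw'] at bound
  refine (norm_integral_le_of_norm_le ((I1.const_mul ((κ + ε * P + 1 + ε * l) * (1 + J) * K)).add
    ((hw ▸ hw' ▸ iw).const_mul ε)) (Eventually.of_forall bound)).trans ?_
  rw [← hw, ← hw']
  refine (le_of_eq (integral_add (I1.const_mul _) (iw.const_mul ε))).trans ?_
  rw [integral_const_mul, integral_const_mul]
  have z1 := mul_le_mul_of_nonneg_left I2
    (by positivity : 0 ≤ (κ + ε * P + 1 + ε * l) * (1 + J) * K)
  have z2 := mul_le_mul_of_nonneg_left (I3.trans (mul_le_mul_of_nonneg_left e0 hA0)) hε.le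
  have z3 : 0 ≤ ε * A * (d * Real.exp (Λ * s)) := by positivity
  have z4 : 0 ≤ ε * A * J * ((D + d) * Real.exp (Λ * s)) := by positivity
  linarith

/-- Stability of the Fourier coefficients with respect to the driving path. -/
theorem exists_stability (h' : KineticSolution ε C n' f₀ u₀ f' u' Ψ') (hk : 1 ≤ k) (hε : 0 < ε)
    (hβ : 3 / 2 < β) (hT : 0 ≤ T)
    (hf₀ : Integrable (fun z => (1 + |z.2| ^ 4) * |f₀ z| ^ 2) dxdv)
    (hP' : ∀ s ∈ Icc 0 T, ‖contRep (u' s).toL2‖ ≤ P) :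
    ∃ κ : ℤ → ℝ, ∀ {n : ℝ → C(Torus, ℝ)} {f : ℝ → G k} {u : ℝ → H β} {Ψ : ℝ → Phase ≃ₜ Phase},
      KineticSolution ε C n f₀ u₀ f u Ψ → (∀ s ∈ Icc 0 T, ‖contRep (u s).toL2‖ ≤ P) →
        ∀ t ∈ Icc 0 T, ∀ j, ‖coeff (u t).toL2 j - coeff (u' t).toL2 j‖ ≤
          κ j * ∫ r in (0 : ℝ)..T, ‖n r - n' r‖ := by
  obtain ⟨M, hM⟩ := exists_norm_le h'.continuous_u T
  have hl0 : 0 ≤ lipConst β * |M| := mul_nonneg (lipConst_nonneg β) (abs_nonneg M)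
  have hlip : ∀ s ∈ Icc 0 T, ∀ x y, |contRep (u' s).toL2 x - contRep (u' s).toL2 y| ≤
      lipConst β * |M| * dist x y := fun s hs x y => by
    refine (H.abs_contRep_sub_le hβ _ x y).trans ?_
    have := lipConst_nonneg β
    have := (hM s hs).trans (le_abs_self M)
    gcongr
  obtain ⟨L, hL, hW'⟩ := h'.fieldBound hε hβ hP'
  obtain ⟨Q, hQ⟩ : ∃ Q, Q = stabConst ε C T P (lipConst β * |M|) L f₀ := ⟨_, rfl⟩
  have hQ0 : 0 ≤ Q := by
    rw [hQ]
    have hP0 := bound_nonneg hT hP'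
    have := velConst_pos hε h'.nonneg hP0 hT
    unfold stabConst l2Const
    positivity
  obtain ⟨Λ, hΛ, hS⟩ := exists_tsum_le (α := 1) (δ := (8 * (Q ^ 2 + 1))⁻¹) (by norm_num)
    (by positivity)
  refine ⟨fun j => 2 * Q * (1 + 2 * Real.pi * |(j : ℝ)|) * Real.exp (Λ * T), ?_⟩
  intro n f u Ψ h hP
  obtain ⟨d, hd⟩ : ∃ d, d = ∫ r in (0 : ℝ)..T, ‖n r - n' r‖ := ⟨_, rfl⟩
  have hd0 : 0 ≤ d := by
    rw [hd]; exact intervalIntegral.integral_nonneg hT fun r _ => norm_nonneg _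
  obtain ⟨D, hD0, ⟨s₀, hs₀, hs₀'⟩, hD⟩ := exists_weighted_bound
    (v := fun s => (u s - u' s).toL2)
    ((H.continuous_toL2 (s := β) (by linarith)).comp (h.continuous_u.sub h'.continuous_u)) hT Λ
  have key : ∀ s ∈ Icc 0 T, ∀ j, ‖coeff (u s).toL2 j - coeff (u' s).toL2 j‖ ≤
      Q * (1 + 2 * Real.pi * |(j : ℝ)|) * (D + d) * Real.exp (Λ * s) / (lam j + Λ) := by
    intro s hs j
    have hl := lam_nonneg j
    have cont : ∀ {n : ℝ → C(Torus, ℝ)} {f : ℝ → G k} {u : ℝ → H β} {Ψ : ℝ → Phase ≃ₜ Phase},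
        KineticSolution ε C n f₀ u₀ f u Ψ → IntervalIntegrable (fun r =>
          (Real.exp (-lam j * (s - r)) : ℂ) * forceCoeff ε (f r) (contRep (u r).toL2) j)
          MeasureTheory.volume 0 s := by
      intro n f u Ψ h
      refine ContinuousOn.intervalIntegrable ?_
      rw [uIcc_of_le hs.1]
      refine ContinuousOn.mul ?_ (h.continuousOn_forceCoeff hk hε hβ s j)
      exact (Complex.continuous_ofReal.comp (by fun_prop)).continuousOn
    have e : coeff (u s).toL2 j - coeff (u' s).toL2 j = ∫ r in (0 : ℝ)..s,
        (Real.exp (-lam j * (s - r)) : ℂ) * (forceCoeff ε (f r) (contRep (u r).toL2) j -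
          forceCoeff ε (f' r) (contRep (u' r).toL2) j) := by
      rw [h.coeff_eq hs.1, h'.coeff_eq hs.1, add_sub_add_left_eq_sub,
        ← intervalIntegral.integral_sub (cont h) (cont h')]
      simp only [mul_sub]
    rw [e]
    refine norm_integral_heat_le hs.1 (by linarith) (by positivity) fun σ hσ => ?_
    have := h.norm_forceCoeff_sub_le h' hk hε hβ hf₀ hP hP' hl0 hL hlip hW' hΛ hD0 hD
      (s := σ) ⟨hσ.1, hσ.2.trans hs.2⟩ j
    rwa [← hQ, ← hd] at this
  have hDd : D ≤ d := by
    have h1 : ‖(u s₀ - u' s₀).toL2‖ ^ 2 ≤ 2 * (Q * (D + d) * Real.exp (Λ * s₀)) ^ 2 *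
        ∑' j : ℤ, (1 + lam j) ^ (1 : ℝ) / (lam j + Λ) ^ 2 := by
      refine hasSum_le (fun j => ?_) (hasSum_sq_coeff _)
        ((summable_rpow_div (α := 1) (by norm_num) hΛ).hasSum.mul_left _)
      have hl := lam_nonneg j
      rw [H.toL2_sub, coeff_sub, Real.rpow_one]
      calc ‖coeff (u s₀).toL2 j - coeff (u' s₀).toL2 j‖ ^ 2
          ≤ (Q * (1 + 2 * Real.pi * |(j : ℝ)|) * (D + d) * Real.exp (Λ * s₀) / (lam j + Λ)) ^ 2 := by
            gcongr; exact key s₀ hs₀ j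
        _ = (Q * (D + d) * Real.exp (Λ * s₀)) ^ 2 / (lam j + Λ) ^ 2 *
            (1 + 2 * Real.pi * |(j : ℝ)|) ^ 2 := by rw [div_pow]; ring
        _ ≤ (Q * (D + d) * Real.exp (Λ * s₀)) ^ 2 / (lam j + Λ) ^ 2 * (2 * (1 + lam j)) := by
            gcongr; exact sq_one_add_le j
        _ = _ := by ring
    have h2 : 2 * (Q * (D + d) * Real.exp (Λ * s₀)) ^ 2 *
        ∑' j : ℤ, (1 + lam j) ^ (1 : ℝ) / (lam j + Λ) ^ 2 ≤
        ((D + d) / 2 * Real.exp (Λ * s₀)) ^ 2 := by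
      have e1 : 2 * Q ^ 2 * (8 * (Q ^ 2 + 1))⁻¹ ≤ 1 / 4 := by
        rw [← div_eq_mul_inv, div_le_div_iff₀ (by positivity) (by norm_num)]
        nlinarith [sq_nonneg Q]
      calc _ ≤ 2 * (Q * (D + d) * Real.exp (Λ * s₀)) ^ 2 * (8 * (Q ^ 2 + 1))⁻¹ := by gcongr
        _ = (2 * Q ^ 2 * (8 * (Q ^ 2 + 1))⁻¹) * ((D + d) * Real.exp (Λ * s₀)) ^ 2 := by ring
        _ ≤ 1 / 4 * ((D + d) * Real.exp (Λ * s₀)) ^ 2 := by gcongr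
        _ = _ := by ring
    have h3 := abs_le_of_sq_le_sq (h1.trans h2) (by positivity)
    rw [abs_of_nonneg (norm_nonneg _), hs₀'] at h3
    have := le_of_mul_le_mul_right h3 (Real.exp_pos _)
    linarith
  intro t ht j
  rw [← hd]
  refine (key t ht j).trans ?_
  have hl := lam_nonneg j
  have ht2 := ht.2
  calc Q * (1 + 2 * Real.pi * |(j : ℝ)|) * (D + d) * Real.exp (Λ * t) / (lam j + Λ)
      ≤ Q * (1 + 2 * Real.pi * |(j : ℝ)|) * (D + d) * Real.exp (Λ * t) :=
        div_le_self (by positivity) (by linarith)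
    _ ≤ Q * (1 + 2 * Real.pi * |(j : ℝ)|) * (d + d) * Real.exp (Λ * T) := by gcongr
    _ = _ := by ring

end KineticSolution

end Kinetic

namespace Kinetic

/-! ### Convergence of transported densities -/

variable {k : ℝ}

theorem continuous_wt (hk : 0 ≤ k) : Continuous (wt k) := by
  unfold wt
  exact continuous_const.add ((continuous_abs.comp continuous_snd).rpow_const fun _ => Or.inr hk)

theorem wt_le_of_abs_le (hk : 0 ≤ k) {κ : ℝ} (hκ : 0 ≤ κ) {z y : Phase}
    (h : |z.2| ≤ κ * (1 + |y.2|)) : wt k z ≤ (1 + (2 * κ) ^ k) * wt k y := by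
  have h0 := abs_nonneg y.2
  have h1 : |z.2| ^ k ≤ (2 * κ) ^ k * wt k y := by
    have e1 : |z.2| ≤ 2 * κ * max 1 |y.2| := by
      have := le_max_left 1 |y.2|
      have := le_max_right 1 |y.2|
      have : κ * (1 + |y.2|) ≤ κ * (2 * max 1 |y.2|) := by gcongr; linarith
      linarith
    have e2 : (max 1 |y.2|) ^ k ≤ wt k y := by
      unfold wt
      rcases max_cases 1 |y.2| with ⟨e, -⟩ | ⟨e, -⟩ <;> rw [e]
      · rw [Real.one_rpow]
        have := Real.rpow_nonneg h0 k
        linarith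
      · linarith
    calc |z.2| ^ k ≤ (2 * κ * max 1 |y.2|) ^ k := Real.rpow_le_rpow (abs_nonneg _) e1 hk
      _ = (2 * κ) ^ k * (max 1 |y.2|) ^ k := Real.mul_rpow (by positivity) (by positivity)
      _ ≤ _ := by gcongr
  have h2 := one_le_wt (k := k) y
  calc wt k z = 1 + |z.2| ^ k := rfl
    _ ≤ _ := by linarith

theorem weightedMeasure_regular (hk : 0 ≤ k) : (weightedMeasure k).Regular := by
  have : IsLocallyFiniteMeasure (weightedMeasure k) := by
    rw [weightedMeasure_eq]
    exact IsLocallyFiniteMeasure.withDensity_ofReal (continuous_wt hk)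
  infer_instance

theorem G.exists_hasCompactSupport (hk : 0 ≤ k) (F : G k) {δ : ℝ} (hδ : 0 < δ) :
    ∃ φ : Phase → ℝ, HasCompactSupport φ ∧ Continuous φ ∧
      Integrable (fun z => wt k z * |F z - φ z|) dxdv ∧ ∫ z, wt k z * |F z - φ z| ∂dxdv ≤ δ := by
  have := weightedMeasure_regular hk
  obtain ⟨φ, h1, h2, h3, h4⟩ := (L1.integrable_coeFn F).exists_hasCompactSupport_integral_sub_le hδ
  refine ⟨φ, h1, h3, ?_, ?_⟩
  · exact integrable_weighted_iff.1 ((L1.integrable_coeFn F).sub h4).norm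
  · rwa [integral_weighted] at h2

theorem integrable_indicator_slab (R : ℝ) :
    Integrable (fun y : Phase => (Icc (-R) R).indicator (fun _ => (1 : ℝ)) y.2) dxdv := by
  have h : Integrable ((Icc (-R) R).indicator fun _ => (1 : ℝ)) volume :=
    (integrable_indicator_iff measurableSet_Icc).2 (integrableOn_const (by simp))
  simpa using (integrable_const (1 : ℝ) (μ := dx)).mul_prod h

/-- Convergence in `G k` of densities transported along converging homeomorphisms. -/
theorem G.tendsto_of_transport (hk : 0 ≤ k) {ι : Type*} {l : Filter ι} [l.IsCountablyGenerated]
    {F : ι → G k} {F' : G k} {g : G k} {S : ι → Phase ≃ₜ Phase} {S' : Phase ≃ₜ Phase}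
    {c : ι → ℝ} {c' κ : ℝ} (hκ : 0 ≤ κ)
    (h1 : ∀ᶠ i in l, 1 ≤ c i ∧ dxdv.map (S i) = ENNReal.ofReal (c i) • dxdv ∧
      (∀ᵐ y ∂dxdv, F i (S i y) = c i * g y) ∧ (∀ y, |(S i y).2| ≤ κ * (1 + |y.2|)) ∧
      ∀ y, |y.2| ≤ κ * (1 + |(S i y).2|))
    (h1' : 1 ≤ c' ∧ dxdv.map S' = ENNReal.ofReal c' • dxdv ∧
      (∀ᵐ y ∂dxdv, F' (S' y) = c' * g y))
    (hc : Tendsto c l (𝓝 c')) (hS : ∀ y, Tendsto (fun i => S i y) l (𝓝 (S' y))) :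
    Tendsto F l (𝓝 F') := by
  have cov : ∀ {S : Phase ≃ₜ Phase} {c : ℝ}, 1 ≤ c → dxdv.map S = ENNReal.ofReal c • dxdv →
      ∀ {F : G k}, (∀ᵐ y ∂dxdv, F (S y) = c * g y) → ∀ φ : Phase → ℝ,
        ∫ z, wt k z * |F z - φ z| ∂dxdv = ∫ y, wt k (S y) * |g y - c⁻¹ * φ (S y)| ∂dxdv := by
    intro S c hc hm F hF φ
    have hc0 : 0 < c := by linarith
    have e1 : ∫ y, wt k (S y) * |F (S y) - φ (S y)| ∂dxdv =
        c * ∫ z, wt k z * |F z - φ z| ∂dxdv := by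
      rw [← S.measurableEmbedding.integral_map (g := fun z => wt k z * |F z - φ z|), hm,
        integral_smul_measure, ENNReal.toReal_ofReal hc0.le, smul_eq_mul]
    have e2 : ∫ y, wt k (S y) * |F (S y) - φ (S y)| ∂dxdv =
        ∫ y, c * (wt k (S y) * |g y - c⁻¹ * φ (S y)|) ∂dxdv := by
      refine integral_congr_ae ?_
      filter_upwards [hF] with y hy
      have : F (S y) - φ (S y) = c * (g y - c⁻¹ * φ (S y)) := by
        rw [hy]; field_simp
      rw [this, abs_mul, abs_of_pos hc0]
      ring
    rw [e1, integral_const_mul] at e2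
    exact mul_left_cancel₀ hc0.ne' e2
  rw [tendsto_iff_norm_sub_tendsto_zero]
  rw [Metric.tendsto_nhds]
  intro δ hδ
  obtain ⟨φ, hφ, cφ, iφ, bφ⟩ := G.exists_hasCompactSupport hk F' (δ := δ / 4) (by positivity)
  obtain ⟨M, hM⟩ := hφ.exists_bound_of_continuous cφ
  obtain ⟨R, hR⟩ : ∃ R, ∀ z, φ z ≠ 0 → |z.2| ≤ R := by
    obtain ⟨R, hR⟩ := (hφ.isCompact.image (continuous_snd.abs)).bddAbove
    exact ⟨R, fun z hz => hR ⟨z, subset_tsupport _ hz, rfl⟩⟩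
  have hM0 : 0 ≤ M := (norm_nonneg _).trans (hM 0)
  have hR0 : 0 ≤ |R| := abs_nonneg R
  have lim : Tendsto (fun i => ∫ y, wt k (S i y) * |g y - (c i)⁻¹ * φ (S i y)| ∂dxdv) l
      (𝓝 (∫ y, wt k (S' y) * |g y - c'⁻¹ * φ (S' y)| ∂dxdv)) := by
    refine tendsto_integral_filter_of_dominated_convergence
      (fun y => (1 + (2 * κ) ^ k) * (wt k y * |g y|) + (1 + |R| ^ k) * M *
        (Icc (-(κ * (1 + |R|))) (κ * (1 + |R|))).indicator (fun _ => (1 : ℝ)) y.2) ?_ ?_ ?_ ?_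
    · refine Eventually.of_forall fun i => ?_
      refine ((continuous_wt hk).comp (S i).continuous).aestronglyMeasurable.mul ?_
      exact (g.aestronglyMeasurable.sub
        (((cφ.comp (S i).continuous).const_mul _).aestronglyMeasurable)).norm
    · filter_upwards [h1] with i ⟨hci, _, _, b1, b2⟩
      refine Eventually.of_forall fun y => ?_
      have w0 := wt_pos (k := k) (S i y)
      rw [Real.norm_of_nonneg (by positivity)]
      have x1 : wt k (S i y) * |g y - (c i)⁻¹ * φ (S i y)| ≤
          wt k (S i y) * |g y| + wt k (S i y) * |φ (S i y)| := by
        rw [← mul_add]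
        refine mul_le_mul_of_nonneg_left ((abs_sub _ _).trans (add_le_add le_rfl ?_)) w0.le
        rw [abs_mul]
        refine mul_le_of_le_one_left (abs_nonneg _) ?_
        rw [abs_of_pos (inv_pos.2 (by linarith))]
        exact inv_le_one_of_one_le₀ hci
      refine x1.trans (add_le_add ?_ ?_)
      · rw [← mul_assoc]
        exact mul_le_mul_of_nonneg_right (wt_le_of_abs_le hk hκ (b1 y)) (abs_nonneg _)
      · by_cases hz : φ (S i y) = 0
        · rw [hz, abs_zero, mul_zero]
          have : 0 ≤ (Icc (-(κ * (1 + |R|))) (κ * (1 + |R|))).indicator (fun _ => (1 : ℝ)) y.2 :=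
            indicator_nonneg (fun _ _ => zero_le_one) _
          positivity
        · have r1 : |(S i y).2| ≤ |R| := (hR _ hz).trans (le_abs_self R)
          have r2 : y.2 ∈ Icc (-(κ * (1 + |R|))) (κ * (1 + |R|)) := by
            refine abs_le.1 ((b2 y).trans ?_)
            gcongr
          rw [indicator_of_mem r2, mul_one]
          refine mul_le_mul ?_ (hM _) (abs_nonneg _) (by positivity)
          exact add_le_add le_rfl (Real.rpow_le_rpow (abs_nonneg _) r1 hk)
    · exact (g.integrable_wt_mul_abs.const_mul _).add ((integrable_indicator_slab _).const_mul _)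
    · refine Eventually.of_forall fun y => ?_
      refine (((continuous_wt hk).tendsto _).comp (hS y)).mul (Tendsto.abs ?_)
      exact tendsto_const_nhds.sub ((hc.inv₀ (by linarith [h1'.1])).mul
        ((cφ.tendsto _).comp (hS y)))
  rw [← cov h1'.1 h1'.2.1 h1'.2.2 φ] at lim
  have ev := lim.eventually (Iio_mem_nhds (show _ < δ / 2 by linarith))
  filter_upwards [ev, h1] with i hi ⟨hci, hm, hF, _, _⟩
  have hi' : ∫ y, wt k (S i y) * |g y - (c i)⁻¹ * φ (S i y)| ∂dxdv < δ / 2 := hi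
  rw [← cov hci hm hF φ] at hi'
  rw [dist_zero_right, norm_norm, G.norm_eq]
  have iφ2 : Integrable (fun z => wt k z * |F i z - φ z|) dxdv := by
    refine (((F i - F').integrable_wt_mul_abs).add iφ).mono' ?_ ?_
    · exact (continuous_wt hk).aestronglyMeasurable.mul
        ((F i).aestronglyMeasurable.sub cφ.aestronglyMeasurable).norm
    · filter_upwards [G.coe_sub_ae (F i) F'] with z hz
      have w0 := wt_pos (k := k) z
      rw [Real.norm_of_nonneg (by positivity), Pi.add_apply, hz, ← mul_add]
      exact mul_le_mul_of_nonneg_left (abs_sub_le _ _ _) w0.le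
  have key : ∫ z, wt k z * |(F i - F' : G k) z| ∂dxdv ≤
      ∫ z, (wt k z * |F i z - φ z| + wt k z * |F' z - φ z|) ∂dxdv := by
    refine integral_mono_ae (F i - F').integrable_wt_mul_abs (iφ2.add iφ) ?_
    filter_upwards [G.coe_sub_ae (F i) F'] with z hz
    have w0 := wt_pos (k := k) z
    simp only [hz]
    rw [← mul_add, abs_sub_comm (F' z)]
    exact mul_le_mul_of_nonneg_left (abs_sub_le _ _ _) w0.le
  rw [integral_add iφ2 iφ] at key
  linarith

namespace KineticSolution

variable {η β ε C : ℝ} {n n' : ℝ → C(Torus, ℝ)} {f₀ : G k} {u₀ : H η}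
  {f f' : ℝ → G k} {u u' : ℝ → H β} {Ψ Ψ' : ℝ → Phase ≃ₜ Phase} {t T P : ℝ}

theorem transport_bounds (h : KineticSolution ε C n f₀ u₀ f u Ψ) (hε : 0 < ε) (hβ : 3 / 2 < β)
    (hP : ∀ s ∈ Icc 0 T, ‖contRep (u s).toL2‖ ≤ P) (ht : t ∈ Icc 0 T) :
    1 ≤ Real.exp (t / ε ^ 2) ∧ dxdv.map (Ψ t) = ENNReal.ofReal (Real.exp (t / ε ^ 2)) • dxdv ∧
      (∀ᵐ y ∂dxdv, f t (Ψ t y) = Real.exp (t / ε ^ 2) * f₀ y) ∧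
      (∀ y, |(Ψ t y).2| ≤ velConst ε C T P * (1 + |y.2|)) ∧
      ∀ y, |y.2| ≤ velConst ε C T P * (1 + |(Ψ t y).2|) :=
  ⟨Real.one_le_exp (div_nonneg ht.1 (sq_nonneg ε)), h.volume t ht.1, h.transport t ht.1,
    h.abs_flow_le hε hβ hP ht, h.abs_le_flow hε hβ hP ht⟩

/-- The density is continuous in time. -/
theorem continuousOn_f (h : KineticSolution ε C n f₀ u₀ f u Ψ) (hk : 1 ≤ k) (hε : 0 < ε)
    (hβ : 3 / 2 < β) (hT : 0 ≤ T) : ContinuousOn f (Icc 0 T) := by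
  intro t ht
  obtain ⟨P, hP⟩ := exists_norm_le
    ((H.continuous_contRep (s := β) (by linarith)).comp h.continuous_u) T
  have hκ := velConst_pos hε h.nonneg (bound_nonneg hT hP) hT
  refine G.tendsto_of_transport (by linarith) hκ.le (S := fun s => Ψ s)
    (c := fun s => Real.exp (s / ε ^ 2))
    (eventually_mem_nhdsWithin.mono fun s hs => h.transport_bounds hε hβ hP hs)
    ⟨(h.transport_bounds hε hβ hP ht).1, (h.transport_bounds hε hβ hP ht).2.1,
      (h.transport_bounds hε hβ hP ht).2.2.1⟩ ?_ fun y => h.continuousOn_flow T y t ht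
  exact (Continuous.tendsto (by fun_prop) t).mono_left nhdsWithin_le_nhds

/-- The solution depends continuously on the driving path. -/
theorem tendsto_solution (h : KineticSolution ε C n f₀ u₀ f u Ψ) (hk : 1 ≤ k) (hε : 0 < ε)
    (hβ : 3 / 2 < β) (hη : 3 / 2 < η)
    (hf₀ : Integrable (fun z => (1 + |z.2| ^ 4) * |f₀ z| ^ 2) dxdv)
    {ι : Type*} {l : Filter ι} [l.IsCountablyGenerated] {n' : ι → ℝ → C(Torus, ℝ)}
    {f' : ι → ℝ → G k} {u' : ι → ℝ → H β} {Ψ' : ι → ℝ → Phase ≃ₜ Phase}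
    (h' : ∀ i, KineticSolution ε C (n' i) f₀ u₀ (f' i) (u' i) (Ψ' i))
    (hl : Tendsto (fun i => ∫ r in (0 : ℝ)..T, ‖n' i r - n r‖) l (𝓝 0)) (ht : t ∈ Icc 0 T)
    {α : ℝ} (hα : α < 3 / 2) (hαβ : α ≤ β) :
    Tendsto (fun i => f' i t) l (𝓝 (f t)) ∧
      Tendsto (fun i => H.incl hαβ (u' i t)) l (𝓝 (H.incl hαβ (u t))) := by
  have hT := ht.1.trans ht.2
  obtain ⟨a, P, ha, hb⟩ := exists_coeff_bound hk hε hβ hη h.nonneg hT f₀ u₀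
  have hP : ∀ s ∈ Icc 0 T, ‖contRep (u s).toL2‖ ≤ P := fun s hs => (hb h s hs).2
  have hP' : ∀ i, ∀ s ∈ Icc 0 T, ‖contRep (u' i s).toL2‖ ≤ P := fun i s hs => (hb (h' i) s hs).2
  obtain ⟨κ, hκ⟩ := h.exists_stability hk hε hβ hT hf₀ hP
  have lu : ∀ {α : ℝ} (hα : α < 3 / 2) (hαβ : α ≤ β), ∀ s ∈ Icc 0 T,
      Tendsto (fun i => H.incl hαβ (u' i s)) l (𝓝 (H.incl hαβ (u s))) := by
    intro α hα hαβ s hs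
    refine H.tendsto_of_dominated (ha α hα) (fun i j => ?_) (fun j => ?_) fun j => ?_
    · rw [H.toL2_incl]; exact (hb (h' i) s hs).1 j
    · rw [H.toL2_incl]; exact (hb h s hs).1 j
    · simp only [H.toL2_incl]
      rw [tendsto_iff_norm_sub_tendsto_zero]
      refine squeeze_zero (fun i => norm_nonneg _) (fun i => hκ (h' i) (hP' i) s hs j) ?_
      simpa using hl.const_mul (κ j)
  refine ⟨?_, lu hα hαβ t ht⟩
  have lw : ∀ s ∈ Icc 0 T, Tendsto (fun i => ‖contRep (u' i s).toL2 - contRep (u s).toL2‖) l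
      (𝓝 0) := by
    intro s hs
    have := ((H.continuous_contRep (s := 1) (by norm_num)).tendsto _).comp
      (lu (α := 1) (by norm_num) (by linarith) s hs)
    have := tendsto_iff_norm_sub_tendsto_zero.1 this
    simpa only [Function.comp_apply, H.toL2_incl] using this
  have hsub : Icc 0 t ⊆ Icc 0 T := Icc_subset_Icc_right ht.2
  have lI : Tendsto (fun i => ∫ r in (0 : ℝ)..t,
      (ε * ‖contRep (u' i r).toL2 - contRep (u r).toL2‖ + ‖n' i r - n r‖)) l (𝓝 0) := by
    have cw : ∀ i, Continuous fun r => ‖contRep (u' i r).toL2 - contRep (u r).toL2‖ := fun i =>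
      (((H.continuous_contRep (by linarith)).comp (h' i).continuous_u).sub
        ((H.continuous_contRep (by linarith)).comp h.continuous_u)).norm
    have l1 : Tendsto (fun i => ∫ r in (0 : ℝ)..t, ‖contRep (u' i r).toL2 - contRep (u r).toL2‖) l
        (𝓝 (∫ r in (0 : ℝ)..t, (0 : ℝ))) := by
      refine intervalIntegral.tendsto_integral_filter_of_dominated_convergence (fun _ => P + P)
        (Eventually.of_forall fun i => (cw i).aestronglyMeasurable)
        (Eventually.of_forall fun i => Eventually.of_forall fun r hr => ?_) (by simp)
        (Eventually.of_forall fun r hr => ?_)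
      · rw [uIoc_of_le ht.1] at hr
        have hr' := hsub ⟨hr.1.le, hr.2⟩
        rw [norm_norm]
        exact (norm_sub_le _ _).trans (add_le_add (hP' i r hr') (hP r hr'))
      · rw [uIoc_of_le ht.1] at hr
        exact lw r (hsub ⟨hr.1.le, hr.2⟩)
    have l2 : Tendsto (fun i => ∫ r in (0 : ℝ)..t, ‖n' i r - n r‖) l (𝓝 0) := by
      refine squeeze_zero (fun i => intervalIntegral.integral_nonneg ht.1 fun r _ => norm_nonneg _)
        (fun i => ?_) hl
      exact intervalIntegral.integral_mono_interval le_rfl ht.1 ht.2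
        (Eventually.of_forall fun r => norm_nonneg _) ((h' i).integrable_norm_sub h 0 T)
    have := (l1.const_mul ε).add l2
    rw [intervalIntegral.integral_zero, mul_zero, add_zero] at this
    refine this.congr fun i => ?_
    rw [intervalIntegral.integral_add (((cw i).intervalIntegrable _ _).const_mul ε)
      ((h' i).integrable_norm_sub h 0 t), intervalIntegral.integral_const_mul]
  obtain ⟨L, hL, hW⟩ := h.fieldBound hε hβ hP
  have lS : ∀ y, Tendsto (fun i => Ψ' i t y) l (𝓝 (Ψ t y)) := by
    intro y
    have b : ∀ i, dist (Ψ' i t y) (Ψ t y) ≤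
        (ε ^ 2)⁻¹ * Real.exp ((ε⁻¹ + (ε ^ 2)⁻¹ + (ε ^ 2)⁻¹ * L) * T) * ∫ r in (0 : ℝ)..t,
          (ε * ‖contRep (u' i r).toL2 - contRep (u r).toL2‖ + ‖n' i r - n r‖) := by
      intro i
      have h1 := (h' i).flow_dist_le h hε hβ (hP' i) hL hW ht y
      have h2 : dist (Ψ' i t y) (Ψ t y) ≤
          dist (Ψ' i t y).1 (Ψ t y).1 + |(Ψ' i t y).2 - (Ψ t y).2| := by
        rw [Prod.dist_eq, Real.dist_eq]
        exact max_le_add_of_nonneg dist_nonneg (abs_nonneg _)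
      refine (h2.trans h1).trans (mul_le_mul_of_nonneg_left ?_ (by positivity))
      have c1 : Continuous fun s => contRep (u' i s).toL2 :=
        (H.continuous_contRep (by linarith)).comp (h' i).continuous_u
      have c2 : Continuous fun s => contRep (u s).toL2 :=
        (H.continuous_contRep (by linarith)).comp h.continuous_u
      have c3 : Continuous fun q : C(Torus, ℝ) × Torus => q.1 q.2 := by fun_prop
      have cont : ContinuousOn
          (fun r => (contRep (u' i r).toL2 - contRep (u r).toL2) (Ψ' i r y).1) (Icc 0 t) :=
        c3.comp_continuousOn
          (f := fun r => (contRep (u' i r).toL2 - contRep (u r).toL2, (Ψ' i r y).1))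
          ((c1.sub c2).continuousOn.prodMk ((h' i).curve t y).contX)
      refine intervalIntegral.integral_mono_on ht.1 ?_ ?_ fun r hr => ?_
      · exact ((intervalIntegrable_of_Icc cont.abs.integrableOn_Icc ⟨le_rfl, ht.1⟩
          ⟨ht.1, le_rfl⟩).const_mul ε).add ((h' i).integrable_norm_sub h 0 t)
      · exact (((c1.sub c2).norm.intervalIntegrable _ _).const_mul ε).add
          ((h' i).integrable_norm_sub h 0 t)
      · gcongr
        exact (contRep (u' i r).toL2 - contRep (u r).toL2).norm_coe_le_norm _
    rw [tendsto_iff_dist_tendsto_zero]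
    refine squeeze_zero (fun i => dist_nonneg) b ?_
    simpa using lI.const_mul ((ε ^ 2)⁻¹ * Real.exp ((ε⁻¹ + (ε ^ 2)⁻¹ + (ε ^ 2)⁻¹ * L) * T))
  exact G.tendsto_of_transport (by linarith)
    (velConst_pos hε h.nonneg (bound_nonneg hT hP) hT).le (S := fun i => Ψ' i t)
    (c := fun _ => Real.exp (t / ε ^ 2))
    (Eventually.of_forall fun i => (h' i).transport_bounds hε hβ (hP' i) ht)
    ⟨(h.transport_bounds hε hβ hP ht).1, (h.transport_bounds hε hβ hP ht).2.1,
      (h.transport_bounds hε hβ hP ht).2.2.1⟩ tendsto_const_nhds lS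

end KineticSolution

end Kinetic

namespace Kinetic

/-! ### Time regularity of the density -/

variable {k : ℝ}

theorem one_add_rpow_le (hk : 0 ≤ k) {a : ℝ} (ha : 0 ≤ a) : (1 + a) ^ k ≤ 2 ^ k * (1 + a ^ k) := by
  have e1 : 1 + a ≤ 2 * max 1 a := by
    linarith [le_max_left 1 a, le_max_right 1 a]
  have e2 : (max 1 a) ^ k ≤ 1 + a ^ k := by
    have := Real.rpow_nonneg ha k
    rcases max_cases 1 a with ⟨e, -⟩ | ⟨e, -⟩ <;> rw [e]
    · rw [Real.one_rpow]; linarith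
    · linarith
  calc (1 + a) ^ k ≤ (2 * max 1 a) ^ k := Real.rpow_le_rpow (by positivity) e1 hk
    _ = 2 ^ k * (max 1 a) ^ k := Real.mul_rpow (by positivity) (by positivity)
    _ ≤ _ := by gcongr

/-- The constant in the bound of the gradient of elements of `𝓒_k` along characteristics. -/
def gradConst (k κ : ℝ) : ℝ := 2 * (1 + κ) ^ (k - 1) * 2 ^ k

theorem gradConst_nonneg {κ : ℝ} (hκ : 0 ≤ κ) : 0 ≤ gradConst k κ := by
  unfold gradConst; positivity

theorem grad_le (hk : 1 ≤ k) {κ a : ℝ} (hκ : 0 ≤ κ) (ha : 0 ≤ a) {ξ : Phase → ℝ}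
    (hξ : Nk k ξ ≠ ∞) {z : Phase} (hz : |z.2| ≤ κ * (1 + a)) :
    (1 + a) * max |dX ξ z| |dV ξ z| ≤ nk k ξ * (gradConst k κ * (1 + a ^ k)) := by
  have hv := abs_nonneg z.2
  have h1 : (1 + |z.2|) * max |dX ξ z| |dV ξ z| ≤ nk k ξ * wt k z := by
    rw [mul_max_of_nonneg _ _ (by positivity)]
    exact max_le (dX_le_nk hξ z) (dV_le_nk hξ z)
  have h2 : wt k z ≤ (1 + |z.2|) * (2 * (1 + |z.2|) ^ (k - 1)) := by
    have e : (1 + |z.2|) * (2 * (1 + |z.2|) ^ (k - 1)) = 2 * (1 + |z.2|) ^ k := by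
      rw [Real.rpow_sub_one (by positivity)]; field_simp
    rw [e]
    have e1 : (1 : ℝ) ≤ (1 + |z.2|) ^ k := Real.one_le_rpow (by linarith) (by linarith)
    have e2 : |z.2| ^ k ≤ (1 + |z.2|) ^ k := Real.rpow_le_rpow hv (by linarith) (by linarith)
    unfold wt
    linarith
  have h3 : max |dX ξ z| |dV ξ z| ≤ nk k ξ * (2 * (1 + |z.2|) ^ (k - 1)) := by
    have := h1.trans (mul_le_mul_of_nonneg_left h2 (nk_nonneg ξ))
    rw [mul_left_comm] at this
    exact le_of_mul_le_mul_left this (by positivity)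
  have h4 : (1 + |z.2|) ^ (k - 1) ≤ (1 + κ) ^ (k - 1) * (1 + a) ^ (k - 1) := by
    rw [← Real.mul_rpow (by positivity) (by positivity)]
    refine Real.rpow_le_rpow (by positivity) ?_ (by linarith)
    linarith
  have h5 : (1 + a) * (1 + a) ^ (k - 1) ≤ 2 ^ k * (1 + a ^ k) := by
    have e : (1 + a) * (1 + a) ^ (k - 1) = (1 + a) ^ k := by
      rw [Real.rpow_sub_one (by positivity)]; field_simp
    rw [e]
    exact one_add_rpow_le (by linarith) ha
  have hn := nk_nonneg (k := k) ξ
  calc (1 + a) * max |dX ξ z| |dV ξ z|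
      ≤ (1 + a) * (nk k ξ * (2 * ((1 + κ) ^ (k - 1) * (1 + a) ^ (k - 1)))) := by
        refine mul_le_mul_of_nonneg_left (h3.trans ?_) (by positivity)
        gcongr
    _ = nk k ξ * (2 * (1 + κ) ^ (k - 1)) * ((1 + a) * (1 + a) ^ (k - 1)) := by ring
    _ ≤ nk k ξ * (2 * (1 + κ) ^ (k - 1)) * (2 ^ k * (1 + a ^ k)) := by gcongr
    _ = _ := by unfold gradConst; ring

theorem abs_lift_sub_le {ξ : Phase → ℝ} (hξ : ContDiff ℝ 1 (lift ξ)) {R N : ℝ}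
    (hN : ∀ z : Phase, |z.2| ≤ R → max |dX ξ z| |dV ξ z| ≤ N) {p q : ℝ × ℝ} (hp : |p.2| ≤ R)
    (hq : |q.2| ≤ R) : |lift ξ p - lift ξ q| ≤ 2 * N * (|p.1 - q.1| + |p.2 - q.2|) := by
  have hN0 : 0 ≤ N := (le_max_of_le_left (abs_nonneg _)).trans (hN ((p.1 : Torus), p.2) hp)
  have conv : Convex ℝ ((univ : Set ℝ) ×ˢ Icc (-R) R) := convex_univ.prod (convex_Icc _ _)
  have key := Convex.norm_image_sub_le_of_norm_fderiv_le (𝕜 := ℝ) (f := lift ξ) (C := 2 * N)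
    (fun x _ => hξ.differentiable one_ne_zero x) (fun x hx => ?_) conv
    (x := q) (y := p) ⟨mem_univ _, abs_le.1 hq⟩ ⟨mem_univ _, abs_le.1 hp⟩
  · refine key.trans (mul_le_mul_of_nonneg_left ?_ (by positivity))
    rw [Prod.norm_def]
    exact max_le_add_of_nonneg (norm_nonneg _) (norm_nonneg _)
  · refine ContinuousLinearMap.opNorm_le_bound _ (by positivity) fun w => ?_
    have e : fderiv ℝ (lift ξ) x w = w.1 * dX ξ ((x.1 : Torus), x.2) +
        w.2 * dV ξ ((x.1 : Torus), x.2) := fderiv_lift hξ x.1 x.2 w.1 w.2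
    have hb := hN ((x.1 : Torus), x.2) (abs_le.2 hx.2)
    rw [e]
    refine (norm_add_le _ _).trans ?_
    rw [norm_mul, norm_mul]
    have h1 : ‖w.1‖ * ‖dX ξ ((x.1 : Torus), x.2)‖ ≤ ‖w‖ * N :=
      mul_le_mul (norm_fst_le w) ((le_max_left _ _).trans hb) (norm_nonneg _) (norm_nonneg _)
    have h2 : ‖w.2‖ * ‖dV ξ ((x.1 : Torus), x.2)‖ ≤ ‖w‖ * N :=
      mul_le_mul (norm_snd_le w) ((le_max_right _ _).trans hb) (norm_nonneg _) (norm_nonneg _)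
    linarith

namespace KineticSolution

variable {η β ε C : ℝ} {n : ℝ → C(Torus, ℝ)} {f₀ : G k} {u₀ : H η}
  {f : ℝ → G k} {u : ℝ → H β} {Ψ : ℝ → Phase ≃ₜ Phase} {t T P : ℝ}

/-- The lift of the characteristic curves to `ℝ × ℝ`. -/
def lifted (ε : ℝ) (Ψ : ℝ → Phase ≃ₜ Phase) (x v s : ℝ) : ℝ × ℝ :=
  (x + ∫ σ in (0 : ℝ)..s, ε⁻¹ * (Ψ σ ((x : Torus), v)).2, (Ψ s ((x : Torus), v)).2)

theorem lift_lifted (h : KineticSolution ε C n f₀ u₀ f u Ψ) (ξ : Phase → ℝ) (x v : ℝ) {s : ℝ}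
    (hs : 0 ≤ s) : lift ξ (lifted ε Ψ x v s) = ξ (Ψ s ((x : Torus), v)) := by
  have e := (h.curve s ((x : Torus), v)).eqX s ⟨hs, le_rfl⟩
  unfold lift lifted
  congr 1
  refine Prod.ext ?_ rfl
  simp only [] at e ⊢
  rw [e, AddCircle.coe_add]

/-- The constant in the Lipschitz bound of the characteristic curves. -/
def speedConst (ε C T P : ℝ) : ℝ :=
  ε⁻¹ * velConst ε C T P + (ε ^ 2)⁻¹ * (velConst ε C T P + (ε * P + C))

theorem lifted_sub_le (h : KineticSolution ε C n f₀ u₀ f u Ψ) (hε : 0 < ε) (hβ : 3 / 2 < β)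
    (hP : ∀ s ∈ Icc 0 T, ‖contRep (u s).toL2‖ ≤ P) (x v : ℝ) {a b : ℝ} (ha : a ∈ Icc 0 T)
    (hb : b ∈ Icc 0 T) :
    |(lifted ε Ψ x v b).1 - (lifted ε Ψ x v a).1| + |(lifted ε Ψ x v b).2 - (lifted ε Ψ x v a).2| ≤
      speedConst ε C T P * (1 + |v|) * |b - a| := by
  have hT := ha.1.trans ha.2
  have hP0 := bound_nonneg hT hP
  have hC := h.nonneg
  have hκ := velConst_pos hε hC hP0 hT
  obtain ⟨L, hL, hW⟩ := h.fieldBound hε hβ hP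
  have hcur := h.curve T ((x : Torus), v)
  have h0 : (0 : ℝ) ∈ Icc 0 T := ⟨le_rfl, hT⟩
  have iV := hcur.integrableOn_V
  have iW := hW.integrableOn hcur.contX
  have hsub : ∀ σ ∈ uIoc a b, σ ∈ Icc 0 T := fun σ hσ =>
    (uIcc_subset_Icc ha hb) (uIoc_subset_uIcc hσ)
  have hV : ∀ σ ∈ uIoc a b, |(Ψ σ ((x : Torus), v)).2| ≤ velConst ε C T P * (1 + |v|) :=
    fun σ hσ => h.abs_flow_le hε hβ hP (hsub σ hσ) _
  have e1 : |(lifted ε Ψ x v b).1 - (lifted ε Ψ x v a).1| ≤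
      ε⁻¹ * (velConst ε C T P * (1 + |v|)) * |b - a| := by
    have ii : ∀ {r}, r ∈ Icc 0 T → IntervalIntegrable
        (fun σ => ε⁻¹ * (Ψ σ ((x : Torus), v)).2) MeasureTheory.volume 0 r := fun hr =>
      (intervalIntegrable_of_Icc iV h0 hr).const_mul _
    unfold lifted
    simp only [add_sub_add_left_eq_sub]
    rw [intervalIntegral.integral_interval_sub_left (ii hb) (ii ha), ← Real.norm_eq_abs]
    refine intervalIntegral.norm_integral_le_of_norm_le_const fun σ hσ => ?_
    rw [Real.norm_eq_abs, abs_mul, abs_of_pos (inv_pos.2 hε)]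
    exact mul_le_mul_of_nonneg_left (hV σ hσ) (inv_pos.2 hε).le
  have e2 : |(lifted ε Ψ x v b).2 - (lifted ε Ψ x v a).2| ≤
      (ε ^ 2)⁻¹ * (velConst ε C T P * (1 + |v|) + (ε * P + C)) * |b - a| := by
    have ii : ∀ {r}, r ∈ Icc 0 T → IntervalIntegrable
        (fun σ => -(ε ^ 2)⁻¹ * (Ψ σ ((x : Torus), v)).2 + (ε ^ 2)⁻¹ *
          (ε • contRep (u σ).toL2 + n σ) (Ψ σ ((x : Torus), v)).1) MeasureTheory.volume 0 r :=
      fun hr => intervalIntegrable_of_Icc ((iV.const_mul _).add (iW.const_mul _)) h0 hr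
    unfold lifted
    simp only []
    have q1 := hcur.eqV b hb
    have q2 := hcur.eqV a ha
    simp only [] at q1 q2
    rw [q1, q2, add_sub_add_left_eq_sub, intervalIntegral.integral_interval_sub_left (ii hb) (ii ha),
      ← Real.norm_eq_abs]
    refine intervalIntegral.norm_integral_le_of_norm_le_const fun σ hσ => ?_
    refine (norm_add_le _ _).trans ?_
    rw [Real.norm_eq_abs, Real.norm_eq_abs, abs_mul, abs_mul, abs_neg,
      abs_of_pos (by positivity : 0 < (ε ^ 2)⁻¹), mul_add]
    gcongr
    · exact hV σ hσ
    · exact hW.abs_apply_le (hsub σ hσ) _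
  have e3 : ε * P + C ≤ (ε * P + C) * (1 + |v|) :=
    le_mul_of_one_le_right (by positivity) (by linarith [abs_nonneg v])
  calc _ ≤ ε⁻¹ * (velConst ε C T P * (1 + |v|)) * |b - a| +
        (ε ^ 2)⁻¹ * (velConst ε C T P * (1 + |v|) + (ε * P + C) * (1 + |v|)) * |b - a| :=
        add_le_add e1 (e2.trans (by gcongr))
    _ = _ := by unfold speedConst; ring

theorem abs_comp_flow_sub_le (h : KineticSolution ε C n f₀ u₀ f u Ψ) (hk : 1 ≤ k) (hε : 0 < ε)
    (hβ : 3 / 2 < β) (hP : ∀ s ∈ Icc 0 T, ‖contRep (u s).toL2‖ ≤ P) {ξ : Phase → ℝ}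
    (hξ : ContDiff ℝ 1 (lift ξ)) (hξ' : Nk k ξ ≠ ∞) {a b : ℝ} (ha : a ∈ Icc 0 T)
    (hb : b ∈ Icc 0 T) (y : Phase) :
    |ξ (Ψ b y) - ξ (Ψ a y)| ≤ 2 * (gradConst k (velConst ε C T P) * speedConst ε C T P) *
      nk k ξ * |b - a| * wt k y := by
  obtain ⟨x, v⟩ := y
  obtain ⟨x, rfl⟩ := QuotientAddGroup.mk_surjective x
  have hT := ha.1.trans ha.2
  have hκ := velConst_pos hε h.nonneg (bound_nonneg hT hP) hT
  have h1 : |lift ξ (lifted ε Ψ x v b) - lift ξ (lifted ε Ψ x v a)| ≤ _ :=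
    abs_lift_sub_le hξ (R := velConst ε C T P * (1 + |v|))
    (N := nk k ξ * (gradConst k (velConst ε C T P) * (1 + |v| ^ k)) / (1 + |v|))
    (fun z hz => by
      rw [le_div_iff₀ (by positivity), mul_comm]
      exact grad_le hk hκ.le (abs_nonneg v) hξ' hz)
    (h.abs_flow_le hε hβ hP hb _) (h.abs_flow_le hε hβ hP ha _)
  rw [h.lift_lifted ξ x v ha.1, h.lift_lifted ξ x v hb.1] at h1
  refine h1.trans ?_
  have h2 := h.lifted_sub_le hε hβ hP x v ha hb
  have := gradConst_nonneg (k := k) hκ.le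
  have hn := nk_nonneg (k := k) ξ
  calc _ ≤ 2 * (nk k ξ * (gradConst k (velConst ε C T P) * (1 + |v| ^ k)) / (1 + |v|)) *
        (speedConst ε C T P * (1 + |v|) * |b - a|) := by gcongr
    _ = _ := by
        have : 1 + |v| ≠ 0 := by positivity
        unfold wt
        field_simp

theorem integral_mul (h : KineticSolution ε C n f₀ u₀ f u Ψ) (ht : 0 ≤ t) (ξ : Phase → ℝ) :
    ∫ z, f t z * ξ z ∂dxdv = ∫ y, f₀ y * ξ (Ψ t y) ∂dxdv := h.integral_smul ht ξ

theorem integrable_mul_comp (h : KineticSolution ε C n f₀ u₀ f u Ψ) (ht : 0 ≤ t) {ξ : Phase → ℝ}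
    (hξ : Continuous ξ) (hξ' : Nk k ξ ≠ ∞) : Integrable (fun y => f₀ y * ξ (Ψ t y)) dxdv :=
  (h.integrable_smul_iff ht (Θ := ξ)).1
    (G.integrable_mul hξ.aestronglyMeasurable fun z => abs_le_nk hξ' z)

theorem abs_integral_sub_le (h : KineticSolution ε C n f₀ u₀ f u Ψ) (hk : 1 ≤ k) (hε : 0 < ε)
    (hβ : 3 / 2 < β) (hP : ∀ s ∈ Icc 0 T, ‖contRep (u s).toL2‖ ≤ P) {ξ : Phase → ℝ}
    (hξ : ContDiff ℝ 1 (lift ξ)) (hξ' : Nk k ξ ≠ ∞) {a b : ℝ} (ha : a ∈ Icc 0 T)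
    (hb : b ∈ Icc 0 T) :
    |∫ z, f b z * ξ z ∂dxdv - ∫ z, f a z * ξ z ∂dxdv| ≤
      2 * (gradConst k (velConst ε C T P) * speedConst ε C T P) * ‖f₀‖ * nk k ξ * |b - a| := by
  have cξ : Continuous ξ := continuous_of_lift hξ.continuous
  rw [h.integral_mul ha.1, h.integral_mul hb.1,
    ← integral_sub (h.integrable_mul_comp hb.1 cξ hξ') (h.integrable_mul_comp ha.1 cξ hξ')]
  simp only [← mul_sub]
  refine (G.abs_integral_mul_le f₀ fun y => h.abs_comp_flow_sub_le hk hε hβ hP hξ hξ' ha hb y).trans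
    (le_of_eq (by ring))

theorem hasDerivWithinAt_comp_flow (h : KineticSolution ε C n f₀ u₀ f u Ψ) (hε : 0 < ε)
    (hβ : 3 / 2 < β) (ht : 0 ≤ t) (hn : ContinuousWithinAt n (Ioi t) t) {ξ : Phase → ℝ}
    (hξ : ContDiff ℝ 1 (lift ξ)) (y : Phase) :
    HasDerivWithinAt (fun r => ξ (Ψ r y)) (drift ε (n t) (contRep (u t).toL2) ξ 0 (Ψ t y))
      (Ici t) t := by
  obtain ⟨x, v⟩ := y
  obtain ⟨x, rfl⟩ := QuotientAddGroup.mk_surjective x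
  have hT : 0 ≤ t + 1 := by linarith
  have htm : t ∈ Icc 0 (t + 1) := ⟨ht, by linarith⟩
  have cu : Continuous fun s => contRep (u s).toL2 :=
    (H.continuous_contRep (by linarith)).comp h.continuous_u
  obtain ⟨P, hP⟩ := exists_norm_le cu (t + 1)
  obtain ⟨L, hL, hW⟩ := h.fieldBound hε hβ hP
  have hcur := h.curve (t + 1) ((x : Torus), v)
  have iV := hcur.integrableOn_V
  have iW := hW.integrableOn hcur.contX
  have nhd : Icc 0 (t + 1) ∈ 𝓝[>] t := mem_of_superset
    (Ioc_mem_nhdsGT (show t < t + 1 by linarith)) fun s hs => ⟨by linarith [hs.1], hs.2⟩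
  have cwt : ∀ {X : Type} [TopologicalSpace X] {g : ℝ → X}, ContinuousOn g (Icc 0 (t + 1)) →
      ContinuousWithinAt g (Ioi t) t := fun hg =>
    (hg t htm).mono_of_mem_nhdsWithin nhd
  have cV := cwt hcur.contV
  have cX := cwt hcur.contX
  have sm : ∀ {g : ℝ → ℝ}, IntegrableOn g (Icc 0 (t + 1)) →
      StronglyMeasurableAtFilter g (𝓝[>] t) MeasureTheory.volume := fun hg =>
    ⟨_, nhd, hg.aestronglyMeasurable⟩
  have d1 : HasDerivWithinAt (fun s => (lifted ε Ψ x v s).1)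
      (ε⁻¹ * (Ψ t ((x : Torus), v)).2) (Ici t) t := by
    have := intervalIntegral.integral_hasDerivWithinAt_right (s := Ici t) (t := Ioi t)
      (intervalIntegrable_of_Icc (iV.const_mul ε⁻¹) ⟨le_rfl, hT⟩ htm) (sm (iV.const_mul ε⁻¹))
      (cV.const_smul ε⁻¹)
    exact this.const_add x
  have iT := (iV.const_mul (-(ε ^ 2)⁻¹)).add (iW.const_mul (ε ^ 2)⁻¹)
  have d2 : HasDerivWithinAt (fun s => (lifted ε Ψ x v s).2)
      (-(ε ^ 2)⁻¹ * (Ψ t ((x : Torus), v)).2 + (ε ^ 2)⁻¹ *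
          (ε • contRep (u t).toL2 + n t) (Ψ t ((x : Torus), v)).1) (Ici t) t := by
    have c3 : Continuous fun q : C(Torus, ℝ) × Torus => q.1 q.2 := by fun_prop
    have cW : ContinuousWithinAt (fun s => (ε • contRep (u s).toL2 + n s) (Ψ s ((x : Torus), v)).1)
        (Ioi t) t :=
      (c3.tendsto _).comp (Tendsto.prodMk_nhds
        (((cu.const_smul ε).continuousWithinAt).add hn) cX)
    have := intervalIntegral.integral_hasDerivWithinAt_right (s := Ici t) (t := Ioi t)
      (intervalIntegrable_of_Icc iT ⟨le_rfl, hT⟩ htm) (sm iT)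
      ((cV.const_smul (-(ε ^ 2)⁻¹)).add (cW.const_smul (ε ^ 2)⁻¹))
    refine (this.const_add v).congr_of_eventuallyEq_of_mem ?_ (mem_Ici.2 le_rfl)
    filter_upwards [Icc_mem_nhdsGE (show t < t + 1 by linarith)] with s hs
    exact hcur.eqV s ⟨ht.trans hs.1, hs.2⟩
  have d3 := (hξ.differentiable one_ne_zero (lifted ε Ψ x v t)).hasFDerivAt.comp_hasDerivWithinAt t
    (d1.prodMk d2)
  have e := fderiv_lift hξ (lifted ε Ψ x v t).1 (lifted ε Ψ x v t).2 (ε⁻¹ * (Ψ t ((x : Torus), v)).2)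
    (-(ε ^ 2)⁻¹ * (Ψ t ((x : Torus), v)).2 + (ε ^ 2)⁻¹ *
          (ε • contRep (u t).toL2 + n t) (Ψ t ((x : Torus), v)).1)
  have e' : (((lifted ε Ψ x v t).1 : Torus), (lifted ε Ψ x v t).2) = Ψ t ((x : Torus), v) :=
    by
      have q := hcur.eqX t htm
      refine Prod.ext ?_ rfl
      unfold lifted
      simp only [] at q ⊢
      rw [q, AddCircle.coe_add]
  rw [e'] at e
  have d4 : HasDerivWithinAt (fun r => ξ (Ψ r ((x : Torus), v))) _ (Ici t) t :=
    d3.congr_of_eventuallyEq_of_mem (by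
      filter_upwards [self_mem_nhdsWithin] with s hs
      exact (h.lift_lifted ξ x v (ht.trans hs)).symm) (mem_Ici.2 le_rfl)
  refine d4.congr_deriv (e.trans ?_)
  unfold drift
  simp only [ContinuousMap.add_apply, ContinuousMap.smul_apply, smul_eq_mul, Pi.zero_apply, mul_zero]
  field_simp
  ring

theorem hasDerivWithinAt_integral (h : KineticSolution ε C n f₀ u₀ f u Ψ) (hk : 1 ≤ k)
    (hε : 0 < ε) (hβ : 3 / 2 < β) (ht : 0 ≤ t) (hn : ContinuousWithinAt n (Ioi t) t)
    {ξ : Phase → ℝ} (hξ : ContDiff ℝ 1 (lift ξ)) (hξ' : Nk k ξ ≠ ∞) :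
    HasDerivWithinAt (fun r => ∫ z, f r z * ξ z ∂dxdv)
      (∫ z, f t z * drift ε (n t) (contRep (u t).toL2) ξ 0 z ∂dxdv) (Ioi t) t := by
  have cξ : Continuous ξ := continuous_of_lift hξ.continuous
  have htm : t ∈ Icc 0 (t + 1) := ⟨ht, by linarith⟩
  obtain ⟨P, hP⟩ := exists_norm_le
    ((H.continuous_contRep (s := β) (by linarith)).comp h.continuous_u) (t + 1)
  have nhd : Ioc t (t + 1) ∈ 𝓝[>] t := Ioc_mem_nhdsGT (by linarith)
  rw [hasDerivWithinAt_iff_tendsto_slope' self_notMem_Ioi, h.integral_mul ht]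
  have key : Tendsto (fun r => ∫ y, f₀ y * slope (fun r => ξ (Ψ r y)) t r ∂dxdv) (𝓝[>] t)
      (𝓝 (∫ y, f₀ y * drift ε (n t) (contRep (u t).toL2) ξ 0 (Ψ t y) ∂dxdv)) := by
    refine tendsto_integral_filter_of_dominated_convergence
      (fun y => 2 * (gradConst k (velConst ε C (t + 1) P) * speedConst ε C (t + 1) P) *
        nk k ξ * (wt k y * |f₀ y|)) ?_ ?_ (f₀.integrable_wt_mul_abs.const_mul _) ?_
    · refine Eventually.of_forall fun r => f₀.aestronglyMeasurable.mul ?_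
      simp only [slope_def_field]
      exact (((cξ.comp (Ψ r).continuous).sub (cξ.comp (Ψ t).continuous)).div_const _)
        |>.aestronglyMeasurable
    · filter_upwards [nhd] with r hr
      refine Eventually.of_forall fun y => ?_
      have hr' : r ∈ Icc 0 (t + 1) := ⟨ht.trans hr.1.le, hr.2⟩
      have b := h.abs_comp_flow_sub_le hk hε hβ hP hξ hξ' htm hr' y
      have hpos : 0 < |r - t| := abs_pos.2 (sub_ne_zero.2 hr.1.ne')
      rw [norm_mul, slope_def_field, norm_div, Real.norm_eq_abs, Real.norm_eq_abs, Real.norm_eq_abs]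
      have : |ξ (Ψ r y) - ξ (Ψ t y)| / |r - t| ≤
          2 * (gradConst k (velConst ε C (t + 1) P) * speedConst ε C (t + 1) P) *
            nk k ξ * wt k y := by
        rw [div_le_iff₀ hpos]
        linarith
      have := mul_le_mul_of_nonneg_left this (abs_nonneg (f₀ y))
      linarith
    · refine Eventually.of_forall fun y => Tendsto.const_mul _ ?_
      exact (hasDerivWithinAt_iff_tendsto_slope' self_notMem_Ioi).1
        ((h.hasDerivWithinAt_comp_flow hε hβ ht hn hξ y).mono Ioi_subset_Ici_self)
  refine key.congr' ?_
  filter_upwards [self_mem_nhdsWithin] with r hr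
  have hr0 : 0 ≤ r := ht.trans (le_of_lt hr)
  simp only [slope_def_field]
  rw [h.integral_mul ht, h.integral_mul hr0, ← integral_sub (h.integrable_mul_comp hr0 cξ hξ')
    (h.integrable_mul_comp ht cξ hξ'), ← integral_div]
  refine integral_congr_ae (Eventually.of_forall fun y => ?_)
  simp only []
  ring

end KineticSolution

end Kinetic

namespace Kinetic

/-! ### Time regularity of the velocity -/

theorem hasSum_integral_fourier {c : ℤ → ℂ} {g φ : Torus → ℝ} (hc : Summable fun j => ‖c j‖)
    (hg : ∀ x, HasSum (fun j => c j * fourier j x) ((g x : ℝ) : ℂ)) (hφ : Integrable φ dx) :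
    HasSum (fun j => c j * fourierCoeff (fun x => ((φ x : ℝ) : ℂ)) (-j))
      ((∫ x, g x * φ x ∂dx : ℝ) : ℂ) := by
  have hF : ∀ j, Integrable (fun x => c j * (fourier j x * ((φ x : ℝ) : ℂ))) dx := fun j =>
    ((hφ.ofReal (𝕜 := ℂ)).bdd_mul (c := 1) (map_continuous (fourier j)).aestronglyMeasurable
      (Eventually.of_forall fun x => (norm_fourier_apply j x).le)).const_mul _
  have hs : Summable fun j => ∫ x, ‖c j * (fourier j x * ((φ x : ℝ) : ℂ))‖ ∂dx := by
    refine (hc.mul_right (∫ x, ‖φ x‖ ∂dx)).congr fun j => ?_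
    rw [← integral_const_mul]
    refine integral_congr_ae (Eventually.of_forall fun x => ?_)
    simp only [norm_mul, norm_fourier_apply, one_mul, Complex.norm_real]
  have key := hasSum_integral_of_summable_integral_norm hF hs
  have e : ∀ x, ∑' j, c j * (fourier j x * ((φ x : ℝ) : ℂ)) = ((g x * φ x : ℝ) : ℂ) := by
    intro x
    have := ((hg x).mul_right ((φ x : ℝ) : ℂ)).tsum_eq
    simp only [mul_assoc] at this
    rw [this]
    push_cast
    rfl
  simp only [e] at key
  rw [integral_complex_ofReal] at key
  refine Eq.subst (motive := fun F => HasSum F _) (funext fun j => ?_) key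
  rw [integral_const_mul]
  unfold fourierCoeff
  simp only [neg_neg, smul_eq_mul]

theorem MemC2.hasSum_fourier {ζ : Torus → ℝ} (h : MemC2 ζ) :
    (Summable fun j => ‖fourierCoeff (fun x => ((ζ x : ℝ) : ℂ)) j‖) ∧
    ∀ x, HasSum (fun j => fourierCoeff (fun x => ((ζ x : ℝ) : ℂ)) j * fourier j x)
      ((ζ x : ℝ) : ℂ) := by
  obtain ⟨U, hU⟩ := h.mem_sobolev (α := 2) le_rfl
  have e : ∀ j, coeff U.toL2 j = fourierCoeff (fun x => ((ζ x : ℝ) : ℂ)) j := fun j => by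
    rw [hU]
    exact coeff_congr (coe_contL2 h.toC) j
  have h1 := (H.summable_coeff (by norm_num) U).1
  have h2 := hasSum_contRep h1
  simp only [e] at h1 h2
  refine ⟨h1, fun x => ?_⟩
  have := h2 x
  rwa [hU, contRep_contL2] at this

theorem MemC2.lam_mul_norm_le {ζ : Torus → ℝ} (h : MemC2 ζ) (hζ : C2norm ζ ≠ ∞) (j : ℤ) :
    lam j * ‖fourierCoeff (fun x => ((ζ x : ℝ) : ℂ)) j‖ ≤ c2 ζ := by
  have e := h.fourierCoeff_dT_dT j
  have e2 : ‖fourierCoeff (fun x => ((dT (dT ζ) x : ℝ) : ℂ)) j‖ ≤ c2 ζ := by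
    unfold fourierCoeff
    refine (norm_integral_le_of_norm_le_const (C := c2 ζ) (Eventually.of_forall fun x => ?_)).trans
      (by simp)
    rw [norm_smul, norm_fourier_apply, one_mul, Complex.norm_real]
    exact abs_dT_dT_le_c2 hζ x
  rw [e, norm_mul, norm_neg, Complex.norm_real, Real.norm_of_nonneg (lam_nonneg j)] at e2
  exact e2

theorem lam_neg (j : ℤ) : lam (-j) = lam j := by
  unfold lam; push_cast; ring

theorem summable_of_sq {a : ℤ → ℝ} (h0 : ∀ j, 0 ≤ a j)
    (h : Summable fun j => (1 + lam j) ^ (1 : ℝ) * a j ^ 2) : Summable a := by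
  have h1 := summable_one_add_lam_rpow (s := 1) (by norm_num)
  refine Summable.of_nonneg_of_le h0 (fun j => ?_) (h.add h1)
  have hp := one_add_lam_pos j
  rw [Real.rpow_one, Real.rpow_neg_one, ← sub_nonneg]
  have e : (1 + lam j) * a j ^ 2 + (1 + lam j)⁻¹ - a j =
      (((1 + lam j) * a j - 1 / 2) ^ 2 + 3 / 4) / (1 + lam j) := by
    field_simp
    ring
  rw [e]
  positivity

/-- The solution of `A' = -l A + F` given by Duhamel's formula. -/
theorem duhamel_sub_eq {l T : ℝ} {A0 : ℂ} {A F : ℝ → ℂ} (hF : ContinuousOn F (Icc 0 T))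
    (hA : ∀ t ∈ Icc 0 T, A t = (Real.exp (-l * t) : ℂ) * A0 + ∫ s in (0 : ℝ)..t,
      (Real.exp (-l * (t - s)) : ℂ) * F s) :
    ContinuousOn A (Icc 0 T) ∧ ∀ a ∈ Icc 0 T, ∀ b ∈ Icc 0 T,
      A b - A a = ∫ s in a..b, (-(l : ℂ) * A s + F s) := by
  rcases lt_or_ge T 0 with hT | hT
  · rw [Icc_eq_empty (not_le.2 hT)]
    exact ⟨continuousOn_empty _, fun a ha => ha.elim⟩
  obtain ⟨F', hF'⟩ : ∃ F' : ℝ → ℂ, F' = fun s => F (max 0 (min s T)) := ⟨_, rfl⟩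
  have cF' : Continuous F' := by
    rw [hF']
    exact hF.comp_continuous (by fun_prop) fun r => ⟨le_max_left _ _, max_le hT (min_le_right _ _)⟩
  have eF' : ∀ s ∈ Icc 0 T, F' s = F s := fun s hs => by
    rw [hF']; simp only []; rw [min_eq_left hs.2, max_eq_right hs.1]
  obtain ⟨B, hB⟩ : ∃ B : ℝ → ℂ, B = fun t => (Real.exp (-l * t) : ℂ) * (A0 + ∫ s in (0 : ℝ)..t,
      (Real.exp (l * s) : ℂ) * F' s) := ⟨_, rfl⟩
  have cE : ∀ c : ℝ, Continuous fun s : ℝ => (Real.exp (c * s) : ℂ) := fun c =>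
    Complex.continuous_ofReal.comp (by fun_prop)
  have dE : ∀ t : ℝ, HasDerivAt (fun t : ℝ => (Real.exp (-l * t) : ℂ))
      ((-l * Real.exp (-l * t) : ℝ) : ℂ) t := fun t => by
    have := ((hasDerivAt_id t).const_mul (-l)).exp
    simp only [mul_one, id_eq] at this
    rw [mul_comm]
    exact this.ofReal_comp
  have dB : ∀ t, HasDerivAt B (-(l : ℂ) * B t + F' t) t := by
    intro t
    have c1 : Continuous fun s : ℝ => (Real.exp (l * s) : ℂ) * F' s := (cE l).mul cF'
    have h1 := (dE t).mul ((c1.integral_hasStrictDerivAt 0 t).hasDerivAt.const_add A0)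
    rw [hB]
    refine h1.congr_deriv ?_
    have : (Real.exp (-l * t) : ℂ) * (Real.exp (l * t) : ℂ) = 1 := by
      rw [← Complex.ofReal_mul, ← Real.exp_add]; simp
    rw [← mul_assoc, this]
    push_cast
    ring
  have cB : Continuous B := continuous_iff_continuousAt.2 fun t => (dB t).continuousAt
  have eA : ∀ t ∈ Icc 0 T, A t = B t := by
    intro t ht
    rw [hA t ht, hB]
    simp only []
    rw [mul_add, ← intervalIntegral.integral_const_mul]
    congr 1
    refine intervalIntegral.integral_congr fun s hs => ?_
    rw [uIcc_of_le ht.1] at hs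
    rw [eF' s ⟨hs.1, hs.2.trans ht.2⟩, ← mul_assoc, ← Complex.ofReal_mul, ← Real.exp_add]
    congr 3
    ring
  refine ⟨cB.continuousOn.congr eA, fun a ha b hb => ?_⟩
  rw [eA a ha, eA b hb, ← intervalIntegral.integral_eq_sub_of_hasDerivAt (fun t _ => dB t)
    ((((continuous_const.mul cB).add cF').intervalIntegrable _ _))]
  refine intervalIntegral.integral_congr fun s hs => ?_
  have hs' := uIcc_subset_Icc ha hb hs
  rw [eA s hs', eF' s hs']

namespace KineticSolution

variable {k η β ε C : ℝ} {n : ℝ → C(Torus, ℝ)} {f₀ : G k} {u₀ : H η}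
  {f : ℝ → G k} {u : ℝ → H β} {Ψ : ℝ → Phase ≃ₜ Phase} {t T P : ℝ}

/-- The time derivative of `⟨u, ζ⟩`. -/
def rateU (ε : ℝ) (f : G k) (w : C(Torus, ℝ)) (ζ : Torus → ℝ) : ℝ :=
  ∫ x, w x * dT (dT ζ) x ∂dx + ∫ z, f z * drift ε 0 w 0 ζ z ∂dxdv

theorem drift_zero (w : C(Torus, ℝ)) (ζ : Torus → ℝ) (z : Phase) :
    drift ε 0 w 0 ζ z = (z.2 - ε * w z.1) * ζ z.1 := by
  have e1 : dV (0 : Phase → ℝ) z = 0 := by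
    unfold dV; simp
  have e2 : dX (0 : Phase → ℝ) z = 0 := by
    unfold dX; simp
  unfold drift
  rw [e1, e2]
  ring

theorem hasSum_force (hk : 1 ≤ k) (f : G k) (w : C(Torus, ℝ)) {ζ : Torus → ℝ} (hζ : MemC2 ζ) :
    HasSum (fun j => fourierCoeff (fun x => ((ζ x : ℝ) : ℂ)) (-j) * forceCoeff ε f w j)
      ((∫ z, f z * drift ε 0 w 0 ζ z ∂dxdv : ℝ) : ℂ) := by
  have one : Continuous fun _ : Torus => (1 : ℝ) := continuous_const
  obtain ⟨i1, e1⟩ := G.integral_mul_momentum (f := f) hk hζ.continuous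
  obtain ⟨i2, e2⟩ := G.integral_mul_rho (f := f) (ζ := fun x => w x * ζ x)
    (w.continuous.mul hζ.continuous)
  obtain ⟨i3, -⟩ := G.integral_mul_momentum (f := f) hk one
  obtain ⟨i4, -⟩ := G.integral_mul_rho (f := f) w.continuous
  have iφ : Integrable (fun x => momentum f x - ε * rho f x * w x) dx := by
    refine (i3.sub (i4.const_mul ε)).congr (Eventually.of_forall fun x => ?_)
    simp only [Pi.sub_apply]
    ring
  have key := hasSum_integral_fourier hζ.hasSum_fourier.1 hζ.hasSum_fourier.2 iφ
  have e : ∫ x, ζ x * (momentum f x - ε * rho f x * w x) ∂dx =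
      ∫ z, f z * drift ε 0 w 0 ζ z ∂dxdv := by
    have h1 : ∫ x, ζ x * (momentum f x - ε * rho f x * w x) ∂dx =
        ∫ z, f z * (z.2 * ζ z.1) ∂dxdv - ε * ∫ z, f z * (w z.1 * ζ z.1) ∂dxdv := by
      rw [← e1, ← e2, ← integral_const_mul, ← integral_sub i1 (i2.const_mul ε)]
      refine integral_congr_ae (Eventually.of_forall fun x => ?_)
      simp only []
      ring
    obtain ⟨K, hK⟩ := isCompact_univ.exists_bound_of_continuousOn hζ.continuous.continuousOn
    have hK0 : 0 ≤ K := (norm_nonneg _).trans (hK 0 (mem_univ _))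
    have j1 : Integrable (fun z => f z * (z.2 * ζ z.1)) dxdv := by
      have := hζ.continuous
      refine G.integrable_mul (C := K) (by fun_prop) fun z => ?_
      rw [abs_mul, mul_comm]
      exact mul_le_mul (hK _ (mem_univ _)) (abs_snd_le_wt hk z) (abs_nonneg _) hK0
    have j2 : Integrable (fun z => f z * (w z.1 * ζ z.1)) dxdv := by
      have := hζ.continuous
      refine G.integrable_mul (C := ‖w‖ * K) (by fun_prop) fun z => ?_
      rw [abs_mul]
      exact (mul_le_mul (abs_apply_le w _) (hK _ (mem_univ _)) (abs_nonneg _) (norm_nonneg _)).trans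
        (le_mul_of_one_le_right (by positivity) (one_le_wt z))
    rw [h1, ← integral_const_mul, ← integral_sub j1 (j2.const_mul ε)]
    refine integral_congr_ae (Eventually.of_forall fun z => ?_)
    simp only [drift_zero]
    ring
  rw [e] at key
  rw [← (Equiv.neg ℤ).hasSum_iff]
  refine Eq.subst (motive := fun F => HasSum F _) (funext fun j => ?_) key
  simp only [Function.comp_apply, Equiv.neg_apply, neg_neg]
  rfl

theorem hasSum_rateU (hk : 1 ≤ k) (hβ : 1 / 2 < β) (f : G k) (u : H β) {ζ : Torus → ℝ}
    (hζ : MemC2 ζ) :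
    HasSum (fun j => fourierCoeff (fun x => ((ζ x : ℝ) : ℂ)) (-j) *
      (-(lam j : ℂ) * coeff u.toL2 j + forceCoeff ε f (contRep u.toL2) j))
      ((rateU ε f (contRep u.toL2) ζ : ℝ) : ℂ) := by
  have h1 := (H.summable_coeff hβ u).1
  have h2 := hasSum_integral_fourier h1 (hasSum_contRep h1)
    (integrable_of_continuous hζ.continuous_dT_dT)
  have h3 := h2.add (hasSum_force (ε := ε) hk f (contRep u.toL2) hζ)
  unfold rateU
  push_cast
  refine Eq.subst (motive := fun F => HasSum F _) (funext fun j => ?_) h3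
  rw [hζ.fourierCoeff_dT_dT, lam_neg]
  ring

theorem norm_f_le (h : KineticSolution ε C n f₀ u₀ f u Ψ) (hk : 1 ≤ k) (hε : 0 < ε)
    (hβ : 3 / 2 < β) (hP : ∀ s ∈ Icc 0 T, ‖contRep (u s).toL2‖ ≤ P) (ht : t ∈ Icc 0 T) :
    ‖f t‖ ≤ (1 + (2 * velConst ε C T P) ^ k) * ‖f₀‖ := by
  have hT := ht.1.trans ht.2
  have hκ := velConst_pos hε h.nonneg (bound_nonneg hT hP) hT
  have hpos := Real.exp_pos (t / ε ^ 2)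
  have e1 := h.integral_comp ht.1 fun z => wt k z * |f t z|
  have e2 : ∫ y, wt k (Ψ t y) * |f t (Ψ t y)| ∂dxdv =
      Real.exp (t / ε ^ 2) * ∫ y, wt k (Ψ t y) * |f₀ y| ∂dxdv := by
    rw [← integral_const_mul]
    refine integral_congr_ae ?_
    filter_upwards [h.transport t ht.1] with y hy
    rw [hy, abs_mul, abs_of_pos hpos]
    ring
  rw [e2, smul_eq_mul, ← G.norm_eq] at e1
  rw [← mul_left_cancel₀ hpos.ne' e1, G.norm_eq f₀, ← integral_const_mul]
  refine integral_mono_of_nonneg (Eventually.of_forall fun y => ?_)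
    (f₀.integrable_wt_mul_abs.const_mul _) (Eventually.of_forall fun y => ?_)
  · exact mul_nonneg (wt_pos _).le (abs_nonneg _)
  · simp only []
    rw [← mul_assoc]
    exact mul_le_mul_of_nonneg_right
      (wt_le_of_abs_le (by linarith) hκ.le (h.abs_flow_le hε hβ hP ht y)) (abs_nonneg _)

theorem abs_rateU_le (hk : 1 ≤ k) (hε : 0 < ε) (f : G k) {w : C(Torus, ℝ)} (hw : ‖w‖ ≤ P)
    {ζ : Torus → ℝ} (hζ : C2norm ζ ≠ ∞) :
    |rateU ε f w ζ| ≤ (P + (1 + ε * P) * ‖f‖) * c2 ζ := by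
  have hP0 : 0 ≤ P := (norm_nonneg _).trans hw
  have hc := c2_nonneg ζ
  have h1 : |∫ x, w x * dT (dT ζ) x ∂dx| ≤ P * c2 ζ := by
    rw [← Real.norm_eq_abs]
    refine (norm_integral_le_of_norm_le_const (C := P * c2 ζ) (Eventually.of_forall fun x => ?_)).trans
      (by simp)
    rw [norm_mul]
    exact mul_le_mul ((w.norm_coe_le_norm x).trans hw) (abs_dT_dT_le_c2 hζ x) (norm_nonneg _) hP0
  have h2 : |∫ z, f z * drift ε 0 w 0 ζ z ∂dxdv| ≤ (1 + ε * P) * c2 ζ * ‖f‖ := by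
    refine G.abs_integral_mul_le _ fun z => ?_
    rw [drift_zero, abs_mul]
    have e1 : |z.2 - ε * w z.1| ≤ (1 + ε * P) * wt k z := by
      refine (abs_sub _ _).trans ?_
      rw [abs_mul, abs_of_pos hε, add_mul, one_mul]
      refine add_le_add (abs_snd_le_wt hk z) ?_
      have : ε * |w z.1| ≤ ε * P := by
        gcongr; exact (abs_apply_le w _).trans hw
      exact this.trans (le_mul_of_one_le_right (by positivity) (one_le_wt z))
    have := wt_pos (k := k) z
    calc |z.2 - ε * w z.1| * |ζ z.1| ≤ ((1 + ε * P) * wt k z) * c2 ζ := by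
          gcongr; exact abs_le_c2 hζ _
      _ = _ := by ring
  unfold rateU
  refine (abs_add_le _ _).trans ?_
  linarith

theorem integral_contRep_sub_eq (h : KineticSolution ε C n f₀ u₀ f u Ψ) (hk : 1 ≤ k)
    (hε : 0 < ε) (hβ : 3 / 2 < β) (hη : 3 / 2 < η) (hT : 0 ≤ T) {ζ : Torus → ℝ} (hζ : MemC2 ζ)
    (hζ' : C2norm ζ ≠ ∞) :
    ContinuousOn (fun s => rateU ε (f s) (contRep (u s).toL2) ζ) (Icc 0 T) ∧
    ∀ a ∈ Icc 0 T, ∀ b ∈ Icc 0 T,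
      ∫ x, contRep (u b).toL2 x * ζ x ∂dx - ∫ x, contRep (u a).toL2 x * ζ x ∂dx =
        ∫ s in a..b, rateU ε (f s) (contRep (u s).toL2) ζ := by
  obtain ⟨A, P, hA, hAP⟩ := exists_coeff_bound (β := β) hk hε hβ hη h.nonneg hT f₀ u₀
  have hP : ∀ s ∈ Icc 0 T, ‖contRep (u s).toL2‖ ≤ P := fun s hs => (hAP h s hs).2
  have hA0 : ∀ j, 0 ≤ A j := fun j => (norm_nonneg _).trans ((hAP h 0 ⟨le_rfl, hT⟩).1 j)
  have sA : Summable A := summable_of_sq hA0 (hA 1 (by norm_num))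
  obtain ⟨z, hz⟩ : ∃ z : ℤ → ℂ, z = fun j => fourierCoeff (fun x => ((ζ x : ℝ) : ℂ)) (-j) :=
    ⟨_, rfl⟩
  have sz : Summable fun j => ‖z j‖ := by
    rw [hz]; exact (Equiv.neg ℤ).summable_iff.2 hζ.hasSum_fourier.1
  have lz : ∀ j, lam j * ‖z j‖ ≤ c2 ζ := fun j => by
    have := hζ.lam_mul_norm_le hζ' (-j)
    rwa [lam_neg, ← congrFun hz j] at this
  obtain ⟨M, hM⟩ : ∃ M, M = (2 * velConst ε C T P + ε * P) * ‖f₀‖ := ⟨_, rfl⟩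
  have force : ∀ s ∈ Icc 0 T, ∀ j, ‖forceCoeff ε (f s) (contRep (u s).toL2) j‖ ≤ M := by
    intro s hs j
    rw [h.forceCoeff_eq hk hε.le hs.1, hM]
    exact G.norm_integral_smul_le f₀ (h.norm_forceKernel_flow_le hk hε hβ hP hs j)
  obtain ⟨g, hg⟩ : ∃ g : ℤ → ℝ → ℂ, g = fun j s => z j * (-(lam j : ℂ) * coeff (u s).toL2 j +
    forceCoeff ε (f s) (contRep (u s).toL2) j) := ⟨_, rfl⟩
  have duh : ∀ j, ContinuousOn (fun s => coeff (u s).toL2 j) (Icc 0 T) ∧ _ := fun j =>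
    duhamel_sub_eq (h.continuousOn_forceCoeff hk hε hβ T j) fun t ht => h.coeff_eq ht.1 j
  have cg : ∀ j, ContinuousOn (g j) (Icc 0 T) := fun j => by
    rw [hg]
    exact continuousOn_const.mul ((continuousOn_const.mul (duh j).1).add
      (h.continuousOn_forceCoeff hk hε hβ T j))
  have bg : ∀ j, ∀ s ∈ Icc 0 T, ‖g j s‖ ≤ c2 ζ * A j + M * ‖z j‖ := by
    intro j s hs
    rw [hg]
    simp only [norm_mul]
    have e1 : ‖-(lam j : ℂ) * coeff (u s).toL2 j + forceCoeff ε (f s) (contRep (u s).toL2) j‖ ≤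
        lam j * A j + M := by
      refine (norm_add_le _ _).trans (add_le_add ?_ (force s hs j))
      rw [norm_mul, norm_neg, Complex.norm_real, Real.norm_of_nonneg (lam_nonneg j)]
      exact mul_le_mul_of_nonneg_left ((hAP h s hs).1 j) (lam_nonneg j)
    have e2 := mul_le_mul_of_nonneg_left e1 (norm_nonneg (z j))
    have e3 := mul_le_mul_of_nonneg_right (lz j) (hA0 j)
    linarith
  have sb : Summable fun j => c2 ζ * A j + M * ‖z j‖ := (sA.mul_left _).add (sz.mul_left _)
  have hs : ∀ s, HasSum (fun j => g j s)
      ((rateU ε (f s) (contRep (u s).toL2) ζ : ℝ) : ℂ) := fun s => by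
    rw [hg, hz]
    exact hasSum_rateU hk (by linarith) (f s) (u s) hζ
  refine ⟨?_, fun a ha b hb => ?_⟩
  · have := continuousOn_tsum cg sb bg
    have := Complex.continuous_re.comp_continuousOn this
    refine this.congr fun s _ => ?_
    simp only [Function.comp_apply]
    rw [(hs s).tsum_eq, Complex.ofReal_re]
  · have hsub : uIoc a b ⊆ Icc 0 T := uIoc_subset_uIcc.trans (uIcc_subset_Icc ha hb)
    have k1 := intervalIntegral.hasSum_integral_of_dominated_convergence
      (μ := MeasureTheory.volume) (a := a) (b := b)
      (f := fun s => ((rateU ε (f s) (contRep (u s).toL2) ζ : ℝ) : ℂ)) (F := g)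
      (fun j _ => c2 ζ * A j + M * ‖z j‖)
      (fun j => ((cg j).mono hsub).aestronglyMeasurable measurableSet_uIoc)
      (fun j => Eventually.of_forall fun s hs => bg j s (hsub hs))
      (Eventually.of_forall fun s _ => sb) intervalIntegrable_const
      (Eventually.of_forall fun s _ => hs s)
    have k2 : ∀ s, HasSum (fun j => coeff (u s).toL2 j * z j)
        ((∫ x, contRep (u s).toL2 x * ζ x ∂dx : ℝ) : ℂ) := fun s => by
      have h1 := (H.summable_coeff (by linarith) (u s)).1
      rw [hz]
      exact hasSum_integral_fourier h1 (hasSum_contRep h1) (integrable_of_continuous hζ.continuous)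
    have k3 := (k2 b).sub (k2 a)
    have e : ∀ j, ∫ s in a..b, g j s = coeff (u b).toL2 j * z j - coeff (u a).toL2 j * z j := by
      intro j
      rw [hg]
      simp only []
      rw [intervalIntegral.integral_const_mul, ← (duh j).2 a ha b hb]
      ring
    simp only [e] at k1
    have := k3.unique k1
    rw [intervalIntegral.integral_ofReal] at this
    exact_mod_cast this

end KineticSolution

end Kinetic

namespace Kinetic

/-! ### Good test functions along solutions -/

variable {k α : ℝ}

theorem convex_G0 : Convex ℝ (G0 k) := by
  rintro f ⟨hf, hf'⟩ g ⟨hg, hg'⟩ a b ha hb hab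
  have e : ∀ᵐ z ∂dxdv, (a • f + b • g : G k) z = a * f z + b * g z := by
    have h1 := Lp.coeFn_add (a • f) (b • g)
    have h2 := Lp.coeFn_smul a f
    have h3 := Lp.coeFn_smul b g
    rw [EventuallyEq, ae_weighted] at h1 h2 h3
    filter_upwards [h1, h2, h3] with z h1 h2 h3
    rw [h1, Pi.add_apply, h2, h3]
    rfl
  refine ⟨?_, ?_⟩
  · have hf := (Lp.coeFn_nonneg f).2 hf
    have hg := (Lp.coeFn_nonneg g).2 hg
    rw [← Lp.coeFn_nonneg]
    rw [EventuallyLE, ae_weighted] at hf hg ⊢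
    filter_upwards [e, hf, hg] with z e hf hg
    rw [e]
    exact add_nonneg (mul_nonneg ha hf) (mul_nonneg hb hg)
  rw [integral_congr_ae e, integral_add (f.integrable.const_mul a) (g.integrable.const_mul b),
    integral_const_mul, integral_const_mul, hf', hg']
  linarith

theorem abs_sub_le_of_hasDerivAt {g g' : ℝ → ℝ} {c A : ℝ}
    (h : ∀ θ ∈ Icc (0 : ℝ) 1, HasDerivAt g (g' θ) θ) (h' : ∀ θ ∈ Icc (0 : ℝ) 1, |g' θ - c| ≤ A) :
    |g 1 - g 0 - c| ≤ A := by
  have key := Convex.norm_image_sub_le_of_norm_hasDerivWithin_le (f := fun θ => g θ - θ * c)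
    (f' := fun θ => g' θ - c) (s := Icc (0 : ℝ) 1) (C := A) (fun θ hθ => by
      have := (h θ hθ).sub ((hasDerivAt_id θ).mul_const c)
      simp only [id_eq, one_mul] at this
      exact this.hasDerivWithinAt) h' (convex_Icc 0 1)
    (x := 0) (y := 1) ⟨le_rfl, zero_le_one⟩ ⟨zero_le_one, le_rfl⟩
  simp only [one_mul, zero_mul, sub_zero, norm_one, mul_one] at key
  rw [Real.norm_eq_abs] at key
  rwa [sub_right_comm] at key

section Good

variable {Ω F : Type*} [MeasurableSpace Ω] [NormedAddCommGroup F] [NormedSpace ℝ F]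
  [MeasurableSpace F] {E : Set F} {m : MarkovProcess Ω E} {ψ : G k × H α × E → ℝ}
  {ι : F →ₗ[ℝ] C(Torus, ℝ)} {ε : ℝ}

/-- Mean value inequality for good test functions. -/
theorem IsGoodTestFunction.abs_sub_le (h : IsGoodTestFunction m ψ) (f f' : G0 k) (u u' : H α)
    (y : E) {a b A B : ℝ}
    (hA : ∀ g : G0 k, (g : G k) ∈ segment ℝ (f : G k) f' →
      |∫ z, ((f' : G k) - f : G k) z * Df ψ ((g, u', y) : State k α E) z ∂dxdv - a| ≤ A)
    (hB : ∀ w ∈ segment ℝ u u',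
      |∫ x, (u' - u).toL2 x * Du ψ ((f, w, y) : State k α E) x ∂dx - b| ≤ B) :
    |ψ (f', u', y) - ψ (f, u, y) - (a + b)| ≤ A + B := by
  have h1 : |ψ (f', u', y) - ψ (f, u', y) - a| ≤ A := by
    have hmem : ∀ θ ∈ Icc (0 : ℝ) 1, (f : G k) + θ • ((f' : G k) - f) ∈ segment ℝ (f : G k) f' :=
      fun θ hθ => by rw [segment_eq_image']; exact ⟨θ, hθ, rfl⟩
    have hG : ∀ θ ∈ Icc (0 : ℝ) 1, (f : G k) + θ • ((f' : G k) - f) ∈ G0 k := fun θ hθ =>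
      convex_G0.segment_subset f.2 f'.2 (hmem θ hθ)
    have key := abs_sub_le_of_hasDerivAt
      (g := fun θ : ℝ => ψ ((f : G k) + θ • ((f' : G k) - f), u', y))
      (g' := fun θ => if hθ : θ ∈ Icc (0 : ℝ) 1 then ∫ z, ((f' : G k) - f : G k) z *
        Df ψ ((⟨_, hG θ hθ⟩, u', y) : State k α E) z ∂dxdv else 0) (c := a) (A := A)
      (fun θ hθ => ?_) fun θ hθ => ?_
    · simpa using key
    · obtain ⟨L, hL, hL'⟩ := (h.Df_spec ((⟨_, hG θ hθ⟩, u', y) : State k α E)).2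
      rw [dif_pos hθ, ← hL']
      have hl : HasDerivAt (fun θ : ℝ => (f : G k) + θ • ((f' : G k) - f)) ((f' : G k) - f) θ := by
        have := ((hasDerivAt_id θ).smul_const ((f' : G k) - f)).const_add (f : G k)
        simpa using this
      exact hL.comp_hasDerivAt θ hl
    · rw [dif_pos hθ]
      exact hA ⟨_, hG θ hθ⟩ (hmem θ hθ)
  have h2 : |ψ (f, u', y) - ψ (f, u, y) - b| ≤ B := by
    have key := abs_sub_le_of_hasDerivAt (g := fun θ : ℝ => ψ (f, u + θ • (u' - u), y))
      (g' := fun θ => ∫ x, (u' - u).toL2 x * Du ψ ((f, u + θ • (u' - u), y) : State k α E) x ∂dx)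
      (c := b) (A := B) (fun θ hθ => ?_) fun θ hθ => ?_
    · simpa using key
    · obtain ⟨L, hL, hL'⟩ := (h.Du_spec ((f, u + θ • (u' - u), y) : State k α E)).2
      rw [← hL']
      have hl : HasDerivAt (fun θ : ℝ => u + θ • (u' - u)) (u' - u) θ := by
        have := ((hasDerivAt_id θ).smul_const (u' - u)).const_add u
        simpa using this
      exact hL.comp_hasDerivAt θ hl
    · exact hB _ (by rw [segment_eq_image']; exact ⟨θ, hθ, rfl⟩)
  have e : ψ (f', u', y) - ψ (f, u, y) - (a + b) = (ψ (f', u', y) - ψ (f, u', y) - a) +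
      (ψ (f, u', y) - ψ (f, u, y) - b) := by ring
  rw [e]
  exact (abs_add_le _ _).trans (add_le_add h1 h2)

theorem drift_eq_add (n w : C(Torus, ℝ)) (ξ : Phase → ℝ) (ζ : Torus → ℝ) (z : Phase) :
    drift ε n w ξ ζ z = drift ε n w ξ 0 z + drift ε 0 w 0 ζ z := by
  rw [KineticSolution.drift_zero]
  unfold drift
  simp only [Pi.zero_apply, mul_zero]
  ring

/-- The states whose components `f`, `u` are bounded by `R`. -/
def State.ballSet (k α : ℝ) (E : Set F) (R : ℝ) : Set (State k α E) :=
  {p | ‖(p.1 : G k)‖ ≤ R ∧ ‖p.2.1‖ ≤ R}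

theorem State.isBounded_ballSet (hE : DrivingSpace E ι) (R : ℝ) :
    Bornology.IsBounded (State.ballSet k α E R) := by
  have h1 : Bornology.IsBounded {f : G0 k | ‖(f : G k)‖ ≤ R} := by
    refine Metric.isBounded_iff.2 ⟨R + R, fun f hf g hg => ?_⟩
    rw [Subtype.dist_eq, dist_eq_norm]
    exact (norm_sub_le _ _).trans (add_le_add hf hg)
  have h2 : Bornology.IsBounded {u : H α | ‖u‖ ≤ R} :=
    (Metric.isBounded_closedBall (x := (0 : H α)) (r := R)).subset fun u hu => by simpa using hu
  exact (h1.prod (h2.prod hE.isBounded_univ)).subset fun p hp => ⟨hp.1, hp.2, mem_univ _⟩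

end Good

namespace KineticSolution

variable {Ω F : Type*} [MeasurableSpace Ω] [NormedAddCommGroup F] [NormedSpace ℝ F]
  [MeasurableSpace F] {E : Set F} {m : MarkovProcess Ω E} {ψ : G k × H α × E → ℝ}
  {ι : F →ₗ[ℝ] C(Torus, ℝ)} {ε : ℝ}

variable {η β C : ℝ} {n : ℝ → C(Torus, ℝ)} {f₀ : G k} {u₀ : H η}
  {f : ℝ → G k} {u : ℝ → H β} {Ψ : ℝ → Phase ≃ₜ Phase} {t T P : ℝ}

theorem integral_incl_sub_mul {u : ℝ → H β} (hβ : 3 / 2 < β) (hαβ : α ≤ β)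
    {ζ : Torus → ℝ} (hζ : Continuous ζ) (a b : ℝ) :
    ∫ x, (H.incl hαβ (u b) - H.incl hαβ (u a)).toL2 x * ζ x ∂dx =
      ∫ x, contRep (u b).toL2 x * ζ x ∂dx - ∫ x, contRep (u a).toL2 x * ζ x ∂dx := by
  rw [← integral_sub (integrable_of_continuous (by fun_prop))
    (integrable_of_continuous (by fun_prop)), H.toL2_sub, H.toL2_incl, H.toL2_incl]
  refine integral_congr_ae ?_
  filter_upwards [Lp.coeFn_sub (u b).toL2 (u a).toL2, H.contRep_ae (by linarith) (u b),
    H.contRep_ae (by linarith) (u a)] with x h1 h2 h3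
  rw [h1, Pi.sub_apply, h2, h3]
  ring

/-- Uniform bounds for the solutions on bounded time intervals. -/
theorem exists_uniform_bound (hk : 1 ≤ k) (hε : 0 < ε) (hβ : 3 / 2 < β) (hη : 3 / 2 < η)
    (hC : 0 ≤ C) (hT : 0 ≤ T) (hα : α < 3 / 2) (hαβ : α ≤ β) (f₀ : G k) (u₀ : H η) :
    ∃ P R : ℝ, ∀ {n : ℝ → C(Torus, ℝ)} {f : ℝ → G k} {u : ℝ → H β} {Ψ : ℝ → Phase ≃ₜ Phase},
      KineticSolution ε C n f₀ u₀ f u Ψ → ∀ t ∈ Icc 0 T,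
        ‖contRep (u t).toL2‖ ≤ P ∧ ‖f t‖ ≤ R ∧ ‖H.incl hαβ (u t)‖ ≤ R := by
  obtain ⟨a, P, ha, hb⟩ := exists_coeff_bound (β := β) hk hε hβ hη hC hT f₀ u₀
  refine ⟨P, max ((1 + (2 * velConst ε C T P) ^ k) * ‖f₀‖)
    √(∑' j, (1 + lam j) ^ α * a j ^ 2), fun h t ht => ⟨(hb h t ht).2, le_max_of_le_left
      (h.norm_f_le hk hε hβ (fun s hs => (hb h s hs).2) ht), le_max_of_le_right ?_⟩⟩
  refine Real.le_sqrt_of_sq_le (hasSum_le (fun j => ?_) (H.hasSum_norm_sq _) (ha α hα).hasSum)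
  have := one_add_lam_pos j
  rw [H.toL2_incl]
  gcongr
  exact (hb h t ht).1 j

section Increment

variable (h : KineticSolution ε C n f₀ u₀ f u Ψ) (hk : 1 ≤ k) (hε : 0 < ε) (hβ : 3 / 2 < β)
  (hη : 3 / 2 < η) (hT : 0 ≤ T) (hαβ : α ≤ β)
  (hP : ∀ s ∈ Icc 0 T, ‖contRep (u s).toL2‖ ≤ P)
include h hk hε hβ hη hT hP

/-- The constant in the Lipschitz bound of `t ↦ ⟨f_t, ξ⟩` and `t ↦ ⟨u_t, ζ⟩`. -/
def rateConst (k ε C T P : ℝ) (f₀ : G k) : ℝ :=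
  2 * (gradConst k (velConst ε C T P) * speedConst ε C T P) * ‖f₀‖ +
    (P + (1 + ε * P) * ((1 + (2 * velConst ε C T P) ^ k) * ‖f₀‖))

theorem rateConst_spec : 0 ≤ rateConst k ε C T P f₀ ∧
    (∀ {ξ : Phase → ℝ}, ContDiff ℝ 1 (lift ξ) → Nk k ξ ≠ ∞ → ∀ {a b : ℝ}, a ∈ Icc 0 T →
      b ∈ Icc 0 T → |∫ z, (f b - f a : G k) z * ξ z ∂dxdv| ≤
        rateConst k ε C T P f₀ * nk k ξ * |b - a|) ∧
    ∀ {ζ : Torus → ℝ}, MemC2 ζ → C2norm ζ ≠ ∞ → ∀ {a b : ℝ}, a ∈ Icc 0 T →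
      b ∈ Icc 0 T → |∫ x, (H.incl hαβ (u b) - H.incl hαβ (u a)).toL2 x * ζ x ∂dx| ≤
        rateConst k ε C T P f₀ * c2 ζ * |b - a| := by
  have hP0 := bound_nonneg hT hP
  have hκ := velConst_pos hε h.nonneg hP0 hT
  have hC := h.nonneg
  obtain ⟨R1, hR1⟩ : ∃ R1, R1 = 2 * (gradConst k (velConst ε C T P) * speedConst ε C T P) * ‖f₀‖ :=
    ⟨_, rfl⟩
  obtain ⟨R2, hR2⟩ : ∃ R2, R2 = P + (1 + ε * P) * ((1 + (2 * velConst ε C T P) ^ k) * ‖f₀‖) :=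
    ⟨_, rfl⟩
  have e : rateConst k ε C T P f₀ = R1 + R2 := by rw [hR1, hR2]; rfl
  have h1 : 0 ≤ R1 := by
    have := gradConst_nonneg (k := k) hκ.le
    rw [hR1]; unfold speedConst; positivity
  have h2 : 0 ≤ R2 := by rw [hR2]; positivity
  rw [e]
  refine ⟨by positivity, fun {ξ} hξ hξ' a b ha hb => ?_, fun {ζ} hζ hζ' a b ha hb => ?_⟩
  · have cξ : Continuous ξ := continuous_of_lift hξ.continuous
    rw [G.integral_sub_mul cξ.aestronglyMeasurable fun z => abs_le_nk hξ' z]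
    refine (h.abs_integral_sub_le hk hε hβ hP hξ hξ' ha hb).trans ?_
    rw [← hR1]
    have := nk_nonneg (k := k) ξ
    gcongr
    linarith
  · rw [integral_incl_sub_mul hβ hαβ hζ.continuous,
      (h.integral_contRep_sub_eq hk hε hβ hη hT hζ hζ').2 a ha b hb, ← Real.norm_eq_abs]
    refine (intervalIntegral.norm_integral_le_of_norm_le_const (C := R2 * c2 ζ)
      fun s hs => ?_).trans ?_
    · have hs' : s ∈ Icc 0 T := (uIcc_subset_Icc ha hb) (uIoc_subset_uIcc hs)
      refine (abs_rateU_le hk hε (f s) (hP s hs') hζ').trans ?_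
      have := h.norm_f_le hk hε hβ hP hs'
      have := c2_nonneg ζ
      rw [hR2]
      gcongr
    · have := c2_nonneg ζ
      gcongr
      linarith

end Increment

/-- Along solutions, good test functions are Lipschitz continuous in time, uniformly in the driving
path and in the driving variable. -/
theorem exists_lipschitz (hE : DrivingSpace E ι) (hψ : IsGoodTestFunction m ψ) (hk : 1 ≤ k)
    (hε : 0 < ε) (hβ : 3 / 2 < β) (hη : 3 / 2 < η) (hC : 0 ≤ C) (hT : 0 ≤ T) (hα : α < 3 / 2)
    (hαβ : α ≤ β) (f₀ : G k) (u₀ : H η) :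
    ∃ K : ℝ, ∀ {n : ℝ → C(Torus, ℝ)} {f : ℝ → G k} {u : ℝ → H β} {Ψ : ℝ → Phase ≃ₜ Phase},
      KineticSolution ε C n f₀ u₀ f u Ψ → (∀ t, f t ∈ G0 k) → ∀ a ∈ Icc 0 T, ∀ b ∈ Icc 0 T,
        ∀ y : E, |ψ (f b, H.incl hαβ (u b), y) - ψ (f a, H.incl hαβ (u a), y)| ≤ K * |b - a| := by
  obtain ⟨P, R, hPR⟩ := exists_uniform_bound (β := β) hk hε hβ hη hC hT hα hαβ f₀ u₀
  have hS := State.isBounded_ballSet (k := k) (α := α) hE R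
  obtain ⟨N, hN0, hN⟩ := hψ.exists_nk_le hS
  obtain ⟨Z, hZ0, hZ⟩ := hψ.exists_c2_le hS
  refine ⟨rateConst k ε C T P f₀ * N + rateConst k ε C T P f₀ * Z, fun {n f u Ψ} h hf a ha b hb y => ?_⟩
  obtain ⟨hr0, hr1, hr2⟩ := h.rateConst_spec (P := P) hk hε hβ hη hT hαβ fun s hs => (hPR h s hs).1
  have key := hψ.abs_sub_le ⟨f a, hf a⟩ ⟨f b, hf b⟩ (H.incl hαβ (u a)) (H.incl hαβ (u b)) y
    (a := 0) (b := 0) (A := rateConst k ε C T P f₀ * N * |b - a|)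
    (B := rateConst k ε C T P f₀ * Z * |b - a|) (fun g hg => ?_) fun w hw => ?_
  · rw [add_zero, sub_zero] at key
    linarith
  · have hg' : ‖(g : G k)‖ ≤ R := by
      have := (convex_closedBall (0 : G k) R).segment_subset (x := f a) (y := f b)
        (by simpa using (hPR h a ha).2.1) (by simpa using (hPR h b hb).2.1) hg
      simpa using this
    rw [sub_zero]
    have sp := (hψ.Df_spec ((g, H.incl hαβ (u b), y) : State k α E)).1
    refine (hr1 sp.1 sp.2.ne ha hb).trans ?_
    have := hN (g, H.incl hαβ (u b), y) ⟨hg', (hPR h b hb).2.2⟩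
    gcongr
  · have hw' : ‖w‖ ≤ R := by
      have := (convex_closedBall (0 : H α) R).segment_subset (x := H.incl hαβ (u a))
        (y := H.incl hαβ (u b)) (by simpa using (hPR h a ha).2.2) (by simpa using (hPR h b hb).2.2) hw
      simpa using this
    rw [sub_zero]
    have sp := (hψ.Du_spec ((⟨f a, hf a⟩, w, y) : State k α E)).1
    refine (hr2 sp (hψ.C2norm_ne_top _) ha hb).trans ?_
    have := hZ (⟨f a, hf a⟩, w, y) ⟨(hPR h a ha).2.1, hw'⟩
    gcongr

/-- The derivative from the right of good test functions along solutions. -/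
theorem tendsto_slope (hψ : IsGoodTestFunction m ψ) (hk : 1 ≤ k) (hε : 0 < ε) (hβ : 3 / 2 < β)
    (hη : 3 / 2 < η) (hαβ : α ≤ β) (h : KineticSolution ε C n f₀ u₀ f u Ψ)
    (hf : ∀ t, f t ∈ G0 k) (ht : 0 ≤ t) (hn : ContinuousWithinAt n (Ioi t) t) {y : ℝ → E}
    (hy : ContinuousWithinAt y (Ioi t) t) (hyn : ι (y t) = n t) :
    Tendsto (fun r => (ψ (f r, H.incl hαβ (u r), y r) - ψ (f t, H.incl hαβ (u t), y r)) / (r - t))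
      (𝓝[>] t) (𝓝 (Lfu ε ι ψ ((⟨f t, hf t⟩, H.incl hαβ (u t), y t) : State k α E))) := by
  obtain ⟨p, hp⟩ : ∃ p : State k α E, p = (⟨f t, hf t⟩, H.incl hαβ (u t), y t) := ⟨_, rfl⟩
  have hT : 0 ≤ t + 1 := by linarith
  have htm : t ∈ Icc 0 (t + 1) := ⟨ht, by linarith⟩
  obtain ⟨P, hP⟩ := exists_norm_le
    ((H.continuous_contRep (s := β) (by linarith)).comp h.continuous_u) (t + 1)
  obtain ⟨hr0, hr1, hr2⟩ := h.rateConst_spec (P := P) hk hε hβ hη hT hαβ hP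
  obtain ⟨K, hK⟩ : ∃ K, K = rateConst k ε C (t + 1) P f₀ := ⟨_, rfl⟩
  rw [← hK] at hr0
  have hξ := (hψ.Df_spec p).1
  have hζ := (hψ.Du_spec p).1
  have hζ' := hψ.C2norm_ne_top p
  have cξ : Continuous (Df ψ p) := continuous_of_lift hξ.1.continuous
  have nhd : Ioc t (t + 1) ∈ 𝓝[>] t := Ioc_mem_nhdsGT (by linarith)
  obtain ⟨lin, hlin⟩ : ∃ lin : ℝ → ℝ, lin = fun r =>
    ∫ z, (f r - f t : G k) z * Df ψ p z ∂dxdv +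
      ∫ x, (H.incl hαβ (u r) - H.incl hαβ (u t)).toL2 x * Du ψ p x ∂dx := ⟨_, rfl⟩
  have t1 : Tendsto (fun r => lin r / (r - t)) (𝓝[>] t) (𝓝 (Lfu ε ι ψ p)) := by
    have d1 := (hasDerivWithinAt_iff_tendsto_slope' self_notMem_Ioi).1
      (h.hasDerivWithinAt_integral hk hε hβ ht hn hξ.1 hξ.2.ne)
    obtain ⟨c2, e2⟩ := h.integral_contRep_sub_eq hk hε hβ hη hT hζ hζ'
    have ii : ∀ r ∈ Icc 0 (t + 1), IntervalIntegrable
        (fun s => rateU ε (f s) (contRep (u s).toL2) (Du ψ p)) MeasureTheory.volume 0 r :=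
      fun r hr => intervalIntegrable_of_Icc c2.integrableOn_Icc ⟨le_rfl, hT⟩ hr
    have nhd' : Icc 0 (t + 1) ∈ 𝓝[>] t := mem_of_superset nhd fun s hs => ⟨by linarith [hs.1], hs.2⟩
    have d2 := (hasDerivWithinAt_iff_tendsto_slope' self_notMem_Ioi).1
      ((intervalIntegral.integral_hasDerivWithinAt_right (s := Ici t) (t := Ioi t) (ii t htm)
        ⟨_, nhd', c2.integrableOn_Icc.aestronglyMeasurable⟩
        ((c2 t htm).mono_of_mem_nhdsWithin nhd')).mono Ioi_subset_Ici_self)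
    have d3 := d1.add d2
    have e3 : Lfu ε ι ψ p = ∫ z, f t z * drift ε (n t) (contRep (u t).toL2) (Df ψ p) 0 z ∂dxdv +
        rateU ε (f t) (contRep (u t).toL2) (Du ψ p) := by
      have hv : p.vel = contRep (u t).toL2 := by
        rw [hp]; unfold State.vel; simp only [H.toL2_incl]
      have z1 : MemC2 (0 : Torus → ℝ) := contDiff_const
      have z2 : ContDiff ℝ 1 (lift (0 : Phase → ℝ)) := contDiff_const
      have q0 : C2norm (0 : Torus → ℝ) ≠ ∞ := by
        have : dT (0 : Torus → ℝ) = 0 := by funext x; unfold dT; simp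
        unfold C2norm
        rw [this, this]
        simp
      have q1 : Nk k (0 : Phase → ℝ) ≠ ∞ := by
        have a1 : ∀ z, dX (0 : Phase → ℝ) z = 0 := fun z => by unfold dX; simp
        have a2 : ∀ z, dV (0 : Phase → ℝ) z = 0 := fun z => by unfold dV; simp
        unfold Nk
        simp [a1, a2]
      unfold Lfu rateU
      rw [hv]
      have s1 : (p.1 : G k) = f t := by rw [hp]
      have s2 : ι p.2.2 = n t := by rw [hp]; exact hyn
      rw [s1, s2, add_comm (∫ x, contRep (u t).toL2 x * dT (dT (Du ψ p)) x ∂dx), ← add_assoc]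
      congr 1
      have j1 := G.integrable_mul (f := f t) (continuous_drift (ε := ε) (n := n t)
        (w := contRep (u t).toL2) hξ.1 z1.continuous).aestronglyMeasurable
        (abs_drift_le hk hε hξ.2.ne q0 le_rfl le_rfl)
      have j2 := G.integrable_mul (f := f t) (continuous_drift (ε := ε) (n := 0)
        (w := contRep (u t).toL2) z2 hζ.continuous).aestronglyMeasurable
        (abs_drift_le hk hε q1 hζ' le_rfl le_rfl)
      rw [← integral_add j1 j2]
      refine integral_congr_ae (Eventually.of_forall fun z => ?_)
      simp only []
      rw [drift_eq_add (n t)]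
      ring
    rw [e3]
    refine d3.congr' ?_
    filter_upwards [nhd] with r hr
    have hr' : r ∈ Icc 0 (t + 1) := ⟨ht.trans hr.1.le, hr.2⟩
    rw [hlin]
    simp only [slope_def_field]
    rw [G.integral_sub_mul cξ.aestronglyMeasurable fun z => abs_le_nk hξ.2.ne z,
      integral_incl_sub_mul hβ hαβ hζ.continuous, e2 t htm r hr',
      intervalIntegral.integral_interval_sub_left (ii r hr') (ii t htm), add_div]
  have t2 : Tendsto (fun r => (ψ (f r, H.incl hαβ (u r), y r) - ψ (f t, H.incl hαβ (u t), y r) -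
      lin r) / (r - t)) (𝓝[>] t) (𝓝 0) := by
    rw [Metric.tendsto_nhds]
    intro δ hδ
    obtain ⟨e, he, heδ⟩ : ∃ e, 0 < e ∧ (K * e + K * e) < δ := by
      refine ⟨δ / (2 * K + 1) / 2, by positivity, ?_⟩
      have : δ / (2 * K + 1) * (2 * K + 1) = δ := div_mul_cancel₀ _ (by positivity)
      have h0 : 0 < δ / (2 * K + 1) := by positivity
      nlinarith
    have ev := ((hψ.tendsto_nk p).1.eventually (Iio_mem_nhds he)).and ((hψ.tendsto_nk p).2.and
      (((hψ.tendsto_c2 p).1.eventually (Iio_mem_nhds he)).and (hψ.tendsto_c2 p).2))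
    obtain ⟨ρ, hρ, hball⟩ := Metric.eventually_nhds_iff.1 ev
    have cf : ContinuousWithinAt f (Ioi t) t :=
      (h.continuousOn_f hk hε hβ hT t htm).mono_of_mem_nhdsWithin
        (mem_of_superset nhd fun s hs => ⟨by linarith [hs.1], hs.2⟩)
    have cu : ContinuousWithinAt (fun r => H.incl hαβ (u r)) (Ioi t) t :=
      ((H.continuous_incl hαβ).comp h.continuous_u).continuousWithinAt
    filter_upwards [nhd, (Metric.tendsto_nhds.1 cf) ρ hρ, (Metric.tendsto_nhds.1 cu) ρ hρ,
      (Metric.tendsto_nhds.1 hy) ρ hρ] with r hr hr1' hr2' hr3'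
    have hr' : r ∈ Icc 0 (t + 1) := ⟨ht.trans hr.1.le, hr.2⟩
    have hpos : 0 < |r - t| := abs_pos.2 (sub_ne_zero.2 hr.1.ne')
    have seg : ∀ {X : Type} [NormedAddCommGroup X] [NormedSpace ℝ X] {a b g : X},
        g ∈ segment ℝ a b → dist b a < ρ → dist g a < ρ := by
      intro X _ _ a b g hg hab
      exact (convex_ball a ρ).segment_subset (Metric.mem_ball_self hρ) hab hg
    have key := hψ.abs_sub_le ⟨f t, hf t⟩ ⟨f r, hf r⟩ (H.incl hαβ (u t)) (H.incl hαβ (u r)) (y r)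
      (a := ∫ z, (f r - f t : G k) z * Df ψ p z ∂dxdv)
      (b := ∫ x, (H.incl hαβ (u r) - H.incl hαβ (u t)).toL2 x * Du ψ p x ∂dx)
      (A := K * e * |r - t|) (B := K * e * |r - t|) (fun g hg => ?_) fun w hw => ?_
    · rw [dist_zero_right, norm_div, Real.norm_eq_abs, Real.norm_eq_abs, div_lt_iff₀ hpos, hlin]
      refine key.trans_lt ?_
      rw [← add_mul]
      exact mul_lt_mul_of_pos_right heδ hpos
    · have hq := hball (y := (g, H.incl hαβ (u r), y r)) (by
        rw [hp, Prod.dist_eq, Prod.dist_eq]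
        exact max_lt (seg hg hr1') (max_lt hr2' hr3'))
      have sp := (hψ.Df_spec ((g, H.incl hαβ (u r), y r) : State k α E)).1
      have cξ' : Continuous (Df ψ ((g, H.incl hαβ (u r), y r) : State k α E)) :=
        continuous_of_lift sp.1.continuous
      rw [← integral_sub (G.integrable_mul cξ'.aestronglyMeasurable fun z => abs_le_nk sp.2.ne z)
        (G.integrable_mul cξ.aestronglyMeasurable fun z => abs_le_nk hξ.2.ne z)]
      simp only [← mul_sub]
      refine (hr1 (ξ := Df ψ ((g, H.incl hαβ (u r), y r) : State k α E) - Df ψ p)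
        (sp.1.sub hξ.1) hq.2.1 htm hr').trans ?_
      rw [← hK]
      have := hq.1
      gcongr
    · have hq := hball (y := (⟨f t, hf t⟩, w, y r)) (by
        rw [hp, Prod.dist_eq, Prod.dist_eq, dist_self]
        exact max_lt hρ (max_lt (seg hw hr2') hr3'))
      have sp := (hψ.Du_spec ((⟨f t, hf t⟩, w, y r) : State k α E)).1
      have iu : ∀ {ζ : Torus → ℝ}, Continuous ζ → Integrable (fun x =>
          (H.incl hαβ (u r) - H.incl hαβ (u t)).toL2 x * ζ x) dx := by
        intro ζ hζ
        obtain ⟨M, hM⟩ := isCompact_univ.exists_bound_of_continuousOn hζ.continuousOn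
        exact ((Lp.memLp _).integrable (by norm_num)).mul_bdd (c := M)
          hζ.aestronglyMeasurable (Eventually.of_forall fun x => hM x (mem_univ x))
      rw [← integral_sub (iu sp.continuous) (iu hζ.continuous)]
      simp only [← mul_sub]
      refine (hr2 (ζ := Du ψ ((⟨f t, hf t⟩, w, y r) : State k α E) - Du ψ p)
        (ContDiff.sub sp hζ) hq.2.2.2 htm hr').trans ?_
      rw [← hK]
      have := hq.2.2.1
      gcongr
  have := t2.add t1
  rw [zero_add, hp] at this
  refine this.congr fun r => ?_
  ring

end KineticSolution

end Kinetic

namespace Kinetic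

/-! ### Bounded progressive processes -/

/-- The process `Y` is jointly measurable on `[0, t]`. -/
def MeasProc {Ω S : Type*} (mΩ : MeasurableSpace Ω) [MeasurableSpace S] (t : ℝ≥0)
    (Y : ℝ≥0 → Ω → S) : Prop :=
  Measurable fun q : ℝ≥0 × Ω => Y (min q.1 t) q.2

section MeasProc

variable {Ω S S' : Type*} {mΩ : MeasurableSpace Ω} [MeasurableSpace S] [MeasurableSpace S']
  {t : ℝ≥0}

theorem MeasProc.of_rightCont [TopologicalSpace S] [TopologicalSpace.PseudoMetrizableSpace S]
    [BorelSpace S] {x : ℝ≥0 → Ω → S} (hm : ∀ s ≤ t, Measurable (x s))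
    (hc : ∀ ω s, ContinuousWithinAt (fun s => x s ω) (Ioi s) s) : MeasProc mΩ t x := by
  refine measurable_of_tendsto_metrizable
    (f := fun (N : ℕ) (q : ℝ≥0 × Ω) => x (min (rightApprox N q.1) t) q.2) (fun N => ?_)
    (tendsto_pi_nhds.2 fun ⟨s, ω⟩ => ?_)
  · have h1 : Measurable fun q : ℕ × Ω => x (min (((q.1 + 1 : ℕ) : ℝ≥0) / (N + 1 : ℕ)) t) q.2 :=
      measurable_from_prod_countable_right fun i =>
        hm (min (((i + 1 : ℕ) : ℝ≥0) / (N + 1 : ℕ)) t) (min_le_right _ _)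
    exact h1.comp (f := fun q : ℝ≥0 × Ω => (⌊q.1 * (N + 1 : ℕ)⌋₊, q.2))
      ((Nat.measurable_floor.comp (by fun_prop)).prodMk measurable_snd)
  · rcases lt_or_ge s t with hs | hs
    · have h2 := (hc ω s).tendsto.comp (tendsto_rightApprox s)
      simp only [min_eq_left hs.le]
      refine h2.congr' ?_
      have := ((tendsto_rightApprox s).mono_right nhdsWithin_le_nhds).eventually (Iio_mem_nhds hs)
      filter_upwards [this] with N hN
      simp only [Function.comp_apply, min_eq_left (le_of_lt hN)]
    · simp only [min_eq_right hs]
      refine tendsto_const_nhds.congr fun N => ?_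
      rw [min_eq_right (hs.trans (lt_rightApprox N s).le)]

theorem MeasProc.comp {x : ℝ≥0 → Ω → S} (h : MeasProc mΩ t x) {φ : S → S'} (hφ : Measurable φ) :
    MeasProc mΩ t fun s ω => φ (x s ω) :=
  Measurable.comp hφ h

theorem MeasProc.mono {m' : MeasurableSpace Ω} {x : ℝ≥0 → Ω → S} (h : MeasProc mΩ t x)
    (hm : mΩ ≤ m') : MeasProc m' t x :=
  Measurable.mono h (sup_le_sup le_rfl (MeasurableSpace.comap_mono hm)) le_rfl

theorem MeasProc.measurable {x : ℝ≥0 → Ω → S} (h : MeasProc mΩ t x) {s : ℝ≥0} (hs : s ≤ t) :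
    Measurable (x s) := by
  have := Measurable.comp h (measurable_prodMk_left (x := s))
  simpa only [Function.comp_def, min_eq_left hs] using this

theorem MeasProc.measurable_real {x : ℝ≥0 → Ω → ℝ} (h : MeasProc mΩ t x) :
    Measurable fun q : ℝ × Ω => x (min q.1.toNNReal t) q.2 :=
  Measurable.comp h ((measurable_real_toNNReal.comp measurable_fst).prodMk measurable_snd)

theorem isFiniteMeasure_restrict_uIoc (a b : ℝ) :
    IsFiniteMeasure ((volume : Measure ℝ).restrict (uIoc a b)) :=
  ⟨by rw [Measure.restrict_apply_univ, uIoc]; exact measure_Ioc_lt_top⟩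

theorem integral_eq_integral_min {E : Type*} [NormedAddCommGroup E] [NormedSpace ℝ E]
    (x : ℝ≥0 → E) {t : ℝ≥0} {a b : ℝ} (ha : a ≤ t) (hb : b ≤ t) :
    ∫ s in a..b, x s.toNNReal = ∫ s in a..b, x (min s.toNNReal t) := by
  refine intervalIntegral.integral_congr fun s hs => ?_
  have : s.toNNReal ≤ t := Real.toNNReal_le_iff_le_coe.2 (hs.2.trans (max_le ha hb))
  simp only [min_eq_left this]

theorem MeasProc.integral {x : ℝ≥0 → Ω → ℝ} (h : MeasProc mΩ t x) :
    Measurable fun ω => ∫ s in (0 : ℝ)..t, x s.toNNReal ω := by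
  have h1 := h.measurable_real.stronglyMeasurable.integral_prod_left'
    (μ := volume.restrict (Ioc 0 (t : ℝ)))
  have e : (fun ω => ∫ s in (0 : ℝ)..t, x s.toNNReal ω) =
      fun ω => ∫ s in Ioc 0 (t : ℝ), x (min s.toNNReal t) ω := by
    funext ω
    rw [integral_eq_integral_min (fun s => x s ω) t.2 le_rfl]
    exact intervalIntegral.integral_of_le t.2
  rw [e]
  exact h1.measurable

end MeasProc

variable {Ω : Type*} [mΩ : MeasurableSpace Ω] {𝓕 : Filtration ℝ≥0 mΩ} {Y L : ℝ≥0 → Ω → ℝ}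
  {μ : Measure Ω}

/-- Progressively measurable real processes which are bounded on bounded time intervals. -/
structure BddProg (𝓕 : Filtration ℝ≥0 mΩ) (Y : ℝ≥0 → Ω → ℝ) : Prop where
  meas : ∀ t, MeasProc (𝓕 t) t Y
  bdd : ∀ T, ∃ C, ∀ t ≤ T, ∀ ω, |Y t ω| ≤ C

namespace BddProg

theorem adapted (h : BddProg 𝓕 Y) (t : ℝ≥0) : Measurable[𝓕 t] (Y t) := (h.meas t).measurable le_rfl

theorem measurable (h : BddProg 𝓕 Y) (t : ℝ≥0) : Measurable (Y t) := (h.adapted t).mono (𝓕.le t) le_rfl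

theorem integrable [IsFiniteMeasure μ] (h : BddProg 𝓕 Y) (t : ℝ≥0) : Integrable (Y t) μ := by
  obtain ⟨C, hC⟩ := h.bdd t
  exact MarkovProcess.integrable_comp (h.measurable t) (hC t le_rfl)

theorem memLp [IsFiniteMeasure μ] (h : BddProg 𝓕 Y) (t : ℝ≥0) (p : ℝ≥0∞) : MemLp (Y t) p μ := by
  obtain ⟨C, hC⟩ := h.bdd t
  exact MemLp.of_bound (h.measurable t).aestronglyMeasurable C (Eventually.of_forall (hC t le_rfl))

theorem sub (h : BddProg 𝓕 Y) (h' : BddProg 𝓕 L) : BddProg 𝓕 fun t ω => Y t ω - L t ω where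
  meas t := Measurable.sub (h.meas t) (h'.meas t)
  bdd T := by
    obtain ⟨C, hC⟩ := h.bdd T
    obtain ⟨D, hD⟩ := h'.bdd T
    exact ⟨C + D, fun t ht ω => (abs_sub _ _).trans (add_le_add (hC t ht ω) (hD t ht ω))⟩

theorem mul (h : BddProg 𝓕 Y) (h' : BddProg 𝓕 L) : BddProg 𝓕 fun t ω => Y t ω * L t ω where
  meas t := Measurable.mul (h.meas t) (h'.meas t)
  bdd T := by
    obtain ⟨C, hC⟩ := h.bdd T
    obtain ⟨D, hD⟩ := h'.bdd T
    refine ⟨C * D, fun t ht ω => ?_⟩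
    rw [abs_mul]
    exact mul_le_mul (hC t ht ω) (hD t ht ω) (abs_nonneg _) ((abs_nonneg _).trans (hC t ht ω))

theorem integrable_prod (h : BddProg 𝓕 Y) [IsFiniteMeasure μ] (a b : ℝ) :
    Integrable (Function.uncurry fun (s : ℝ) ω => Y s.toNNReal ω)
      ((volume.restrict (uIoc a b)).prod μ) := by
  obtain ⟨C, hC⟩ := h.bdd (max a b).toNNReal
  have hm : MeasProc mΩ (max a b).toNNReal Y :=
    (h.meas _).mono (𝓕.le _)
  have hle : ∀ s ∈ uIoc a b, s.toNNReal ≤ (max a b).toNNReal := fun s hs =>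
    Real.toNNReal_le_toNNReal hs.2
  have e : (Function.uncurry fun (s : ℝ) ω => Y s.toNNReal ω) =ᵐ[(volume.restrict (uIoc a b)).prod μ]
      fun q => Y (min q.1.toNNReal (max a b).toNNReal) q.2 := by
    have := ae_restrict_mem (μ := (volume : Measure ℝ)) (measurableSet_uIoc (a := a) (b := b))
    filter_upwards [Measure.quasiMeasurePreserving_fst.ae this] with q hq
    rw [min_eq_left (hle _ hq)]
    rfl
  have := isFiniteMeasure_restrict_uIoc a b
  refine Integrable.congr ?_ e.symm
  exact Integrable.of_bound hm.measurable_real.aestronglyMeasurable C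
    (Eventually.of_forall fun q => hC _ (min_le_right _ _) _)

theorem intervalIntegrable (h : BddProg 𝓕 Y) (ω : Ω) (a b : ℝ) :
    IntervalIntegrable (fun s => Y s.toNNReal ω) volume a b := by
  rw [intervalIntegrable_iff]
  have := isFiniteMeasure_restrict_uIoc a b
  obtain ⟨C, hC⟩ := h.bdd (max a b).toNNReal
  have hm : MeasProc mΩ (max a b).toNNReal Y :=
    (h.meas _).mono (𝓕.le _)
  have hle : ∀ s ∈ uIoc a b, s.toNNReal ≤ (max a b).toNNReal := fun s hs =>
    Real.toNNReal_le_toNNReal hs.2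
  have h1 : Integrable (fun s : ℝ => Y (min s.toNNReal (max a b).toNNReal) ω)
      (volume.restrict (uIoc a b)) :=
    Integrable.of_bound (hm.measurable_real.comp
      (measurable_prodMk_right (y := ω))).aestronglyMeasurable C
      (Eventually.of_forall fun q => hC _ (min_le_right _ _) _)
  refine h1.congr ?_
  filter_upwards [ae_restrict_mem measurableSet_uIoc] with s hs
  rw [min_eq_left (hle s hs)]

theorem continuous_integral (h : BddProg 𝓕 Y) (ω : Ω) :
    Continuous fun t : ℝ≥0 => ∫ s in (0 : ℝ)..t, Y s.toNNReal ω :=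
  (intervalIntegral.continuous_primitive (h.intervalIntegrable ω) 0).comp NNReal.continuous_coe

theorem measurable_integral (h : BddProg 𝓕 Y) {s t : ℝ≥0} (hst : s ≤ t) :
    Measurable[𝓕 t] fun ω => ∫ r in (0 : ℝ)..s, Y r.toNNReal ω :=
  (h.meas s).integral.mono (𝓕.mono hst) le_rfl

theorem integral (h : BddProg 𝓕 Y) : BddProg 𝓕 fun t ω => ∫ s in (0 : ℝ)..t, Y s.toNNReal ω where
  meas t := MeasProc.of_rightCont (fun _ hs => h.measurable_integral hs)
    fun ω _ => (h.continuous_integral ω).continuousWithinAt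
  bdd T := by
    obtain ⟨C, hC⟩ := h.bdd T
    refine ⟨|C| * T, fun t ht ω => ?_⟩
    rw [← Real.norm_eq_abs]
    refine (intervalIntegral.norm_integral_le_of_norm_le_const (C := |C|) fun s hs => ?_).trans ?_
    · rw [uIoc_of_le t.coe_nonneg] at hs
      exact (hC _ (Real.toNNReal_le_iff_le_coe.2 (hs.2.trans ht)) ω).trans (le_abs_self _)
    · rw [sub_zero, abs_of_nonneg t.coe_nonneg]
      gcongr

theorem integral_swap (h : BddProg 𝓕 Y) [IsFiniteMeasure μ] (s t : ℝ≥0) :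
    ∫ r in (s : ℝ)..t, (∫ ω, Y r.toNNReal ω ∂μ) =
      ∫ ω, (∫ r in (0 : ℝ)..t, Y r.toNNReal ω) ∂μ - ∫ ω, (∫ r in (0 : ℝ)..s, Y r.toNNReal ω) ∂μ := by
  rw [intervalIntegral_integral_swap (h.integrable_prod s t),
    ← integral_sub (h.integral.integrable t) (h.integral.integrable s)]
  refine integral_congr_ae (Eventually.of_forall fun ω => ?_)
  exact (intervalIntegral.integral_interval_sub_left (h.intervalIntegrable ω _ _)
    (h.intervalIntegrable ω _ _)).symm

end BddProg

/-- A bounded progressive process `Y` whose expectations `𝔼[Y_t 1_A]` are differentiable from the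
right yields a martingale after subtraction of its drift. -/
theorem BddProg.martingale_sub_integral [IsFiniteMeasure μ] (hY : BddProg 𝓕 Y) (hL : BddProg 𝓕 L)
    (hcont : ∀ (s T : ℝ≥0) (A : Set Ω), MeasurableSet[𝓕 s] A →
      ContinuousOn (fun r : ℝ => ∫ ω in A, Y r.toNNReal ω ∂μ) (Icc s T))
    (hder : ∀ (s : ℝ≥0) (A : Set Ω), MeasurableSet[𝓕 s] A →
      HasDerivWithinAt (fun r : ℝ => ∫ ω in A, Y r.toNNReal ω ∂μ) (∫ ω in A, L s ω ∂μ) (Ioi s) s) :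
    Martingale (fun t ω => Y t ω - ∫ s in (0 : ℝ)..t, L s.toNNReal ω) 𝓕 μ := by
  have hN := hY.sub hL.integral
  refine ⟨fun t => (hN.adapted t).stronglyMeasurable, fun s t hst => ?_⟩
  refine (ae_eq_condExp_of_forall_setIntegral_eq (𝓕.le s) (hN.integrable t)
    (fun A _ _ => (hN.integrable s).integrableOn) (fun A hA _ => ?_)
    (hN.adapted s).stronglyMeasurable.aestronglyMeasurable).symm
  have key : ∫ r in (s : ℝ)..t, (∫ ω in A, L r.toNNReal ω ∂μ) =
      ∫ ω in A, Y t ω ∂μ - ∫ ω in A, Y s ω ∂μ := by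
    rw [intervalIntegral.integral_eq_sub_of_hasDeriv_right_of_le (a := (s : ℝ)) (b := t)
      (f := fun r : ℝ => ∫ ω in A, Y r.toNNReal ω ∂μ) hst (hcont s t A hA), Real.toNNReal_coe,
      Real.toNNReal_coe]
    · intro r hr
      have hr0 : 0 ≤ r := s.2.trans hr.1.le
      lift r to ℝ≥0 using hr0
      rw [Real.toNNReal_coe]
      exact hder r A (𝓕.mono hr.1.le A hA)
    · rw [intervalIntegrable_iff]
      exact (hL.integrable_prod (μ := μ.restrict A) s t).integral_prod_left
  rw [hL.integral_swap (μ := μ.restrict A)] at key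
  rw [integral_sub (hY.integrable s).integrableOn (hL.integral.integrable s).integrableOn,
    integral_sub (hY.integrable t).integrableOn (hL.integral.integrable t).integrableOn]
  linarith

theorem integral_mul_eq_of_martingale [IsFiniteMeasure μ] {N : ℝ≥0 → Ω → ℝ} (hM : Martingale N 𝓕 μ)
    {s t : ℝ≥0} (hst : s ≤ t) {Z : Ω → ℝ} (hZ : Measurable[𝓕 s] Z) {C : ℝ} (hC : ∀ ω, |Z ω| ≤ C)
    {A : Set Ω} (hA : MeasurableSet[𝓕 s] A) :
    ∫ ω in A, N t ω * Z ω ∂μ = ∫ ω in A, N s ω * Z ω ∂μ := by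
  have hi := hM.integrable t
  have h1 := condExp_stronglyMeasurable_mul_of_bound (𝓕.le s) hZ.stronglyMeasurable hi C
    (Eventually.of_forall hC)
  have h2 : Integrable (Z * N t) μ :=
    hi.bdd_mul (c := C) (hZ.mono (𝓕.le s) le_rfl).aestronglyMeasurable (Eventually.of_forall hC)
  have h3 := setIntegral_condExp (𝓕.le s) h2 hA
  simp only [mul_comm (N _ _)]
  refine h3.symm.trans (integral_congr_ae (ae_restrict_of_ae ?_))
  filter_upwards [h1, hM.2 s t hst] with ω h1 h2
  rw [h1, Pi.mul_apply, h2]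

/-- Integration by parts for a martingale and an absolutely continuous process. -/
theorem BddProg.martingale_mul_sub [IsFiniteMeasure μ] {N : ℝ≥0 → Ω → ℝ} (hN : BddProg 𝓕 N)
    (hM : Martingale N 𝓕 μ) (hL : BddProg 𝓕 L) :
    Martingale (fun t ω => N t ω * (∫ s in (0 : ℝ)..t, L s.toNNReal ω) -
      ∫ s in (0 : ℝ)..t, N s.toNNReal ω * L s.toNNReal ω) 𝓕 μ := by
  have hB := hL.integral
  have hNL := hN.mul hL
  have hK := (hN.mul hB).sub hNL.integral
  refine ⟨fun t => (hK.adapted t).stronglyMeasurable, fun s t hst => ?_⟩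
  refine (ae_eq_condExp_of_forall_setIntegral_eq (𝓕.le s) (hK.integrable t)
    (fun A _ _ => (hK.integrable s).integrableOn) (fun A hA _ => ?_)
    (hK.adapted s).stronglyMeasurable.aestronglyMeasurable).symm
  obtain ⟨C, hC⟩ := hL.bdd t
  obtain ⟨D, hD⟩ := hN.bdd t
  obtain ⟨D', hD'⟩ := hB.bdd s
  have p1 : ∫ ω in A, N t ω * (∫ r in (0 : ℝ)..s, L r.toNNReal ω) ∂μ =
      ∫ ω in A, N s ω * (∫ r in (0 : ℝ)..s, L r.toNNReal ω) ∂μ :=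
    integral_mul_eq_of_martingale hM hst (hB.adapted s) (hD' s le_rfl) hA
  have hNt : BddProg (⟨fun _ => mΩ, fun _ _ _ => le_rfl, fun _ => le_rfl⟩ : Filtration ℝ≥0 mΩ)
      fun r ω => N t ω * L r ω := by
    refine ⟨fun T => ?_, fun T => ?_⟩
    · exact Measurable.mul ((hN.measurable t).comp measurable_snd) ((hL.meas T).mono (𝓕.le T))
    · obtain ⟨C', hC'⟩ := hL.bdd T
      refine ⟨D * C', fun r hr ω => ?_⟩
      rw [abs_mul]
      exact mul_le_mul (hD t le_rfl ω) (hC' r hr ω) (abs_nonneg _)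
        ((abs_nonneg _).trans (hD t le_rfl ω))
  have p2 := hNt.integral_swap (μ := μ.restrict A) s t
  have p3 := hNL.integral_swap (μ := μ.restrict A) s t
  have p4 : ∫ r in (s : ℝ)..t, (∫ ω in A, N t ω * L r.toNNReal ω ∂μ) =
      ∫ r in (s : ℝ)..t, (∫ ω in A, N r.toNNReal ω * L r.toNNReal ω ∂μ) := by
    refine intervalIntegral.integral_congr fun r hr => ?_
    rw [uIcc_of_le (NNReal.coe_le_coe.2 hst)] at hr
    have hr0 : 0 ≤ r := s.2.trans hr.1
    lift r to ℝ≥0 using hr0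
    simp only [Real.toNNReal_coe]
    exact integral_mul_eq_of_martingale hM hr.2 (hL.adapted r) (hC r hr.2) (𝓕.mono hr.1 A hA)
  rw [p4, p3] at p2
  simp only [intervalIntegral.integral_const_mul] at p2
  rw [integral_sub ((hN.mul hB).integrable s).integrableOn (hNL.integral.integrable s).integrableOn,
    integral_sub ((hN.mul hB).integrable t).integrableOn (hNL.integral.integrable t).integrableOn]
  linarith

/-- Adapted processes with continuous paths are predictable. -/
theorem isStronglyPredictable_of_continuous (hY : ∀ t, Measurable[𝓕 t] (Y t))
    (hc : ∀ ω, Continuous fun t => Y t ω) : IsStronglyPredictable 𝓕 Y := by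
  obtain ⟨lt, hlt⟩ : ∃ lt : ℕ → ℝ≥0 → ℝ≥0, ∀ N t, lt N t =
    ((⌈t * (N + 1 : ℕ)⌉₊ - 1 : ℕ) : ℝ≥0) / (N + 1 : ℕ) := ⟨_, fun _ _ => rfl⟩
  have hle : ∀ N t, lt N t ≤ t ∧ t ≤ lt N t + 1 / (N + 1 : ℕ) := by
    intro N t
    have hpos : (0 : ℝ≥0) < (N + 1 : ℕ) := by positivity
    rw [hlt, ← add_div, div_le_iff₀ hpos, le_div_iff₀ hpos]
    rcases eq_or_ne ⌈t * (N + 1 : ℕ)⌉₊ 0 with h0 | h0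
    · rw [h0]
      refine ⟨by simp, (Nat.ceil_eq_zero.1 h0).trans (by simp)⟩
    · have := (Nat.ceil_eq_iff h0).1 rfl
      refine ⟨this.1.le, this.2.trans ?_⟩
      have h1 : ⌈t * (N + 1 : ℕ)⌉₊ ≤ ⌈t * (N + 1 : ℕ)⌉₊ - 1 + 1 := by omega
      exact_mod_cast h1
  have hlim : ∀ t, Tendsto (fun N => lt N t) atTop (𝓝 t) := by
    intro t
    rw [tendsto_iff_dist_tendsto_zero]
    refine squeeze_zero (fun _ => dist_nonneg) (fun N => ?_) (tendsto_one_div_add_atTop_nhds_zero_nat (𝕜 := ℝ))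
    have h1 := (hle N t).1
    have h2 := (hle N t).2
    rw [NNReal.dist_eq, abs_sub_comm, abs_of_nonneg (sub_nonneg.2 (NNReal.coe_le_coe.2 h1))]
    have h3 := NNReal.coe_le_coe.2 h2
    push_cast at h3
    linarith
  refine stronglyMeasurable_of_tendsto atTop (f := fun (N : ℕ) (q : ℝ≥0 × Ω) => Y (lt N q.1) q.2)
    (fun N => ?_) (tendsto_pi_nhds.2 fun q => ((hc q.2).tendsto q.1).comp (hlim q.1))
  refine Measurable.stronglyMeasurable fun B hB => ?_
  have e : (fun q : ℝ≥0 × Ω => Y (lt N q.1) q.2) ⁻¹' B = ({⊥} ×ˢ (Y 0 ⁻¹' B)) ∪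
      ⋃ i : ℕ, Ioc ((i : ℝ≥0) / (N + 1 : ℕ)) (((i + 1 : ℕ) : ℝ≥0) / (N + 1 : ℕ)) ×ˢ
        (Y ((i : ℝ≥0) / (N + 1 : ℕ)) ⁻¹' B) := by
    ext ⟨t, ω⟩
    have hpos : (0 : ℝ≥0) < (N + 1 : ℕ) := by positivity
    have hi : ∀ i : ℕ, t ∈ Ioc ((i : ℝ≥0) / (N + 1 : ℕ)) (((i + 1 : ℕ) : ℝ≥0) / (N + 1 : ℕ)) ↔
        ⌈t * (N + 1 : ℕ)⌉₊ = i + 1 := by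
      intro i
      rw [Nat.ceil_eq_iff (Nat.succ_ne_zero i), mem_Ioc, div_lt_iff₀ hpos, le_div_iff₀ hpos]
      rfl
    simp only [mem_preimage, mem_union, mem_prod, mem_singleton_iff, mem_iUnion, hi]
    rcases eq_or_ne t 0 with rfl | ht
    · have h0 : lt N 0 = 0 := by rw [hlt]; simp
      simp [h0]
    · have h1 : ⌈t * (N + 1 : ℕ)⌉₊ ≠ 0 := by
        rw [Ne, Nat.ceil_eq_zero, not_le]
        positivity
      obtain ⟨j, hj⟩ := Nat.exists_eq_succ_of_ne_zero h1
      have h2 : lt N t = (j : ℝ≥0) / (N + 1 : ℕ) := by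
        rw [hlt, hj]
        simp
      rw [h2, hj]
      constructor
      · exact fun h => Or.inr ⟨j, rfl, h⟩
      · rintro (⟨h, -⟩ | ⟨i, hi, h⟩)
        · exact absurd h ht
        · rwa [Nat.succ_injective hi]
  rw [e]
  refine (measurableSet_predictable_singleton_bot_prod (hY 0 hB)).union
    (MeasurableSet.iUnion fun i => measurableSet_predictable_Ioc_prod _ _ (hY _ hB))

end Kinetic

namespace Kinetic

/-! ### Measurability of the solutions -/

theorem measurable_of_tendsto_comap {Ω S M : Type*} [MeasurableSpace Ω] [TopologicalSpace S]
    [MeasurableSpace S] [BorelSpace S] [PseudoMetricSpace M] [SecondCountableTopology M]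
    {Φ : Ω → M} {g : Ω → S} (hd : ∀ ω₀, Measurable fun ω => dist (Φ ω) (Φ ω₀))
    (hg : ∀ ω₀, Tendsto g (comap Φ (𝓝 (Φ ω₀))) (𝓝 (g ω₀))) : Measurable g := by
  refine measurable_of_isOpen fun U hU => ?_
  have key : ∀ ω₀ : g ⁻¹' U, ∃ r > 0, ∀ ω, dist (Φ ω) (Φ ω₀) < r → g ω ∈ U := by
    intro ω₀
    have h1 := (hg ω₀).eventually (hU.mem_nhds ω₀.2)
    rw [eventually_comap, Metric.eventually_nhds_iff] at h1
    obtain ⟨r, hr, h⟩ := h1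
    exact ⟨r, hr, fun ω hω => h hω ω rfl⟩
  choose r hr hrU using key
  obtain ⟨T, hT, hTU⟩ := TopologicalSpace.isOpen_iUnion_countable
    (fun ω₀ : g ⁻¹' U => Metric.ball (Φ ω₀) (r ω₀)) fun _ => Metric.isOpen_ball
  have e : g ⁻¹' U = ⋃ ω₀ ∈ T, {ω | dist (Φ ω) (Φ (ω₀ : Ω)) < r ω₀} := by
    ext ω
    constructor
    · intro hω
      have : Φ ω ∈ ⋃ ω₀ : g ⁻¹' U, Metric.ball (Φ ω₀) (r ω₀) :=
        mem_iUnion.2 ⟨⟨ω, hω⟩, Metric.mem_ball_self (hr _)⟩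
      rw [← hTU] at this
      simpa using this
    · intro hω
      simp only [mem_iUnion] at hω
      obtain ⟨ω₀, _, h⟩ := hω
      exact hrU ω₀ ω h
  rw [e]
  exact MeasurableSet.biUnion hT fun ω₀ _ => measurableSet_lt (hd ω₀) measurable_const

variable {k α η β ε C : ℝ}

/-- Solutions at time `t` depend measurably on the driving path on `[0, t]`. -/
theorem measurable_solution {Ω : Type*} [MeasurableSpace Ω] [MeasurableSpace (G k)]
    [BorelSpace (G k)] [MeasurableSpace (H α)] [BorelSpace (H α)] (hk : 1 ≤ k) (hε : 0 < ε)
    (hβ : 3 / 2 < β) (hη : 3 / 2 < η) (hα : α < 3 / 2) (hαβ : α ≤ β) {f₀ : G k} {u₀ : H η}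
    (hf₀ : Integrable (fun z => (1 + |z.2| ^ 4) * |f₀ z| ^ 2) dxdv)
    {n : Ω → ℝ → C(Torus, ℝ)} {f : Ω → ℝ → G k} {u : Ω → ℝ → H β} {Ψ : Ω → ℝ → Phase ≃ₜ Phase}
    (h : ∀ ω, KineticSolution ε C (n ω) f₀ u₀ (f ω) (u ω) (Ψ ω)) {t : ℝ} (ht : 0 ≤ t)
    (hn : StronglyMeasurable fun q : ℝ × Ω => n q.2 (min q.1 t)) :
    Measurable (fun ω => f ω t) ∧ Measurable fun ω => H.incl hαβ (u ω t) := by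
  have := Fact.mk (ENNReal.one_ne_top)
  have hsc : SecondCountableTopology (Lp C(Torus, ℝ) 1 (volume.restrict (Ioc 0 t))) :=
    Lp.SecondCountableTopology
  have hm : ∀ ω, MemLp (n ω) 1 (volume.restrict (Ioc 0 t)) := fun ω =>
    MemLp.of_bound (h ω).meas_n.aestronglyMeasurable C (Eventually.of_forall (h ω).norm_n)
  have hdist : ∀ ω ω₀, dist ((hm ω).toLp (n ω)) ((hm ω₀).toLp (n ω₀)) =
      ∫ r in (0 : ℝ)..t, ‖n ω r - n ω₀ r‖ := by
    intro ω ω₀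
    rw [L1.dist_eq_integral_dist, intervalIntegral.integral_of_le ht]
    refine integral_congr_ae ?_
    filter_upwards [(hm ω).coeFn_toLp, (hm ω₀).coeFn_toLp] with r h1 h2
    rw [h1, h2, dist_eq_norm]
  have hd : ∀ ω₀, Measurable fun ω => dist ((hm ω).toLp (n ω)) ((hm ω₀).toLp (n ω₀)) := by
    intro ω₀
    have e : (fun ω => dist ((hm ω).toLp (n ω)) ((hm ω₀).toLp (n ω₀))) =
        fun ω => ∫ r in Ioc 0 t, ‖n ω (min r t) - n ω₀ r‖ := by
      funext ω
      rw [hdist, intervalIntegral.integral_of_le ht]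
      refine setIntegral_congr_fun measurableSet_Ioc fun r hr => ?_
      simp only [min_eq_left hr.2]
    rw [e]
    have h1 : StronglyMeasurable fun q : ℝ × Ω => ‖n q.2 (min q.1 t) - n ω₀ q.1‖ :=
      (hn.sub ((h ω₀).meas_n.comp_measurable measurable_fst)).norm
    exact (h1.integral_prod_left' (μ := volume.restrict (Ioc 0 t))).measurable
  have hlim : ∀ ω₀, Tendsto (fun ω => ∫ r in (0 : ℝ)..t, ‖n ω r - n ω₀ r‖)
      (comap (fun ω => (hm ω).toLp (n ω)) (𝓝 ((hm ω₀).toLp (n ω₀)))) (𝓝 0) := by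
    intro ω₀
    simp only [← hdist]
    exact tendsto_iff_dist_tendsto_zero.1 tendsto_comap
  have htt : t ∈ Icc 0 t := ⟨ht, le_rfl⟩
  exact ⟨measurable_of_tendsto_comap hd fun ω₀ => ((h ω₀).tendsto_solution hk hε hβ hη hf₀ h
      (hlim ω₀) htt hα hαβ).1,
    measurable_of_tendsto_comap hd fun ω₀ => ((h ω₀).tendsto_solution hk hε hβ hη hf₀ h
      (hlim ω₀) htt hα hαβ).2⟩

end Kinetic

namespace Kinetic

/-! ### The state process -/

instance {k : ℝ} : MeasurableSpace (G k) := borel _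
instance {k : ℝ} : BorelSpace (G k) := ⟨rfl⟩
instance {s : ℝ} : MeasurableSpace (H s) := borel _
instance {s : ℝ} : BorelSpace (H s) := ⟨rfl⟩

variable {Ω F : Type*} [mΩ : MeasurableSpace Ω] [NormedAddCommGroup F] [NormedSpace ℝ F]
  [MeasurableSpace F] [BorelSpace F] {E : Set F} {m : MarkovProcess Ω E} {k α η β ε : ℝ}
  {ψ : G k × H α × E → ℝ} {ι : F →ₗ[ℝ] C(Torus, ℝ)}

/-- The Markov process `(f, u, m^ε)`. -/
def stateAt (m : MarkovProcess Ω E) (ε : ℝ) (hαβ : α ≤ β) (f : ℝ≥0 → Ω → G0 k)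
    (u : ℝ≥0 → Ω → H β) (t : ℝ≥0) (ω : Ω) : State k α E :=
  (f t ω, H.incl hαβ (u t ω), rescaled ε m.X t ω)

/-- The canonical filtration of the rescaled driving process. -/
def drivingFiltration (m : MarkovProcess Ω E) (ε : ℝ) : Filtration ℝ≥0 mΩ :=
  canonicalFiltration (rescaled ε m.X) (fun _ => m.measurable_X _)

/-- For every `ω`, `(f, u)` is the solution of the kinetic system driven by the rescaled process. -/
structure IsDriven (ι : F →ₗ[ℝ] C(Torus, ℝ)) (m : MarkovProcess Ω E) (ε α : ℝ) (f₀ : G0 k) (u₀ : H η)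
    (f : ℝ≥0 → Ω → G0 k) (u : ℝ≥0 → Ω → H β) : Prop where
  drivingSpace : DrivingSpace E ι
  pos : 0 < ε
  one_le : 1 ≤ k
  lt_α : 1 / 2 < α
  α_lt : α < 3 / 2
  lt_η : 3 / 2 < η
  lt_β : 3 / 2 < β
  integrable : Integrable (fun z => (1 + |z.2| ^ 4) * |(f₀ : G k) z| ^ 2) dxdv
  sol : ∀ ω, IsSolution ε (fun t x => ι (rescaled ε m.X t ω : E) x) (f₀ : G k) u₀
    (fun t => (f t ω : G k)) (fun t => u t ω)

namespace IsDriven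

variable {f₀ : G0 k} {u₀ : H η} {f : ℝ≥0 → Ω → G0 k} {u : ℝ≥0 → Ω → H β} {hαβ : α ≤ β}

theorem scale_pos (hε : 0 < ε) : 0 < ((ε ^ 2)⁻¹).toNNReal := Real.toNNReal_pos.2 (by positivity)

theorem isCadlag_driving (hε : 0 < ε) (m : MarkovProcess Ω E) (ω : Ω) :
    IsCadlag fun t => rescaled ε m.X t ω :=
  (m.cadlag ω).comp_mul (scale_pos hε)

theorem exists_kineticSolution (D : IsDriven ι m ε α f₀ u₀ f u) :
    ∃ C, 0 ≤ C ∧ ∃ Ψ : Ω → ℝ → Phase ≃ₜ Phase, ∀ ω, KineticSolution ε C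
      (fun s => ι (rescaled ε m.X s.toNNReal ω : E)) (f₀ : G k) u₀
      (fun s => (f s.toNNReal ω : G k)) (fun s => u s.toNNReal ω) (Ψ ω) := by
  obtain ⟨C, hC, h⟩ := D.drivingSpace.exists_bound
  have key : ∀ ω, ∃ Ψ : ℝ → Phase ≃ₜ Phase, KineticSolution ε C
      (fun s => ι (rescaled ε m.X s.toNNReal ω : E)) (f₀ : G k) u₀
      (fun s => (f s.toNNReal ω : G k)) (fun s => u s.toNNReal ω) Ψ := fun ω =>
    (D.sol ω).exists_kineticSolution (n := fun t => ι (rescaled ε m.X t ω : E)) D.pos hC D.lt_β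
      (((isCadlag_driving D.pos m ω).comp (g := fun y : E => ι y)
        (D.drivingSpace.continuous_embedding.comp continuous_subtype_val)).rightCont)
      (fun s => (h _ (Subtype.coe_prop _)).1) fun s => (h _ (Subtype.coe_prop _)).2
  choose Ψ hΨ using key
  exact ⟨C, hC, Ψ, hΨ⟩

theorem measurable_driving (m : MarkovProcess Ω E) (ε : ℝ) {s t : ℝ≥0} (hst : s ≤ t) :
    Measurable[drivingFiltration m ε t] (rescaled ε m.X s) := by
  refine Measurable.mono (comap_measurable (rescaled ε m.X s)) ?_ le_rfl
  exact le_iSup₂ (f := fun s (_ : s ≤ t) => MeasurableSpace.comap (rescaled ε m.X s) inferInstance)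
    s hst

theorem drivingFiltration_le (m : MarkovProcess Ω E) (ε : ℝ) (t : ℝ≥0) :
    drivingFiltration m ε t ≤
      canonicalFiltration m.X m.measurable_X (((ε ^ 2)⁻¹).toNNReal * t) := by
  refine iSup₂_le fun s hs => ?_
  exact le_iSup₂ (f := fun s (_ : s ≤ ((ε ^ 2)⁻¹).toNNReal * t) =>
    MeasurableSpace.comap (m.X s) inferInstance) _ (mul_le_mul_right hs _)

theorem measurable_stateAt (D : IsDriven ι m ε α f₀ u₀ f u) (t : ℝ≥0) :
    Measurable[drivingFiltration m ε t] (stateAt m ε hαβ f u t) := by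
  obtain ⟨C, hC, Ψ, hΨ⟩ := D.exists_kineticSolution
  have hsc := D.drivingSpace.secondCountable
  have h1 : MeasProc (drivingFiltration m ε t) t (rescaled ε m.X) :=
    MeasProc.of_rightCont (mΩ := drivingFiltration m ε t)
      (fun s hs => measurable_driving m ε hs) fun ω => (isCadlag_driving D.pos m ω).rightCont
  have h2 : @StronglyMeasurable _ _ _ (@Prod.instMeasurableSpace ℝ≥0 Ω _ (drivingFiltration m ε t))
      fun q : ℝ≥0 × Ω => ι (rescaled ε m.X (min q.1 t) q.2 : E) :=
    (D.drivingSpace.continuous_embedding.comp continuous_subtype_val).comp_stronglyMeasurable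
      (Measurable.stronglyMeasurable h1)
  have h3 := @measurable_solution k α η β ε C Ω (drivingFiltration m ε t) _ _ _ _ D.one_le D.pos
    D.lt_β D.lt_η D.α_lt hαβ _ _ D.integrable _ _ _ Ψ hΨ t t.coe_nonneg (by
      have := h2.comp_measurable (g := fun q : ℝ × Ω => (q.1.toNNReal, q.2))
        (@Measurable.prodMk _ _ _ _ _ (drivingFiltration m ε t) _ _
        (measurable_real_toNNReal.comp measurable_fst) (@measurable_snd _ _ _ (drivingFiltration m ε t)))
      refine Eq.subst (motive := fun x => @StronglyMeasurable _ _ _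
        (@Prod.instMeasurableSpace ℝ Ω _ (drivingFiltration m ε t)) x) (funext fun q => ?_) this
      simp only [Function.comp_apply]
      rw [Monotone.map_min (f := Real.toNNReal) fun _ _ h => Real.toNNReal_le_toNNReal h,
        Real.toNNReal_coe])
  simp only [Real.toNNReal_coe] at h3
  exact (h3.1.subtype_mk).prodMk (h3.2.prodMk (measurable_driving m ε le_rfl))

theorem rightCont_stateAt (D : IsDriven ι m ε α f₀ u₀ f u) (ω : Ω) (t : ℝ≥0) :
    ContinuousWithinAt (fun t => stateAt m ε hαβ f u t ω) (Ioi t) t := by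
  obtain ⟨C, hC, Ψ, hΨ⟩ := D.exists_kineticSolution
  have h1 := (hΨ ω).continuousOn_f D.one_le D.pos D.lt_β (T := t + 1) (by positivity)
  have h2 : ContinuousWithinAt (fun s => f s ω) (Ioi t) t := by
    refine tendsto_subtype_rng.2 ?_
    have h3 := (h1 t ⟨t.coe_nonneg, by simp⟩).tendsto.comp (tendsto_nhdsWithin_iff.2
      ⟨(NNReal.continuous_coe.tendsto t).mono_left (nhdsWithin_le_nhds (s := Ioi t)), by
        filter_upwards [mem_nhdsWithin_of_mem_nhds (Iio_mem_nhds (lt_add_one t))] with s hs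
        exact ⟨s.coe_nonneg, NNReal.coe_le_coe.2 (le_of_lt hs)⟩⟩)
    simpa only [Function.comp_def, Real.toNNReal_coe] using h3
  exact h2.prodMk ((((H.continuous_incl hαβ).comp (D.sol ω).continuous_u).continuousWithinAt).prodMk
    ((isCadlag_driving D.pos m ω).rightCont t))

theorem exists_mem_ballSet (D : IsDriven ι m ε α f₀ u₀ f u) (hαβ : α ≤ β) (T : ℝ≥0) :
    ∃ R, ∀ t ≤ T, ∀ ω, stateAt m ε hαβ f u t ω ∈ State.ballSet k α E R := by
  obtain ⟨C, hC, Ψ, hΨ⟩ := D.exists_kineticSolution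
  obtain ⟨P, R, hR⟩ := KineticSolution.exists_uniform_bound (β := β) D.one_le D.pos D.lt_β D.lt_η hC
    T.coe_nonneg D.α_lt hαβ (f₀ : G k) u₀
  refine ⟨R, fun t ht ω => ?_⟩
  have := hR (hΨ ω) t ⟨t.coe_nonneg, ht⟩
  simp only [Real.toNNReal_coe] at this
  exact this.2

theorem bddProg (D : IsDriven ι m ε α f₀ u₀ f u) (hαβ : α ≤ β) {φ : State k α E → ℝ} (hφ : BLoc φ) :
    BddProg (drivingFiltration m ε) fun t ω => φ (stateAt m ε hαβ f u t ω) where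
  meas t := (MeasProc.of_rightCont (fun s hs => (D.measurable_stateAt s).mono
    ((drivingFiltration m ε).mono hs) le_rfl) D.rightCont_stateAt).comp hφ.measurable
  bdd T := by
    obtain ⟨R, hR⟩ := D.exists_mem_ballSet hαβ T
    obtain ⟨C, hC⟩ := hφ.2 _ (State.isBounded_ballSet D.drivingSpace R)
    exact ⟨C, fun t ht ω => hC _ (hR t ht ω)⟩

end IsDriven

end Kinetic

namespace Kinetic

variable {Ω F : Type*} [mΩ : MeasurableSpace Ω] [NormedAddCommGroup F] [NormedSpace ℝ F]
  [MeasurableSpace F] [BorelSpace F] {E : Set F} {m : MarkovProcess Ω E} {k α η β ε : ℝ}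
  {ψ : G k × H α × E → ℝ} {ι : F →ₗ[ℝ] C(Torus, ℝ)}

theorem CbLoc.bLoc {S : Type*} [PseudoMetricSpace S] {φ : S → ℝ} (h : CbLoc φ) : BLoc φ := by
  let _ : MeasurableSpace S := borel S
  have : BorelSpace S := ⟨rfl⟩
  exact ⟨h.1.measurable, h.2⟩

theorem State.measurableSet_ballSet (R : ℝ) : MeasurableSet (State.ballSet k α E R) := by
  refine MeasurableSet.inter (s₁ := {p : State k α E | ‖(p.1 : G k)‖ ≤ R})
    (s₂ := {p | ‖p.2.1‖ ≤ R}) (measurableSet_le ?_ measurable_const)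
    (measurableSet_le ?_ measurable_const)
  · exact (measurable_subtype_coe.comp measurable_fst).norm
  · exact (measurable_fst.comp measurable_snd).norm

namespace IsDriven

variable {f₀ : G0 k} {u₀ : H η} {f : ℝ≥0 → Ω → G0 k} {u : ℝ≥0 → Ω → H β} {hαβ : α ≤ β}

/-- The change of the driving variable, the other ones being frozen at time `t`. -/
def frozenIncrement (m : MarkovProcess Ω E) (ψ : G k × H α × E → ℝ) (h : ℝ≥0) (p : State k α E) : ℝ :=
  m.semigroup h (fun y => ψ (p.1, p.2.1, y)) p.2.2 - ψ p.toAmbient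

theorem exists_frozenIncrement_le (D : IsDriven ι m ε α f₀ u₀ f u) (hψ : IsGoodTestFunction m ψ)
    (R : ℝ) : ∃ K, ∀ p ∈ State.ballSet k α E R, ∀ h : ℝ≥0, |frozenIncrement m ψ h p| ≤ K * h := by
  obtain ⟨K, hK⟩ := hψ.genN_cbLoc.2 _ (State.isBounded_ballSet D.drivingSpace R)
  refine ⟨K, fun p hp h => ?_⟩
  exact MarkovProcess.abs_semigroup_sub_le D.drivingSpace.isBounded_univ
    (hψ.inDomain p.1 p.1.2 p.2.1).hasGenerator (K := K) (fun y => hK (p.1, p.2.1, y) hp) h p.2.2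

/-- Expectation of the change of the driving variable. -/
theorem setIntegral_frozenIncrement (D : IsDriven ι m ε α f₀ u₀ f u) (hαβ : α ≤ β)
    (hψ : IsGoodTestFunction m ψ) (n : E) (t h : ℝ≥0) :
    Measurable (fun ω => frozenIncrement m ψ (((ε ^ 2)⁻¹).toNNReal * h)
      (stateAt m ε hαβ f u t ω)) ∧
    Measurable (fun ω => ψ (f t ω, H.incl hαβ (u t ω), rescaled ε m.X (t + h) ω)) ∧
    ∀ A, MeasurableSet[drivingFiltration m ε t] A →
      ∫ ω in A, frozenIncrement m ψ (((ε ^ 2)⁻¹).toNNReal * h) (stateAt m ε hαβ f u t ω)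
          ∂(m.law n) =
        ∫ ω in A, (ψ (f t ω, H.incl hαβ (u t ω), rescaled ε m.X (t + h) ω) -
          ψ (stateAt m ε hαβ f u t ω).toAmbient) ∂(m.law n) := by
  obtain ⟨R, hR⟩ := D.exists_mem_ballSet hαβ t
  have hR := hR t le_rfl
  obtain ⟨C, hC⟩ := hψ.bLoc.2 _ (State.isBounded_ballSet D.drivingSpace R)
  obtain ⟨c, hc⟩ : ∃ c, c = ((ε ^ 2)⁻¹).toNNReal := ⟨_, rfl⟩
  have hZ := D.measurable_stateAt (hαβ := hαβ) t
  have hZ' := hZ.mono ((drivingFiltration m ε).le t) le_rfl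
  have hY := (D.bddProg hαβ hψ.bLoc).measurable t
  obtain ⟨Θ, hΘdef⟩ : ∃ Θ : State k α E × E → ℝ, Θ = fun q =>
    (State.ballSet k α E R).indicator (fun p => ψ p.toAmbient) (q.1.1, q.1.2.1, q.2) := ⟨_, rfl⟩
  have hΘ : Measurable Θ := by
    rw [hΘdef]
    exact (hψ.bLoc.measurable.indicator (State.measurableSet_ballSet R)).comp
      ((measurable_fst.comp measurable_fst).prodMk
      (((measurable_fst.comp measurable_snd).comp measurable_fst).prodMk measurable_snd))
  have hΘC : ∀ q, |Θ q| ≤ |C| := by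
    intro q
    rw [hΘdef]
    by_cases hq : (q.1.1, q.1.2.1, q.2) ∈ State.ballSet k α E R
    · simp only [indicator_of_mem hq]
      exact (hC _ hq).trans (le_abs_self _)
    · simp only [indicator_of_notMem hq, abs_zero, abs_nonneg]
  have hΘZ : ∀ ω y, Θ (stateAt m ε hαβ f u t ω, y) =
      ψ (f t ω, H.incl hαβ (u t ω), y) := by
    intro ω y
    have : (((stateAt m ε hαβ f u t ω).1, (stateAt m ε hαβ f u t ω).2.1, y) :
      State k α E) ∈ State.ballSet k α E R := hR ω
    rw [hΘdef]
    simp only [indicator_of_mem this]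
    rfl
  have hX : rescaled ε m.X (t + h) = m.X (c * t + c * h) := by
    rw [← mul_add, hc]
    rfl
  have m2 : Measurable fun ω => ψ (f t ω, H.incl hαβ (u t ω), rescaled ε m.X (t + h) ω) := by
    simp only [← hΘZ]
    exact hΘ.comp (hZ'.prodMk (m.measurable_X _))
  have hP : Measurable fun p : State k α E => ∫ ω', Θ (p, m.X (c * h) ω') ∂(m.law p.2.2) := by
    have hπ : Measurable fun p : State k α E => p.2.2 := measurable_snd.comp measurable_snd
    exact (StronglyMeasurable.integral_kernel_prod_right (κ := m.law.comap _ hπ)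
      (f := fun (p : State k α E) ω' => Θ (p, m.X (c * h) ω'))
      (hΘ.comp (measurable_fst.prodMk
        ((m.measurable_X _).comp measurable_snd))).stronglyMeasurable).measurable
  have e : (fun ω => frozenIncrement m ψ (c * h) (stateAt m ε hαβ f u t ω)) = fun ω =>
      ∫ ω', Θ (stateAt m ε hαβ f u t ω, m.X (c * h) ω') ∂(m.law (m.X (c * t) ω)) -
        ψ (stateAt m ε hαβ f u t ω).toAmbient := by
    funext ω
    simp only [hΘZ]
    rw [hc]
    rfl
  have mP : Measurable fun ω =>
      ∫ ω', Θ (stateAt m ε hαβ f u t ω, m.X (c * h) ω') ∂(m.law (m.X (c * t) ω)) := by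
    have := hP.comp hZ'
    rw [hc]
    rw [hc] at this
    exact this
  rw [← hc]
  refine ⟨?_, m2, fun A hA => ?_⟩
  · rw [e]
    exact mP.sub hY
  · have hi : Integrable (fun ω => ψ (stateAt m ε hαβ f u t ω).toAmbient)
      ((m.law n).restrict A) := (D.bddProg hαβ hψ.bLoc).integrable t
    have key := MarkovProcess.setIntegral_frozen (m := m) (π := fun p : State k α E => p.2.2)
      (measurable_snd.comp measurable_snd) (W := stateAt m ε hαβ f u t) (s := c * t)
      (by rw [hc]; exact hZ.mono (drivingFiltration_le m ε t) le_rfl)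
      (fun ω => by rw [hc]; rfl) hΘ hΘC n (c * h)
      (by rw [hc]; exact drivingFiltration_le m ε t A hA)
    rw [e, integral_sub _ hi, integral_sub _ hi, ← key, ← hX]
    · simp only [hΘZ]
    · refine MarkovProcess.integrable_comp m2 (C := |C|) fun ω => ?_
      rw [← hΘZ]
      exact hΘC _
    · refine MarkovProcess.integrable_comp mP (C := |C|) fun ω => ?_
      rw [← Real.norm_eq_abs]
      refine (norm_integral_le_of_norm_le_const (C := |C|)
        (Eventually.of_forall fun ω' => hΘC _)).trans (by simp)

/-- The change of `(f, u)`, the driving variable being taken at the final time. -/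
theorem exists_abs_sub_le (D : IsDriven ι m ε α f₀ u₀ f u) (hαβ : α ≤ β)
    (hψ : IsGoodTestFunction m ψ) (T : ℝ≥0) :
    ∃ K, 0 ≤ K ∧ ∀ ω (y : E) (a b : ℝ≥0), a ≤ T → b ≤ T → |ψ (f b ω, H.incl hαβ (u b ω), y) -
      ψ (f a ω, H.incl hαβ (u a ω), y)| ≤ K * |(b : ℝ) - a| := by
  obtain ⟨C, hC, Ψ, hΨ⟩ := D.exists_kineticSolution
  obtain ⟨K, hK⟩ := KineticSolution.exists_lipschitz D.drivingSpace hψ D.one_le D.pos D.lt_β D.lt_η hC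
    T.coe_nonneg D.α_lt hαβ (f₀ : G k) u₀
  refine ⟨|K|, abs_nonneg K, fun ω y a b ha hb => ?_⟩
  have := hK (hΨ ω) (fun t => (f t.toNNReal ω).2) a ⟨a.coe_nonneg, ha⟩ b ⟨b.coe_nonneg, hb⟩ y
  simp only [Real.toNNReal_coe] at this
  refine this.trans ?_
  gcongr
  exact le_abs_self K

theorem exists_setIntegral_sub_le (D : IsDriven ι m ε α f₀ u₀ f u) (hαβ : α ≤ β)
    (hψ : IsGoodTestFunction m ψ) (n : E) (T : ℝ≥0) :
    ∃ K : ℝ, ∀ a b : ℝ≥0, a ≤ b → b ≤ T → ∀ A, MeasurableSet[drivingFiltration m ε a] A →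
      |∫ ω in A, ψ (stateAt m ε hαβ f u b ω).toAmbient ∂(m.law n) -
        ∫ ω in A, ψ (stateAt m ε hαβ f u a ω).toAmbient ∂(m.law n)| ≤ K * ((b : ℝ) - a) := by
  obtain ⟨K, hK0, hK⟩ := D.exists_abs_sub_le hαβ hψ T
  obtain ⟨R, hR⟩ := D.exists_mem_ballSet hαβ T
  obtain ⟨K', hK'⟩ := D.exists_frozenIncrement_le hψ R
  refine ⟨K + K' * ((ε ^ 2)⁻¹).toNNReal, fun a b hab hb A hA => ?_⟩
  obtain ⟨h, rfl⟩ := exists_add_of_le hab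
  obtain ⟨m1, m2, key⟩ := D.setIntegral_frozenIncrement hαβ hψ n a h
  have key := key A hA
  have hY := D.bddProg hαβ hψ.bLoc
  have i2 : Integrable (fun ω => ψ (f a ω, H.incl hαβ (u a ω), rescaled ε m.X (a + h) ω))
      ((m.law n).restrict A) := by
    obtain ⟨C, hC⟩ := hψ.bLoc.2 _ (State.isBounded_ballSet D.drivingSpace R)
    exact MarkovProcess.integrable_comp m2 (C := C) fun ω =>
      hC (f a ω, H.incl hαβ (u a ω), rescaled ε m.X (a + h) ω) (hR a (hab.trans hb) ω)
  rw [integral_sub i2 (hY.integrable a)] at key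
  have e : ∫ ω in A, ψ (stateAt m ε hαβ f u (a + h) ω).toAmbient ∂(m.law n) -
      ∫ ω in A, ψ (stateAt m ε hαβ f u a ω).toAmbient ∂(m.law n) =
      ∫ ω in A, (ψ (stateAt m ε hαβ f u (a + h) ω).toAmbient -
        ψ (f a ω, H.incl hαβ (u a ω), rescaled ε m.X (a + h) ω)) ∂(m.law n) +
      ∫ ω in A, frozenIncrement m ψ (((ε ^ 2)⁻¹).toNNReal * h) (stateAt m ε hαβ f u a ω)
          ∂(m.law n) := by
    rw [key, integral_sub (hY.integrable (a + h)) i2]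
    ring
  have hbd : ∀ {g : Ω → ℝ} {M : ℝ}, (∀ ω, |g ω| ≤ M) → |∫ ω in A, g ω ∂(m.law n)| ≤ M := by
    intro g M hg
    have hM : 0 ≤ M := by
      have := nonempty_of_isProbabilityMeasure (m.law n)
      exact (abs_nonneg _).trans (hg this.some)
    rw [← Real.norm_eq_abs]
    refine (norm_integral_le_of_norm_le_const (C := M) (Eventually.of_forall hg)).trans ?_
    refine mul_le_of_le_one_right hM ?_
    rw [Measure.real, Measure.restrict_apply_univ]
    exact measureReal_le_one
  rw [e, add_mul]
  refine (abs_add_le _ _).trans (add_le_add (hbd fun ω => ?_) (hbd fun ω => ?_))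
  · refine (hK ω _ a (a + h) (hab.trans hb) hb).trans_eq ?_
    rw [abs_of_nonneg (sub_nonneg.2 (NNReal.coe_le_coe.2 hab))]
  · refine (hK' _ (hR a (hab.trans hb) ω) _).trans_eq ?_
    push_cast
    ring

theorem hasDerivWithinAt_setIntegral (D : IsDriven ι m ε α f₀ u₀ f u) (hαβ : α ≤ β)
    (hψ : IsGoodTestFunction m ψ) (n : E) (t : ℝ≥0) (A : Set Ω)
    (hA : MeasurableSet[drivingFiltration m ε t] A) :
    HasDerivWithinAt
      (fun r : ℝ => ∫ ω in A, ψ (stateAt m ε hαβ f u r.toNNReal ω).toAmbient ∂(m.law n))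
      (∫ ω in A, Leps ε m ι ψ (stateAt m ε hαβ f u t ω) ∂(m.law n)) (Ioi t) t := by
  obtain ⟨c, hc⟩ : ∃ c, c = ((ε ^ 2)⁻¹).toNNReal := ⟨_, rfl⟩
  have hcpos : 0 < c := by rw [hc]; exact scale_pos D.pos
  have hcε : (c : ℝ) = (ε ^ 2)⁻¹ := by
    rw [hc]
    exact Real.coe_toNNReal _ (by positivity)
  obtain ⟨K, hK0, hK⟩ := D.exists_abs_sub_le hαβ hψ (t + 1)
  obtain ⟨R, hR⟩ := D.exists_mem_ballSet hαβ (t + 1)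
  obtain ⟨K', hK'⟩ := D.exists_frozenIncrement_le hψ R
  have hY := D.bddProg hαβ hψ.bLoc
  have ht1 : t ≤ t + 1 := by simp
  obtain ⟨C₀, hC₀, Ψ, hΨ⟩ := D.exists_kineticSolution
  rw [hasDerivWithinAt_iff_tendsto_slope' self_notMem_Ioi]
  have near : ∀ᶠ r : ℝ in 𝓝[>] (t : ℝ), ∃ h : ℝ≥0, 0 < h ∧ r = ((t + h : ℝ≥0) : ℝ) ∧
      t + h ≤ t + 1 := by
    filter_upwards [Ioc_mem_nhdsGT (lt_add_one (t : ℝ))] with r hr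
    have e : (((t + (r - t).toNNReal : ℝ≥0) : ℝ≥0) : ℝ) = r := by
      push_cast
      rw [Real.coe_toNNReal _ (sub_nonneg.2 hr.1.le)]
      ring
    refine ⟨(r - t).toNNReal, Real.toNNReal_pos.2 (sub_pos.2 hr.1), e.symm, ?_⟩
    rw [← NNReal.coe_le_coe, e]
    exact hr.2
  -- the two parts of the difference quotient
  obtain ⟨S₁, hS₁⟩ : ∃ S₁ : ℝ → Ω → ℝ, ∀ r ω, S₁ r ω =
    (ψ (stateAt m ε hαβ f u r.toNNReal ω).toAmbient -
      ψ (f t ω, H.incl hαβ (u t ω), rescaled ε m.X r.toNNReal ω)) / (r - t) := ⟨_, fun _ _ => rfl⟩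
  obtain ⟨S₂, hS₂⟩ : ∃ S₂ : ℝ → Ω → ℝ, ∀ r ω, S₂ r ω =
    frozenIncrement m ψ (c * (r - t).toNNReal) (stateAt m ε hαβ f u t ω) / (r - t) :=
    ⟨_, fun _ _ => rfl⟩
  have pos : ∀ {h : ℝ≥0}, 0 < h → (0 : ℝ) < ((t + h : ℝ≥0) : ℝ) - t := by
    intro h hh
    push_cast
    rw [add_sub_cancel_left]
    exact hh
  have b₁ : ∀ {h : ℝ≥0}, 0 < h → t + h ≤ t + 1 → ∀ ω, |S₁ (t + h : ℝ≥0) ω| ≤ K := by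
    intro h hh hle ω
    rw [hS₁, abs_div, Real.toNNReal_coe, abs_of_pos (pos hh), div_le_iff₀ (pos hh)]
    refine (hK ω _ t (t + h) ht1 hle).trans_eq ?_
    rw [abs_of_pos (pos hh)]
  have b₂ : ∀ {h : ℝ≥0}, 0 < h → ∀ ω, |S₂ (t + h : ℝ≥0) ω| ≤ K' * c := by
    intro h hh ω
    rw [hS₂, abs_div, abs_of_pos (pos hh), div_le_iff₀ (pos hh)]
    refine (hK' _ (hR t ht1 ω) _).trans_eq ?_
    push_cast
    rw [add_sub_cancel_left, Real.toNNReal_coe]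
    ring
  have meas : ∀ {h : ℝ≥0}, 0 < h → Measurable (S₁ (t + h : ℝ≥0)) ∧
      Measurable (S₂ (t + h : ℝ≥0)) := by
    intro h hh
    obtain ⟨m1, m2, -⟩ := D.setIntegral_frozenIncrement hαβ hψ n t h
    rw [← hc] at m1
    have e1 : S₁ (t + h : ℝ≥0) = _ := funext (hS₁ _)
    have e2 : S₂ (t + h : ℝ≥0) = _ := funext (hS₂ _)
    rw [e1, e2]
    constructor
    · simp only [Real.toNNReal_coe]
      exact ((hY.measurable (t + h)).sub m2).div_const _
    · have : (((t + h : ℝ≥0) : ℝ) - t).toNNReal = h := by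
        push_cast
        rw [add_sub_cancel_left, Real.toNNReal_coe]
      rw [this]
      exact m1.div_const _
  have hslope : ∀ᶠ r : ℝ in 𝓝[>] (t : ℝ),
      ∫ ω in A, S₁ r ω ∂(m.law n) + ∫ ω in A, S₂ r ω ∂(m.law n) = slope (fun r : ℝ =>
        ∫ ω in A, ψ (stateAt m ε hαβ f u r.toNNReal ω).toAmbient ∂(m.law n)) t r := by
    filter_upwards [near] with r hr
    obtain ⟨h, hh, rfl, hle⟩ := hr
    obtain ⟨m1, m2, key⟩ := D.setIntegral_frozenIncrement hαβ hψ n t h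
    have key := key A hA
    rw [← hc] at key
    have i2 : Integrable (fun ω => ψ (f t ω, H.incl hαβ (u t ω), rescaled ε m.X (t + h) ω))
        ((m.law n).restrict A) := by
      obtain ⟨C, hC⟩ := hψ.bLoc.2 _ (State.isBounded_ballSet D.drivingSpace R)
      exact MarkovProcess.integrable_comp m2 (C := C) fun ω =>
        hC (f t ω, H.incl hαβ (u t ω), rescaled ε m.X (t + h) ω) (hR t ht1 ω)
    have eh : (((t + h : ℝ≥0) : ℝ) - t).toNNReal = h := by
      push_cast
      rw [add_sub_cancel_left, Real.toNNReal_coe]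
    simp only [hS₁, hS₂, Real.toNNReal_coe, eh]
    rw [integral_div, integral_div, key, integral_sub (hY.integrable (t + h)) i2,
      integral_sub i2 (hY.integrable t), slope_def_field, Real.toNNReal_coe, Real.toNNReal_coe]
    ring
  have l₁ : Tendsto (fun r => ∫ ω in A, S₁ r ω ∂(m.law n)) (𝓝[>] (t : ℝ))
      (𝓝 (∫ ω in A, Lfu ε ι ψ (stateAt m ε hαβ f u t ω) ∂(m.law n))) := by
    refine tendsto_integral_filter_of_dominated_convergence (fun _ => K) ?_ ?_
      (integrable_const K) (Eventually.of_forall fun ω => ?_)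
    · filter_upwards [near] with r hr
      obtain ⟨h, hh, rfl, hle⟩ := hr
      exact (meas hh).1.aestronglyMeasurable
    · filter_upwards [near] with r hr
      obtain ⟨h, hh, rfl, hle⟩ := hr
      exact Eventually.of_forall (b₁ hh hle)
    · have hnn : Tendsto Real.toNNReal (𝓝[>] (t : ℝ)) (𝓝[>] t) := by
        refine tendsto_nhdsWithin_iff.2 ⟨?_, ?_⟩
        · have := (continuous_real_toNNReal.tendsto (t : ℝ)).mono_left
            (nhdsWithin_le_nhds (s := Ioi (t : ℝ)))
          rwa [Real.toNNReal_coe] at this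
        · filter_upwards [self_mem_nhdsWithin] with r hr
          exact Real.lt_toNNReal_iff_coe_lt.2 hr
      have hy : ContinuousWithinAt (fun r : ℝ => rescaled ε m.X r.toNNReal ω) (Ioi (t : ℝ)) t := by
        have := ((isCadlag_driving D.pos m ω).rightCont t).tendsto.comp hnn
        rw [ContinuousWithinAt, Real.toNNReal_coe]
        exact this
      have hn : ContinuousWithinAt (fun r : ℝ => ι (rescaled ε m.X r.toNNReal ω : E))
          (Ioi (t : ℝ)) t :=
        (D.drivingSpace.continuous_embedding.comp continuous_subtype_val).continuousAt
          |>.comp_continuousWithinAt hy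
      have := (hΨ ω).tendsto_slope (m := m) hψ D.one_le D.pos D.lt_β D.lt_η hαβ
        (fun s => (f s.toNNReal ω).2) t.coe_nonneg hn hy rfl
      simp only [Real.toNNReal_coe] at this
      simp only [hS₁]
      exact this
  have l₂ : Tendsto (fun r => ∫ ω in A, S₂ r ω ∂(m.law n)) (𝓝[>] (t : ℝ))
      (𝓝 (∫ ω in A, (ε ^ 2)⁻¹ * genN m ψ (stateAt m ε hαβ f u t ω) ∂(m.law n))) := by
    refine tendsto_integral_filter_of_dominated_convergence (fun _ => K' * c) ?_ ?_
      (integrable_const _) (Eventually.of_forall fun ω => ?_)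
    · filter_upwards [near] with r hr
      obtain ⟨h, hh, rfl, hle⟩ := hr
      exact (meas hh).2.aestronglyMeasurable
    · filter_upwards [near] with r hr
      obtain ⟨h, hh, rfl, hle⟩ := hr
      exact Eventually.of_forall (b₂ hh)
    · obtain ⟨p, hp⟩ : ∃ p, p = stateAt m ε hαβ f u t ω := ⟨_, rfl⟩
      have hgen := (hψ.inDomain p.1 p.1.2 p.2.1).hasGenerator.2.2.1 p.2.2
      have hh : Tendsto (fun r : ℝ => c * (r - t).toNNReal) (𝓝[>] (t : ℝ)) (𝓝[>] 0) := by
        refine tendsto_nhdsWithin_iff.2 ⟨?_, ?_⟩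
        · have : Continuous fun r : ℝ => c * (r - t).toNNReal := by fun_prop
          have := (this.tendsto (t : ℝ)).mono_left (nhdsWithin_le_nhds (s := Ioi (t : ℝ)))
          simpa using this
        · filter_upwards [self_mem_nhdsWithin] with r hr
          exact mul_pos hcpos (Real.toNNReal_pos.2 (sub_pos.2 hr))
      have := ((hgen.comp hh).const_mul (c : ℝ))
      rw [hcε] at this
      rw [← hp]
      refine this.congr' ?_
      filter_upwards [self_mem_nhdsWithin] with r hr
      have hr' : 0 < r - t := sub_pos.2 hr
      rw [hS₂, ← hp, ← hcε, Function.comp_apply, MarkovProcess.quotient]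
      push_cast
      rw [Real.coe_toNNReal _ hr'.le]
      have hc' : (c : ℝ) ≠ 0 := by exact_mod_cast hcpos.ne'
      unfold frozenIncrement
      field_simp
      rfl
  have hsum := (l₁.add l₂).congr' hslope
  convert hsum using 2
  have hg := D.bddProg hαβ hψ.genN_cbLoc.bLoc
  have hl := D.bddProg hαβ (Leps_cbLoc D.drivingSpace D.pos D.one_le D.lt_α hψ).bLoc
  have e : ∀ ω, Lfu ε ι ψ (stateAt m ε hαβ f u t ω) =
      Leps ε m ι ψ (stateAt m ε hαβ f u t ω) -
        (ε ^ 2)⁻¹ * genN m ψ (stateAt m ε hαβ f u t ω) := by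
    intro ω
    rw [Leps_eq D.one_le D.lt_α hψ]
    ring
  simp only [e]
  rw [integral_sub (hl.integrable t) ((hg.integrable t).const_mul _), sub_add_cancel]

/-- `ψ(Z_t) - ∫₀ᵗ 𝓛^ε ψ(Z_s) ds` is a martingale. -/
theorem martingale (D : IsDriven ι m ε α f₀ u₀ f u) (hαβ : α ≤ β)
    (hψ : IsGoodTestFunction m ψ) (n : E) :
    Martingale (fun t ω => ψ (stateAt m ε hαβ f u t ω).toAmbient -
      ∫ s in (0 : ℝ)..t, Leps ε m ι ψ (stateAt m ε hαβ f u s.toNNReal ω))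
      (drivingFiltration m ε) (m.law n) := by
  refine (D.bddProg hαβ hψ.bLoc).martingale_sub_integral
    (D.bddProg hαβ (Leps_cbLoc D.drivingSpace D.pos D.one_le D.lt_α hψ).bLoc) (fun s T A hA => ?_)
    fun s A hA => D.hasDerivWithinAt_setIntegral hαβ hψ n s A hA
  obtain ⟨K, hK⟩ := D.exists_setIntegral_sub_le hαβ hψ n T
  have key : ∀ a ∈ Icc (s : ℝ) T, ∀ b ∈ Icc (s : ℝ) T, a ≤ b →
      |∫ ω in A, ψ (stateAt m ε hαβ f u b.toNNReal ω).toAmbient ∂(m.law n) -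
        ∫ ω in A, ψ (stateAt m ε hαβ f u a.toNNReal ω).toAmbient ∂(m.law n)| ≤
        |K| * |b - a| := by
    intro a ha b hb hab
    have ha0 := s.coe_nonneg.trans ha.1
    lift a to ℝ≥0 using ha0
    have hb0 := s.coe_nonneg.trans hb.1
    lift b to ℝ≥0 using hb0
    rw [Real.toNNReal_coe, Real.toNNReal_coe, abs_of_nonneg (sub_nonneg.2 hab)]
    refine (hK a b hab hb.2 A ((drivingFiltration m ε).mono ha.1 A hA)).trans ?_
    have := sub_nonneg.2 hab
    gcongr
    exact le_abs_self K
  refine LipschitzOnWith.continuousOn (K := ⟨|K|, abs_nonneg K⟩)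
    (LipschitzOnWith.of_dist_le_mul fun a ha b hb => ?_)
  rw [Real.dist_eq, Real.dist_eq]
  rcases le_total a b with h | h
  · rw [abs_sub_comm, abs_sub_comm a]
    exact key a ha b hb h
  · exact key b hb a ha h

theorem tendsto_comp_stateAt (D : IsDriven ι m ε α f₀ u₀ f u) (hψ : IsGoodTestFunction m ψ)
    (hc : ∀ f ∈ G0 k, ∀ u : H α, Continuous fun y : E => ψ (f, u, y)) (ω : Ω) {t : ℝ≥0}
    {l : Filter ℝ≥0} (hl : l ≤ 𝓝 t) {y : E}
    (hy : Tendsto (fun s => rescaled ε m.X s ω) l (𝓝 y)) :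
    Tendsto (fun s => ψ (stateAt m ε hαβ f u s ω).toAmbient) l
      (𝓝 (ψ (f t ω, H.incl hαβ (u t ω), y))) := by
  obtain ⟨K, hK0, hK⟩ := D.exists_abs_sub_le hαβ hψ (t + 1)
  have h1 := ((hc _ (f t ω).2 (H.incl hαβ (u t ω))).tendsto y).comp hy
  have h2 : Tendsto (fun s => ψ (stateAt m ε hαβ f u s ω).toAmbient -
      ψ (f t ω, H.incl hαβ (u t ω), rescaled ε m.X s ω)) l (𝓝 0) := by
    have h3 : Tendsto (fun s : ℝ≥0 => K * |(s : ℝ) - t|) l (𝓝 0) := by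
      have : Continuous fun s : ℝ≥0 => K * |(s : ℝ) - t| := by fun_prop
      have := (this.tendsto t).mono_left hl
      simpa using this
    refine squeeze_zero_norm' ?_ h3
    filter_upwards [hl (Iio_mem_nhds (lt_add_one t))] with s hs
    exact hK ω _ t s (by simp) (le_of_lt hs)
  have := h2.add h1
  rw [zero_add] at this
  refine this.congr fun s => ?_
  simp only [Function.comp_apply]
  ring

end IsDriven

end Kinetic

namespace Kinetic

variable {Ω F : Type*} [mΩ : MeasurableSpace Ω] [NormedAddCommGroup F] [NormedSpace ℝ F]
  [MeasurableSpace F] [BorelSpace F] {E : Set F} {m : MarkovProcess Ω E} {k α η β ε : ℝ}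
  {ψ : G k × H α × E → ℝ} {ι : F →ₗ[ℝ] C(Torus, ℝ)}

theorem BddProg.const_mul {𝓕 : Filtration ℝ≥0 mΩ} {Y : ℝ≥0 → Ω → ℝ} (h : BddProg 𝓕 Y) (c : ℝ) :
    BddProg 𝓕 fun t ω => c * Y t ω where
  meas t := Measurable.const_mul (h.meas t) c
  bdd T := by
    obtain ⟨C, hC⟩ := h.bdd T
    refine ⟨|c| * C, fun t ht ω => ?_⟩
    rw [abs_mul]
    exact mul_le_mul_of_nonneg_left (hC t ht ω) (abs_nonneg c)

theorem _root_.Continuous.isCadlag {S : Type*} [TopologicalSpace S] {x : ℝ≥0 → S}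
    (h : Continuous x) : IsCadlag x := fun t =>
  ⟨h.continuousWithinAt, x t, (h.tendsto t).mono_left nhdsWithin_le_nhds⟩

theorem IsCadlag.sub {x y : ℝ≥0 → ℝ} (hx : IsCadlag x) (hy : IsCadlag y) :
    IsCadlag fun t => x t - y t := fun t => by
  obtain ⟨l, hl⟩ := (hx t).2
  obtain ⟨l', hl'⟩ := (hy t).2
  exact ⟨(hx t).1.sub (hy t).1, l - l', hl.sub hl'⟩

/-- `∫₀ᵗ L_s (∫₀ˢ L) ds = (∫₀ᵗ L)² / 2` for right-continuous `L`. -/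
theorem integral_mul_primitive {L : ℝ≥0 → ℝ} (hc : ∀ t, ContinuousWithinAt L (Ioi t) t)
    (hi : ∀ a b, IntervalIntegrable (fun s : ℝ => L s.toNNReal) volume a b) (t : ℝ≥0) :
    2 * ∫ s in (0 : ℝ)..t, (∫ r in (0 : ℝ)..s.toNNReal, L r.toNNReal) * L s.toNNReal =
      (∫ s in (0 : ℝ)..t, L s.toNNReal) ^ 2 := by
  have hB := intervalIntegral.continuous_primitive hi 0
  have hm : StronglyMeasurable fun s : ℝ => L s.toNNReal :=
    (stronglyMeasurable_of_rightCont hc).comp_measurable measurable_real_toNNReal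
  have key := intervalIntegral.integral_eq_sub_of_hasDeriv_right_of_le (a := (0 : ℝ)) (b := t)
    (f := fun s : ℝ => (∫ r in (0 : ℝ)..s, L r.toNNReal) ^ 2)
    (f' := fun s : ℝ => 2 * ((∫ r in (0 : ℝ)..s, L r.toNNReal) * L s.toNNReal)) t.coe_nonneg
    (hB.pow 2).continuousOn (fun s hs => ?_) (((hi 0 t).continuousOn_mul hB.continuousOn).const_mul 2)
  · rw [intervalIntegral.integral_const_mul, intervalIntegral.integral_same] at key
    rw [zero_pow two_ne_zero, sub_zero] at key
    rw [← key]
    congr 1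
    refine intervalIntegral.integral_congr fun s hs => ?_
    rw [uIcc_of_le t.coe_nonneg] at hs
    simp only [Real.coe_toNNReal s hs.1]
  · have hs0 := hs.1.le
    have h1 : ContinuousWithinAt (fun s : ℝ => L s.toNNReal) (Ioi s) s := by
      refine (hc s.toNNReal).tendsto.comp (tendsto_nhdsWithin_iff.2
        ⟨(continuous_real_toNNReal.tendsto s).mono_left nhdsWithin_le_nhds, ?_⟩)
      filter_upwards [self_mem_nhdsWithin] with r hr
      exact (Real.toNNReal_lt_toNNReal_iff (hs.1.trans hr)).2 hr
    have h2 := intervalIntegral.integral_hasDerivWithinAt_right (hi 0 s) (s := Ici s) (t := Ioi s)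
      hm.stronglyMeasurableAtFilter h1
    have := (h2.mono Ioi_subset_Ici_self).pow 2
    simp only [Nat.cast_ofNat, Nat.add_one_sub_one, pow_one] at this
    rw [mul_assoc] at this
    exact this

namespace IsDriven

variable {f₀ : G0 k} {u₀ : H η} {f : ℝ≥0 → Ω → G0 k} {u : ℝ≥0 → Ω → H β} {hαβ : α ≤ β}

theorem isCadlag (D : IsDriven ι m ε α f₀ u₀ f u) (hαβ : α ≤ β) (hψ : IsGoodTestFunction m ψ)
    (hc : ∀ f ∈ G0 k, ∀ u : H α, Continuous fun y : E => ψ (f, u, y)) (ω : Ω) :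
    IsCadlag fun t => ψ (stateAt m ε hαβ f u t ω).toAmbient -
      ∫ s in (0 : ℝ)..t, Leps ε m ι ψ (stateAt m ε hαβ f u s.toNNReal ω) := by
  refine IsCadlag.sub (fun t => ⟨?_, ?_⟩) (((D.bddProg hαβ
    (Leps_cbLoc D.drivingSpace D.pos D.one_le D.lt_α hψ).bLoc).continuous_integral ω).isCadlag)
  · exact D.tendsto_comp_stateAt hψ hc ω nhdsWithin_le_nhds
      (isCadlag_driving D.pos m ω t).1
  · obtain ⟨y, hy⟩ := (isCadlag_driving D.pos m ω t).2
    exact ⟨_, D.tendsto_comp_stateAt hψ hc ω nhdsWithin_le_nhds hy⟩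

theorem isPredictableQuadraticVariation (D : IsDriven ι m ε α f₀ u₀ f u) (hαβ : α ≤ β)
    (hψ : IsGoodTestFunction m ψ) (hψ2 : IsGoodTestFunction m fun q => |ψ q| ^ 2) (n : E) :
    IsPredictableQuadraticVariation
      (fun t ω => ψ (stateAt m ε hαβ f u t ω).toAmbient -
        ∫ s in (0 : ℝ)..t, Leps ε m ι ψ (stateAt m ε hαβ f u s.toNNReal ω))
      (fun t ω => (ε ^ 2)⁻¹ * ∫ s in (0 : ℝ)..t,
        (genN m (fun q => |ψ q| ^ 2) (stateAt m ε hαβ f u s.toNNReal ω)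
          - 2 * ψ (stateAt m ε hαβ f u s.toNNReal ω).toAmbient *
            genN m ψ (stateAt m ε hαβ f u s.toNNReal ω)))
      (drivingFiltration m ε) (m.law n) := by
  have hY := D.bddProg hαβ hψ.bLoc
  have hcb := Leps_cbLoc D.drivingSpace D.pos D.one_le D.lt_α hψ
  have hL := D.bddProg hαβ hcb.bLoc
  have hΓ := (D.bddProg hαβ hψ2.genN_cbLoc.bLoc).sub
    ((hY.const_mul 2).mul (D.bddProg hαβ hψ.genN_cbLoc.bLoc))
  have hA := hΓ.integral.const_mul (ε ^ 2)⁻¹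
  have hcont := fun ω => (hΓ.continuous_integral ω).const_mul (ε ^ 2)⁻¹
  have hε := D.pos
  refine ⟨fun ω => (hcont ω).isCadlag, isStronglyPredictable_of_continuous hA.adapted hcont,
    fun ω s t hst => ?_, fun ω => by simp, ?_⟩
  · have hnn : ∀ r, 0 ≤ genN m (fun q => |ψ q| ^ 2) (stateAt m ε hαβ f u r ω)
          - 2 * ψ (stateAt m ε hαβ f u r ω).toAmbient *
            genN m ψ (stateAt m ε hαβ f u r ω) := fun r =>
      MarkovProcess.carreDuChamp_nonneg D.drivingSpace.isBounded_univ
        (hψ.inDomain _ (f r ω).2 _) (hψ2.inDomain _ (f r ω).2 _) _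
    refine mul_le_mul_of_nonneg_left ?_ (by positivity)
    have := intervalIntegral.integral_interval_sub_left (hΓ.intervalIntegrable ω 0 t)
      (hΓ.intervalIntegrable ω 0 s)
    have h2 := intervalIntegral.integral_nonneg_of_forall (μ := volume) (NNReal.coe_le_coe.2 hst)
      (f := fun r : ℝ => genN m (fun q => |ψ q| ^ 2) (stateAt m ε hαβ f u r.toNNReal ω)
          - 2 * ψ (stateAt m ε hαβ f u r.toNNReal ω).toAmbient *
            genN m ψ (stateAt m ε hαβ f u r.toNNReal ω)) fun r => hnn _
    linarith
  · have hN := hY.sub hL.integral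
    have hM := D.martingale hαβ hψ n
    have hM2 := D.martingale hαβ hψ2 n
    have hK := hN.martingale_mul_sub hM hL
    have := hM2.sub (hK.add hK)
    convert this using 1
    funext t ω
    simp only [Pi.sub_apply, Pi.add_apply]
    have h1 := integral_mul_primitive (L := fun s => Leps ε m ι ψ (stateAt m ε hαβ f u s ω))
      (fun s => hcb.1.continuousAt.comp_continuousWithinAt (D.rightCont_stateAt ω s))
      (hL.intervalIntegrable ω) t
    have h2 : ∫ s in (0 : ℝ)..t, Leps ε m ι (fun q => |ψ q| ^ 2)
        (stateAt m ε hαβ f u s.toNNReal ω) =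
        2 * (∫ s in (0 : ℝ)..t, ψ (stateAt m ε hαβ f u s.toNNReal ω).toAmbient *
          Leps ε m ι ψ (stateAt m ε hαβ f u s.toNNReal ω)) + (ε ^ 2)⁻¹ * ∫ s in (0 : ℝ)..t,
        (genN m (fun q => |ψ q| ^ 2) (stateAt m ε hαβ f u s.toNNReal ω)
          - 2 * ψ (stateAt m ε hαβ f u s.toNNReal ω).toAmbient *
            genN m ψ (stateAt m ε hαβ f u s.toNNReal ω)) := by
      rw [← intervalIntegral.integral_const_mul, ← intervalIntegral.integral_const_mul,
        ← intervalIntegral.integral_add ((hY.mul hL).intervalIntegrable ω 0 t |>.const_mul 2)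
          ((hΓ.intervalIntegrable ω 0 t).const_mul _)]
      refine intervalIntegral.integral_congr fun s _ => ?_
      simp only [Leps_sq D.one_le D.lt_α (D.α_lt.le.trans (by norm_num)) hψ hψ2]
      ring
    have h3 : ∫ s in (0 : ℝ)..t, (ψ (stateAt m ε hαβ f u s.toNNReal ω).toAmbient -
        ∫ r in (0 : ℝ)..s.toNNReal, Leps ε m ι ψ (stateAt m ε hαβ f u r.toNNReal ω)) *
          Leps ε m ι ψ (stateAt m ε hαβ f u s.toNNReal ω) =
        (∫ s in (0 : ℝ)..t, ψ (stateAt m ε hαβ f u s.toNNReal ω).toAmbient *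
          Leps ε m ι ψ (stateAt m ε hαβ f u s.toNNReal ω)) -
        ∫ s in (0 : ℝ)..t, (∫ r in (0 : ℝ)..s.toNNReal,
          Leps ε m ι ψ (stateAt m ε hαβ f u r.toNNReal ω)) *
          Leps ε m ι ψ (stateAt m ε hαβ f u s.toNNReal ω) := by
      rw [← intervalIntegral.integral_sub ((hY.mul hL).intervalIntegrable ω 0 t)
        ((hL.integral.mul hL).intervalIntegrable ω 0 t)]
      refine intervalIntegral.integral_congr fun s _ => ?_
      ring
    rw [h2, h3, sq_abs, sq_abs]
    linear_combination h1

end IsDriven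

end Kinetic

end

open Kinetic in
theorem proposition3p7
    {Ω F : Type*} [MeasurableSpace Ω] [NormedAddCommGroup F] [NormedSpace ℝ F]
    [MeasurableSpace F] [BorelSpace F]
    (E : Set F) (ι : F →ₗ[ℝ] C(Torus, ℝ)) (hE : DrivingSpace E ι)
    (m : MarkovProcess Ω E)
    (ε : ℝ) (hε : 0 < ε) (k : ℝ) (hk : 1 ≤ k) (α : ℝ) (hα : α ∈ Set.Ioo (1 / 2 : ℝ) (3 / 2))
    (ψ : G k × H α × E → ℝ) (hψ : IsGoodTestFunction m ψ) :
    (∀ p : State k α E, LepsWellDefined ι ψ p) ∧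
    CbLoc (fun p : State k α E => Leps ε m ι ψ p) ∧
    ∀ (η β : ℝ) (_ : η ∈ Set.Ioo (3 / 2 : ℝ) 2) (hβ : β ∈ Set.Ioo (3 / 2 : ℝ) η)
      (f₀ : G0 k) (u₀ : H η) (n : E) (_ : RegularDensity (f₀ : G k))
      (f : ℝ≥0 → Ω → G0 k) (u : ℝ≥0 → Ω → H β)
      (_ : ∀ ω, IsSolution ε (fun t x => ι (rescaled ε m.X t ω : E) x) (f₀ : G k) u₀
        (fun t => (f t ω : G k)) (fun t => u t ω)),
      let 𝓕 : Filtration ℝ≥0 _ :=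
        canonicalFiltration (rescaled ε m.X) (fun _ => m.measurable_X _)
      let Z : ℝ≥0 → Ω → State k α E := fun t ω =>
        (f t ω, H.incl (hα.2.trans hβ.1).le (u t ω), rescaled ε m.X t ω)
      let N : ℝ≥0 → Ω → ℝ := fun t ω =>
        ψ (Z t ω).toAmbient - ∫ s in (0 : ℝ)..t, Leps ε m ι ψ (Z s.toNNReal ω)
      Martingale N 𝓕 (m.law n) ∧
      (∀ t, MemLp (N t) 2 (m.law n)) ∧
      ((∀ f ∈ G0 k, ∀ u : H α, Continuous fun y : E => ψ (f, u, y)) →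
        ∀ ω, IsCadlag fun t => N t ω) ∧
      (IsGoodTestFunction m (fun q => |ψ q| ^ 2) →
        IsPredictableQuadraticVariation N
          (fun t ω => (ε ^ 2)⁻¹ * ∫ s in (0 : ℝ)..t,
            (genN m (fun q => |ψ q| ^ 2) (Z s.toNNReal ω)
              - 2 * ψ (Z s.toNNReal ω).toAmbient * genN m ψ (Z s.toNNReal ω)))
          𝓕 (m.law n)) := by
  refine ⟨lepsWellDefined hk hα.1 hψ, Leps_cbLoc hE hε hk hα.1 hψ, ?_⟩
  intro η β hη hβ f₀ u₀ n hf₀ f u hsol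
  have D : IsDriven ι m ε α f₀ u₀ f u := ⟨hE, hε, hk, hα.1, hα.2, hη.1, hβ.1, hf₀.1, hsol⟩
  have hαβ := (hα.2.trans hβ.1).le
  have hN := (D.bddProg hαβ hψ.bLoc).sub (D.bddProg hαβ (Leps_cbLoc hE hε hk hα.1 hψ).bLoc).integral
  exact ⟨D.martingale hαβ hψ n, fun t => hN.memLp t 2, fun hc ω => D.isCadlag hαβ hψ hc ω,
    fun h2 => D.isPredictableQuadraticVariation hαβ hψ h2 n⟩
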